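/- Let $f:(\mathbb C^3,0)\to(\mathbb C^3,0)$ be a contracting holomorphic germ, i.e. all eigenvalues of $df_0$ have modulus $<1$. Let $\mathcal C(f)=\{\det df=0\}$ and $\mathcal C^\infty(f)=\bigcup_{n\ge 0}f^{-n}(\mathcal C(f))$. Assume that $f$ is rigid: in suitable holomorphic coordinates at $0$, $\mathcal C^\infty(f)$ is, as a germ at $0$, a union of $q\ge0$ distinct coordinate hyperplanes $W^1,\dots,W^q$. Write $f^*W^k=\sum_l a_l^kW^l$ (pull-back of divisors) and assume that the internal action $A=(a_l^k)\in\mathrm{Mat}_{q\times q}(\mathbb N)$ is injective. A component $W^k$ is periodic if $(f^*)^jW^k=W^k$ for some $j\ge1$; let $r$ be the number of periodic components, and $\eta\geq 1$ the least integer with $(f^*)^\eta W^k=W^k$ for all periodic $W^k$. Let $\lambda^1,\lambda^2,\lambda^3$ be the eigenvalues of $df_0$ with multiplicity, numbered so that $|\lambda^1|\ge|\lambda^2|\ge|\lambda^3|$, and let $s$ be the number of non-zero ones. Coordinates are denoted $(X,Y,Z)$; exponents are non-negative integers; $\omega$ denotes a holomorphic germ at $0\in\mathbb C^2$ with $\omega(0)=0$,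 and $\mathfrak m$ is the maximal ideal of germs vanishing at $0$. Then $(q,r,s)$ is one of the triples below, and $f$ is holomorphically conjugate to a germ $\tilde f$ of the corresponding form, with $\mathcal C^\infty(\tilde f)$ equal to the indicated set. * $(0,0,3)$, $\emptyset$: $(\lambda^1X,\ \lambda^2Y+\rho^1(X),\ \lambda^3Z+\rho^2(X,Y))$ (Poincaré–Dulac normal form), where $\rho^1,\rho^2$ are polynomials, $\rho^1$ contains only monomials $X^n$ with $(\lambda^1)^n=\lambda^2$, and $\rho^2$ only monomials $X^aY^b$ with $(\lambda^1)^a(\lambda^2)^b=\lambda^3$. * $(1,0,0)$, $\{X=0\}$: $(\beta X^d,\ ?,\ ?)$ with $d\ge2$, $\beta\in\mathbb C^*$ (the other two components are unspecified holomorphic germs vanishing at $0$). * $(1,0,1)$, $\{Y=0\}$: $(\lambda^1X,\ Y^d,\ \nu Y^mZ+\omega(X,Y))$ with $d\ge2$, $m\ge1$, $\nu\in\mathbb C^*$, $\omega-\varepsilon Y\in\mathfrak m^2$ for some $\varepsilon\in\{0,1\}$. * $(1,0,2)$, $\{Z=0\}$: $(\lambda^1X,\ \lambda^2Y+\rho X^n,\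 Z^d)$ with $d\ge2$, $n\ge1$, and $\rho\in\{0,1\}$ if $(\lambda^1)^n=\lambda^2$, $\rho=0$ otherwise. * $(1,1,1)$, $\{X=0\}$: $(\lambda^1X,\ ?,\ ?)$ (the other two components are unspecified holomorphic germs vanishing at $0$). * $(1,1,2)$: either, with $\{X=0\}$, $(\lambda^1X,\ \lambda^2Y+\rho X^n,\ X^lZ+\omega(X,Y))$ with $n\ge1$, and $\rho\in\{0,1\}$ if $(\lambda^1)^n=\lambda^2$, $\rho=0$ otherwise; or, with $\{Y=0\}$, $(\lambda^1X,\ \lambda^2Y,\ Y^lZ+\omega(X,Y))$. In both cases $l\ge1$, $\omega\in\mathfrak m^2$. * $(2,0,0)$, $\{XY=0\}$: $(\beta^1X^{d_1^1}Y^{d_2^1},\ \beta^2X^{d_1^2}Y^{d_2^2},\ \nu X^lY^mZ+\omega(X,Y))$ with $\beta^1,\beta^2,\nu\in\mathbb C^*$, $d_1^1d_2^2\ne d_1^2d_2^1$, $d_1^2+d_2^2\ge2$, $\max\{d_1^1-1,d_2^1\}\ge1$, $l+m\ge1$, and $\omega-\varepsilon_1X-\varepsilon_2Y\in\mathfrak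 m^2$ for some $\varepsilon_1,\varepsilon_2\in\{0,1\}$. * $(2,0,1)$, $\{YZ=0\}$: $(\lambda^1X,\ \beta^1Y^{d_1^1}Z^{d_2^1}(1+gX^n),\ \beta^2Y^{d_1^2}Z^{d_2^2})$ with $\beta^1,\beta^2\in\mathbb C^*$, $d_1^1d_2^2\ne d_1^2d_2^1$, $\max\{d_1^1-1,d_2^1\}\ge1$, $n\ge1$, and $g\in\{0,1\}$ if $((\lambda^1)^n-d_1^1)((\lambda^1)^n-d_2^2)=d_1^2d_2^1$, $g=0$ otherwise. * $(2,1,1)$, $\{XY=0\}$: $(\lambda^1X,\ X^cY^d,\ \nu X^lY^mZ+\omega(X,Y))$ with $c+d\ge2$, $l+m\ge1$, $c+l\ge1$, $d\ge1$, $d+m\ge2$, $\nu\in\mathbb C^*$, $\omega-\varepsilon Y\in\mathfrak m^2$ for some $\varepsilon\in\{0,1\}$. * $(2,1,2)$: either, with $\{XZ=0\}$, $(\lambda^1X,\ \lambda^2Y+\rho X^n,\ X^cZ^d)$ with $n\ge1$, and $\rho\in\{0,1\}$ if $(\lambda^1)^n=\lambda^2$, $\rho=0$ otherwise; or, with $\{YZ=0\}$,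 $(\lambda^1X,\ \lambda^2Y,\ Y^cZ^d)$. In both cases $c\ge1$, $d\ge2$. * $(2,2,2)$, $\{XY=0\}$: either $\eta=1$ and $(\lambda^1X,\ \lambda^2Y,\ X^lY^mZ+\omega(X,Y))$ with $l,m\ge1$; or $\eta=2$ and $(\alpha^1Y,\ \alpha^2X,\ X^lY^mZ+\omega(X,Y))$ with $\alpha^1\alpha^2=-\lambda^1\lambda^2$, $l+m\ge1$. In both cases $\omega\in\mathfrak m^2$. * $(3,0,0)$, $\{XYZ=0\}$: $(\beta^jX^{d_1^j}Y^{d_2^j}Z^{d_3^j})_{j=1,2,3}$ with $\beta^j\in\mathbb C^*$, $\det(d_i^j)\ne0$, $\max\{d_1^1-1,d_2^1,d_3^1\}\ge1$, $\max\{d_1^2+d_2^2-1,d_3^2\}\ge1$, $d_1^3+d_2^3+d_3^3\ge2$. * $(3,1,1)$, $\{XYZ=0\}$: $(\lambda^1X,\ \beta^1X^{c_1}Y^{d_1^1}Z^{d_2^1}(1+gX^n),\ \beta^2X^{c_2}Y^{d_1^2}Z^{d_2^2})$ with $\beta^1,\beta^2\in\mathbb C^*$, $d_1^1d_2^2\ne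 d_1^2d_2^1$, $c_1+c_2\ge1$, $\max\{c_1+d_1^1-1,d_2^1\}\ge1$, $c_2+d_1^2+d_2^2\ge2$, $n\ge1$, and $g\in\{0,1\}$ if $((\lambda^1)^n-d_1^1)((\lambda^1)^n-d_2^2)=d_1^2d_2^1$, $g=0$ otherwise. * $(3,2,2)$, $\{XYZ=0\}$: either $\eta=1$ and $(\lambda^1X,\ \lambda^2Y,\ X^{c_1}Y^{c_2}Z^d)$ with $c_1,c_2\ge1$; or $\eta=2$ and $(\alpha^1Y,\ \alpha^2X,\ X^{c_1}Y^{c_2}Z^d)$ with $\alpha^1\alpha^2=-\lambda^1\lambda^2$, $c_1+c_2\ge1$. In both cases $d\ge2$. Thus the normal form is fully explicit up to the germ $\omega$, except when $q=1$ and $r=s\in\{0,1\}$. -/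

import Mathlib

open Filter Topology

noncomputable section

/-- `IsContractingGerm f`: `f` is (a representative of) a holomorphic germ `(ℂ^d, 0) → (ℂ^d, 0)` all
of whose eigenvalues at `0` have modulus `< 1`. -/
structure IsContractingGerm {d : ℕ} (f : (Fin d → ℂ) → (Fin d → ℂ)) : Prop where
  analytic : AnalyticAt ℂ f 0
  map_zero : f 0 = 0
  contracting : ∀ μ : ℂ,
    Module.End.HasEigenvalue (fderiv ℂ f 0 : (Fin d → ℂ) →ₗ[ℂ] (Fin d → ℂ)) μ → ‖μ‖ < 1

/-- A germ of biholomorphism of `(ℂ^d, 0)`, i.e. a local holomorphic coordinate system at `0`. -/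
structure IsLocalBiholomorphism {d : ℕ} (φ : (Fin d → ℂ) → (Fin d → ℂ)) : Prop where
  analytic : AnalyticAt ℂ φ 0
  map_zero : φ 0 = 0
  det_ne_zero : (fderiv ℂ φ 0).det ≠ 0

/-- The generalized critical set `⋃ₙ f⁻ⁿ(C(f))`, with `C(f) = {det df = 0}`. For a contracting germ
only its germ at `0` matters, and that depends only on the germ of `f` (orbits of points near `0`
stay near `0`). -/
def genCritSet {d : ℕ} (f : (Fin d → ℂ) → (Fin d → ℂ)) : Set (Fin d → ℂ) :=
  {x | ∃ n : ℕ, (fderiv ℂ f (f^[n] x)).det = 0}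

/-- In the coordinates `φ`, the generalized critical set of `f` is, as a germ at `0`, the union of
the coordinate hyperplanes `W^k = {φ^k = 0}`, `k ∈ K`; so it has simple normal crossings, and its
irreducible components are the `W^k`, `k ∈ K`. -/
def GenCritEq {d : ℕ} (f φ : (Fin d → ℂ) → (Fin d → ℂ)) (K : Finset (Fin d)) : Prop :=
  ∀ᶠ x in 𝓝 (0 : Fin d → ℂ), x ∈ genCritSet f ↔ ∃ k ∈ K, φ x k = 0

/-- `φ` and `K` exhibit the germ `f` as a rigid germ. A germ `f` is rigid iff such `φ`, `K` exist. -/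
structure IsRigidWith {d : ℕ} (f φ : (Fin d → ℂ) → (Fin d → ℂ)) (K : Finset (Fin d)) : Prop where
  coord : IsLocalBiholomorphism φ
  genCrit : GenCritEq f φ K

/-- Multiplicity of the smooth hypersurface `{ψ = 0}` in the divisor of the germ `g` at `0`: the
largest `n` such that `ψ ^ n` divides `g` in the ring of holomorphic germs at `0`. -/
def multAlong {d : ℕ} (g ψ : (Fin d → ℂ) → ℂ) : ℕ :=
  sSup {n : ℕ | ∃ h : (Fin d → ℂ) → ℂ, AnalyticAt ℂ h 0 ∧
    g =ᶠ[𝓝 0] fun x => ψ x ^ n * h x}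

/-- The internal action `A = (a_l^k)`, where `f^* W^k = ∑_l a_l^k W^l`; the entry at row `l` and
column `k` is the multiplicity of `W^l` in `f^* W^k`. -/
def internalAction {d : ℕ} (f φ : (Fin d → ℂ) → (Fin d → ℂ)) (K : Finset (Fin d)) :
    Matrix K K ℕ :=
  Matrix.of fun l k => multAlong (fun x => φ (f x) k) (fun x => φ x l)

/-- Injectivity of the internal action, as an endomorphism of `ℤ^q`. -/
def InjectiveInternalAction {d : ℕ} (f φ : (Fin d → ℂ) → (Fin d → ℂ)) (K : Finset (Fin d)) :
    Prop :=
  Function.Injective ((internalAction f φ K).map (Nat.cast : ℕ → ℤ)).mulVec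

/-- `(f^*)^η W^k = W^k`. -/
def FixedByIterate {d : ℕ} (f φ : (Fin d → ℂ) → (Fin d → ℂ)) (K : Finset (Fin d)) (η : ℕ)
    (k : K) : Prop :=
  ∀ l : K, (internalAction f φ K ^ η) l k = (1 : Matrix K K ℕ) l k

/-- `W^k` is a periodic component. -/
def IsPeriodicComponent {d : ℕ} (f φ : (Fin d → ℂ) → (Fin d → ℂ)) (K : Finset (Fin d))
    (k : K) : Prop :=
  ∃ η : ℕ, 1 ≤ η ∧ FixedByIterate f φ K η k

/-- `r`: the number of periodic components. -/
def numPeriodic {d : ℕ} (f φ : (Fin d → ℂ) → (Fin d → ℂ)) (K : Finset (Fin d)) : ℕ :=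
  Set.ncard {k : K | IsPeriodicComponent f φ K k}

/-- `η`: the order of the permutation that `f^*` induces on the periodic components. -/
def periodOrder {d : ℕ} (f φ : (Fin d → ℂ) → (Fin d → ℂ)) (K : Finset (Fin d)) : ℕ :=
  sInf {η : ℕ | 1 ≤ η ∧ ∀ k : K, IsPeriodicComponent f φ K k → FixedByIterate f φ K η k}

/-- The eigenvalues of `df₀`, with algebraic multiplicity. -/
def eigenvaluesAtZero {d : ℕ} (f : (Fin d → ℂ) → (Fin d → ℂ)) : Multiset ℂ :=
  (fderiv ℂ f 0 : (Fin d → ℂ) →ₗ[ℂ] (Fin d → ℂ)).charpoly.roots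

open Classical in
/-- `s`: the number of non-zero eigenvalues of `df₀`, with algebraic multiplicity. -/
def numNonzeroEigenvalues {d : ℕ} (f : (Fin d → ℂ) → (Fin d → ℂ)) : ℕ :=
  ((eigenvaluesAtZero f).filter (fun μ => μ ≠ 0)).card

/-- `f` is holomorphically conjugated to `g` as germs at `0`, and the generalized critical set of
`g` is `⋃ {x^k = 0}`, `k ∈ K`. -/
def HasNormalForm {d : ℕ} (f g : (Fin d → ℂ) → (Fin d → ℂ)) (K : Finset (Fin d)) : Prop :=
  (∃ Φ : (Fin d → ℂ) → (Fin d → ℂ), IsLocalBiholomorphism Φ ∧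
    ∀ᶠ x in 𝓝 (0 : Fin d → ℂ), Φ (f x) = g (Φ x)) ∧
  GenCritEq g id K

/-- `ω` is a holomorphic germ at `0 ∈ ℂ²` with `ω(X, Y) - a X - b Y ∈ 𝔪²`. -/
structure IsGermWithLinearPart (ω : ℂ × ℂ → ℂ) (a b : ℂ) : Prop where
  analytic : AnalyticAt ℂ ω 0
  map_zero : ω 0 = 0
  deriv_fst : fderiv ℂ ω 0 (1, 0) = a
  deriv_snd : fderiv ℂ ω 0 (0, 1) = b

/-! ### The normal forms

Coordinates: `X = v 0`, `Y = v 1`, `Z = v 2`. The eigenvalues `λ¹, λ², λ³` are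
`lam 0, lam 1, lam 2`. In exponent matrices, `D i j` is the exponent of the `i`-th variable in the
`j`-th component. A name `NormalForm_q_r_s` refers to the invariants `q`, `r`, `s`. -/

/-- Poincaré-Dulac normal form: `ρ₁`, `ρ₂` are polynomials with resonant monomials only. -/
def NormalForm_0_0_3 (f : (Fin 3 → ℂ) → (Fin 3 → ℂ)) (lam : Fin 3 → ℂ) : Prop :=
  ∃ (ρ₁ : Polynomial ℂ) (ρ₂ : MvPolynomial (Fin 2) ℂ),
    (∀ n ∈ ρ₁.support, lam 0 ^ n = lam 1) ∧
    (∀ n ∈ ρ₂.support, lam 0 ^ n 0 * lam 1 ^ n 1 = lam 2) ∧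
    HasNormalForm f
      (fun v => ![lam 0 * v 0,
        lam 1 * v 1 + ρ₁.eval (v 0),
        lam 2 * v 2 + MvPolynomial.eval ![v 0, v 1] ρ₂]) ∅

/-- Only the first component is explicit. -/
def NormalForm_1_0_0 (f : (Fin 3 → ℂ) → (Fin 3 → ℂ)) : Prop :=
  ∃ (β : ℂ) (d : ℕ) (h₁ h₂ : (Fin 3 → ℂ) → ℂ),
    β ≠ 0 ∧ 2 ≤ d ∧ AnalyticAt ℂ h₁ 0 ∧ h₁ 0 = 0 ∧ AnalyticAt ℂ h₂ 0 ∧ h₂ 0 = 0 ∧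
    HasNormalForm f (fun v => ![β * v 0 ^ d, h₁ v, h₂ v]) {0}

def NormalForm_1_0_1 (f : (Fin 3 → ℂ) → (Fin 3 → ℂ)) (lam : Fin 3 → ℂ) : Prop :=
  ∃ (d m : ℕ) (ν ε : ℂ) (ω : ℂ × ℂ → ℂ),
    2 ≤ d ∧ 1 ≤ m ∧ ν ≠ 0 ∧ (ε = 0 ∨ ε = 1) ∧ IsGermWithLinearPart ω 0 ε ∧
    HasNormalForm f
      (fun v => ![lam 0 * v 0, v 1 ^ d, ν * v 1 ^ m * v 2 + ω (v 0, v 1)]) {1}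

def NormalForm_1_0_2 (f : (Fin 3 → ℂ) → (Fin 3 → ℂ)) (lam : Fin 3 → ℂ) : Prop :=
  ∃ (n d : ℕ) (ρ : ℂ),
    1 ≤ n ∧ 2 ≤ d ∧ (ρ = 0 ∨ ρ = 1 ∧ lam 0 ^ n = lam 1) ∧
    HasNormalForm f
      (fun v => ![lam 0 * v 0, lam 1 * v 1 + ρ * v 0 ^ n, v 2 ^ d]) {2}

/-- Only the first component is explicit. -/
def NormalForm_1_1_1 (f : (Fin 3 → ℂ) → (Fin 3 → ℂ)) (lam : Fin 3 → ℂ) : Prop :=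
  ∃ h₁ h₂ : (Fin 3 → ℂ) → ℂ,
    AnalyticAt ℂ h₁ 0 ∧ h₁ 0 = 0 ∧ AnalyticAt ℂ h₂ 0 ∧ h₂ 0 = 0 ∧
    HasNormalForm f (fun v => ![lam 0 * v 0, h₁ v, h₂ v]) {0}

def NormalForm_1_1_2 (f : (Fin 3 → ℂ) → (Fin 3 → ℂ)) (lam : Fin 3 → ℂ) : Prop :=
  ∃ (l : ℕ) (ω : ℂ × ℂ → ℂ),
    1 ≤ l ∧ IsGermWithLinearPart ω 0 0 ∧
    ((∃ (n : ℕ) (ρ : ℂ), 1 ≤ n ∧ (ρ = 0 ∨ ρ = 1 ∧ lam 0 ^ n = lam 1) ∧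
        HasNormalForm f
          (fun v => ![lam 0 * v 0, lam 1 * v 1 + ρ * v 0 ^ n,
            v 0 ^ l * v 2 + ω (v 0, v 1)]) {0}) ∨
      HasNormalForm f
        (fun v => ![lam 0 * v 0, lam 1 * v 1, v 1 ^ l * v 2 + ω (v 0, v 1)]) {1})

def NormalForm_2_0_0 (f : (Fin 3 → ℂ) → (Fin 3 → ℂ)) : Prop :=
  ∃ (D : Matrix (Fin 2) (Fin 2) ℕ) (β₁ β₂ ν : ℂ) (l m : ℕ) (ε₁ ε₂ : ℂ) (ω : ℂ × ℂ → ℂ),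
    β₁ ≠ 0 ∧ β₂ ≠ 0 ∧ D 0 0 * D 1 1 ≠ D 0 1 * D 1 0 ∧
    2 ≤ D 0 1 + D 1 1 ∧ (2 ≤ D 0 0 ∨ 1 ≤ D 1 0) ∧ ν ≠ 0 ∧ 1 ≤ l + m ∧
    (ε₁ = 0 ∨ ε₁ = 1) ∧ (ε₂ = 0 ∨ ε₂ = 1) ∧ IsGermWithLinearPart ω ε₁ ε₂ ∧
    HasNormalForm f
      (fun v => ![β₁ * v 0 ^ D 0 0 * v 1 ^ D 1 0, β₂ * v 0 ^ D 0 1 * v 1 ^ D 1 1,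
        ν * v 0 ^ l * v 1 ^ m * v 2 + ω (v 0, v 1)]) {0, 1}

def NormalForm_2_0_1 (f : (Fin 3 → ℂ) → (Fin 3 → ℂ)) (lam : Fin 3 → ℂ) : Prop :=
  ∃ (D : Matrix (Fin 2) (Fin 2) ℕ) (β₁ β₂ g : ℂ) (n : ℕ),
    β₁ ≠ 0 ∧ β₂ ≠ 0 ∧ D 0 0 * D 1 1 ≠ D 0 1 * D 1 0 ∧ (2 ≤ D 0 0 ∨ 1 ≤ D 1 0) ∧ 1 ≤ n ∧
    (g = 0 ∨ g = 1 ∧ (lam 0 ^ n - D 0 0) * (lam 0 ^ n - D 1 1) = (D 0 1 : ℂ) * D 1 0) ∧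
    HasNormalForm f
      (fun v => ![lam 0 * v 0,
        β₁ * v 1 ^ D 0 0 * v 2 ^ D 1 0 * (1 + g * v 0 ^ n),
        β₂ * v 1 ^ D 0 1 * v 2 ^ D 1 1]) {1, 2}

def NormalForm_2_1_1 (f : (Fin 3 → ℂ) → (Fin 3 → ℂ)) (lam : Fin 3 → ℂ) : Prop :=
  ∃ (c d l m : ℕ) (ν ε : ℂ) (ω : ℂ × ℂ → ℂ),
    2 ≤ c + d ∧ 1 ≤ l + m ∧ 1 ≤ c + l ∧ 1 ≤ d ∧ 2 ≤ d + m ∧ ν ≠ 0 ∧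
    (ε = 0 ∨ ε = 1) ∧ IsGermWithLinearPart ω 0 ε ∧
    HasNormalForm f
      (fun v => ![lam 0 * v 0, v 0 ^ c * v 1 ^ d,
        ν * v 0 ^ l * v 1 ^ m * v 2 + ω (v 0, v 1)]) {0, 1}

def NormalForm_2_1_2 (f : (Fin 3 → ℂ) → (Fin 3 → ℂ)) (lam : Fin 3 → ℂ) : Prop :=
  ∃ c d : ℕ,
    1 ≤ c ∧ 2 ≤ d ∧
    ((∃ (n : ℕ) (ρ : ℂ), 1 ≤ n ∧ (ρ = 0 ∨ ρ = 1 ∧ lam 0 ^ n = lam 1) ∧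
        HasNormalForm f
          (fun v => ![lam 0 * v 0, lam 1 * v 1 + ρ * v 0 ^ n, v 0 ^ c * v 2 ^ d]) {0, 2}) ∨
      HasNormalForm f
        (fun v => ![lam 0 * v 0, lam 1 * v 1, v 1 ^ c * v 2 ^ d]) {1, 2})

/-- The case where both periodic components are fixed (`η = 1`). -/
def NormalForm_2_2_2_fixed (f : (Fin 3 → ℂ) → (Fin 3 → ℂ)) (lam : Fin 3 → ℂ) : Prop :=
  ∃ (l m : ℕ) (ω : ℂ × ℂ → ℂ),
    1 ≤ l ∧ 1 ≤ m ∧ IsGermWithLinearPart ω 0 0 ∧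
    HasNormalForm f
      (fun v => ![lam 0 * v 0, lam 1 * v 1, v 0 ^ l * v 1 ^ m * v 2 + ω (v 0, v 1)]) {0, 1}

/-- The case where the two periodic components are exchanged (`η = 2`). -/
def NormalForm_2_2_2_swapped (f : (Fin 3 → ℂ) → (Fin 3 → ℂ)) (lam : Fin 3 → ℂ) : Prop :=
  ∃ (α₁ α₂ : ℂ) (l m : ℕ) (ω : ℂ × ℂ → ℂ),
    α₁ * α₂ = -(lam 0 * lam 1) ∧ 1 ≤ l + m ∧ IsGermWithLinearPart ω 0 0 ∧
    HasNormalForm f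
      (fun v => ![α₁ * v 1, α₂ * v 0, v 0 ^ l * v 1 ^ m * v 2 + ω (v 0, v 1)]) {0, 1}

def NormalForm_3_0_0 (f : (Fin 3 → ℂ) → (Fin 3 → ℂ)) : Prop :=
  ∃ (D : Matrix (Fin 3) (Fin 3) ℕ) (β : Fin 3 → ℂ),
    (∀ j, β j ≠ 0) ∧ (D.map (Nat.cast : ℕ → ℤ)).det ≠ 0 ∧
    (2 ≤ D 0 0 ∨ 1 ≤ D 1 0 ∨ 1 ≤ D 2 0) ∧
    (2 ≤ D 0 1 + D 1 1 ∨ 1 ≤ D 2 1) ∧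
    2 ≤ D 0 2 + D 1 2 + D 2 2 ∧
    HasNormalForm f
      (fun v j => β j * (v 0 ^ D 0 j * v 1 ^ D 1 j * v 2 ^ D 2 j)) {0, 1, 2}

def NormalForm_3_1_1 (f : (Fin 3 → ℂ) → (Fin 3 → ℂ)) (lam : Fin 3 → ℂ) : Prop :=
  ∃ (D : Matrix (Fin 2) (Fin 2) ℕ) (c₁ c₂ : ℕ) (β₁ β₂ g : ℂ) (n : ℕ),
    β₁ ≠ 0 ∧ β₂ ≠ 0 ∧ D 0 0 * D 1 1 ≠ D 0 1 * D 1 0 ∧ 1 ≤ c₁ + c₂ ∧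
    (2 ≤ c₁ + D 0 0 ∨ 1 ≤ D 1 0) ∧ 2 ≤ c₂ + D 0 1 + D 1 1 ∧ 1 ≤ n ∧
    (g = 0 ∨ g = 1 ∧ (lam 0 ^ n - D 0 0) * (lam 0 ^ n - D 1 1) = (D 0 1 : ℂ) * D 1 0) ∧
    HasNormalForm f
      (fun v => ![lam 0 * v 0,
        β₁ * v 0 ^ c₁ * v 1 ^ D 0 0 * v 2 ^ D 1 0 * (1 + g * v 0 ^ n),
        β₂ * v 0 ^ c₂ * v 1 ^ D 0 1 * v 2 ^ D 1 1]) {0, 1, 2}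

/-- The case where both periodic components are fixed (`η = 1`). -/
def NormalForm_3_2_2_fixed (f : (Fin 3 → ℂ) → (Fin 3 → ℂ)) (lam : Fin 3 → ℂ) : Prop :=
  ∃ c₁ c₂ d : ℕ,
    1 ≤ c₁ ∧ 1 ≤ c₂ ∧ 2 ≤ d ∧
    HasNormalForm f
      (fun v => ![lam 0 * v 0, lam 1 * v 1, v 0 ^ c₁ * v 1 ^ c₂ * v 2 ^ d]) {0, 1, 2}

/-- The case where the two periodic components are exchanged (`η = 2`). -/
def NormalForm_3_2_2_swapped (f : (Fin 3 → ℂ) → (Fin 3 → ℂ)) (lam : Fin 3 → ℂ) : Prop :=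
  ∃ (α₁ α₂ : ℂ) (c₁ c₂ d : ℕ),
    α₁ * α₂ = -(lam 0 * lam 1) ∧ 1 ≤ c₁ + c₂ ∧ 2 ≤ d ∧
    HasNormalForm f
      (fun v => ![α₁ * v 1, α₂ * v 0, v 0 ^ c₁ * v 1 ^ c₂ * v 2 ^ d]) {0, 1, 2}

/-- The classification table, row by row, in terms of the invariants `q, r, s, η`. -/
def NormalFormTable (f : (Fin 3 → ℂ) → (Fin 3 → ℂ)) (lam : Fin 3 → ℂ) (q r s η : ℕ) : Prop :=
  (q = 0 ∧ r = 0 ∧ s = 3 ∧ NormalForm_0_0_3 f lam) ∨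
  (q = 1 ∧ r = 0 ∧ s = 0 ∧ NormalForm_1_0_0 f) ∨
  (q = 1 ∧ r = 0 ∧ s = 1 ∧ NormalForm_1_0_1 f lam) ∨
  (q = 1 ∧ r = 0 ∧ s = 2 ∧ NormalForm_1_0_2 f lam) ∨
  (q = 1 ∧ r = 1 ∧ s = 1 ∧ NormalForm_1_1_1 f lam) ∨
  (q = 1 ∧ r = 1 ∧ s = 2 ∧ NormalForm_1_1_2 f lam) ∨
  (q = 2 ∧ r = 0 ∧ s = 0 ∧ NormalForm_2_0_0 f) ∨
  (q = 2 ∧ r = 0 ∧ s = 1 ∧ NormalForm_2_0_1 f lam) ∨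
  (q = 2 ∧ r = 1 ∧ s = 1 ∧ NormalForm_2_1_1 f lam) ∨
  (q = 2 ∧ r = 1 ∧ s = 2 ∧ NormalForm_2_1_2 f lam) ∨
  (q = 2 ∧ r = 2 ∧ s = 2 ∧
    (η = 1 ∧ NormalForm_2_2_2_fixed f lam ∨ η = 2 ∧ NormalForm_2_2_2_swapped f lam)) ∨
  (q = 3 ∧ r = 0 ∧ s = 0 ∧ NormalForm_3_0_0 f) ∨
  (q = 3 ∧ r = 1 ∧ s = 1 ∧ NormalForm_3_1_1 f lam) ∨
  (q = 3 ∧ r = 2 ∧ s = 2 ∧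
    (η = 1 ∧ NormalForm_3_2_2_fixed f lam ∨ η = 2 ∧ NormalForm_3_2_2_swapped f lam))

end

/-! The generalized critical set is backward invariant. Hence the pull-back of an equation `y k` of
one of its components vanishes only on that set, and is a monomial in the equations times a unit,
with exponents read off from a column of A (`exists_monomial_mul_unit`,
`IsRigidWith.exists_pullback`). What remains is to remove units and higher order terms by coordinate
changes, and this always leads to an equation v ∘ f = D v + h, where D is a scalar or the matrix of
exponents. Multiplying the `y k` by exp(v k) absorbs units; adding v to an approximate coordinate
corrects it. The solution is v = -∑ D^{-(n+1)} h ∘ f^n (`exists_functional_solution`), which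
converges when h ∘ f^n decays faster than D^{-n} grows. For a scalar D with |D| ≥ 1 it suffices that
h(0) = 0. If df₀ is nilpotent, f contracts at every geometric rate, so any invertible D is allowed.
Otherwise h must vanish to high order, and the finitely many remaining terms are a problem of linear
algebra on jets.

That linear algebra is the Poincaré–Dulac theory. Pull-back by f is an algebra endomorphism of the
finite-dimensional algebra of jets, and products of generalized eigenvectors are generalized
eigenvectors for the product eigenvalue (`mul_mem_maxGenEigenspace`). In coordinates made of
generalized eigenvectors only resonant monomials can occur, and ordering the eigenvalues by modulus
makes the result triangular (`IsContractingWithEigenvalues.poincareDulac`). If λ¹ is the only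
non-zero eigenvalue, with eigenfunction w, every germ becomes a polynomial in w, up to high order,
after finitely many iterates. The equation then splits by degree in w, and degree n is obstructed
only if (λ¹)^n is an eigenvalue of the exponent matrix. This happens for at most one n: two such
powers would be the two roots of the characteristic polynomial, and their product would be a
non-zero integer of modulus < 1. The obstruction is carried by the factor 1 + gX^n.

If the first two components depend on X and Y only, the derivative of the third along the fibre can
vanish only on the critical hyperplanes, so it is again a monomial times a unit. Solving w ∘ f = w -
log(unit) and taking a primitive of exp(w) as the new fibre coordinate makes the third component
νX^lY^mZ + ω(X,Y) (`IsContractingWithEigenvalues.exists_affine_fibre`). Adding multiples of X and Y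
to Z, and scaling, then simplifies the linear part of ω.

The cases come from the columns of A. By injectivity no column is zero, so each is a basis vector or
has sum at least 2. Periodic components have basis vectors as columns and are permuted; the
non-periodic ones can be ordered triangularly. A column of sum at least 2 gives a covector killed by
the transpose of df₀, and a basis vector gives a non-zero multiple of another covector, so A
controls the eigenvalues; in particular three periodic components would make df₀ invertible,
contradicting that 0 is critical. The remaining inequalities between exponents hold because
otherwise one of the hyperplanes would not be critical (`HasNormalForm.false_of_invariant`). -/

noncomputable section


/-! ### Holomorphic functions of several variables: Weierstrass and Osgood. -/

section SeveralVariables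

variable {E : Type*} [NormedAddCommGroup E] [NormedSpace ℂ E]
  {F : Type*} [NormedAddCommGroup F] [NormedSpace ℂ F]

/-- Cauchy estimate for the differential. -/
theorem norm_fderiv_le_of_ball {f : E → F} {x : E} {R M : ℝ} (hR : 0 < R)
    (hf : DifferentiableOn ℂ f (Metric.ball x R)) (hM : ∀ y ∈ Metric.ball x R, ‖f y‖ ≤ M) :
    ‖fderiv ℂ f x‖ ≤ 2 * M / R := by
  refine Complex.norm_fderiv_le_div_of_mapsTo_ball hf (fun y hy => ?_) hR
  rw [Metric.mem_closedBall, dist_eq_norm]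
  have h1 := hM y hy
  have h2 := hM x (Metric.mem_ball_self hR)
  linarith [norm_sub_le (f y) (f x)]

/-- The Cauchy estimate bounds the differentials of the terms on the half ball by a summable
sequence, so the series can be differentiated term by term (Weierstrass). -/
theorem differentiableOn_tsum_ball [CompleteSpace F] {u : ℕ → E → F} {x₀ : E} {R : ℝ} {b : ℕ → ℝ}
    (hR : 0 < R)
    (hu : ∀ n, DifferentiableOn ℂ (u n) (Metric.ball x₀ R))
    (hb : ∀ n, ∀ x ∈ Metric.ball x₀ R, ‖u n x‖ ≤ b n) (hs : Summable b) :
    DifferentiableOn ℂ (fun x => ∑' n, u n x) (Metric.ball x₀ (R / 2)) := by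
  intro x hx
  have hsub : ∀ y ∈ Metric.ball x₀ (R / 2), Metric.ball y (R / 2) ⊆ Metric.ball x₀ R := by
    intro y hy
    apply Metric.ball_subset_ball'
    rw [Metric.mem_ball] at hy
    linarith
  have hmem : ∀ y ∈ Metric.ball x₀ (R / 2), y ∈ Metric.ball x₀ R := fun y hy =>
    hsub y hy (Metric.mem_ball_self (by linarith))
  let _ : NormedSpace ℝ E := NormedSpace.restrictScalars ℝ ℂ E
  refine (hasFDerivAt_tsum_of_isPreconnected (u := fun n => 2 * b n / (R / 2))
    (f' := fun n x => fderiv ℂ (u n) x) ?_ Metric.isOpen_ball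
    (convex_ball x₀ (R / 2)).isPreconnected (fun n y hy => ?_) (fun n y hy => ?_)
    (Metric.mem_ball_self (by linarith : 0 < R / 2)) ?_ hx).differentiableAt.differentiableWithinAt
  · exact (hs.mul_left 2).div_const _
  · exact ((hu n).differentiableAt (Metric.isOpen_ball.mem_nhds (hmem y hy))).hasFDerivAt
  · exact norm_fderiv_le_of_ball (by linarith) ((hu n).mono (hsub y hy))
      (fun z hz => hb n z (hsub y hy hz))
  · exact Summable.of_norm_bounded hs (fun n => hb n x₀ (Metric.mem_ball_self hR))

/-- Schwarz lemma of second order: subtracting the linear part leaves a map which stays within 4M of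
its central value and agrees with it to first order. Hence its deviation is quadratic in the
relative distance. -/
theorem norm_sub_fderiv_le_of_ball {f : E → F} {x z : E} {R M : ℝ} (hR : 0 < R)
    (hf : DifferentiableOn ℂ f (Metric.ball x R)) (hM : ∀ y ∈ Metric.ball x R, ‖f y‖ ≤ M)
    (hz : z ∈ Metric.ball x R) :
    ‖f z - f x - fderiv ℂ f x (z - x)‖ ≤ 4 * M * (dist z x / R) ^ 2 := by
  have hx := Metric.mem_ball_self (x := x) hR
  have hC := norm_fderiv_le_of_ball hR hf hM
  have key := Complex.dist_le_mul_div_pow_of_mapsTo_ball_of_isLittleO (n := 1) (R₂ := 4 * M)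
    (f := fun y => f y - fderiv ℂ f x (y - x)) (c := x) (z := z) (R₁ := R) ?_ ?_ ?_ hz
  · simpa [dist_eq_norm, sub_right_comm] using key
  · exact hf.sub (by fun_prop)
  · intro y hy
    rw [Metric.mem_closedBall, dist_eq_norm]
    have h1 : ‖fderiv ℂ f x (y - x)‖ ≤ 2 * M := by
      refine (ContinuousLinearMap.le_opNorm _ _).trans ?_
      have h2 : ‖y - x‖ ≤ R := by rw [← dist_eq_norm]; exact (Metric.mem_ball.1 hy).le
      calc _ ≤ 2 * M / R * R := by gcongr; exact (norm_nonneg _).trans hC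
        _ = 2 * M := by field_simp
    simp only [sub_self, map_zero, sub_zero]
    have h3 := hM y hy
    have h4 := hM x hx
    calc ‖f y - fderiv ℂ f x (y - x) - f x‖ ≤ ‖f y‖ + ‖fderiv ℂ f x (y - x)‖ + ‖f x‖ :=
          (norm_sub_le _ _).trans (by gcongr; exact norm_sub_le _ _)
      _ ≤ 4 * M := by linarith
  · have h := (hf.differentiableAt (Metric.isOpen_ball.mem_nhds hx)).hasFDerivAt.isLittleO
    simp only [pow_one]
    refine (h.congr_left fun y => ?_).norm_right
    simp [sub_right_comm]

/-- The directional derivative is the limit of the difference quotients with steps δ/2^n. By the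
second order estimate they converge geometrically and uniformly, so the derivative is a uniformly
convergent telescoping series of holomorphic functions. -/
theorem differentiableAt_fderiv_apply [CompleteSpace F] {f : E → F} {x₀ : E} {R M : ℝ}
    (hR : 0 < R)
    (hf : DifferentiableOn ℂ f (Metric.ball x₀ R)) (hM : ∀ y ∈ Metric.ball x₀ R, ‖f y‖ ≤ M)
    (v : E) : DifferentiableAt ℂ (fun x => fderiv ℂ f x v) x₀ := by
  set δ : ℝ := R / (4 * (‖v‖ + 1)) with hδ
  have hv : 0 < ‖v‖ + 1 := by positivity
  have hδ0 : 0 < δ := by positivity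
  have hδv : δ * ‖v‖ < R / 2 := by
    rw [hδ, div_mul_eq_mul_div, div_lt_div_iff₀ (by positivity) (by norm_num)]
    nlinarith [norm_nonneg v]
  set t : ℕ → ℂ := fun n => ((δ * (1 / 2) ^ n : ℝ) : ℂ) with ht
  have htn : ∀ n, ‖t n‖ = δ * (1 / 2) ^ n := fun n => by
    rw [ht]; simp only [Complex.norm_real, Real.norm_eq_abs]; exact abs_of_pos (by positivity)
  have ht0 : ∀ n, t n ≠ 0 := fun n => by
    rw [← norm_pos_iff, htn]; positivity
  have htv : ∀ n, ‖t n • v‖ < R / 2 := fun n => by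
    rw [norm_smul, htn]
    have : (1 / 2 : ℝ) ^ n ≤ 1 := pow_le_one₀ (by norm_num) (by norm_num)
    have : δ * (1 / 2) ^ n * ‖v‖ ≤ δ * 1 * ‖v‖ := by gcongr
    linarith
  set Q : ℕ → E → F := fun n x => (t n)⁻¹ • (f (x + t n • v) - f x) with hQ
  have hsub : ∀ y ∈ Metric.ball x₀ (R / 2), Metric.ball y (R / 2) ⊆ Metric.ball x₀ R := by
    intro y hy
    apply Metric.ball_subset_ball'
    rw [Metric.mem_ball] at hy
    linarith
  have hmem : ∀ n, ∀ y ∈ Metric.ball x₀ (R / 2), y + t n • v ∈ Metric.ball x₀ R := fun n y hy =>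
    hsub y hy (by rw [Metric.mem_ball, dist_eq_norm]; simpa using htv n)
  have hQd : ∀ n, DifferentiableOn ℂ (Q n) (Metric.ball x₀ (R / 2)) := by
    intro n
    refine DifferentiableOn.const_smul (DifferentiableOn.sub ?_ ?_) _
    · exact hf.comp (by fun_prop) (fun y hy => hmem n y hy)
    · exact hf.mono (Metric.ball_subset_ball (by linarith))
  have hM0 : 0 ≤ M := (norm_nonneg _).trans (hM x₀ (Metric.mem_ball_self hR))
  set C : ℝ := 4 * M * (‖v‖ / (R / 2)) ^ 2 * δ
  have hQb : ∀ n, ∀ x ∈ Metric.ball x₀ (R / 2), ‖Q n x - fderiv ℂ f x v‖ ≤ C * (1 / 2) ^ n := by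
    intro n x hx
    have h1 := norm_sub_fderiv_le_of_ball (z := x + t n • v) (by linarith : 0 < R / 2)
      (hf.mono (hsub x hx)) (fun y hy => hM y (hsub x hx hy))
      (by rw [Metric.mem_ball, dist_eq_norm]; simpa using htv n)
    have h2 : Q n x - fderiv ℂ f x v
        = (t n)⁻¹ • (f (x + t n • v) - f x - fderiv ℂ f x (x + t n • v - x)) := by
      simp only [hQ, add_sub_cancel_left, map_smul, smul_sub, inv_smul_smul₀ (ht0 n)]
    rw [h2, norm_smul, norm_inv, htn]
    have h3 : dist (x + t n • v) x = δ * (1 / 2) ^ n * ‖v‖ := by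
      rw [dist_eq_norm, add_sub_cancel_left, norm_smul, htn]
    rw [h3] at h1
    calc (δ * (1 / 2) ^ n)⁻¹ * _ ≤ (δ * (1 / 2) ^ n)⁻¹ *
          (4 * M * (δ * (1 / 2) ^ n * ‖v‖ / (R / 2)) ^ 2) := by gcongr
      _ = C * (1 / 2) ^ n := by simp only [C]; field_simp
  have hsum : Summable fun n : ℕ => 2 * C * (1 / 2 : ℝ) ^ n :=
    (summable_geometric_of_lt_one (by norm_num) (by norm_num)).mul_left _
  have hC0 : 0 ≤ C := by positivity
  have hDb : ∀ n, ∀ x ∈ Metric.ball x₀ (R / 2), ‖Q (n + 1) x - Q n x‖ ≤ 2 * C * (1 / 2) ^ n := by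
    intro n x hx
    have h1 := hQb n x hx
    have h2 := hQb (n + 1) x hx
    have h3 : C * (1 / 2 : ℝ) ^ (n + 1) ≤ C * (1 / 2) ^ n := by
      gcongr C * ?_
      exact pow_le_pow_of_le_one (by norm_num) (by norm_num) (Nat.le_succ n)
    have h4 : Q (n + 1) x - Q n x
        = (Q (n + 1) x - fderiv ℂ f x v) - (Q n x - fderiv ℂ f x v) := by abel
    rw [h4]
    linarith [norm_sub_le (Q (n + 1) x - fderiv ℂ f x v) (Q n x - fderiv ℂ f x v)]
  have hdiff := differentiableOn_tsum_ball (by linarith : 0 < R / 2)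
    (fun n => (hQd (n + 1)).sub (hQd n)) hDb hsum
  have hx₀ : x₀ ∈ Metric.ball x₀ (R / 2 / 2) := Metric.mem_ball_self (by linarith)
  have h5 := (hdiff.add ((hQd 0).mono (Metric.ball_subset_ball (by linarith)))).differentiableAt
    (Metric.isOpen_ball.mem_nhds hx₀)
  refine h5.congr_of_eventuallyEq ?_
  filter_upwards [Metric.isOpen_ball.mem_nhds hx₀] with x hx
  have hx' : x ∈ Metric.ball x₀ (R / 2) := Metric.ball_subset_ball (by linarith) hx
  have hlim : Tendsto (fun n => Q n x) atTop (𝓝 (fderiv ℂ f x v)) := by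
    rw [tendsto_iff_norm_sub_tendsto_zero]
    refine squeeze_zero (fun _ => norm_nonneg _) (fun n => hQb n x hx') ?_
    simpa using (tendsto_pow_atTop_nhds_zero_of_lt_one (by norm_num : (0:ℝ) ≤ 1 / 2)
      (by norm_num)).const_mul C
  have hS : Summable fun n => Q (n + 1) x - Q n x :=
    Summable.of_norm_bounded hsum (fun n => hDb n x hx')
  have h6 := hS.hasSum.tendsto_sum_nat
  simp only [Finset.sum_range_sub (fun n => Q n x)] at h6
  have h7 := tendsto_nhds_unique h6 (hlim.sub_const (Q 0 x))
  simp only [Pi.sub_apply, Pi.add_apply]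
  rw [h7]; abel

theorem differentiableAt_clm_of_apply [FiniteDimensional ℂ E] {f : E → E →L[ℂ] F} {x : E}
    (h : ∀ v, DifferentiableAt ℂ (fun x => f x v) x) : DifferentiableAt ℂ f x := by
  let d := Module.finrank ℂ E
  have hd : d = Module.finrank ℂ (Fin d → ℂ) := (Module.finrank_fin_fun ℂ).symm
  let e₁ := ContinuousLinearEquiv.ofFinrankEq hd
  let e₂ := (e₁.arrowCongr (1 : F ≃L[ℂ] F)).trans (ContinuousLinearEquiv.piRing (Fin d))
  rw [← Function.id_comp f, ← e₂.symm_comp_self]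
  exact e₂.symm.differentiableAt.comp x (differentiableAt_pi.mpr fun i => h _)

theorem DifferentiableOn.fderiv_of_isOpen_complex [FiniteDimensional ℂ E] [CompleteSpace F] {f : E → F} {s : Set E} (hs : IsOpen s)
    (hf : DifferentiableOn ℂ f s) : DifferentiableOn ℂ (fderiv ℂ f) s := by
  intro x hx
  apply DifferentiableAt.differentiableWithinAt
  have hc : ContinuousAt f x := (hf.differentiableAt (hs.mem_nhds hx)).continuousAt
  have h1 : ∀ᶠ y in 𝓝 x, y ∈ s ∧ ‖f y‖ ≤ ‖f x‖ + 1 := by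
    filter_upwards [hs.mem_nhds hx, hc.norm.eventually (gt_mem_nhds (lt_add_one _))] with y h1 h2
      using ⟨h1, h2.le⟩
  obtain ⟨R, hR, hb⟩ := Metric.eventually_nhds_iff_ball.1 h1
  exact differentiableAt_clm_of_apply
    (differentiableAt_fderiv_apply hR (hf.mono fun y hy => (hb y hy).1) fun y hy => (hb y hy).2)

theorem DifferentiableOn.iteratedFDeriv_of_isOpen_complex [FiniteDimensional ℂ E]
    [CompleteSpace F] {f : E → F} {s : Set E} (hs : IsOpen s)
    (hf : DifferentiableOn ℂ f s) (n : ℕ) : DifferentiableOn ℂ (iteratedFDeriv ℂ n f) s := by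
  induction n with
  | zero =>
    rw [iteratedFDeriv_zero_eq_comp]
    exact (LinearIsometryEquiv.differentiable _).comp_differentiableOn hf
  | succ n ih =>
    rw [iteratedFDeriv_succ_eq_comp_left]
    intro x hx
    have h1 : HasFDerivWithinAt (fderiv ℂ (iteratedFDeriv ℂ n f)) _ s x :=
      (ih.fderiv_of_isOpen_complex hs x hx).hasFDerivWithinAt
    let L := (continuousMultilinearCurryLeftEquiv ℂ
      (fun _ : Fin (n + 1) => E) F).symm.toContinuousLinearEquiv.toContinuousLinearMap
    exact (L.hasFDerivAt.comp_hasFDerivWithinAt x h1).differentiableWithinAt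

/-- Each further derivative costs one Cauchy estimate on a ball of radius δ: the radius shrinks by δ
and the bound grows by 2/δ. The radius δ stays free, because the best choice depends on n. -/
theorem differentiable_bound_iteratedFDeriv {f : E → F} {x : E} {r δ M : ℝ} (hδ : 0 < δ)
    (hd : ∀ n, DifferentiableOn ℂ (iteratedFDeriv ℂ n f) (Metric.ball x r))
    (hM : ∀ y ∈ Metric.ball x r, ‖f y‖ ≤ M) (n : ℕ) :
    ∀ y ∈ Metric.ball x (r - n * δ), ‖iteratedFDeriv ℂ n f y‖ ≤ M * (2 / δ) ^ n := by
  induction n with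
  | zero => intro y hy; simpa using hM y (by simpa using hy)
  | succ n ih =>
    intro y hy
    have hsub : Metric.ball y δ ⊆ Metric.ball x (r - n * δ) := by
      apply Metric.ball_subset_ball'
      rw [Metric.mem_ball] at hy
      push_cast at hy
      linarith
    have h0 : (0 : ℝ) ≤ n * δ := by positivity
    have hsub' : Metric.ball x (r - n * δ) ⊆ Metric.ball x r :=
      Metric.ball_subset_ball (by linarith)
    have h1 : DifferentiableOn ℂ (iteratedFDeriv ℂ n f) (Metric.ball y δ) :=
      (hd n).mono (hsub.trans hsub')
    have this : ‖fderiv ℂ (iteratedFDeriv ℂ n f) y‖ ≤ 2 * (M * (2 / δ) ^ n) / δ :=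
      norm_fderiv_le_of_ball hδ h1 fun z hz => ih z (hsub hz)
    rw [norm_fderiv_iteratedFDeriv] at this
    refine this.trans (le_of_eq ?_)
    rw [pow_succ]; ring

/-- Taylor expansion along a complex line. -/
theorem hasSum_iteratedFDeriv_diag [CompleteSpace F] {f : E → F} {x v : E} {r : ℝ}
    (hd : ∀ n, DifferentiableOn ℂ (iteratedFDeriv ℂ n f) (Metric.ball x r))
    (hv : ‖v‖ < r) :
    HasSum (fun n : ℕ => ((n.factorial : ℂ))⁻¹ • iteratedFDeriv ℂ n f x (fun _ => v))
      (f (x + v)) := by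
  obtain ⟨ρ, hρ1, hρ⟩ : ∃ ρ : ℝ, 1 < ρ ∧ ρ * ‖v‖ < r := by
    have hc : ContinuousAt (fun ρ : ℝ => ρ * ‖v‖) 1 := by fun_prop
    have h1 : ∀ᶠ ρ in 𝓝[>] (1 : ℝ), ρ * ‖v‖ < r :=
      (hc.tendsto.mono_left nhdsWithin_le_nhds).eventually (gt_mem_nhds (by simpa using hv))
    obtain ⟨ρ, h2, h3⟩ := (h1.and self_mem_nhdsWithin).exists
    exact ⟨ρ, h3, h2⟩
  have hmem : ∀ t ∈ Metric.ball (0 : ℂ) ρ, x + t • v ∈ Metric.ball x r := fun t ht => by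
    rw [Metric.mem_ball, dist_eq_norm, add_sub_cancel_left, norm_smul]
    rw [mem_ball_zero_iff] at ht
    exact lt_of_le_of_lt (by gcongr) hρ
  set g : ℂ → F := fun t => f (x + t • v) with hg
  have hfd : DifferentiableOn ℂ f (Metric.ball x r) := by
    have h0 := hd 0
    rw [iteratedFDeriv_zero_eq_comp] at h0
    exact ((LinearIsometryEquiv.comp_differentiableOn_iff _).1 h0)
  have hgd : DifferentiableOn ℂ g (Metric.ball 0 ρ) :=
    hfd.comp (by fun_prop) hmem
  have key : ∀ n : ℕ, ∀ t ∈ Metric.ball (0 : ℂ) ρ,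
      iteratedDeriv n g t = iteratedFDeriv ℂ n f (x + t • v) (fun _ => v) := by
    intro n
    induction n with
    | zero => intro t _; simp [hg]
    | succ n ih =>
      intro t ht
      rw [iteratedDeriv_succ]
      have h1 : iteratedDeriv n g =ᶠ[𝓝 t]
          fun s => iteratedFDeriv ℂ n f (x + s • v) (fun _ => v) := by
        filter_upwards [Metric.isOpen_ball.mem_nhds ht] with s hs using ih s hs
      rw [h1.deriv_eq, iteratedFDeriv_succ_apply_left]
      have h2 : HasFDerivAt (iteratedFDeriv ℂ n f) (fderiv ℂ (iteratedFDeriv ℂ n f) (x + t • v))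
          (x + t • v) :=
        ((hd n).differentiableAt (Metric.isOpen_ball.mem_nhds (hmem t ht))).hasFDerivAt
      have h3 : HasDerivAt (fun s : ℂ => x + s • v) v t := by
        simpa using ((hasDerivAt_id t).smul_const v).const_add x
      have h4 := h2.comp_hasDerivAt t h3
      have h5 := (ContinuousMultilinearMap.apply ℂ (fun _ : Fin n => E) F
        (fun _ => v)).hasFDerivAt.comp_hasDerivAt t h4
      exact h5.deriv
  have h1 := Complex.hasSum_taylorSeries_on_ball hgd
    (show (1 : ℂ) ∈ Metric.ball (0 : ℂ) ρ by simpa using hρ1)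
  simp only [sub_zero, one_pow, one_smul] at h1
  have h0 : (0 : ℂ) ∈ Metric.ball (0 : ℂ) ρ := Metric.mem_ball_self (by linarith)
  simp only [key _ 0 h0, zero_smul, add_zero] at h1
  simpa [hg] using h1

/-- **Osgood's lemma**: a function of finitely many complex variables which is differentiable near
a point is analytic there. -/
theorem analyticAt_of_eventually_differentiableAt [FiniteDimensional ℂ E] [CompleteSpace F]
    {f : E → F} {x : E} (hf : ∀ᶠ y in 𝓝 x, DifferentiableAt ℂ f y) : AnalyticAt ℂ f x := by
  have hc : ContinuousAt f x := hf.self_of_nhds.continuousAt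
  obtain ⟨r, hr, hb⟩ := Metric.eventually_nhds_iff_ball.1
    (hf.and (hc.norm.eventually (gt_mem_nhds (lt_add_one _))))
  set M := ‖f x‖ + 1
  have hM0 : 0 ≤ M := by positivity
  have hfd : DifferentiableOn ℂ f (Metric.ball x r) := fun y hy =>
    (hb y hy).1.differentiableWithinAt
  have hd := fun n => hfd.iteratedFDeriv_of_isOpen_complex Metric.isOpen_ball n
  set p : FormalMultilinearSeries ℂ E F := fun n =>
    ((n.factorial : ℂ))⁻¹ • iteratedFDeriv ℂ n f x with hp
  have hpn : ∀ n, ‖p n‖ * (r / 6) ^ n ≤ M := by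
    intro n
    rcases Nat.eq_zero_or_pos n with rfl | hn
    · have := differentiable_bound_iteratedFDeriv one_pos hd (fun y hy => (hb y hy).2.le) 0 x
        (by simpa using hr)
      simpa [hp] using this
    have hn' : (0 : ℝ) < n := by exact_mod_cast hn
    have hle : ∀ δ : ℝ, 0 < δ → n * δ < r → ‖p n‖ ≤ (n.factorial : ℝ)⁻¹ * (M * (2 / δ) ^ n) := by
      intro δ h0 h1
      have := differentiable_bound_iteratedFDeriv h0 hd (fun y hy => (hb y hy).2.le) n x
        (Metric.mem_ball_self (by linarith))
      rw [hp, norm_smul, norm_inv, Complex.norm_natCast]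
      gcongr
    have h2 : ‖p n‖ ≤ (n.factorial : ℝ)⁻¹ * (M * (6 * n / (r * Real.exp 1)) ^ n) := by
      have he : (2.7 : ℝ) < Real.exp 1 := by linarith [Real.exp_one_gt_d9]
      have he' : Real.exp 1 < 3 := by linarith [Real.exp_one_lt_d9]
      -- The choice δ = er/(3n) is admissible because nδ = er/3 < r. It gives (2/δ)^n = (6n/(er))^n,
      -- whose growth n^n/e^n is compensated by n!; hence the radius r/6.
      refine (hle (r * Real.exp 1 / (3 * n)) (by positivity) ?_).trans (le_of_eq ?_)
      · rw [mul_div_assoc', div_lt_iff₀ (by positivity)]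
        nlinarith [mul_pos hr hn']
      · congr 3
        field_simp
        norm_num
    have h3 : (n : ℝ) ^ n ≤ n.factorial * Real.exp n := by
      have := Real.pow_div_factorial_le_exp (n : ℝ) hn'.le n
      rwa [div_le_iff₀ (by positivity), mul_comm] at this
    calc ‖p n‖ * (r / 6) ^ n
        ≤ (n.factorial : ℝ)⁻¹ * (M * (6 * n / (r * Real.exp 1)) ^ n) * (r / 6) ^ n := by gcongr
      _ = M * ((n : ℝ) ^ n / (n.factorial * Real.exp n)) := by
        have : Real.exp n = Real.exp 1 ^ n := by rw [← Real.exp_nat_mul, mul_one]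
        rw [this]
        simp only [div_pow, mul_pow]
        field_simp
      _ ≤ M * 1 := by
        gcongr
        exact div_le_one_of_le₀ h3 (by positivity)
      _ = M := mul_one M
  have hr6 : 0 < r / 6 := by positivity
  refine ⟨p, ENNReal.ofReal (r / 6), ?_, by simpa using hr6, ?_⟩
  · refine p.le_radius_of_bound M (r := (r / 6).toNNReal) fun n => ?_
    rw [Real.coe_toNNReal _ hr6.le]
    exact hpn n
  · intro y hy
    rw [Metric.eball_ofReal, mem_ball_zero_iff] at hy
    exact hasSum_iteratedFDeriv_diag hd (by linarith)

end SeveralVariables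

/-! ### Contracting germs and the equation v ∘ f = D v + h. -/

section Contraction

open Asymptotics

/-- Iterates of points near `0` converge to `0` at the geometric rate `θ`. -/
def ContractsAt {E : Type*} [NormedAddCommGroup E] (f : E → E) (θ : ℝ) : Prop :=
  ∃ C r : ℝ, 0 < C ∧ 0 < r ∧ ∀ x, ‖x‖ < r → ∀ n : ℕ, ‖f^[n] x‖ ≤ C * θ ^ n * ‖x‖

/-- Orbits of points near `0` stay near `0`. -/
def OrbitStable {E : Type*} [NormedAddCommGroup E] (f : E → E) : Prop :=
  ∀ V ∈ 𝓝 (0 : E), ∀ᶠ x in 𝓝 (0 : E), ∀ n : ℕ, f^[n] x ∈ V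

variable {E : Type*} [NormedAddCommGroup E] [NormedSpace ℂ E]

/-- Gelfand's formula for the spectral radius. In finite dimension the spectrum consists of
eigenvalues, and the one of largest modulus is below θ. -/
theorem exists_norm_pow_lt [FiniteDimensional ℂ E] (A : E →L[ℂ] E) {θ : ℝ} (hθ : 0 < θ)
    (h : ∀ μ : ℂ, Module.End.HasEigenvalue (A : E →ₗ[ℂ] E) μ → ‖μ‖ < θ) :
    ∃ m : ℕ, 0 < m ∧ ‖A ^ m‖ < θ ^ m := by
  rcases subsingleton_or_nontrivial E with hE | hE
  · refine ⟨1, one_pos, ?_⟩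
    have : A = 0 := Subsingleton.elim _ _
    simpa [this] using hθ
  have : CompleteSpace E := FiniteDimensional.complete ℂ E
  have hspec : spectralRadius ℂ A < ENNReal.ofReal θ := by
    obtain ⟨μ, hμ, h1⟩ := spectrum.exists_nnnorm_eq_spectralRadius A
    rw [← h1]
    have h2 : Module.End.HasEigenvalue (A : E →ₗ[ℂ] E) μ := by
      rw [Module.End.hasEigenvalue_iff_mem_spectrum]
      rw [spectrum.mem_iff] at hμ ⊢
      intro hu
      apply hμ
      have hb : Function.Bijective (algebraMap ℂ (Module.End ℂ E) μ - (A : E →ₗ[ℂ] E)) :=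
        (Module.End.isUnit_iff _).1 hu
      let e := (LinearEquiv.ofBijective _ hb).toContinuousLinearEquiv
      have he : (e : E →L[ℂ] E) = algebraMap ℂ (E →L[ℂ] E) μ - A := by
        ext x; rfl
      rw [← he]
      exact ⟨ContinuousLinearEquiv.toUnit e, rfl⟩
    have h3 := h μ h2
    have h4 : ((‖μ‖₊ : NNReal) : ENNReal) = ENNReal.ofReal ‖μ‖ := by
      rw [ofReal_norm]; rfl
    rw [h4]
    exact (ENNReal.ofReal_lt_ofReal_iff hθ).2 h3
  have ht := spectrum.pow_nnnorm_pow_one_div_tendsto_nhds_spectralRadius A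
  obtain ⟨m, hm, hm0⟩ := ((ht.eventually (gt_mem_nhds hspec)).and (eventually_gt_atTop 0)).exists
  refine ⟨m, hm0, ?_⟩
  have hm0' : (0 : ℝ) < m := by exact_mod_cast hm0
  rw [one_div, ENNReal.rpow_inv_lt_iff hm0', ENNReal.rpow_natCast, ← ENNReal.ofReal_pow hθ.le] at hm
  have : ((‖A ^ m‖₊ : NNReal) : ENNReal) = ENNReal.ofReal ‖A ^ m‖ := by
    rw [ofReal_norm]; rfl
  rw [this, ENNReal.ofReal_lt_ofReal_iff (by positivity)] at hm
  exact hm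

/-- The norm is replaced by the adapted norm ν(x) = ∑_{j<m} θ^{-j}‖A^j x‖, with ‖A^m‖ < θ^m.
Telescoping shows that A contracts ν by θ with something to spare, and near 0 this margin absorbs
the nonlinear part of f. -/
theorem contractsAt_of_eigenvalues [FiniteDimensional ℂ E] {f : E → E}
    (hf : DifferentiableAt ℂ f 0) (h0 : f 0 = 0) {θ : ℝ} (hθ : 0 < θ) (hθ1 : θ ≤ 1)
    (h : ∀ μ : ℂ, Module.End.HasEigenvalue (fderiv ℂ f 0 : E →ₗ[ℂ] E) μ → ‖μ‖ < θ) :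
    ContractsAt f θ := by
  set A := fderiv ℂ f 0 with hA
  obtain ⟨m, hm, hlt⟩ := exists_norm_pow_lt A hθ h
  set ν : E → ℝ := fun x => ∑ j ∈ Finset.range m, (θ ^ j)⁻¹ * ‖(A ^ j) x‖ with hν
  have hν0 : ∀ x, ‖x‖ ≤ ν x := fun x => by
    have h1 := Finset.single_le_sum (f := fun j => (θ ^ j)⁻¹ * ‖(A ^ j) x‖)
      (fun j _ => by positivity) (Finset.mem_range.2 hm)
    refine le_trans (le_of_eq ?_) h1
    simp
  set K : ℝ := ∑ j ∈ Finset.range m, (θ ^ j)⁻¹ * ‖A ^ j‖ with hK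
  have hνK : ∀ x, ν x ≤ K * ‖x‖ := fun x => by
    rw [hν, hK, Finset.sum_mul]
    refine Finset.sum_le_sum fun j _ => ?_
    rw [mul_assoc]
    gcongr
    exact ContinuousLinearMap.le_opNorm _ _
  have hK0 : 0 ≤ K := Finset.sum_nonneg fun j _ => by positivity
  have hadd : ∀ x y, ν (x + y) ≤ ν x + ν y := fun x y => by
    simp only [hν, ← Finset.sum_add_distrib, ← mul_add, map_add]
    gcongr
    exact norm_add_le _ _
  have hνA : ∀ x, ν (A x) = θ * (ν x - ‖x‖ + (θ ^ m)⁻¹ * ‖(A ^ m) x‖) := fun x => by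
    have h1 : ν x + (θ ^ m)⁻¹ * ‖(A ^ m) x‖
        = (∑ j ∈ Finset.range m, (θ ^ (j + 1))⁻¹ * ‖(A ^ (j + 1)) x‖) + ‖x‖ := by
      rw [hν]
      simp only
      rw [← Finset.sum_range_succ, Finset.sum_range_succ']
      simp
    have h2 : ν (A x) = θ * ∑ j ∈ Finset.range m, (θ ^ (j + 1))⁻¹ * ‖(A ^ (j + 1)) x‖ := by
      rw [hν, Finset.mul_sum]
      refine Finset.sum_congr rfl fun j _ => ?_
      rw [pow_succ A]
      simp only [mul_apply_eq_comp]
      rw [pow_succ θ]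
      field_simp
    rw [h2]; congr 1; linarith
  -- The margin ν(Ax) ≤ θν(x) - θε‖x‖ is measured in the original norm, in which f - A is small. It
  -- allows f to contract at exactly the rate θ.
  set ε : ℝ := 1 - (θ ^ m)⁻¹ * ‖A ^ m‖ with hε
  have hε0 : 0 < ε := by
    rw [hε, sub_pos, inv_mul_lt_iff₀ (by positivity)]; simpa using hlt
  have hνA' : ∀ x, ν (A x) ≤ θ * ν x - θ * ε * ‖x‖ := fun x => by
    rw [hνA]
    have : (θ ^ m)⁻¹ * ‖(A ^ m) x‖ ≤ (θ ^ m)⁻¹ * (‖A ^ m‖ * ‖x‖) := by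
      gcongr; exact ContinuousLinearMap.le_opNorm _ _
    have h3 : θ * (ν x - ‖x‖ + (θ ^ m)⁻¹ * ‖(A ^ m) x‖) ≤
      θ * (ν x - ‖x‖ + (θ ^ m)⁻¹ * (‖A ^ m‖ * ‖x‖)) := by gcongr
    refine h3.trans (le_of_eq ?_)
    rw [hε]; ring
  have hlo := hf.hasFDerivAt.isLittleO
  have hη : 0 < θ * ε / (K + 1) := by positivity
  have h1 := hlo.def hη
  simp only [sub_zero, h0] at h1
  obtain ⟨r, hr, hb⟩ := Metric.eventually_nhds_iff_ball.1 h1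
  have hstep : ∀ x, ‖x‖ < r → ν (f x) ≤ θ * ν x := fun x hx => by
    have h2 := hb x (by simpa using hx)
    have h3 : ν (f x) ≤ ν (A x) + K * ‖f x - A x‖ := by
      have := hadd (A x) (f x - A x)
      rw [add_sub_cancel] at this
      linarith [hνK (f x - A x)]
    have h4 : K * ‖f x - A x‖ ≤ θ * ε * ‖x‖ := by
      calc K * ‖f x - A x‖ ≤ K * (θ * ε / (K + 1) * ‖x‖) := by gcongr
        _ = K / (K + 1) * (θ * ε * ‖x‖) := by ring
        _ ≤ 1 * (θ * ε * ‖x‖) := by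
          gcongr
          exact div_le_one_of_le₀ (by linarith) (by linarith)
        _ = _ := one_mul _
    linarith [hνA' x]
  refine ⟨K + 1, r / (K + 1), by linarith, by positivity, fun x hx n => ?_⟩
  have hx' : ν x < r := by
    rw [lt_div_iff₀ (by linarith)] at hx
    nlinarith [hνK x, norm_nonneg x]
  have hind : ∀ n : ℕ, ν (f^[n] x) ≤ θ ^ n * ν x := by
    intro n
    induction n with
    | zero => simp
    | succ n ih =>
      rw [Function.iterate_succ_apply']
      have hνx : 0 ≤ ν x := (norm_nonneg x).trans (hν0 x)
      have h5 : ‖f^[n] x‖ < r := by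
        have : θ ^ n ≤ 1 := pow_le_one₀ hθ.le hθ1
        calc _ ≤ ν (f^[n] x) := hν0 _
          _ ≤ θ ^ n * ν x := ih
          _ ≤ 1 * ν x := by gcongr
          _ < r := by simpa using hx'
      calc _ ≤ θ * ν (f^[n] x) := hstep _ h5
        _ ≤ θ * (θ ^ n * ν x) := by gcongr
        _ = _ := by ring
  calc _ ≤ ν (f^[n] x) := hν0 _
    _ ≤ θ ^ n * ν x := hind n
    _ ≤ θ ^ n * ((K + 1) * ‖x‖) := by
      gcongr; exact (hνK x).trans (by gcongr; linarith)
    _ = _ := by ring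

theorem ContractsAt.orbitStable {E : Type*} [NormedAddCommGroup E] {f : E → E} {θ : ℝ} (h : ContractsAt f θ) (hθ : 0 ≤ θ)
    (hθ1 : θ ≤ 1) : OrbitStable f := by
  obtain ⟨C, r, hC, hr, h⟩ := h
  intro V hV
  obtain ⟨ε, hε, hb⟩ := Metric.mem_nhds_iff.1 hV
  have h1 : 0 < min r (ε / C) := lt_min hr (by positivity)
  filter_upwards [Metric.ball_mem_nhds (0 : E) h1] with x hx n
  rw [mem_ball_zero_iff, lt_min_iff] at hx
  apply hb
  rw [mem_ball_zero_iff]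
  have : θ ^ n ≤ 1 := pow_le_one₀ hθ hθ1
  calc _ ≤ C * θ ^ n * ‖x‖ := h x hx.1 n
    _ ≤ C * 1 * ‖x‖ := by gcongr
    _ < ε := by rw [mul_one, mul_comm]; exact (lt_div_iff₀ hC).1 hx.2

theorem OrbitStable.eventually {E : Type*} [NormedAddCommGroup E] {f : E → E} (h : OrbitStable f) {P : E → Prop}
    (hP : ∀ᶠ x in 𝓝 (0 : E), P x) : ∀ᶠ x in 𝓝 (0 : E), ∀ n : ℕ, P (f^[n] x) :=
  h _ hP

theorem analyticAt_iterate {f : E → E} (hf : AnalyticAt ℂ f 0) (h0 : f 0 = 0) (n : ℕ) :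
    AnalyticAt ℂ f^[n] 0 := by
  induction n with
  | zero => exact analyticAt_id
  | succ n ih =>
    rw [Function.iterate_succ']
    refine AnalyticAt.comp ?_ ih
    rwa [Function.iterate_fixed h0]

theorem OrbitStable.differentiableAt_iterate {f : E → E} {x : E}
    (h : ∀ n : ℕ, DifferentiableAt ℂ f (f^[n] x)) (n : ℕ) : DifferentiableAt ℂ f^[n] x := by
  induction n with
  | zero => exact differentiableAt_id
  | succ n ih =>
    rw [Function.iterate_succ']
    exact (h n).comp x ih

variable {G : Type*} [NormedAddCommGroup G] [NormedSpace ℂ G] [CompleteSpace G]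

/-- Solution of the linear functional equation `v ∘ f = D v + h` when `h` vanishes to an order which
is large with respect to the expansion of `D⁻¹`. -/
theorem exists_functional_solution [FiniteDimensional ℂ E] {f : E → E} {θ : ℝ}
    (hf : AnalyticAt ℂ f 0)
    (hc : ContractsAt f θ) (hθ : 0 < θ) (hθ1 : θ ≤ 1) {B D : G →L[ℂ] G} (hDB : ∀ y, D (B y) = y)
    {h : E → G} (hh : AnalyticAt ℂ h 0) {N : ℕ} (hN : h =O[𝓝 0] fun x => ‖x‖ ^ N)
    (hB : ‖B‖ * θ ^ N < 1) :
    ∃ v : E → G, AnalyticAt ℂ v 0 ∧ (v =O[𝓝 0] fun x => ‖x‖ ^ N) ∧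
      ∀ᶠ x in 𝓝 0, v (f x) = D (v x) + h x := by
  obtain ⟨C₁, hC₁⟩ := hN.bound
  have hst := hc.orbitStable hθ.le hθ1
  obtain ⟨C, r, hC, hr, hcon⟩ := hc
  have hev : ∀ᶠ x in 𝓝 (0 : E), ∀ n : ℕ, DifferentiableAt ℂ f (f^[n] x) ∧
      DifferentiableAt ℂ h (f^[n] x) ∧ ‖h (f^[n] x)‖ ≤ C₁ * ‖f^[n] x‖ ^ N := by
    refine hst.eventually (P := fun y => DifferentiableAt ℂ f y ∧ DifferentiableAt ℂ h y ∧
      ‖h y‖ ≤ C₁ * ‖y‖ ^ N) ?_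
    filter_upwards [hf.eventually_analyticAt, hh.eventually_analyticAt, hC₁] with x h1 h2 h3
    exact ⟨h1.differentiableAt, h2.differentiableAt, by simpa using h3⟩
  obtain ⟨R, hR, hb⟩ := Metric.eventually_nhds_iff_ball.1
    (hev.and (Metric.ball_mem_nhds (0 : E) hr))
  set C₂ := max C₁ 0
  set q := ‖B‖ * θ ^ N with hq
  have hq0 : 0 ≤ q := by positivity
  -- The solution is -∑ u n. The powers of `B` grow at most like ‖B‖^n, while h ∘ f^n decays like
  -- θ^{Nn}; the ratio q is their product.
  set u : ℕ → E → G := fun n x => (B ^ (n + 1)) (h (f^[n] x)) with hu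
  have hbd : ∀ n, ∀ x ∈ Metric.ball (0 : E) R, ‖u n x‖ ≤ ‖B‖ * C₂ * C ^ N * q ^ n * ‖x‖ ^ N := by
    intro n x hx
    obtain ⟨h1, h2⟩ := hb x hx
    have h3 := (h1 n).2.2
    have h4 := hcon x (by simpa using h2) n
    calc ‖u n x‖ ≤ ‖B ^ (n + 1)‖ * ‖h (f^[n] x)‖ := ContinuousLinearMap.le_opNorm _ _
      _ ≤ ‖B‖ ^ (n + 1) * (C₂ * (C * θ ^ n * ‖x‖) ^ N) := by
        gcongr
        · exact norm_pow_le' B (Nat.succ_pos n)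
        · exact h3.trans (mul_le_mul (le_max_left _ _) (by gcongr) (by positivity)
            (le_max_right _ _))
      _ = _ := by
        rw [hq]
        simp only [mul_pow, ← pow_mul, pow_succ]
        rw [mul_comm N n]; ring
  have hs : Summable fun n : ℕ => ‖B‖ * C₂ * C ^ N * q ^ n * R ^ N :=
    ((summable_geometric_of_lt_one hq0 hB).mul_left _).mul_right _
  have hbd' : ∀ n, ∀ x ∈ Metric.ball (0 : E) R, ‖u n x‖ ≤ ‖B‖ * C₂ * C ^ N * q ^ n * R ^ N := by
    intro n x hx
    refine (hbd n x hx).trans ?_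
    have : ‖x‖ ≤ R := (mem_ball_zero_iff.1 hx).le
    have h0 : 0 ≤ C₂ := le_max_right _ _
    gcongr
  have hdiff : DifferentiableOn ℂ (fun x => ∑' n, u n x) (Metric.ball 0 (R / 2)) := by
    refine differentiableOn_tsum_ball hR (fun n x hx => ?_) hbd' hs
    have h1 := (hb x hx).1
    have h2 : DifferentiableAt ℂ (fun x => h (f^[n] x)) x :=
      (h1 n).2.1.comp x (OrbitStable.differentiableAt_iterate (fun k => (h1 k).1) n)
    exact ((B ^ (n + 1)).differentiableAt.comp x h2).differentiableWithinAt
  have hsum : ∀ x ∈ Metric.ball (0 : E) R, Summable fun n => u n x := fun x hx =>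
    Summable.of_norm_bounded hs fun n => hbd' n x hx
  refine ⟨fun x => -∑' n, u n x, ?_, ?_, ?_⟩
  · apply AnalyticAt.neg
    apply analyticAt_of_eventually_differentiableAt
    filter_upwards [Metric.ball_mem_nhds (0 : E) (by linarith : 0 < R / 2)] with x hx
    exact hdiff.differentiableAt (Metric.isOpen_ball.mem_nhds hx)
  · refine IsBigO.of_bound (∑' n : ℕ, ‖B‖ * C₂ * C ^ N * q ^ n) ?_
    filter_upwards [Metric.ball_mem_nhds (0 : E) hR] with x hx
    have hs' : Summable fun n : ℕ => ‖B‖ * C₂ * C ^ N * q ^ n :=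
      (summable_geometric_of_lt_one hq0 hB).mul_left _
    rw [norm_neg, norm_pow, norm_norm, ← tsum_mul_right]
    exact tsum_of_norm_bounded (hs'.mul_right _).hasSum fun n => hbd n x hx
  · have hfc : ∀ᶠ x in 𝓝 (0 : E), f^[1] x ∈ Metric.ball (0 : E) R :=
      (hst _ (Metric.ball_mem_nhds (0 : E) hR)).mono fun x hx => hx 1
    filter_upwards [Metric.ball_mem_nhds (0 : E) hR, hfc] with x hx hx'
    have h1 : D (∑' n, u n x) = h x + ∑' n, u n (f x) := by
      rw [D.map_tsum (hsum x hx), (D.summable (hsum x hx)).tsum_eq_zero_add]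
      congr 1
      · simp [hu, hDB]
      · congr 1
        ext n
        simp only [hu, Function.iterate_succ_apply]
        rw [pow_succ' B, mul_apply_eq_comp, hDB]
    rw [map_neg, h1]; abel

/-- Only h ∘ f^m needs to vanish to high order: if w solves the equation for h ∘ f, then D^{-1}(w -
h) solves it for h, because its pull-back is D^{-1}(Dw) = w. This serves germs that become small
only along the orbits of f. -/
theorem exists_functional_solution_of_iterate [FiniteDimensional ℂ E] {f : E → E} {θ : ℝ}
    (hf : AnalyticAt ℂ f 0) (h0 : f 0 = 0)
    (hc : ContractsAt f θ) (hθ : 0 < θ) (hθ1 : θ ≤ 1) {B D : G →L[ℂ] G} (hDB : ∀ y, D (B y) = y)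
    (hBD : ∀ y, B (D y) = y) {N : ℕ} (hN0 : N ≠ 0) (hB : ‖B‖ * θ ^ N < 1) (m : ℕ)
    {h : E → G} (hh : AnalyticAt ℂ h 0) (hh0 : h 0 = 0)
    (hN : (fun x => h (f^[m] x)) =O[𝓝 0] fun x => ‖x‖ ^ N) :
    ∃ v : E → G, AnalyticAt ℂ v 0 ∧ v 0 = 0 ∧ ∀ᶠ x in 𝓝 0, v (f x) = D (v x) + h x := by
  induction m generalizing h with
  | zero =>
    obtain ⟨v, h1, h2, h3⟩ := exists_functional_solution hf hc hθ hθ1 hDB hh hN hB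
    refine ⟨v, h1, ?_, h3⟩
    have := h2.eq_zero_imp.self_of_nhds
    exact this (by simp [hN0])
  | succ m ih =>
    have hf' : AnalyticAt ℂ (fun x => h (f x)) 0 :=
      AnalyticAt.fun_comp (by rwa [h0]) hf
    obtain ⟨w, h1, h2, h3⟩ := ih hf' (by simp [h0, hh0])
      (by simpa only [← Function.iterate_succ_apply' f] using hN)
    refine ⟨fun x => B (w x - h x), ?_, by simp [h2, hh0], ?_⟩
    · exact (B.analyticAt _).fun_comp (h1.sub hh)
    · filter_upwards [h3] with x hx
      rw [hx, hDB, add_sub_cancel_right, hBD]; abel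

end Contraction

/-! ### Division by a coordinate and primitives along a coordinate. -/

section Division

open MeasureTheory

/-- Differentiation under the integral sign: near 0 the segments from Sv to Sv + Tv stay in a ball
where P is analytic with bounded differential. Averages over such segments give the quotients and
primitives below. -/
theorem hasFDerivAt_segment_integral {E : Type*} [NormedAddCommGroup E] [NormedSpace ℂ E]
    {G : Type*} [NormedAddCommGroup G] [NormedSpace ℂ G] [CompleteSpace G]
    {P : E → G} (hP : AnalyticAt ℂ P 0) (S T : E →L[ℂ] E) :
    ∀ᶠ v in 𝓝 (0 : E),
      (∀ t ∈ Set.Icc (0 : ℝ) 1, AnalyticAt ℂ P (S v + (t : ℂ) • T v)) ∧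
      HasFDerivAt (fun v => ∫ t in (0 : ℝ)..1, P (S v + (t : ℂ) • T v))
        (∫ t in (0 : ℝ)..1, (fderiv ℂ P (S v + (t : ℂ) • T v)).comp (S + (t : ℂ) • T)) v := by
  have hPf : AnalyticAt ℂ (fderiv ℂ P) 0 := hP.fderiv
  obtain ⟨R, hR, hb⟩ := Metric.eventually_nhds_iff_ball.1 (hP.eventually_analyticAt.and
    (hPf.continuousAt.norm.eventually (gt_mem_nhds (lt_add_one _))))
  set M := ‖fderiv ℂ P 0‖ + 1
  set K := ‖S‖ + ‖T‖ + 1 with hK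
  have hK0 : 0 < K := by positivity
  have hmem : ∀ v ∈ Metric.ball (0 : E) (R / K), ∀ t ∈ Set.Icc (0 : ℝ) 1,
      S v + (t : ℂ) • T v ∈ Metric.ball (0 : E) R := by
    intro v hv t ht
    rw [mem_ball_zero_iff, lt_div_iff₀ hK0] at hv
    rw [mem_ball_zero_iff]
    have h1 := S.le_opNorm v
    have h2 := T.le_opNorm v
    have h3 : ‖(t : ℂ) • T v‖ ≤ ‖T v‖ := by
      rw [norm_smul, Complex.norm_real, Real.norm_eq_abs, abs_of_nonneg ht.1]
      exact mul_le_of_le_one_left (norm_nonneg _) ht.2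
    calc _ ≤ ‖S v‖ + ‖(t : ℂ) • T v‖ := norm_add_le _ _
      _ ≤ ‖S‖ * ‖v‖ + ‖T‖ * ‖v‖ := by linarith
      _ ≤ ‖v‖ * K := by rw [hK]; nlinarith [norm_nonneg v]
      _ < R := hv
  have hRK : 0 < R / K := by positivity
  filter_upwards [Metric.ball_mem_nhds (0 : E) hRK] with v hv
  refine ⟨fun t ht => (hb _ (hmem v hv t ht)).1, ?_⟩
  have hline : ∀ w : E, Continuous fun t : ℝ => S w + (t : ℂ) • T w := fun w => by
    fun_prop
  have hcont : ∀ w ∈ Metric.ball (0 : E) (R / K),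
      ContinuousOn (fun t : ℝ => P (S w + (t : ℂ) • T w)) (Set.Icc 0 1) := fun w hw t ht =>
    (((hb _ (hmem w hw t ht)).1.continuousAt).comp (f := fun t : ℝ => S w + (t : ℂ) • T w)
      (hline w).continuousAt).continuousWithinAt
  have hIoc : Set.uIoc (0 : ℝ) 1 ⊆ Set.Icc 0 1 := by
    rw [Set.uIoc_of_le zero_le_one]; exact Set.Ioc_subset_Icc_self
  refine intervalIntegral.hasFDerivAt_integral_of_dominated_of_fderiv_le
    (bound := fun _ => M * K)
    (F' := fun w t => (fderiv ℂ P (S w + (t : ℂ) • T w)).comp (S + (t : ℂ) • T))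
    (Metric.isOpen_ball.mem_nhds hv) ?_ ?_ ?_ ?_ ?_ ?_
  · filter_upwards [Metric.isOpen_ball.mem_nhds hv] with w hw
    exact ((hcont w hw).mono hIoc).aestronglyMeasurable measurableSet_uIoc
  · exact ContinuousOn.intervalIntegrable (by
      rw [Set.uIcc_of_le zero_le_one]; exact hcont v hv)
  · refine ContinuousOn.aestronglyMeasurable (ContinuousOn.mono (s := Set.Icc 0 1) ?_ hIoc)
      measurableSet_uIoc
    intro t ht
    apply ContinuousAt.continuousWithinAt
    apply ContinuousAt.clm_comp
    · exact ((hb _ (hmem v hv t ht)).1.fderiv.continuousAt).comp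
        (f := fun t : ℝ => S v + (t : ℂ) • T v) (hline v).continuousAt
    · fun_prop
  · refine Eventually.of_forall fun t ht w hw => ?_
    have ht' := hIoc ht
    refine (ContinuousLinearMap.opNorm_comp_le _ _).trans ?_
    have h1 := (hb _ (hmem w hw t ht')).2.le
    have h2 : ‖S + (t : ℂ) • T‖ ≤ K := by
      have h3 : ‖(t : ℂ) • T‖ ≤ ‖T‖ := by
        rw [norm_smul, Complex.norm_real, Real.norm_eq_abs, abs_of_nonneg ht'.1]
        exact mul_le_of_le_one_left (norm_nonneg _) ht'.2
      linarith [norm_add_le S ((t : ℂ) • T)]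
    exact mul_le_mul h1 h2 (norm_nonneg _) ((norm_nonneg _).trans h1)
  · exact intervalIntegrable_const
  · refine Eventually.of_forall fun t ht w hw => ?_
    have h1 := ((hb _ (hmem w hw t (hIoc ht))).1.differentiableAt).hasFDerivAt
    exact h1.comp w (S.hasFDerivAt.add (T.hasFDerivAt.const_smul (t : ℂ)))

theorem analyticAt_segment_integral {E : Type*} [NormedAddCommGroup E] [NormedSpace ℂ E]
    [FiniteDimensional ℂ E]
    {G : Type*} [NormedAddCommGroup G] [NormedSpace ℂ G] [CompleteSpace G]
    {P : E → G} (hP : AnalyticAt ℂ P 0) (S T : E →L[ℂ] E) :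
    AnalyticAt ℂ (fun v => ∫ t in (0 : ℝ)..1, P (S v + (t : ℂ) • T v)) 0 :=
  analyticAt_of_eventually_differentiableAt
    ((hasFDerivAt_segment_integral hP S T).mono fun _ h => h.2.differentiableAt)

variable {d : ℕ}

/-- Projection to the `l`-th coordinate axis. -/
def axisProj (l : Fin d) : (Fin d → ℂ) →L[ℂ] (Fin d → ℂ) :=
  (ContinuousLinearMap.proj l).smulRight (Pi.single l 1)

/-- Projection to the `l`-th coordinate hyperplane. -/
def hyperProj (l : Fin d) : (Fin d → ℂ) →L[ℂ] (Fin d → ℂ) :=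
  ContinuousLinearMap.id ℂ _ - axisProj l

theorem axisProj_apply (l : Fin d) (v : Fin d → ℂ) :
    axisProj l v = v l • (Pi.single l 1 : Fin d → ℂ) := rfl

theorem hyperProj_add_axisProj (l : Fin d) (v : Fin d → ℂ) :
    hyperProj l v + axisProj l v = v := by simp [hyperProj]

theorem hyperProj_apply_same (l : Fin d) (v : Fin d → ℂ) : hyperProj l v l = 0 := by
  simp [hyperProj, axisProj_apply]

theorem hyperProj_apply_ne {l j : Fin d} (h : j ≠ l) (v : Fin d → ℂ) : hyperProj l v j = v j := by
  simp [hyperProj, axisProj_apply, h]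

theorem hyperProj_single (l : Fin d) : hyperProj l (Pi.single l 1) = 0 := by
  simp [hyperProj, axisProj_apply]

/-- The difference between a germ and its restriction to a coordinate hyperplane is divisible by the
coordinate. -/
theorem exists_sub_eq_mul {g : (Fin d → ℂ) → ℂ} (hg : AnalyticAt ℂ g 0) (l : Fin d) :
    ∃ h : (Fin d → ℂ) → ℂ, AnalyticAt ℂ h 0 ∧
      ∀ᶠ v in 𝓝 (0 : Fin d → ℂ), g v - g (hyperProj l v) = v l * h v := by
  have hP : AnalyticAt ℂ (fun v => fderiv ℂ g v (Pi.single l 1)) 0 :=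
    ((ContinuousLinearMap.apply ℂ ℂ (Pi.single l 1 : Fin d → ℂ)).analyticAt _).fun_comp hg.fderiv
  refine ⟨_, analyticAt_segment_integral hP (hyperProj l) (axisProj l), ?_⟩
  filter_upwards [hasFDerivAt_segment_integral hg (hyperProj l) (axisProj l),
    hasFDerivAt_segment_integral hP (hyperProj l) (axisProj l)] with v hv hv'
  have h1 : ∀ t ∈ Set.uIcc (0 : ℝ) 1, HasDerivAt
      (fun t : ℝ => g (hyperProj l v + (t : ℂ) • axisProj l v))
      (v l * fderiv ℂ g (hyperProj l v + (t : ℂ) • axisProj l v) (Pi.single l 1)) t := by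
    intro t ht
    rw [Set.uIcc_of_le zero_le_one] at ht
    have h2 : HasDerivAt (fun t : ℝ => hyperProj l v + (t : ℂ) • axisProj l v)
        (axisProj l v) t := by
      have := ((hasDerivAt_id t).ofReal_comp.smul_const (axisProj l v)).const_add (hyperProj l v)
      simpa using this
    have h3 := ((hv.1 t ht).differentiableAt.hasFDerivAt.restrictScalars ℝ).comp_hasDerivAt t h2
    refine h3.congr_deriv ?_
    simp [axisProj_apply]
  have h4 := intervalIntegral.integral_eq_sub_of_hasDerivAt h1 (by
    apply ContinuousOn.intervalIntegrable
    rw [Set.uIcc_of_le zero_le_one]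
    intro t ht
    have hline : Continuous fun t : ℝ => hyperProj l v + (t : ℂ) • axisProj l v := by fun_prop
    exact (continuousAt_const.mul ((hv'.1 t ht).continuousAt.comp
      (f := fun t : ℝ => hyperProj l v + (t : ℂ) • axisProj l v)
      hline.continuousAt)).continuousWithinAt)
  rw [intervalIntegral.integral_const_mul] at h4
  rw [h4]
  simp [hyperProj_add_axisProj]

/-- Primitives with respect to one coordinate. -/
theorem exists_primitive {p : (Fin d → ℂ) → ℂ} (hp : AnalyticAt ℂ p 0) (l : Fin d) :
    ∃ ψ : (Fin d → ℂ) → ℂ, AnalyticAt ℂ ψ 0 ∧ ψ 0 = 0 ∧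
      (∀ v, v l = 0 → ψ v = 0) ∧
      ∀ᶠ v in 𝓝 (0 : Fin d → ℂ), fderiv ℂ ψ v (Pi.single l 1) = p v := by
  have hI := analyticAt_segment_integral hp (hyperProj l) (axisProj l)
  refine ⟨fun v => v l * ∫ t in (0 : ℝ)..1, p (hyperProj l v + (t : ℂ) • axisProj l v),
    ?_, by simp, fun v hv => by simp [hv], ?_⟩
  · exact ((ContinuousLinearMap.proj (R := ℂ) (φ := fun _ : Fin d => ℂ) l).analyticAt 0).mul hI
  have hp' : AnalyticAt ℂ (fderiv ℂ p) 0 := hp.fderiv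
  filter_upwards [hasFDerivAt_segment_integral hp (hyperProj l) (axisProj l),
    hasFDerivAt_segment_integral hp' (hyperProj l) (axisProj l)] with v hv hv'
  have hline : Continuous fun t : ℝ => hyperProj l v + (t : ℂ) • axisProj l v := by fun_prop
  have h1 := ((ContinuousLinearMap.proj (R := ℂ) (φ := fun _ : Fin d => ℂ) l).hasFDerivAt
    (x := v)).mul hv.2
  have h1' : fderiv ℂ (fun v : Fin d → ℂ =>
      v l * ∫ t in (0 : ℝ)..1, p (hyperProj l v + (t : ℂ) • axisProj l v)) v = _ := h1.fderiv
  rw [h1']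
  simp only [add_apply, smul_apply,
    ContinuousLinearMap.proj_apply, Pi.single_eq_same, smul_eq_mul, mul_one]
  have hcont' : ContinuousOn (fun t : ℝ => (fderiv ℂ p
      (hyperProj l v + (t : ℂ) • axisProj l v)).comp (hyperProj l + (t : ℂ) • axisProj l))
      (Set.uIcc 0 1) := by
    rw [Set.uIcc_of_le zero_le_one]
    intro t ht
    apply ContinuousAt.continuousWithinAt
    apply ContinuousAt.clm_comp
    · exact ((hv'.1 t ht).continuousAt).comp
        (f := fun t : ℝ => hyperProj l v + (t : ℂ) • axisProj l v) hline.continuousAt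
    · fun_prop
  rw [ContinuousLinearMap.intervalIntegral_apply hcont'.intervalIntegrable]
  -- By the product rule the derivative of the primitive is the integral over [0,1] of the
  -- derivative of t ↦ t·p(hyperProj + t·axisProj), so it equals p(v).
  have h2 : ∀ t ∈ Set.uIcc (0 : ℝ) 1, HasDerivAt
      (fun t : ℝ => (t : ℂ) * p (hyperProj l v + (t : ℂ) • axisProj l v))
      (v l * ((fderiv ℂ p (hyperProj l v + (t : ℂ) • axisProj l v)).comp
        (hyperProj l + (t : ℂ) • axisProj l)) (Pi.single l 1)
        + p (hyperProj l v + (t : ℂ) • axisProj l v)) t := by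
    intro t ht
    rw [Set.uIcc_of_le zero_le_one] at ht
    have h2 : HasDerivAt (fun t : ℝ => hyperProj l v + (t : ℂ) • axisProj l v)
        (axisProj l v) t := by
      have := ((hasDerivAt_id t).ofReal_comp.smul_const (axisProj l v)).const_add (hyperProj l v)
      simpa using this
    have h3 := ((hv.1 t ht).differentiableAt.hasFDerivAt.restrictScalars ℝ).comp_hasDerivAt t h2
    have h4 := (hasDerivAt_id t).ofReal_comp.mul h3
    refine h4.congr_deriv ?_
    simp [axisProj_apply, hyperProj_single]
    ring
  have hcp : ContinuousOn (fun t : ℝ => p (hyperProj l v + (t : ℂ) • axisProj l v))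
      (Set.uIcc 0 1) := by
    rw [Set.uIcc_of_le zero_le_one]
    intro t ht
    exact ((hv.1 t ht).continuousAt.comp
      (f := fun t : ℝ => hyperProj l v + (t : ℂ) • axisProj l v)
      hline.continuousAt).continuousWithinAt
  have hc1 : ContinuousOn (fun t : ℝ => v l * ((fderiv ℂ p
      (hyperProj l v + (t : ℂ) • axisProj l v)).comp
        (hyperProj l + (t : ℂ) • axisProj l)) (Pi.single l 1)) (Set.uIcc 0 1) :=
    continuousOn_const.mul (hcont'.clm_apply continuousOn_const)
  have h5 := intervalIntegral.integral_eq_sub_of_hasDerivAt h2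
    (hc1.add hcp).intervalIntegrable
  rw [intervalIntegral.integral_add hc1.intervalIntegrable hcp.intervalIntegrable,
    intervalIntegral.integral_const_mul] at h5
  rw [h5]
  simp [hyperProj_add_axisProj]

end Division

/-! ### Analytic germs whose zeros lie on coordinate hyperplanes. -/

section Germs

/-- The ring of germs of analytic functions is a domain. -/
theorem eventually_eq_zero_or_of_mul {E : Type*} [NormedAddCommGroup E] [NormedSpace ℂ E]
    {a b : E → ℂ} {x : E}
    (ha : AnalyticAt ℂ a x) (hb : AnalyticAt ℂ b x) (h : ∀ᶠ y in 𝓝 x, a y * b y = 0) :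
    (∀ᶠ y in 𝓝 x, a y = 0) ∨ ∀ᶠ y in 𝓝 x, b y = 0 := by
  let _ : NormedSpace ℝ E := NormedSpace.restrictScalars ℝ ℂ E
  obtain ⟨R, hR, hball⟩ := Metric.eventually_nhds_iff_ball.1
    (ha.eventually_analyticAt.and (hb.eventually_analyticAt.and h))
  by_cases hz : ∀ y ∈ Metric.ball x R, a y = 0
  · left
    filter_upwards [Metric.ball_mem_nhds x hR] with y hy using hz y hy
  right
  push Not at hz
  obtain ⟨z, hzR, hz0⟩ := hz
  have h1 : b =ᶠ[𝓝 z] 0 := by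
    filter_upwards [Metric.isOpen_ball.mem_nhds hzR,
      (hball z hzR).1.continuousAt.eventually_ne hz0] with y hy hy0
    exact (mul_eq_zero.1 (hball y hy).2.2).resolve_left hy0
  have h2 := AnalyticOnNhd.eqOn_zero_of_preconnected_of_eventuallyEq_zero
    (fun y hy => (hball y hy).2.1) (convex_ball x R).isPreconnected hzR h1
  filter_upwards [Metric.ball_mem_nhds x hR] with y hy using h2 hy

theorem exists_eventually_eq_zero_of_prod {E : Type*} [NormedAddCommGroup E] [NormedSpace ℂ E]
    {ι : Type*} {s : Finset ι} {a : ι → E → ℂ} {x : E}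
    (ha : ∀ i ∈ s, AnalyticAt ℂ (a i) x) (h : ∀ᶠ y in 𝓝 x, ∏ i ∈ s, a i y = 0) :
    ∃ i ∈ s, ∀ᶠ y in 𝓝 x, a i y = 0 := by
  classical
  induction s using Finset.induction_on with
  | empty => simp [NeBot.ne inferInstance] at h
  | insert i s hi ih =>
    simp only [Finset.prod_insert hi] at h
    rcases eventually_eq_zero_or_of_mul (ha i (Finset.mem_insert_self _ _))
      (Finset.analyticAt_fun_prod s fun j hj => ha j (Finset.mem_insert_of_mem hj)) h with h | h
    · exact ⟨i, Finset.mem_insert_self _ _, h⟩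
    · obtain ⟨j, hj, h⟩ := ih (fun j hj => ha j (Finset.mem_insert_of_mem hj)) h
      exact ⟨j, Finset.mem_insert_of_mem hj, h⟩

theorem eventually_eq_of_mul_eq {E : Type*} [NormedAddCommGroup E] [NormedSpace ℂ E]
    {a b c : E → ℂ} {x : E}
    (ha : AnalyticAt ℂ a x) (hb : AnalyticAt ℂ b x) (hc : AnalyticAt ℂ c x)
    (ha0 : ¬ ∀ᶠ y in 𝓝 x, a y = 0) (h : ∀ᶠ y in 𝓝 x, a y * b y = a y * c y) :
    ∀ᶠ y in 𝓝 x, b y = c y := by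
  have := (eventually_eq_zero_or_of_mul ha (hb.fun_sub hc)
    (h.mono fun y hy => by rw [mul_sub, hy, sub_self])).resolve_left ha0
  exact this.mono fun y hy => sub_eq_zero.1 hy

variable {d : ℕ}

theorem analyticAt_coord (l : Fin d) (x : Fin d → ℂ) : AnalyticAt ℂ (fun v : Fin d → ℂ => v l) x :=
  (ContinuousLinearMap.proj (R := ℂ) (φ := fun _ : Fin d => ℂ) l).analyticAt x

/-- Diagonal points. -/
def diagLine (d : ℕ) : ℂ → Fin d → ℂ := fun t _ => t

theorem continuous_diagLine : Continuous (diagLine d) := by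
  unfold diagLine; fun_prop

theorem differentiable_diagLine : Differentiable ℂ (diagLine d) := by
  unfold diagLine; fun_prop

theorem diagLine_zero : diagLine d 0 = 0 := rfl

/-- An analytic germ whose zero set is contained in a union of coordinate hyperplanes, and which
vanishes identically on none of them, is a unit. -/
theorem ne_zero_of_zeros_subset {h : (Fin d → ℂ) → ℂ} (hh : AnalyticAt ℂ h 0) (K : Finset (Fin d))
    (hz : ∀ᶠ v in 𝓝 (0 : Fin d → ℂ), h v = 0 → ∃ k ∈ K, v k = 0)
    (hK : ∀ k ∈ K, ¬ ∀ᶠ v in 𝓝 (0 : Fin d → ℂ), v k = 0 → h v = 0) : h 0 ≠ 0 := by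
  intro h00
  obtain ⟨R, hR, hb⟩ := Metric.eventually_nhds_iff_ball.1 (hz.and hh.eventually_analyticAt)
  have hlt : ∀ (v : Fin d → ℂ) (t : ℂ), ‖v‖ < R / 2 → ‖t‖ ≤ R / 4 →
      v + diagLine d t ∈ Metric.ball (0 : Fin d → ℂ) R := by
    intro v t hv ht
    rw [mem_ball_zero_iff]
    have h1 : ‖diagLine d t‖ ≤ ‖t‖ := pi_norm_const_le t
    linarith [norm_add_le v (diagLine d t)]
  set m : ℝ := R / 4
  have hm : 0 < m := by positivity
  have hcirc : ∀ t ∈ Metric.sphere (0 : ℂ) m, h (diagLine d t) ≠ 0 := by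
    intro t ht h0
    have htm : ‖t‖ = m := by simpa using ht
    obtain ⟨k, _, hk⟩ := (hb (diagLine d t) (by
      simpa using hlt 0 t (by simpa using hR) htm.le)).1 h0
    have : t = 0 := hk
    rw [this, norm_zero] at htm
    exact hm.ne htm
  have hcont : ContinuousOn (fun t => h (diagLine d t)) (Metric.sphere 0 m) := by
    intro t ht
    have htm : ‖t‖ = m := by simpa using ht
    exact ((hb (diagLine d t) (by
      simpa using hlt 0 t (by simpa using hR) htm.le)).2.continuousAt.comp
      continuous_diagLine.continuousAt).continuousWithinAt
  obtain ⟨ε, hε, hεb⟩ : ∃ ε > 0, ∀ t ∈ Metric.sphere (0 : ℂ) m, ε ≤ ‖h (diagLine d t)‖ := by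
    obtain ⟨t₀, ht₀, hmin⟩ := (isCompact_sphere (0 : ℂ) m).exists_isMinOn
      (NormedSpace.sphere_nonempty.2 hm.le) hcont.norm
    exact ⟨_, norm_pos_iff.2 (hcirc t₀ ht₀), fun t ht => hmin ht⟩
  have hunif : ∀ᶠ v in 𝓝 (0 : Fin d → ℂ), ∀ t ∈ Metric.sphere (0 : ℂ) m,
      ε / 2 < ‖h (v + diagLine d t)‖ := by
    have hc : ∀ t ∈ Metric.sphere (0 : ℂ) m, ∀ᶠ p in 𝓝 ((0 : Fin d → ℂ), t),
        ε / 2 < ‖h (p.1 + diagLine d p.2)‖ := by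
      intro t ht
      have htm : ‖t‖ = m := by simpa using ht
      have h1 : ContinuousAt (fun p : (Fin d → ℂ) × ℂ => h (p.1 + diagLine d p.2)) (0, t) := by
        have h2 : Continuous (fun p : (Fin d → ℂ) × ℂ => p.1 + diagLine d p.2) :=
          continuous_fst.add (continuous_diagLine.comp continuous_snd)
        exact ((hb _ (hlt 0 t (by simpa using hR) htm.le)).2.continuousAt).comp
          (f := fun p : (Fin d → ℂ) × ℂ => p.1 + diagLine d p.2) h2.continuousAt
      refine h1.norm.eventually (lt_mem_nhds ?_)
      simp only [zero_add]
      linarith [hεb t ht]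
    have := (isCompact_sphere (0 : ℂ) m).eventually_forall_of_forall_eventually
      (x₀ := (0 : Fin d → ℂ)) (P := fun v t => ε / 2 < ‖h (v + diagLine d t)‖)
      (fun t ht => hc t ht)
    exact this
  have hsmall : ∀ᶠ v in 𝓝 (0 : Fin d → ℂ), ‖h v‖ < ε / 2 :=
    hh.continuousAt.norm.eventually (gt_mem_nhds (by simpa [h00] using hε))
  -- On the diagonal line through v, |h| exceeds ε/2 on a fixed circle but is smaller than ε/2 at v.
  -- By the maximum principle for 1/h there is a zero on the line inside the circle. It lies on some
  -- hyperplane, hence at the parameter -v k. So the product of these values vanishes identically,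
  -- and since germs form a domain, one factor does; restricted to v k = 0 it says that h vanishes
  -- there.
  have hprod : ∀ᶠ v in 𝓝 (0 : Fin d → ℂ), ∏ k ∈ K, h (v + diagLine d (-v k)) = 0 := by
    filter_upwards [hunif, hsmall, Metric.ball_mem_nhds (0 : Fin d → ℂ)
      (by positivity : 0 < R / 2)] with v h1 h2 h3
    rw [mem_ball_zero_iff] at h3
    rw [Finset.prod_eq_zero_iff]
    by_contra! hne
    have hnz : ∀ t ∈ Metric.closedBall (0 : ℂ) m, h (v + diagLine d t) ≠ 0 := by
      intro t ht h0
      have htm : ‖t‖ ≤ m := by simpa using ht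
      obtain ⟨k, hk, hk0⟩ := (hb _ (hlt v t h3 htm)).1 h0
      have h4 : t = -v k := by
        have : v k + t = 0 := hk0
        linear_combination this
      exact hne k hk (h4 ▸ h0)
    have hd : DiffContOnCl ℂ (fun t => (h (v + diagLine d t))⁻¹) (Metric.ball 0 m) := by
      apply DifferentiableOn.diffContOnCl
      rw [closure_ball _ hm.ne']
      intro t ht
      have htm : ‖t‖ ≤ m := by simpa using ht
      apply DifferentiableAt.differentiableWithinAt
      refine DifferentiableAt.inv ?_ (hnz t ht)
      exact ((hb _ (hlt v t h3 htm)).2.differentiableAt).comp t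
        (f := fun t => v + diagLine d t) ((differentiable_diagLine t).const_add v)
    have h5 := Complex.norm_le_of_forall_mem_frontier_norm_le (C := (ε / 2)⁻¹)
      Metric.isBounded_ball hd (fun t ht => by
        rw [frontier_ball _ hm.ne'] at ht
        rw [norm_inv]
        exact inv_anti₀ (by positivity) (h1 t ht).le)
      (subset_closure (Metric.mem_ball_self hm))
    simp only [diagLine_zero, add_zero, norm_inv] at h5
    have h6 : h v ≠ 0 := by
      simpa [diagLine_zero] using hnz 0 (Metric.mem_closedBall_self hm.le)
    exact absurd ((inv_le_inv₀ (norm_pos_iff.2 h6) (by positivity)).1 h5) (not_le.2 h2)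
  have han : ∀ k ∈ K, AnalyticAt ℂ (fun v : Fin d → ℂ => h (v + diagLine d (-v k))) 0 := by
    intro k _
    have h1 : AnalyticAt ℂ (fun v : Fin d → ℂ => v + diagLine d (-v k)) 0 := by
      refine analyticAt_id.fun_add (analyticAt_pi_iff.2 fun j => ?_)
      exact (analyticAt_coord k 0).fun_neg
    refine AnalyticAt.fun_comp (g := h) ?_ h1
    simpa [diagLine_zero] using hh
  obtain ⟨k, hk, hk0⟩ := exists_eventually_eq_zero_of_prod han hprod
  refine hK k hk ?_
  filter_upwards [hk0] with v hv hvk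
  simpa [hvk, diagLine_zero] using hv

/-- An analytic germ which vanishes only on coordinate hyperplanes is the product of a monomial
and a unit. -/
theorem exists_monomial_mul_unit {g : (Fin d → ℂ) → ℂ} (hg : AnalyticAt ℂ g 0) (K : Finset (Fin d))
    (hz : ∀ᶠ v in 𝓝 (0 : Fin d → ℂ), g v = 0 → ∃ k ∈ K, v k = 0) :
    ∃ (a : Fin d → ℕ) (u : (Fin d → ℂ) → ℂ), AnalyticAt ℂ u 0 ∧ u 0 ≠ 0 ∧
      ∀ᶠ v in 𝓝 (0 : Fin d → ℂ), g v = (∏ k ∈ K, v k ^ a k) * u v := by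
  classical
  have hdiag : Tendsto (diagLine d) (𝓝 0) (𝓝 0) := by
    simpa [diagLine_zero] using (continuous_diagLine (d := d)).tendsto 0
  have hgd : AnalyticAt ℂ (fun t => g (diagLine d t)) 0 := by
    refine AnalyticAt.fun_comp (g := g) (f := diagLine d) (by rwa [diagLine_zero]) ?_
    exact analyticAt_pi_iff.2 fun _ => analyticAt_id
  have hord : analyticOrderAt (fun t => g (diagLine d t)) 0 ≠ ⊤ := by
    rw [Ne, analyticOrderAt_eq_top]
    intro h0
    have h1 : ∀ᶠ t in 𝓝[≠] (0 : ℂ), False := by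
      filter_upwards [nhdsWithin_le_nhds h0, nhdsWithin_le_nhds (hdiag.eventually hz),
        self_mem_nhdsWithin] with t h1 h2 h3
      obtain ⟨k, _, hk⟩ := h2 h1
      exact h3 hk
    exact h1.exists.elim fun _ h => h
  obtain ⟨n, hn⟩ := ENat.ne_top_iff_exists.1 hord
  -- A monomial factor of maximal total degree is taken out. The degree is bounded by the order of g
  -- along the diagonal, which is finite because that line meets the hyperplanes only at 0.
  set S : Set ℕ := {s | ∃ (a : Fin d → ℕ) (u : (Fin d → ℂ) → ℂ), AnalyticAt ℂ u 0 ∧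
    (∀ᶠ v in 𝓝 (0 : Fin d → ℂ), g v = (∏ k ∈ K, v k ^ a k) * u v) ∧ ∑ k ∈ K, a k = s} with hS
  have hbd : BddAbove S := by
    refine ⟨n, ?_⟩
    rintro s ⟨a, u, hu, hgu, hs⟩
    have h1 : ((s : ℕ) : ℕ∞) ≤ analyticOrderAt (fun t => g (diagLine d t)) 0 := by
      rw [natCast_le_analyticOrderAt hgd]
      refine ⟨fun t => u (diagLine d t), ?_, ?_⟩
      · refine AnalyticAt.fun_comp (g := u) (f := diagLine d) (by rwa [diagLine_zero]) ?_
        exact analyticAt_pi_iff.2 fun _ => analyticAt_id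
      · filter_upwards [hdiag.eventually hgu] with t ht
        rw [ht]
        simp [diagLine, Finset.prod_pow_eq_pow_sum, hs]
    rw [← hn] at h1
    exact_mod_cast h1
  have hne : S.Nonempty := ⟨0, 0, g, hg, by simp, by simp⟩
  obtain ⟨a, u, hu, hgu, hs⟩ := Nat.sSup_mem hne hbd
  refine ⟨a, u, hu, ?_, hgu⟩
  refine ne_zero_of_zeros_subset hu K ?_ ?_
  · filter_upwards [hz, hgu] with v h1 h2 h3
    exact h1 (by rw [h2, h3, mul_zero])
  -- If the cofactor vanished on v k = 0 it would be divisible by v k, against maximality.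
  · intro k hk hk0
    obtain ⟨w, hw, hw'⟩ := exists_sub_eq_mul hu k
    have hpr : ∀ᶠ v in 𝓝 (0 : Fin d → ℂ), u (hyperProj k v) = 0 := by
      have h1 : Tendsto (hyperProj k) (𝓝 (0 : Fin d → ℂ)) (𝓝 0) := by
        simpa using (hyperProj k).continuous.tendsto (0 : Fin d → ℂ)
      filter_upwards [h1.eventually hk0] with v hv using hv (hyperProj_apply_same k v)
    have : sSup S + 1 ∈ S := by
      refine ⟨a + Pi.single k 1, w, hw, ?_, ?_⟩
      · filter_upwards [hgu, hw', hpr] with v h1 h2 h3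
        rw [h3, sub_zero] at h2
        rw [h1, h2]
        simp only [Pi.add_apply, pow_add, Finset.prod_mul_distrib]
        have : ∏ j ∈ K, v j ^ (Pi.single k 1 : Fin d → ℕ) j = v k := by
          rw [Finset.prod_eq_single k]
          · simp
          · intro j _ hj; simp [hj]
          · intro h; exact absurd hk h
        rw [this, mul_assoc]
      · simp only [Pi.add_apply, Finset.sum_add_distrib, hs]
        congr 1
        simp [hk]
    exact absurd (le_csSup hbd this) (by omega)

/-- Logarithm of a unit. -/
theorem exists_log {E : Type*} [NormedAddCommGroup E] [NormedSpace ℂ E] {u : E → ℂ}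
    (hu : AnalyticAt ℂ u 0) (h0 : u 0 ≠ 0) :
    ∃ h : E → ℂ, AnalyticAt ℂ h 0 ∧ h 0 = 0 ∧ ∀ᶠ v in 𝓝 0, u v = u 0 * Complex.exp (h v) := by
  refine ⟨fun v => Complex.log (u v / u 0), ?_, by simp [h0], ?_⟩
  · refine AnalyticAt.clog (hu.fun_div analyticAt_const h0) ?_
    rw [div_self h0]; exact Complex.one_mem_slitPlane
  · filter_upwards [hu.continuousAt.eventually_ne h0] with v hv
    rw [Complex.exp_log (div_ne_zero hv h0)]
    field_simp

end Germs

/-! ### Order of vanishing at the origin. -/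

section OrderOfVanishing

open Asymptotics

variable {E : Type*} [NormedAddCommGroup E]

/-- The germ `u` vanishes at `0` to order at least `N`. -/
def VanishesToOrder (N : ℕ) (u : E → ℂ) : Prop :=
  u =O[𝓝 0] fun x => ‖x‖ ^ N

theorem VanishesToOrder.mono {N M : ℕ} {u : E → ℂ} (h : VanishesToOrder N u) (hM : M ≤ N) :
    VanishesToOrder M u := by
  refine IsBigO.trans h (IsBigO.of_bound 1 ?_)
  filter_upwards [Metric.ball_mem_nhds (0 : E) one_pos] with x hx
  rw [mem_ball_zero_iff] at hx
  simpa using pow_le_pow_of_le_one (norm_nonneg x) hx.le hM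

theorem VanishesToOrder.mul {N M : ℕ} {u v : E → ℂ} (hu : VanishesToOrder N u)
    (hv : VanishesToOrder M v) : VanishesToOrder (N + M) fun x => u x * v x := by
  have := IsBigO.mul hu hv
  simp only [← pow_add] at this
  exact this

theorem VanishesToOrder.add {N : ℕ} {u v : E → ℂ} (hu : VanishesToOrder N u)
    (hv : VanishesToOrder N v) : VanishesToOrder N fun x => u x + v x :=
  IsBigO.add hu hv

theorem VanishesToOrder.sub {N : ℕ} {u v : E → ℂ} (hu : VanishesToOrder N u)
    (hv : VanishesToOrder N v) : VanishesToOrder N fun x => u x - v x :=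
  IsBigO.sub hu hv

theorem VanishesToOrder.const_mul {N : ℕ} {u : E → ℂ} (hu : VanishesToOrder N u) (c : ℂ) :
    VanishesToOrder N fun x => c * u x :=
  IsBigO.const_mul_left hu c

theorem vanishesToOrder_zero (N : ℕ) : VanishesToOrder N fun _ : E => (0 : ℂ) :=
  isBigO_zero _ _

theorem VanishesToOrder.sum {ι : Type*} {s : Finset ι} {N : ℕ} {u : ι → E → ℂ}
    (h : ∀ i ∈ s, VanishesToOrder N (u i)) : VanishesToOrder N fun x => ∑ i ∈ s, u i x :=
  IsBigO.fun_sum h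

theorem VanishesToOrder.pow {N : ℕ} {u : E → ℂ} (hu : VanishesToOrder N u) (k : ℕ) :
    VanishesToOrder (N * k) fun x => u x ^ k := by
  have := IsBigO.pow hu k
  simp only [← pow_mul] at this
  exact this

theorem VanishesToOrder.congr {N : ℕ} {u v : E → ℂ} (hu : VanishesToOrder N u)
    (h : ∀ᶠ x in 𝓝 0, u x = v x) : VanishesToOrder N v :=
  IsBigO.congr' hu h EventuallyEq.rfl

theorem VanishesToOrder.eq_zero {N : ℕ} {u : E → ℂ} (hu : VanishesToOrder N u) (hN : N ≠ 0) :
    u 0 = 0 :=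
  (IsBigO.eq_zero_imp hu).self_of_nhds (by simp [hN])

theorem vanishesToOrder_of_continuousAt {u : E → ℂ} (hu : ContinuousAt u 0) :
    VanishesToOrder 0 u := by
  simpa [VanishesToOrder] using hu.isBigO_one ℝ

variable [NormedSpace ℂ E]

theorem vanishesToOrder_one {u : E → ℂ} (hu : DifferentiableAt ℂ u 0) (h0 : u 0 = 0) :
    VanishesToOrder 1 u := by
  have := hu.isBigO_sub
  simp only [h0, sub_zero] at this
  simpa [VanishesToOrder] using this.norm_right

theorem VanishesToOrder.hasFDerivAt {u : E → ℂ} (hu : VanishesToOrder 2 u) :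
    HasFDerivAt u (0 : E →L[ℂ] ℂ) 0 := by
  have h0 : u 0 = 0 := hu.eq_zero two_ne_zero
  refine HasFDerivAt.of_isLittleO ?_
  simp only [h0, sub_zero, zero_apply]
  refine IsBigO.trans_isLittleO hu ?_
  have h1 : (fun x : E => ‖x‖ ^ 2) =o[𝓝 0] fun x => ‖x‖ :=  by
    have := (isLittleO_pow_id (𝕜 := ℝ) one_lt_two).comp_tendsto (tendsto_norm_zero (E := E))
    exact this
  exact h1.of_norm_right

theorem VanishesToOrder.comp {N : ℕ} {u : E → ℂ} (hu : VanishesToOrder N u) {f : E → E}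
    (hf : DifferentiableAt ℂ f 0) (h0 : f 0 = 0) : VanishesToOrder N fun x => u (f x) := by
  have h1 : Tendsto f (𝓝 0) (𝓝 0) := by simpa [h0] using hf.continuousAt.tendsto
  have h2 := IsBigO.comp_tendsto hu h1
  refine h2.trans ?_
  have h3 := hf.isBigO_sub
  simp only [h0, sub_zero] at h3
  exact (h3.norm_left.norm_right).pow N

end OrderOfVanishing

/-! ### Local biholomorphisms and transport of the critical set. -/

section Coordinates

variable {d : ℕ}

theorem det_ne_zero_iff (A : (Fin d → ℂ) →L[ℂ] (Fin d → ℂ)) :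
    A.det ≠ 0 ↔ ∀ v, A v = 0 → v = 0 := by
  have h : A.det = LinearMap.det (A : (Fin d → ℂ) →ₗ[ℂ] (Fin d → ℂ)) := rfl
  constructor
  · intro hd v hv
    let e := LinearMap.equivOfDetNeZero _ (h ▸ hd)
    exact e.injective (by rw [map_zero]; exact hv)
  · intro hk h0
    have := LinearMap.bot_lt_ker_of_det_eq_zero (h ▸ h0)
    apply this.ne'
    rw [LinearMap.ker_eq_bot']
    exact hk

theorem isLocalBiholomorphism_of_ker {φ : (Fin d → ℂ) → (Fin d → ℂ)} (hφ : AnalyticAt ℂ φ 0)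
    (h0 : φ 0 = 0) (h : ∀ v, fderiv ℂ φ 0 v = 0 → v = 0) : IsLocalBiholomorphism φ :=
  ⟨hφ, h0, (det_ne_zero_iff _).2 h⟩

theorem IsLocalBiholomorphism.tendsto {φ : (Fin d → ℂ) → (Fin d → ℂ)}
    (hφ : IsLocalBiholomorphism φ) : Tendsto φ (𝓝 0) (𝓝 0) := by
  simpa [hφ.map_zero] using hφ.analytic.continuousAt.tendsto

/-- The differential of φ stays invertible near 0, so the local inverse is differentiable at all
nearby points and hence analytic by Osgood's lemma. -/
theorem IsLocalBiholomorphism.exists_inverse {φ : (Fin d → ℂ) → (Fin d → ℂ)}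
    (hφ : IsLocalBiholomorphism φ) :
    ∃ ψ : (Fin d → ℂ) → (Fin d → ℂ), IsLocalBiholomorphism ψ ∧
      (∀ᶠ y in 𝓝 0, φ (ψ y) = y) ∧ ∀ᶠ x in 𝓝 0, ψ (φ x) = x := by
  have hk := (det_ne_zero_iff _).1 hφ.det_ne_zero
  have hinj : Function.Injective (fderiv ℂ φ 0) :=
    (injective_iff_map_eq_zero (fderiv ℂ φ 0)).2 hk
  let e₀ : (Fin d → ℂ) ≃ₗ[ℂ] (Fin d → ℂ) := LinearEquiv.ofInjectiveEndo
    (fderiv ℂ φ 0 : (Fin d → ℂ) →ₗ[ℂ] (Fin d → ℂ)) hinj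
  let e : (Fin d → ℂ) ≃L[ℂ] (Fin d → ℂ) := e₀.toContinuousLinearEquiv
  have he : (e : (Fin d → ℂ) →L[ℂ] (Fin d → ℂ)) = fderiv ℂ φ 0 := by ext x; rfl
  have hs : HasStrictFDerivAt φ (e : (Fin d → ℂ) →L[ℂ] (Fin d → ℂ)) 0 := by
    rw [he]; exact hφ.analytic.hasStrictFDerivAt
  set ψ := hs.localInverse φ e 0 with hψ
  have hright : ∀ᶠ y in 𝓝 (0 : Fin d → ℂ), φ (ψ y) = y := by
    have := hs.eventually_right_inverse
    rwa [hφ.map_zero] at this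
  have hleft : ∀ᶠ x in 𝓝 (0 : Fin d → ℂ), ψ (φ x) = x := hs.eventually_left_inverse
  have hψ0 : ψ 0 = 0 := by
    have := hs.localInverse_apply_image
    rwa [hφ.map_zero] at this
  have hψc : Tendsto ψ (𝓝 0) (𝓝 0) := by
    have := hs.localInverse_continuousAt
    rw [hφ.map_zero] at this
    rw [ContinuousAt, ← hψ, hψ0] at this
    exact this
  have hψd : ∀ᶠ y in 𝓝 (0 : Fin d → ℂ), DifferentiableAt ℂ ψ y := by
    have hdet : ∀ᶠ x in 𝓝 (0 : Fin d → ℂ), (fderiv ℂ φ x).det ≠ 0 := by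
      have hc : ContinuousAt (fun x => (fderiv ℂ φ x).det) 0 :=
        (ContinuousLinearMap.continuous_det).continuousAt.comp hφ.analytic.fderiv.continuousAt
      exact hc.eventually_ne hφ.det_ne_zero
    filter_upwards [hψc.eventually (hdet.and (hφ.analytic.eventually_analyticAt.and
      hleft.eventually_nhds)), hright] with y ⟨h1, h2, h3⟩ h4
    have hinj' : Function.Injective (fderiv ℂ φ (ψ y)) :=
      (injective_iff_map_eq_zero (fderiv ℂ φ (ψ y))).2 ((det_ne_zero_iff _).1 h1)
    let e' : (Fin d → ℂ) ≃L[ℂ] (Fin d → ℂ) := (LinearEquiv.ofInjectiveEndo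
      (fderiv ℂ φ (ψ y) : (Fin d → ℂ) →ₗ[ℂ] (Fin d → ℂ)) hinj').toContinuousLinearEquiv
    have he' : (e' : (Fin d → ℂ) →L[ℂ] (Fin d → ℂ)) = fderiv ℂ φ (ψ y) := by ext x; rfl
    have hs' : HasStrictFDerivAt φ (e' : (Fin d → ℂ) →L[ℂ] (Fin d → ℂ)) (ψ y) := by
      rw [he']; exact h2.hasStrictFDerivAt
    have := hs'.to_local_left_inverse h3
    rw [h4] at this
    exact this.hasFDerivAt.differentiableAt
  refine ⟨ψ, isLocalBiholomorphism_of_ker (analyticAt_of_eventually_differentiableAt hψd) hψ0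
    fun v hv => ?_, hright, hleft⟩
  have h1 : AnalyticAt ℂ φ (ψ 0) := by rw [hψ0]; exact hφ.analytic
  have h2 := fderiv_comp (0 : Fin d → ℂ) h1.differentiableAt hψd.self_of_nhds
  have h3 : (φ ∘ ψ) =ᶠ[𝓝 0] id := hright
  rw [h3.fderiv_eq, fderiv_id] at h2
  have := congrArg (fun L : (Fin d → ℂ) →L[ℂ] (Fin d → ℂ) => L v) h2
  simpa [hv] using this

theorem IsLocalBiholomorphism.eventually_iff {φ : (Fin d → ℂ) → (Fin d → ℂ)}
    (hφ : IsLocalBiholomorphism φ) {P : (Fin d → ℂ) → Prop} :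
    (∀ᶠ y in 𝓝 0, P y) ↔ ∀ᶠ x in 𝓝 0, P (φ x) := by
  refine ⟨fun h => hφ.tendsto.eventually h, fun h => ?_⟩
  obtain ⟨ψ, hψ, h1, _⟩ := hφ.exists_inverse
  filter_upwards [hψ.tendsto.eventually h, h1] with y h2 h3
  rwa [h3] at h2

variable {f g Φ : (Fin d → ℂ) → (Fin d → ℂ)}

theorem analyticAt_of_conj (hf : AnalyticAt ℂ f 0) (h0 : f 0 = 0) (hΦ : IsLocalBiholomorphism Φ)
    (hconj : ∀ᶠ x in 𝓝 0, Φ (f x) = g (Φ x)) : AnalyticAt ℂ g 0 := by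
  obtain ⟨Ψ, hΨ, h1, _⟩ := hΦ.exists_inverse
  have h2 : AnalyticAt ℂ (fun y => Φ (f (Ψ y))) 0 := by
    refine AnalyticAt.fun_comp (g := Φ) ?_ (AnalyticAt.fun_comp (g := f) ?_ hΨ.analytic)
    · rw [hΨ.map_zero, h0]; exact hΦ.analytic
    · rwa [hΨ.map_zero]
  refine h2.congr ?_
  filter_upwards [hΨ.tendsto.eventually hconj, h1] with y h3 h4
  rw [h3, h4]

theorem map_zero_of_conj (h0 : f 0 = 0) (hΦ : IsLocalBiholomorphism Φ)
    (hconj : ∀ᶠ x in 𝓝 0, Φ (f x) = g (Φ x)) : g 0 = 0 := by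
  have := hconj.self_of_nhds
  rwa [h0, hΦ.map_zero, eq_comm] at this

theorem eventually_iterate_conj (hst : OrbitStable f)
    (hconj : ∀ᶠ x in 𝓝 0, Φ (f x) = g (Φ x)) :
    ∀ᶠ x in 𝓝 0, ∀ n : ℕ, Φ (f^[n] x) = g^[n] (Φ x) := by
  filter_upwards [hst.eventually hconj] with x hx n
  induction n with
  | zero => rfl
  | succ n ih => rw [Function.iterate_succ_apply', Function.iterate_succ_apply', hx, ih]

theorem OrbitStable.conj (hst : OrbitStable f) (hΦ : IsLocalBiholomorphism Φ)
    (hconj : ∀ᶠ x in 𝓝 0, Φ (f x) = g (Φ x)) : OrbitStable g := by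
  intro V hV
  rw [hΦ.eventually_iff]
  filter_upwards [eventually_iterate_conj hst hconj,
    hst.eventually (hΦ.tendsto.eventually hV)] with x h1 h2 n
  rw [← h1]; exact h2 n

/-- By the chain rule the Jacobian determinants of f and g vanish at corresponding points near 0.
Stability of orbits gives this at all points of an orbit at once, which the union over n requires.
-/
theorem genCritSet_conj (hf : AnalyticAt ℂ f 0) (h0 : f 0 = 0) (hst : OrbitStable f)
    (hΦ : IsLocalBiholomorphism Φ) (hconj : ∀ᶠ x in 𝓝 0, Φ (f x) = g (Φ x)) :
    ∀ᶠ x in 𝓝 0, x ∈ genCritSet f ↔ Φ x ∈ genCritSet g := by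
  have hg := analyticAt_of_conj hf h0 hΦ hconj
  have hdet : ∀ᶠ x in 𝓝 (0 : Fin d → ℂ), (fderiv ℂ Φ x).det ≠ 0 := by
    have hc : ContinuousAt (fun x => (fderiv ℂ Φ x).det) 0 :=
      (ContinuousLinearMap.continuous_det).continuousAt.comp hΦ.analytic.fderiv.continuousAt
    exact hc.eventually_ne hΦ.det_ne_zero
  have hft : Tendsto f (𝓝 0) (𝓝 0) := by simpa [h0] using hf.continuousAt.tendsto
  have hgood : ∀ᶠ x in 𝓝 (0 : Fin d → ℂ), (fderiv ℂ f x).det = 0 ↔ (fderiv ℂ g (Φ x)).det = 0 := by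
    filter_upwards [hdet, hft.eventually hdet, hΦ.analytic.eventually_analyticAt,
      hft.eventually hΦ.analytic.eventually_analyticAt, hf.eventually_analyticAt,
      hΦ.tendsto.eventually hg.eventually_analyticAt, hconj.eventually_nhds] with
      x h1 h2 h3 h4 h5 h6 h7
    have e1 := fderiv_comp x h4.differentiableAt h5.differentiableAt
    have e2 := fderiv_comp x h6.differentiableAt h3.differentiableAt
    have e3 : (Φ ∘ f) =ᶠ[𝓝 x] g ∘ Φ := h7
    rw [e3.fderiv_eq, e2] at e1
    have e4 : (fderiv ℂ g (Φ x)).det * (fderiv ℂ Φ x).det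
        = (fderiv ℂ Φ (f x)).det * (fderiv ℂ f x).det := by
      have := congrArg (fun L : (Fin d → ℂ) →L[ℂ] (Fin d → ℂ) => L.det) e1
      simp only [ContinuousLinearMap.det, ContinuousLinearMap.toLinearMap_comp,
        LinearMap.det_comp] at this
      exact this
    constructor
    · intro h; rw [h, mul_zero] at e4; exact (mul_eq_zero.1 e4).resolve_right h1
    · intro h; rw [h, zero_mul] at e4; exact (mul_eq_zero.1 e4.symm).resolve_left h2
  filter_upwards [hst.eventually hgood, eventually_iterate_conj hst hconj] with x h1 h2
  refine exists_congr fun n => ?_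
  rw [h1 n, h2 n]

/-- The critical set of the normal form never has to be computed: it is transported from f, where it
is known by rigidity. -/
theorem hasNormalForm_of_conj (hf : AnalyticAt ℂ f 0) (h0 : f 0 = 0) (hst : OrbitStable f)
    (hΦ : IsLocalBiholomorphism Φ) (hconj : ∀ᶠ x in 𝓝 0, Φ (f x) = g (Φ x)) {K : Finset (Fin d)}
    (hK : ∀ᶠ x in 𝓝 0, x ∈ genCritSet f ↔ ∃ k ∈ K, Φ x k = 0) : HasNormalForm f g K := by
  refine ⟨⟨Φ, hΦ, hconj⟩, ?_⟩
  rw [GenCritEq, hΦ.eventually_iff]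
  filter_upwards [hK, genCritSet_conj hf h0 hst hΦ hconj] with x h1 h2
  rw [← h2, h1]; rfl

end Coordinates

/-! ### Triangular bases of generalized eigenvectors with prescribed order. -/

section Triangularization

universe u

open Module

/-- A lift is decomposed into generalized eigenvectors. The images of the components for other
eigenvalues add up to an element of the eigenspace of μ and of the sum of the others, hence to 0;
the component for μ is therefore a lift. -/
theorem exists_mem_maxGenEigenspace_of_surjective {V W : Type*} [AddCommGroup V] [Module ℂ V]
    [AddCommGroup W] [Module ℂ W] [FiniteDimensional ℂ V] {T : End ℂ V} {S : End ℂ W}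
    (p : V →ₗ[ℂ] W) (hp : Function.Surjective p) (h : ∀ x, p (T x) = S (p x)) {μ : ℂ} {w : W}
    (hw : w ∈ S.maxGenEigenspace μ) : ∃ v ∈ T.maxGenEigenspace μ, p v = w := by
  classical
  have hpow : ∀ (ν : ℂ) (k : ℕ) (x : V), p (((T - ν • 1) ^ k) x) = ((S - ν • 1) ^ k) (p x) := by
    intro ν k
    induction k with
    | zero => intro x; rfl
    | succ k ih =>
      intro x
      rw [pow_succ, pow_succ, End.mul_apply, End.mul_apply, ih]
      congr 1
      simp [h]
  have hmap : ∀ (ν : ℂ) (x : V), x ∈ T.maxGenEigenspace ν → p x ∈ S.maxGenEigenspace ν := by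
    intro ν x hx
    rw [End.mem_maxGenEigenspace] at hx ⊢
    obtain ⟨k, hk⟩ := hx
    exact ⟨k, by rw [← hpow, hk, map_zero]⟩
  obtain ⟨v, rfl⟩ := hp w
  have hv : v ∈ ⨆ ν, T.maxGenEigenspace ν := by rw [End.iSup_maxGenEigenspace_eq_top]; trivial
  rw [Submodule.mem_iSup_iff_exists_finsupp] at hv
  obtain ⟨x, hx, rfl⟩ := hv
  refine ⟨x μ, hx μ, ?_⟩
  have hsplit : (x.sum fun _ y => y) = x μ + ∑ ν ∈ x.support.erase μ, x ν := by
    rw [Finsupp.sum]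
    by_cases hμ : μ ∈ x.support
    · rw [Finset.add_sum_erase _ _ hμ]
    · rw [Finset.erase_eq_of_notMem hμ, Finsupp.notMem_support_iff.1 hμ, zero_add]
  rw [hsplit, map_add] at hw ⊢
  have h1 : p (∑ ν ∈ x.support.erase μ, x ν) ∈ S.maxGenEigenspace μ := by
    have := Submodule.sub_mem _ hw (hmap μ _ (hx μ))
    simpa using this
  have h2 : p (∑ ν ∈ x.support.erase μ, x ν) ∈ ⨆ (ν) (_ : ν ≠ μ), S.maxGenEigenspace ν := by
    rw [map_sum]
    refine Submodule.sum_mem _ fun ν hν => ?_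
    exact Submodule.mem_iSup_of_mem ν (Submodule.mem_iSup_of_mem (Finset.ne_of_mem_erase hν)
      (hmap ν _ (hx ν)))
  have h3 := (Submodule.disjoint_def.1 (End.independent_maxGenEigenspace S μ)) _ h1 h2
  rw [h3, add_zero]

/-- The quotient by the chosen eigenvector w carries the remaining eigenvalues. A triangular family
there is lifted within the generalized eigenspaces, and the error of each lift is a multiple of w.
Keeping w arbitrary allows a given eigenfunction as first coordinate. -/
theorem exists_triangular_step {V : Type u} [AddCommGroup V] [Module ℂ V]
    [FiniteDimensional ℂ V] {n : ℕ} (S : End ℂ V) (lam : Fin (n + 1) → ℂ)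
    (hdet : ∀ z : ℂ, LinearMap.det (algebraMap ℂ (End ℂ V) z - S) = ∏ i, (z - lam i))
    (ih : ∀ (W : Type u) [AddCommGroup W] [Module ℂ W] [FiniteDimensional ℂ W] (S : End ℂ W)
      (lam : Fin n → ℂ), (∀ z : ℂ, LinearMap.det (algebraMap ℂ (End ℂ W) z - S)
        = ∏ i, (z - lam i)) → ∃ b : Fin n → W, LinearIndependent ℂ b ∧
      ∀ i, b i ∈ S.maxGenEigenspace (lam i) ∧
        S (b i) - lam i • b i ∈ Submodule.span ℂ (b '' {j | j < i}))
    {w : V} (hw : w ≠ 0) (hSw : S w = lam 0 • w) :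
    ∃ b : Fin (n + 1) → V, b 0 = w ∧ LinearIndependent ℂ b ∧
      ∀ i, b i ∈ S.maxGenEigenspace (lam i) ∧
        S (b i) - lam i • b i ∈ Submodule.span ℂ (b '' {j | j < i}) := by
  set W : Submodule ℂ V := Submodule.span ℂ {w} with hW
  have hinv : ∀ z : ℂ, W ≤ W.comap (algebraMap ℂ (End ℂ V) z - S) := by
    intro z
    rw [hW, Submodule.span_le]
    intro x hx
    rw [Set.mem_singleton_iff.1 hx]
    simp only [Submodule.comap_coe, Set.mem_preimage, LinearMap.sub_apply, SetLike.mem_coe,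
      Module.algebraMap_end_apply, hSw]
    exact Submodule.sub_mem _ (Submodule.smul_mem _ _ (Submodule.mem_span_singleton_self w))
      (Submodule.smul_mem _ _ (Submodule.mem_span_singleton_self w))
  have hinvS : W ≤ W.comap S := by
    have := hinv 0
    intro x hx
    have h1 := this hx
    simp only [map_zero, zero_sub, Submodule.mem_comap, LinearMap.neg_apply] at h1
    exact (Submodule.neg_mem_iff W).1 h1
  set S' : End ℂ (V ⧸ W) := W.mapQ W S hinvS with hS'
  have hrank : Module.finrank ℂ W = 1 := finrank_span_singleton hw
  have hrestrict : ∀ z : ℂ, LinearMap.det (LinearMap.restrict (p := W) (q := W) (algebraMap ℂ (End ℂ V) z - S) (hinv z))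
      = z - lam 0 := by
    intro z
    have : LinearMap.restrict (p := W) (q := W) (algebraMap ℂ (End ℂ V) z - S) (hinv z) = (z - lam 0) • LinearMap.id := by
      ext ⟨x, hx⟩
      obtain ⟨c, rfl⟩ := Submodule.mem_span_singleton.1 hx
      simp [LinearMap.restrict_apply, Module.algebraMap_end_apply, hSw, sub_smul]
      rw [smul_comm z c w, smul_comm (lam 0) c w, smul_sub]
    rw [this, LinearMap.det_smul, hrank, LinearMap.det_id]; ring
  have hquot : ∀ z : ℂ, W.mapQ W (algebraMap ℂ (End ℂ V) z - S) (hinv z)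
      = algebraMap ℂ (End ℂ (V ⧸ W)) z - S' := by
    intro z
    ext x
    simp [hS', Module.algebraMap_end_apply]
  have hmul : ∀ z : ℂ, (z - lam 0) * LinearMap.det (algebraMap ℂ (End ℂ (V ⧸ W)) z - S')
      = (z - lam 0) * ∏ i : Fin n, (z - lam i.succ) := by
    intro z
    have := LinearMap.det_eq_det_mul_det W (algebraMap ℂ (End ℂ V) z - S) (hinv z)
    rw [hdet, hrestrict, hquot, Fin.prod_univ_succ] at this
    exact this.symm
  -- The identity of values gives nothing at z = lam 0, so the common factor is cancelled between
  -- polynomials.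
  have hpoly : S'.charpoly = ∏ i : Fin n, (Polynomial.X - Polynomial.C (lam i.succ)) := by
    have h1 : (Polynomial.X - Polynomial.C (lam 0)) * S'.charpoly
        = (Polynomial.X - Polynomial.C (lam 0)) *
          ∏ i : Fin n, (Polynomial.X - Polynomial.C (lam i.succ)) := by
      apply Polynomial.funext
      intro z
      simp only [Polynomial.eval_mul, Polynomial.eval_sub, Polynomial.eval_X, Polynomial.eval_C,
        Polynomial.eval_prod]
      rw [LinearMap.eval_charpoly, hmul]
    exact mul_left_cancel₀ (Polynomial.X_sub_C_ne_zero _) h1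
  obtain ⟨b', hb'i, hb'⟩ := ih (V ⧸ W) S' (fun i => lam i.succ) (fun z => by
    rw [← LinearMap.eval_charpoly, hpoly]
    simp [Polynomial.eval_prod])
  have hlift : ∀ i, ∃ v ∈ S.maxGenEigenspace (lam i.succ), W.mkQ v = b' i := fun i =>
    exists_mem_maxGenEigenspace_of_surjective (S := S') W.mkQ W.mkQ_surjective
      (fun x => by simp [hS']) (hb' i).1
  choose c hc hcb using hlift
  refine ⟨Fin.cons w c, rfl, ?_, ?_⟩
  · rw [linearIndependent_finCons]
    have hci : LinearIndependent ℂ (W.mkQ ∘ c) := by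
      have : W.mkQ ∘ c = b' := funext hcb
      rwa [this]
    refine ⟨hci.of_comp, fun hmem => ?_⟩
    rw [← Fintype.range_linearCombination ℂ (v := c)] at hmem
    obtain ⟨a, ha⟩ := hmem
    rw [Fintype.linearCombination_apply] at ha
    have h1 : ∑ i, a i • (W.mkQ ∘ c) i = 0 := by
      have h2 : W.mkQ w = 0 := by
        rw [← LinearMap.mem_ker, Submodule.ker_mkQ]
        exact Submodule.mem_span_singleton_self w
      rw [← h2, ← ha, map_sum]
      simp
    have h3 := Fintype.linearIndependent_iff.1 hci a h1
    apply hw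
    rw [← ha]
    simp [h3]
  · intro i
    refine Fin.cases ?_ (fun i => ?_) i
    · refine ⟨?_, ?_⟩
      · rw [End.mem_maxGenEigenspace]
        exact ⟨1, by simp [hSw]⟩
      · simp [hSw]
    · refine ⟨hc i, ?_⟩
      simp only [Fin.cons_succ]
      have h1 : W.mkQ (S (c i) - lam i.succ • c i) ∈ Submodule.span ℂ (b' '' {j | j < i}) := by
        have : W.mkQ (S (c i) - lam i.succ • c i) = S' (b' i) - lam i.succ • b' i := by
          rw [map_sub, map_smul, hcb, ← hcb i]; simp [hS']
        rw [this]
        exact (hb' i).2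
      have h2 : b' '' {j | j < i} = W.mkQ '' (c '' {j | j < i}) := by
        rw [Set.image_image]
        exact Set.image_congr fun j _ => (hcb j).symm
      rw [h2, Submodule.span_image] at h1
      obtain ⟨y, hy, hyx⟩ := h1
      have h3 : S (c i) - lam i.succ • c i - y ∈ W := by
        rw [← Submodule.ker_mkQ W, LinearMap.mem_ker, map_sub, hyx, sub_self]
      have h4 : S (c i) - lam i.succ • c i = y + (S (c i) - lam i.succ • c i - y) := by abel
      rw [h4]
      refine Submodule.add_mem _ (Submodule.span_mono ?_ hy) (Submodule.span_mono ?_ h3)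
      · rintro _ ⟨j, hj, rfl⟩
        exact ⟨j.succ, Fin.succ_lt_succ_iff.2 hj, rfl⟩
      · rintro _ rfl
        exact ⟨0, Fin.succ_pos i, rfl⟩

theorem exists_eigenvector_of_det {V : Type u} [AddCommGroup V] [Module ℂ V]
    [FiniteDimensional ℂ V] {n : ℕ} (S : End ℂ V) (lam : Fin n → ℂ)
    (hdet : ∀ z : ℂ, LinearMap.det (algebraMap ℂ (End ℂ V) z - S) = ∏ i, (z - lam i))
    (i : Fin n) : ∃ w : V, w ≠ 0 ∧ S w = lam i • w := by
  have h0 : LinearMap.det (algebraMap ℂ (End ℂ V) (lam i) - S) = 0 := by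
    rw [hdet]
    exact Finset.prod_eq_zero (Finset.mem_univ i) (sub_self _)
  obtain ⟨w, hw, hw0⟩ := (Submodule.ne_bot_iff _).1 (LinearMap.bot_lt_ker_of_det_eq_zero h0).ne'
  refine ⟨w, hw0, ?_⟩
  rw [LinearMap.mem_ker, LinearMap.sub_apply, Module.algebraMap_end_apply, sub_eq_zero] at hw
  exact hw.symm

/-- Triangularization by generalized eigenvectors, with prescribed order of the eigenvalues. -/
theorem exists_triangular_family {n : ℕ} (V : Type u) [AddCommGroup V] [Module ℂ V]
    [FiniteDimensional ℂ V] (S : End ℂ V) (lam : Fin n → ℂ)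
    (hdet : ∀ z : ℂ, LinearMap.det (algebraMap ℂ (End ℂ V) z - S) = ∏ i, (z - lam i)) :
    ∃ b : Fin n → V, LinearIndependent ℂ b ∧
      ∀ i, b i ∈ S.maxGenEigenspace (lam i) ∧
        S (b i) - lam i • b i ∈ Submodule.span ℂ (b '' {j | j < i}) := by
  induction n generalizing V with
  | zero => exact ⟨Fin.elim0, linearIndependent_empty_type, fun i => i.elim0⟩
  | succ n ih =>
    obtain ⟨w, hw, hSw⟩ := exists_eigenvector_of_det S lam hdet 0
    obtain ⟨b, _, hb⟩ := exists_triangular_step S lam hdet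
      (fun W _ _ _ S lam h => ih W S lam h) hw hSw
    exact ⟨b, hb⟩

end Triangularization

/-! ### The characteristic polynomial in terms of the given eigenvalues. -/

section EigenvalueIdentities

theorem det_sub_eq_of_eigenvalues {f : (Fin 3 → ℂ) → (Fin 3 → ℂ)} {lam : Fin 3 → ℂ}
    (hlam : eigenvaluesAtZero f = {lam 0, lam 1, lam 2}) (z : ℂ) :
    LinearMap.det (algebraMap ℂ (Module.End ℂ (Fin 3 → ℂ)) z -
      (fderiv ℂ f 0 : (Fin 3 → ℂ) →ₗ[ℂ] (Fin 3 → ℂ))) = ∏ i, (z - lam i) := by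
  rw [← LinearMap.eval_charpoly, (IsAlgClosed.splits _).eq_prod_roots_of_monic
    (LinearMap.charpoly_monic _)]
  rw [eigenvaluesAtZero] at hlam
  rw [hlam]
  simp [Fin.prod_univ_three, mul_assoc]

end EigenvalueIdentities

/-! ### Jets of analytic germs and Hadamard's lemma. -/

section AnalyticFunctions

variable {d : ℕ}

/-- The algebra of functions on `ℂ^d` which are analytic at the origin. -/
def analyticAlgebra (d : ℕ) : Subalgebra ℂ ((Fin d → ℂ) → ℂ) where
  carrier := {u | AnalyticAt ℂ u 0}
  mul_mem' ha hb := AnalyticAt.mul ha hb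
  add_mem' ha hb := AnalyticAt.add ha hb
  algebraMap_mem' _ := analyticAt_const

/-- The ideal of functions vanishing at the origin to order `N`. -/
def vanishingIdeal (d N : ℕ) : Ideal (analyticAlgebra d) where
  carrier := {u | VanishesToOrder N u.1}
  add_mem' ha hb := VanishesToOrder.add ha hb
  zero_mem' := vanishesToOrder_zero N
  smul_mem' c x hx := by
    have h := (vanishesToOrder_of_continuousAt c.2.continuousAt).mul hx
    rw [zero_add] at h
    exact h

/-- Composition with `f` as an algebra endomorphism. -/
def pullbackHom {f : (Fin d → ℂ) → (Fin d → ℂ)} (hf : AnalyticAt ℂ f 0) (h0 : f 0 = 0) :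
    analyticAlgebra d →ₐ[ℂ] analyticAlgebra d where
  toFun u := ⟨fun x => u.1 (f x), AnalyticAt.fun_comp (g := u.1) (by rw [h0]; exact u.2) hf⟩
  map_one' := rfl
  map_mul' _ _ := rfl
  map_zero' := rfl
  map_add' _ _ := rfl
  commutes' _ := rfl

theorem pullbackHom_le {f : (Fin d → ℂ) → (Fin d → ℂ)} (hf : AnalyticAt ℂ f 0) (h0 : f 0 = 0)
    (N : ℕ) : vanishingIdeal d N ≤ (vanishingIdeal d N).comap (pullbackHom hf h0) := fun _ hu =>
  VanishesToOrder.comp hu hf.differentiableAt h0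

/-- The algebra of jets of order `< N`. -/
def JetAlgebra (d N : ℕ) := analyticAlgebra d ⧸ vanishingIdeal d N

instance (d N : ℕ) : CommRing (JetAlgebra d N) :=
  inferInstanceAs (CommRing (analyticAlgebra d ⧸ vanishingIdeal d N))

instance (d N : ℕ) : Algebra ℂ (JetAlgebra d N) :=
  inferInstanceAs (Algebra ℂ (analyticAlgebra d ⧸ vanishingIdeal d N))

/-- The action of `f` on jets. -/
def jetHom {f : (Fin d → ℂ) → (Fin d → ℂ)} (hf : AnalyticAt ℂ f 0) (h0 : f 0 = 0) (N : ℕ) :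
    JetAlgebra d N →ₐ[ℂ] JetAlgebra d N :=
  Ideal.quotientMapₐ _ (pullbackHom hf h0) (pullbackHom_le hf h0 N)

/-- The jet of a function. -/
def jet (N : ℕ) {u : (Fin d → ℂ) → ℂ} (hu : AnalyticAt ℂ u 0) : JetAlgebra d N :=
  Ideal.Quotient.mk (vanishingIdeal d N) ⟨u, hu⟩

theorem jet_surjective {N : ℕ} (q : JetAlgebra d N) :
    ∃ (u : (Fin d → ℂ) → ℂ) (hu : AnalyticAt ℂ u 0), jet N hu = q := by
  obtain ⟨⟨u, hu⟩, rfl⟩ := Ideal.Quotient.mk_surjective q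
  exact ⟨u, hu, rfl⟩

theorem jet_eq_jet_iff {N : ℕ} {u v : (Fin d → ℂ) → ℂ} (hu : AnalyticAt ℂ u 0)
    (hv : AnalyticAt ℂ v 0) :
    jet N hu = jet N hv ↔ VanishesToOrder N fun x => u x - v x :=
  Ideal.Quotient.eq

/-- A linear map on germs which kills the germs vanishing to order `N` induces a linear map on
jets. -/
def jetLift {N : ℕ} {W : Type*} [AddCommGroup W] [Module ℂ W] (L : analyticAlgebra d →ₗ[ℂ] W)
    (h : ∀ u ∈ vanishingIdeal d N, L u = 0) : JetAlgebra d N →ₗ[ℂ] W where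
  toFun := QuotientAddGroup.lift (vanishingIdeal d N).toAddSubgroup L.toAddMonoidHom h
  map_add' := map_add _
  map_smul' c q := by
    obtain ⟨u, hu, rfl⟩ := jet_surjective q
    exact map_smul L c ⟨u, hu⟩

theorem jetHom_jet {f : (Fin d → ℂ) → (Fin d → ℂ)} (hf : AnalyticAt ℂ f 0) (h0 : f 0 = 0) (N : ℕ)
    {u : (Fin d → ℂ) → ℂ} (hu : AnalyticAt ℂ u 0) :
    jetHom hf h0 N (jet N hu) =
      jet N (AnalyticAt.fun_comp (g := u) (f := f) (by rwa [h0]) hf) := rfl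

/-- Hadamard's lemma. -/
theorem exists_hadamard {u : (Fin d → ℂ) → ℂ} (hu : AnalyticAt ℂ u 0) :
    ∃ w : Fin d → (Fin d → ℂ) → ℂ, (∀ l, AnalyticAt ℂ (w l) 0) ∧
      ∀ᶠ v in 𝓝 (0 : Fin d → ℂ), u v = u 0 + ∑ l, v l * w l v := by
  have hI := analyticAt_segment_integral hu.fderiv 0 (ContinuousLinearMap.id ℂ (Fin d → ℂ))
  refine ⟨fun l v => (∫ t in (0 : ℝ)..1, fderiv ℂ u ((0 : (Fin d → ℂ) →L[ℂ] (Fin d → ℂ)) v +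
    (t : ℂ) • ContinuousLinearMap.id ℂ (Fin d → ℂ) v)) (Pi.single l 1), fun l =>
    ((ContinuousLinearMap.apply ℂ ℂ (Pi.single l 1 : Fin d → ℂ)).analyticAt _).fun_comp hI, ?_⟩
  filter_upwards [hasFDerivAt_segment_integral hu 0 (ContinuousLinearMap.id ℂ (Fin d → ℂ)),
    hasFDerivAt_segment_integral hu.fderiv 0 (ContinuousLinearMap.id ℂ (Fin d → ℂ))] with v hv hv'
  simp only [zero_apply, zero_add, ContinuousLinearMap.id_apply] at hv hv' ⊢
  set I := ∫ t in (0 : ℝ)..1, fderiv ℂ u ((t : ℂ) • v) with hIdef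
  have h1 : ∑ l, v l * I (Pi.single l 1) = I v := by
    conv_rhs => rw [← Finset.univ_sum_single v, map_sum]
    refine Finset.sum_congr rfl fun l _ => ?_
    have : Pi.single l (v l) = v l • (Pi.single l 1 : Fin d → ℂ) := by
      rw [← Pi.single_smul]; simp
    rw [this, map_smul, smul_eq_mul]
  have hline : Continuous fun t : ℝ => (t : ℂ) • v := by fun_prop
  have hc : ContinuousOn (fun t : ℝ => fderiv ℂ u ((t : ℂ) • v)) (Set.uIcc 0 1) := by
    rw [Set.uIcc_of_le zero_le_one]
    intro t ht
    exact ((hv'.1 t ht).continuousAt.comp (f := fun t : ℝ => (t : ℂ) • v)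
      hline.continuousAt).continuousWithinAt
  have h2 : ∀ t ∈ Set.uIcc (0 : ℝ) 1, HasDerivAt (fun t : ℝ => u ((t : ℂ) • v))
      (fderiv ℂ u ((t : ℂ) • v) v) t := by
    intro t ht
    rw [Set.uIcc_of_le zero_le_one] at ht
    have h2 : HasDerivAt (fun t : ℝ => (t : ℂ) • v) v t := by
      simpa using (hasDerivAt_id t).ofReal_comp.smul_const v
    exact ((hv.1 t ht).differentiableAt.hasFDerivAt.restrictScalars ℝ).comp_hasDerivAt t h2
  have h3 := intervalIntegral.integral_eq_sub_of_hasDerivAt h2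
    (hc.clm_apply continuousOn_const).intervalIntegrable
  rw [h1, hIdef, ContinuousLinearMap.intervalIntegral_apply hc.intervalIntegrable, h3]
  simp

/-- Taylor's formula by iteration of Hadamard's lemma: approximating the cofactors to order N
approximates the germ to order N + 1. -/
theorem exists_polynomial_coord (N : ℕ) {u : (Fin d → ℂ) → ℂ} (hu : AnalyticAt ℂ u 0) :
    ∃ P : MvPolynomial (Fin d) ℂ, VanishesToOrder N fun x => u x - MvPolynomial.eval x P := by
  induction N generalizing u with
  | zero =>
    refine ⟨0, ?_⟩
    simpa using vanishesToOrder_of_continuousAt hu.continuousAt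
  | succ N ih =>
    obtain ⟨w, hw, huw⟩ := exists_hadamard hu
    choose P hP using fun l => ih (hw l)
    refine ⟨MvPolynomial.C (u 0) + ∑ l, MvPolynomial.X l * P l, ?_⟩
    have h1 : VanishesToOrder (1 + N) fun x => ∑ l, x l * (w l x - MvPolynomial.eval x (P l)) :=
      VanishesToOrder.sum fun l _ => (vanishesToOrder_one
        (analyticAt_coord l 0).differentiableAt (by simp)).mul (hP l)
    rw [add_comm] at h1
    refine h1.congr ?_
    filter_upwards [huw] with x hx
    rw [hx]
    simp [mul_sub, Finset.sum_sub_distrib]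

theorem analyticAt_mvPolynomial {ι E : Type*} [NormedAddCommGroup E] [NormedSpace ℂ E]
    (P : MvPolynomial ι ℂ) {e : E → ι → ℂ} {x : E} (he : ∀ i, AnalyticAt ℂ (fun x => e x i) x) :
    AnalyticAt ℂ (fun x => MvPolynomial.eval (e x) P) x := by
  induction P using MvPolynomial.induction_on with
  | C a => simpa using analyticAt_const
  | add p q hp hq => simpa using hp.fun_add hq
  | mul_X p i hp => simpa using hp.fun_mul (he i)

/-- In any coordinates, a germ is a polynomial up to any given order. -/
theorem exists_polynomial {e : (Fin d → ℂ) → (Fin d → ℂ)} (he : IsLocalBiholomorphism e) (N : ℕ)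
    {u : (Fin d → ℂ) → ℂ} (hu : AnalyticAt ℂ u 0) :
    ∃ P : MvPolynomial (Fin d) ℂ, VanishesToOrder N fun x => u x - MvPolynomial.eval (e x) P := by
  obtain ⟨ψ, hψ, _, h2⟩ := he.exists_inverse
  have h3 : AnalyticAt ℂ (fun y => u (ψ y)) 0 :=
    AnalyticAt.fun_comp (g := u) (by rwa [hψ.map_zero]) hψ.analytic
  obtain ⟨P, hP⟩ := exists_polynomial_coord N h3
  refine ⟨P, (hP.comp he.analytic.differentiableAt he.map_zero).congr ?_⟩
  filter_upwards [h2] with x hx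
  rw [hx]

theorem VanishesToOrder.prod {ι : Type*} {s : Finset ι} {n : ι → ℕ} {u : ι → (Fin d → ℂ) → ℂ}
    (h : ∀ i ∈ s, VanishesToOrder (n i) (u i)) :
    VanishesToOrder (∑ i ∈ s, n i) fun x => ∏ i ∈ s, u i x := by
  classical
  induction s using Finset.induction_on with
  | empty => simpa using vanishesToOrder_of_continuousAt (E := Fin d → ℂ) continuousAt_const
  | insert i s hi ih =>
    simp only [Finset.sum_insert hi, Finset.prod_insert hi]
    exact (h i (Finset.mem_insert_self _ _)).mul
      (ih fun j hj => h j (Finset.mem_insert_of_mem hj))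

/-- The monomials of degree < N span the jets. Finite dimension is needed so that the generalized
eigenspaces of the pull-back by f exhaust them. -/
instance finiteDimensional_jetAlgebra (d N : ℕ) : FiniteDimensional ℂ (JetAlgebra d N) := by
  classical
  set S : Set (JetAlgebra d N) := (fun a : Fin d →₀ ℕ =>
    jet N (analyticAt_mvPolynomial (MvPolynomial.monomial a (1 : ℂ)) (e := fun x : Fin d → ℂ => x)
      (x := 0) fun i => analyticAt_coord i 0)) '' {a | a.degree < N} with hS
  have hfin : S.Finite := (Finsupp.finite_of_degree_lt N).image _
  have htop : Submodule.span ℂ S = ⊤ := by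
    rw [eq_top_iff]
    rintro q -
    obtain ⟨u, hu, rfl⟩ := jet_surjective q
    obtain ⟨P, hP⟩ := exists_polynomial_coord N hu
    have h1 : jet N hu = jet N (analyticAt_mvPolynomial P (e := fun x : Fin d → ℂ => x)
      (x := 0) fun i => analyticAt_coord i 0) := (jet_eq_jet_iff _ _).2 hP
    rw [h1]
    clear h1 hP
    induction P using MvPolynomial.induction_on' with
    | monomial a c =>
      by_cases ha : a.degree < N
      · have h2 := Submodule.smul_mem (Submodule.span ℂ S) c
          (Submodule.subset_span (Set.mem_image_of_mem _ ha))
        convert h2 using 1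
        refine congrArg (Ideal.Quotient.mk (vanishingIdeal d N)) (Subtype.ext (funext fun x => ?_))
        simp [MvPolynomial.eval_monomial]
      · have h2 : jet N (analyticAt_mvPolynomial (MvPolynomial.monomial a c)
            (e := fun x : Fin d → ℂ => x) (x := 0) fun i => analyticAt_coord i 0) = 0 := by
          refine Ideal.Quotient.eq_zero_iff_mem.2 ?_
          have h3 : VanishesToOrder (∑ i, 1 * a i) fun x : Fin d → ℂ => ∏ i, x i ^ a i :=
            VanishesToOrder.prod fun i _ => (vanishesToOrder_one
              (analyticAt_coord i 0).differentiableAt (by simp)).pow _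
          have h4 := (h3.const_mul c).mono (M := N) (by
            simpa [Finsupp.degree_eq_sum] using ha)
          refine h4.congr (Eventually.of_forall fun x => ?_)
          simp [MvPolynomial.eval_monomial, Finsupp.prod_fintype]
        rw [h2]
        exact Submodule.zero_mem _
    | add p q hp hq =>
      have h2 := Submodule.add_mem _ hp hq
      convert h2 using 1
      refine congrArg (Ideal.Quotient.mk (vanishingIdeal d N)) (Subtype.ext (funext fun x => ?_))
      simp
  have : FiniteDimensional ℂ (Submodule.span ℂ S) := FiniteDimensional.span_of_finite ℂ hfin
  rw [htop] at this
  exact Module.Finite.equiv (Submodule.topEquiv (R := ℂ) (M := JetAlgebra d N))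

end AnalyticFunctions

/-! ### Generalized eigenvectors in algebras; covectors and their lifts to jets. -/

section Resonance

open Module

/-- The identity (τ - μν)(xy) = (τ - μ)x · τy + μx · (τ - ν)y lowers the total nilpotency exponent
of the two factors, since τ commutes with τ - ν. Induction on that total gives the claim. -/
theorem mul_mem_maxGenEigenspace {Q : Type*} [CommRing Q] [Algebra ℂ Q] (τ : Q →ₐ[ℂ] Q)
    {μ ν : ℂ} {x y : Q} (hx : x ∈ End.maxGenEigenspace τ.toLinearMap μ)
    (hy : y ∈ End.maxGenEigenspace τ.toLinearMap ν) :
    x * y ∈ End.maxGenEigenspace τ.toLinearMap (μ * ν) := by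
  have key : ∀ n j k : ℕ, j + k ≤ n → ∀ x y : Q, ((τ.toLinearMap - μ • 1) ^ j) x = 0 →
      ((τ.toLinearMap - ν • 1) ^ k) y = 0 →
      x * y ∈ End.maxGenEigenspace τ.toLinearMap (μ * ν) := by
    intro n
    induction n with
    | zero =>
      intro j k hjk x y hx _
      obtain rfl : j = 0 := by omega
      have : x = 0 := hx
      simp [this]
    | succ n ih =>
      intro j k hjk x y hx hy
      rcases j with _ | j
      · have : x = 0 := hx
        simp [this]
      rcases k with _ | k
      · have : y = 0 := hy
        simp [this]
      have hx' : ((τ.toLinearMap - μ • 1) ^ j) (τ x - μ • x) = 0 := by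
        rw [pow_succ] at hx; exact hx
      have hy' : ((τ.toLinearMap - ν • 1) ^ k) (τ y - ν • y) = 0 := by
        rw [pow_succ] at hy; exact hy
      have hcomm : ((τ.toLinearMap - ν • 1) ^ (k + 1)) (τ y) = 0 := by
        have h1 : Commute ((τ.toLinearMap - ν • 1) ^ (k + 1)) τ.toLinearMap :=
          Commute.pow_left (Commute.sub_left (Commute.refl _)
            (Commute.smul_left (Commute.one_left _) _)) _
        have h2 := congrArg (fun L : End ℂ Q => L y) h1.eq
        simp only [End.mul_apply] at h2
        rw [hy, map_zero] at h2
        exact h2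
      have e1 := ih j (k + 1) (by omega) _ _ hx' hcomm
      have e2 := ih (j + 1) k (by omega) _ _ hx hy'
      have e3 := Submodule.add_mem _ e1 (Submodule.smul_mem _ μ e2)
      have e4 : (τ x - μ • x) * τ y + μ • (x * (τ y - ν • y))
          = (τ.toLinearMap - (μ * ν) • 1) (x * y) := by
        simp only [LinearMap.sub_apply, LinearMap.smul_apply, End.one_apply,
          AlgHom.toLinearMap_apply, map_mul, sub_mul, mul_sub, smul_sub, smul_mul_assoc,
          mul_smul_comm, mul_smul]
        abel
      rw [e4, End.mem_maxGenEigenspace] at e3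
      rw [End.mem_maxGenEigenspace]
      obtain ⟨m, hm⟩ := e3
      exact ⟨m + 1, by rw [pow_succ]; exact hm⟩
  rw [End.mem_maxGenEigenspace] at hx hy
  obtain ⟨j, hj⟩ := hx
  obtain ⟨k, hk⟩ := hy
  exact key _ j k le_rfl x y hj hk

theorem one_mem_maxGenEigenspace {Q : Type*} [CommRing Q] [Algebra ℂ Q] (τ : Q →ₐ[ℂ] Q) :
    (1 : Q) ∈ End.maxGenEigenspace τ.toLinearMap 1 := by
  rw [End.mem_maxGenEigenspace]
  exact ⟨1, by simp⟩

theorem pow_mem_maxGenEigenspace {Q : Type*} [CommRing Q] [Algebra ℂ Q] (τ : Q →ₐ[ℂ] Q)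
    {μ : ℂ} {x : Q} (hx : x ∈ End.maxGenEigenspace τ.toLinearMap μ) (n : ℕ) :
    x ^ n ∈ End.maxGenEigenspace τ.toLinearMap (μ ^ n) := by
  induction n with
  | zero => simpa using one_mem_maxGenEigenspace τ
  | succ n ih => rw [pow_succ, pow_succ]; exact mul_mem_maxGenEigenspace τ ih hx

theorem prod_mem_maxGenEigenspace {Q : Type*} [CommRing Q] [Algebra ℂ Q] (τ : Q →ₐ[ℂ] Q)
    {ι : Type*} (s : Finset ι) {μ : ι → ℂ} {x : ι → Q}
    (hx : ∀ i ∈ s, x i ∈ End.maxGenEigenspace τ.toLinearMap (μ i)) :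
    ∏ i ∈ s, x i ∈ End.maxGenEigenspace τ.toLinearMap (∏ i ∈ s, μ i) := by
  classical
  induction s using Finset.induction_on with
  | empty => simpa using one_mem_maxGenEigenspace τ
  | insert i s hi ih =>
    rw [Finset.prod_insert hi, Finset.prod_insert hi]
    exact mul_mem_maxGenEigenspace τ (hx i (Finset.mem_insert_self _ _))
      (ih fun j hj => hx j (Finset.mem_insert_of_mem hj))

/-- In a sum of generalized eigenvectors lying in the generalized eigenspace of `μ`, the terms with
other eigenvalues cancel. -/
theorem sum_filter_eq_of_mem_maxGenEigenspace {V ι : Type*} [AddCommGroup V] [Module ℂ V]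
    (T : End ℂ V) (s : Finset ι) {x : ι → V} {ν : ι → ℂ}
    (hx : ∀ i ∈ s, x i ∈ T.maxGenEigenspace (ν i)) {μ : ℂ}
    (h : ∑ i ∈ s, x i ∈ T.maxGenEigenspace μ) [DecidablePred fun i => ν i = μ] :
    ∑ i ∈ s, x i = ∑ i ∈ s with ν i = μ, x i := by
  rw [← Finset.sum_filter_add_sum_filter_not s (fun i => ν i = μ)] at h ⊢
  have h1 : ∑ i ∈ s with ν i = μ, x i ∈ T.maxGenEigenspace μ :=
    Submodule.sum_mem _ fun i hi => by
      rw [Finset.mem_filter] at hi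
      rw [← hi.2]; exact hx i hi.1
  have h2 : ∑ i ∈ s with ¬ν i = μ, x i ∈ T.maxGenEigenspace μ := by
    simpa using Submodule.sub_mem _ h h1
  have h3 : ∑ i ∈ s with ¬ν i = μ, x i ∈ ⨆ (ν') (_ : ν' ≠ μ), T.maxGenEigenspace ν' := by
    refine Submodule.sum_mem _ fun i hi => ?_
    rw [Finset.mem_filter] at hi
    exact Submodule.mem_iSup_of_mem (ν i) (Submodule.mem_iSup_of_mem hi.2 (hx i hi.1))
  rw [(Submodule.disjoint_def.1 (End.independent_maxGenEigenspace T μ)) _ h2 h3, add_zero]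

variable {d : ℕ} {f : (Fin d → ℂ) → (Fin d → ℂ)}

/-- The transpose of `df₀`, acting on covectors. -/
def codifferential (f : (Fin d → ℂ) → (Fin d → ℂ)) : End ℂ (Dual ℂ (Fin d → ℂ)) :=
  (fderiv ℂ f 0 : (Fin d → ℂ) →ₗ[ℂ] (Fin d → ℂ)).dualMap

/-- The differential at the origin, as a covector. -/
def covector (u : (Fin d → ℂ) → ℂ) : Dual ℂ (Fin d → ℂ) :=
  (fderiv ℂ u 0 : (Fin d → ℂ) →ₗ[ℂ] ℂ)

theorem covector_apply (u : (Fin d → ℂ) → ℂ) (v : Fin d → ℂ) : covector u v = fderiv ℂ u 0 v := rfl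

theorem codifferential_covector (hf : AnalyticAt ℂ f 0) (h0 : f 0 = 0) {u : (Fin d → ℂ) → ℂ}
    (hu : AnalyticAt ℂ u 0) : codifferential f (covector u) = covector fun x => u (f x) := by
  refine LinearMap.ext fun v => ?_
  have h1 : DifferentiableAt ℂ u (f 0) := by rw [h0]; exact hu.differentiableAt
  have h2 := fderiv_comp (0 : Fin d → ℂ) h1 hf.differentiableAt
  rw [h0] at h2
  exact (congrArg (fun L : (Fin d → ℂ) →L[ℂ] ℂ => L v) h2).symm

theorem covector_congr {u w : (Fin d → ℂ) → ℂ} (h : ∀ᶠ x in 𝓝 0, u x = w x) :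
    covector u = covector w := by
  rw [covector, covector, Filter.EventuallyEq.fderiv_eq h]

theorem covector_add {u w : (Fin d → ℂ) → ℂ} (hu : AnalyticAt ℂ u 0) (hw : AnalyticAt ℂ w 0) :
    (covector fun x => u x + w x) = covector u + covector w := by
  rw [covector, fderiv_fun_add hu.differentiableAt hw.differentiableAt]; rfl

theorem covector_sub {u w : (Fin d → ℂ) → ℂ} (hu : AnalyticAt ℂ u 0) (hw : AnalyticAt ℂ w 0) :
    (covector fun x => u x - w x) = covector u - covector w := by
  rw [covector, fderiv_fun_sub hu.differentiableAt hw.differentiableAt]; rfl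

theorem covector_const_mul {u : (Fin d → ℂ) → ℂ} (hu : AnalyticAt ℂ u 0) (c : ℂ) :
    (covector fun x => c * u x) = c • covector u := by
  rw [covector, fderiv_const_mul hu.differentiableAt]; rfl

theorem covector_mul {u w : (Fin d → ℂ) → ℂ} (hu : AnalyticAt ℂ u 0) (hw : AnalyticAt ℂ w 0) :
    (covector fun x => u x * w x) = u 0 • covector w + w 0 • covector u := by
  rw [covector, fderiv_fun_mul hu.differentiableAt hw.differentiableAt]; rfl

theorem covector_const (c : ℂ) : (covector fun _ : Fin d → ℂ => c) = 0 := by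
  rw [covector, fderiv_fun_const]; rfl

theorem VanishesToOrder.covector_eq_zero {u : (Fin d → ℂ) → ℂ} (hu : VanishesToOrder 2 u) :
    covector u = 0 := by
  rw [covector, hu.hasFDerivAt.fderiv]; rfl

theorem VanishesToOrder.covector_eq {u w : (Fin d → ℂ) → ℂ} (hu : AnalyticAt ℂ u 0)
    (hw : AnalyticAt ℂ w 0) (h : VanishesToOrder 2 fun x => u x - w x) :
    covector u = covector w := by
  have := h.covector_eq_zero
  rwa [covector_sub hu hw, sub_eq_zero] at this

theorem isLocalBiholomorphism_of_linearIndependent {e : (Fin d → ℂ) → (Fin d → ℂ)}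
    (he : ∀ i, AnalyticAt ℂ (fun x => e x i) 0) (h0 : e 0 = 0)
    (hi : LinearIndependent ℂ fun i => covector fun x => e x i) : IsLocalBiholomorphism e := by
  have hea : AnalyticAt ℂ e 0 := analyticAt_pi_iff.2 he
  refine isLocalBiholomorphism_of_ker hea h0 fun v hv => ?_
  have hspan : Submodule.span ℂ (Set.range fun i => covector fun x => e x i) = ⊤ :=
    hi.span_eq_top_of_card_eq_finrank' (by simp)
  have h1 : ∀ i, covector (fun x => e x i) v = 0 := by
    intro i
    have h2 := hasFDerivAt_pi'.1 hea.differentiableAt.hasFDerivAt i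
    rw [covector_apply, h2.fderiv, ContinuousLinearMap.comp_apply, hv, map_zero]
  have h2 : ∀ ℓ : Dual ℂ (Fin d → ℂ), ℓ v = 0 := by
    intro ℓ
    have : ℓ ∈ Submodule.span ℂ (Set.range fun i => covector fun x => e x i) := by
      rw [hspan]; trivial
    refine Submodule.span_induction (p := fun ℓ _ => ℓ v = 0) ?_ ?_ ?_ ?_ this
    · rintro _ ⟨i, rfl⟩; exact h1 i
    · rfl
    · intro a b _ _ ha hb; simp [ha, hb]
    · intro c a _ ha; simp [ha]
  ext i
  exact h2 (LinearMap.proj i)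

theorem IsLocalBiholomorphism.linearIndependent {e : (Fin d → ℂ) → (Fin d → ℂ)}
    (he : IsLocalBiholomorphism e) : LinearIndependent ℂ fun i => covector fun x => e x i := by
  rw [Fintype.linearIndependent_iff]
  intro c hc i
  have hk := (det_ne_zero_iff _).1 he.det_ne_zero
  have hinj : Function.Injective (fderiv ℂ e 0 : (Fin d → ℂ) →ₗ[ℂ] (Fin d → ℂ)) :=
    (injective_iff_map_eq_zero (fderiv ℂ e 0)).2 hk
  obtain ⟨v, hv⟩ := LinearMap.surjective_of_injective hinj (Pi.single i 1)
  have hv' : fderiv ℂ e 0 v = Pi.single i 1 := hv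
  have h1 := congrArg (fun L : Dual ℂ (Fin d → ℂ) => L v) hc
  have h2 : ∀ j, covector (fun x => e x j) v = (Pi.single i 1 : Fin d → ℂ) j := by
    intro j
    have h2 := hasFDerivAt_pi'.1 he.analytic.differentiableAt.hasFDerivAt j
    rw [covector_apply, h2.fderiv, ContinuousLinearMap.comp_apply, hv']; rfl
  simpa [LinearMap.sum_apply, h2, Pi.single_apply] using h1

theorem det_codifferential {d : ℕ} {f : (Fin d → ℂ) → (Fin d → ℂ)} (z : ℂ) :
    LinearMap.det (algebraMap ℂ (End ℂ (Dual ℂ (Fin d → ℂ))) z - codifferential f)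
      = LinearMap.det (algebraMap ℂ (End ℂ (Fin d → ℂ)) z -
        (fderiv ℂ f 0 : (Fin d → ℂ) →ₗ[ℂ] (Fin d → ℂ))) := by
  rw [← LinearMap.det_dualMap (algebraMap ℂ (End ℂ (Fin d → ℂ)) z -
    (fderiv ℂ f 0 : (Fin d → ℂ) →ₗ[ℂ] (Fin d → ℂ)))]
  congr 1
  refine LinearMap.ext fun ℓ => LinearMap.ext fun v => ?_
  simp [codifferential, Module.algebraMap_end_apply, LinearMap.dualMap_apply]

/-- The linear map from jets to covectors. -/
def jetCovector {N : ℕ} (hN : 2 ≤ N) : JetAlgebra d N →ₗ[ℂ] Dual ℂ (Fin d → ℂ) :=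
  jetLift
    { toFun := fun u : analyticAlgebra d => covector u.1
      map_add' := fun u w => covector_add u.2 w.2
      map_smul' := fun c u => covector_const_mul u.2 c }
    fun _ hu => (VanishesToOrder.mono hu hN).covector_eq_zero

theorem jetCovector_jet {N : ℕ} (hN : 2 ≤ N) {u : (Fin d → ℂ) → ℂ} (hu : AnalyticAt ℂ u 0) :
    jetCovector (d := d) hN (jet N hu) = covector u := rfl

/-- The covector map from jets is surjective and intertwines the pull-back with the codifferential,
so generalized eigenvectors lift. Evaluation at 0 is invariant under pull-back, hence it kills
generalized eigenvectors with eigenvalue μ ≠ 1; this gives u(0) = 0. -/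
theorem exists_jet_mem_maxGenEigenspace (hf : AnalyticAt ℂ f 0) (h0 : f 0 = 0) {N : ℕ} (hN : 2 ≤ N)
    {μ : ℂ} (hμ : μ ≠ 1) {b : Dual ℂ (Fin d → ℂ)}
    (hb : b ∈ (codifferential f).maxGenEigenspace μ) :
    ∃ (u : (Fin d → ℂ) → ℂ) (hu : AnalyticAt ℂ u 0), u 0 = 0 ∧ covector u = b ∧
      jet N hu ∈ End.maxGenEigenspace (jetHom hf h0 N).toLinearMap μ := by
  have hsurj : Function.Surjective (jetCovector (d := d) hN) := by
    intro ℓ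
    let L : (Fin d → ℂ) →L[ℂ] ℂ := ℓ.toContinuousLinearMap
    refine ⟨jet N (L.analyticAt 0), ?_⟩
    rw [jetCovector_jet, covector, L.fderiv]
    rfl
  obtain ⟨q, hq, hqb⟩ := exists_mem_maxGenEigenspace_of_surjective
    (T := (jetHom hf h0 N).toLinearMap) (S := codifferential f)
    (jetCovector (d := d) hN) hsurj
    (fun q => by
      obtain ⟨u, hu, rfl⟩ := jet_surjective q
      rw [jetCovector_jet, codifferential_covector hf h0 hu, AlgHom.toLinearMap_apply,
        jetHom_jet, jetCovector_jet]) hb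
  obtain ⟨u, hu, rfl⟩ := jet_surjective q
  refine ⟨u, hu, ?_, by rw [← jetCovector_jet hN hu, hqb], hq⟩
  let ev : JetAlgebra d N →ₗ[ℂ] ℂ := jetLift
    { toFun := fun u : analyticAlgebra d => u.1 0
      map_add' := fun u w => rfl
      map_smul' := fun c u => rfl }
    fun _ hu => VanishesToOrder.eq_zero hu (by omega)
  have hev : ∀ (k : ℕ) (q : JetAlgebra d N),
      ev ((((jetHom hf h0 N).toLinearMap - μ • 1) ^ k) q) = (1 - μ) ^ k * ev q := by
    intro k
    induction k with
    | zero => intro q; simp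
    | succ k ih =>
      intro q
      rw [pow_succ, End.mul_apply, ih, pow_succ, mul_assoc]
      congr 1
      obtain ⟨u, hu, rfl⟩ := jet_surjective q
      have h1 : ev ((jetHom hf h0 N) (jet N hu)) = ev (jet N hu) := by
        rw [jetHom_jet]
        change u (f 0) = u 0
        rw [h0]
      simp only [LinearMap.sub_apply, LinearMap.smul_apply, End.one_apply,
        AlgHom.toLinearMap_apply, map_sub, map_smul, h1, smul_eq_mul]
      ring
  rw [End.mem_maxGenEigenspace] at hq
  obtain ⟨k, hk⟩ := hq
  have h1 := hev k (jet N hu)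
  rw [hk, map_zero] at h1
  exact (mul_eq_zero.1 h1.symm).resolve_left (pow_ne_zero _ (sub_ne_zero.2 hμ.symm))

end Resonance

/-! ### Resonant polynomials and the contraction hypotheses. -/

section ResonantCoordinates

open Module

variable {d : ℕ} {f : (Fin d → ℂ) → (Fin d → ℂ)}

theorem jet_mvPolynomial {N : ℕ} {e : (Fin d → ℂ) → (Fin d → ℂ)}
    (he : ∀ i, AnalyticAt ℂ (fun x => e x i) 0) (P : MvPolynomial (Fin d) ℂ) :
    jet N (analyticAt_mvPolynomial P he) = MvPolynomial.aeval (fun i => jet N (he i)) P := by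
  induction P using MvPolynomial.induction_on with
  | C a =>
    rw [MvPolynomial.aeval_C]
    refine congrArg (Ideal.Quotient.mk (vanishingIdeal d N)) (Subtype.ext (funext fun x => ?_))
    simp
  | add p q hp hq =>
    rw [map_add, ← hp, ← hq]
    refine congrArg (Ideal.Quotient.mk (vanishingIdeal d N)) (Subtype.ext (funext fun x => ?_))
    simp
  | mul_X p i hp =>
    rw [map_mul, ← hp, MvPolynomial.aeval_X]
    refine congrArg (Ideal.Quotient.mk (vanishingIdeal d N)) (Subtype.ext (funext fun x => ?_))
    simp

/-- The part of a polynomial which consists of the monomials `X ^ a` with `lam ^ a = μ`. -/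
def resonantPart {ι : Type*} [Fintype ι] (lam : ι → ℂ) (μ : ℂ) (P : MvPolynomial ι ℂ) :
    MvPolynomial ι ℂ := by
  classical
  exact ∑ a ∈ P.support with ∏ i, lam i ^ a i = μ, MvPolynomial.monomial a (P.coeff a)

theorem prod_pow_eq_of_mem_support_resonantPart {ι : Type*} [Fintype ι] {lam : ι → ℂ} {μ : ℂ}
    {P : MvPolynomial ι ℂ} {a : ι →₀ ℕ} (ha : a ∈ (resonantPart lam μ P).support) :
    ∏ i, lam i ^ a i = μ := by
  classical
  rw [resonantPart, MvPolynomial.mem_support_iff, MvPolynomial.coeff_sum] at ha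
  obtain ⟨b, hb, hba⟩ := Finset.exists_ne_zero_of_sum_ne_zero ha
  rw [MvPolynomial.coeff_monomial] at hba
  split_ifs at hba with h
  · rw [← h]; exact (Finset.mem_filter.1 hb).2
  · exact absurd rfl hba

/-- A monomial in generalized eigenvectors is one for the product eigenvalue. If the whole sum
belongs to μ, the non-resonant monomials must cancel among themselves. -/
theorem aeval_resonantPart {ι Q : Type*} [Fintype ι] [CommRing Q] [Algebra ℂ Q] (τ : Q →ₐ[ℂ] Q)
    {lam : ι → ℂ} {q : ι → Q} (hq : ∀ i, q i ∈ End.maxGenEigenspace τ.toLinearMap (lam i)) {μ : ℂ}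
    {P : MvPolynomial ι ℂ}
    (hP : MvPolynomial.aeval q P ∈ End.maxGenEigenspace τ.toLinearMap μ) :
    MvPolynomial.aeval q (resonantPart lam μ P) = MvPolynomial.aeval q P := by
  classical
  have hsum : MvPolynomial.aeval q P = ∑ a ∈ P.support,
      MvPolynomial.aeval q (MvPolynomial.monomial a (P.coeff a)) := by
    conv_lhs => rw [P.as_sum, map_sum]
  have hmem : ∀ a ∈ P.support, MvPolynomial.aeval q (MvPolynomial.monomial a (P.coeff a)) ∈
      End.maxGenEigenspace τ.toLinearMap (∏ i, lam i ^ a i) := by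
    intro a _
    rw [MvPolynomial.aeval_monomial, ← Algebra.smul_def, Finsupp.prod_fintype _ _ (by simp)]
    exact Submodule.smul_mem _ _ (prod_mem_maxGenEigenspace _ _ fun i _ =>
      pow_mem_maxGenEigenspace _ (hq i) _)
  rw [hsum] at hP ⊢
  rw [sum_filter_eq_of_mem_maxGenEigenspace _ _ hmem hP, resonantPart, map_sum]

/-- A germ whose jet is a generalized eigenvector is a polynomial in the coordinates with resonant
monomials only, up to the order of the jet. -/
theorem exists_resonant_polynomial (hf : AnalyticAt ℂ f 0) (h0 : f 0 = 0)
    {e : (Fin d → ℂ) → (Fin d → ℂ)} (heb : IsLocalBiholomorphism e)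
    (he : ∀ i, AnalyticAt ℂ (fun x => e x i) 0) {N : ℕ} {lam : Fin d → ℂ}
    (hjet : ∀ i, jet N (he i) ∈ End.maxGenEigenspace (jetHom hf h0 N).toLinearMap (lam i))
    {u : (Fin d → ℂ) → ℂ} (hu : AnalyticAt ℂ u 0) {μ : ℂ}
    (hju : jet N hu ∈ End.maxGenEigenspace (jetHom hf h0 N).toLinearMap μ) :
    ∃ P : MvPolynomial (Fin d) ℂ, (∀ a ∈ P.support, ∏ i, lam i ^ a i = μ) ∧
      VanishesToOrder N fun x => u x - MvPolynomial.eval (e x) P := by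
  obtain ⟨P, hP⟩ := exists_polynomial heb N hu
  have h1 : jet N hu = MvPolynomial.aeval (fun i => jet N (he i)) P :=
    ((jet_eq_jet_iff hu (analyticAt_mvPolynomial P he)).2 hP).trans (jet_mvPolynomial he P)
  have h2 : MvPolynomial.aeval (fun i => jet N (he i)) (resonantPart lam μ P) = jet N hu :=
    (aeval_resonantPart (jetHom hf h0 N) hjet (h1 ▸ hju)).trans h1.symm
  exact ⟨resonantPart lam μ P, fun a ha => prod_pow_eq_of_mem_support_resonantPart ha,
    (jet_eq_jet_iff hu (analyticAt_mvPolynomial _ he)).1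
      (h2.symm.trans (jet_mvPolynomial he _).symm)⟩

theorem covector_mvPolynomial {e : (Fin d → ℂ) → (Fin d → ℂ)}
    (he : ∀ i, AnalyticAt ℂ (fun x => e x i) 0) (he0 : e 0 = 0) (P : MvPolynomial (Fin d) ℂ) :
    (covector fun x => MvPolynomial.eval (e x) P)
      = ∑ i, P.coeff (Finsupp.single i 1) • covector fun x => e x i := by
  induction P using MvPolynomial.induction_on with
  | C a =>
    have : ∀ i : Fin d, (0 : Fin d →₀ ℕ) ≠ Finsupp.single i 1 := fun i h => by
      simpa using congrArg (fun a => a i) h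
    simp [covector_const, MvPolynomial.coeff_C, this]
  | add p q hp hq =>
    simp only [map_add, MvPolynomial.coeff_add, add_smul, Finset.sum_add_distrib]
    rw [covector_add (analyticAt_mvPolynomial p he) (analyticAt_mvPolynomial q he), hp, hq]
  | mul_X p i hp =>
    simp only [map_mul, MvPolynomial.eval_X]
    rw [covector_mul (analyticAt_mvPolynomial p he) (he i), he0, Pi.zero_apply, zero_smul, add_zero]
    rw [Finset.sum_eq_single i]
    · rw [MvPolynomial.coeff_mul_X', if_pos (by simp), tsub_self]
      congr 1
      simp [MvPolynomial.constantCoeff_eq]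
    · intro j _ hj
      rw [MvPolynomial.coeff_mul_X', if_neg (by simp [hj.symm]), zero_smul]
    · simp

/-- The hypotheses under which the Poincaré-Dulac theory is developed. -/
structure IsContractingWithEigenvalues (f : (Fin d → ℂ) → (Fin d → ℂ)) (lam : Fin d → ℂ) :
    Prop where
  analytic : AnalyticAt ℂ f 0
  apply_zero : f 0 = 0
  det_sub : ∀ z : ℂ, LinearMap.det (algebraMap ℂ (End ℂ (Dual ℂ (Fin d → ℂ))) z - codifferential f)
    = ∏ i, (z - lam i)
  norm_lt_one : ∀ i, ‖lam i‖ < 1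

variable {lam : Fin d → ℂ}

theorem IsContractingWithEigenvalues.contractsAt (H : IsContractingWithEigenvalues f lam) {θ : ℝ}
    (hθ : 0 < θ) (hθ1 : θ ≤ 1) (h : ∀ i, ‖lam i‖ < θ) : ContractsAt f θ := by
  refine contractsAt_of_eigenvalues H.analytic.differentiableAt H.apply_zero hθ hθ1 fun μ hμ => ?_
  have h1 : LinearMap.det (algebraMap ℂ (End ℂ (Fin d → ℂ)) μ -
      (fderiv ℂ f 0 : (Fin d → ℂ) →ₗ[ℂ] (Fin d → ℂ))) = 0 := by
    by_contra hne
    obtain ⟨v, hv⟩ := hμ.exists_hasEigenvector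
    refine hv.2 ((LinearMap.equivOfDetNeZero _ hne).injective ?_)
    refine Eq.trans ?_ (map_zero _).symm
    change (algebraMap ℂ (End ℂ (Fin d → ℂ)) μ -
      (fderiv ℂ f 0 : (Fin d → ℂ) →ₗ[ℂ] (Fin d → ℂ))) v = 0
    rw [LinearMap.sub_apply, hv.apply_eq_smul, Module.algebraMap_end_apply, sub_self]
  rw [← det_codifferential, H.det_sub, Finset.prod_eq_zero_iff] at h1
  obtain ⟨i, _, hi⟩ := h1
  rw [sub_eq_zero.1 hi]
  exact h i

theorem IsContractingWithEigenvalues.exists_contractsAt (H : IsContractingWithEigenvalues f lam) :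
    ∃ θ : ℝ, 0 < θ ∧ θ < 1 ∧ ContractsAt f θ := by
  obtain ⟨θ, h1, h2, h3⟩ : ∃ θ : ℝ, 0 < θ ∧ θ < 1 ∧ ∀ i, ‖lam i‖ < θ := by
    have h1 : ∀ᶠ θ in 𝓝[<] (1 : ℝ), ∀ i, ‖lam i‖ < θ := by
      rw [eventually_all]
      exact fun i => eventually_nhdsWithin_of_eventually_nhds (lt_mem_nhds (H.norm_lt_one i))
    have h2 : ∀ᶠ θ in 𝓝[<] (1 : ℝ), 0 < θ :=
      eventually_nhdsWithin_of_eventually_nhds (lt_mem_nhds one_pos)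
    obtain ⟨θ, ⟨h3, h4⟩, h5⟩ := ((h1.and h2).and self_mem_nhdsWithin).exists
    exact ⟨θ, h4, h5, h3⟩
  exact ⟨θ, h1, h2, H.contractsAt h1 h2.le h3⟩

theorem IsContractingWithEigenvalues.orbitStable (H : IsContractingWithEigenvalues f lam) :
    OrbitStable f := by
  obtain ⟨θ, h1, h2, h3⟩ := H.exists_contractsAt
  exact h3.orbitStable h1.le h2.le

/-- Solution of `v ∘ f = D v + h` when `h` vanishes to a sufficiently high order. -/
theorem IsContractingWithEigenvalues.exists_order (H : IsContractingWithEigenvalues f lam)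
    {μ : ℂ} (hμ : μ ≠ 0) : ∃ N₀ : ℕ, ∀ N, N₀ ≤ N → ∀ h : (Fin d → ℂ) → ℂ, AnalyticAt ℂ h 0 →
      VanishesToOrder N h → ∃ v : (Fin d → ℂ) → ℂ, AnalyticAt ℂ v 0 ∧ VanishesToOrder N v ∧
        ∀ᶠ x in 𝓝 0, v (f x) = μ * v x + h x := by
  obtain ⟨θ, h1, h2, h3⟩ := H.exists_contractsAt
  have h4 : Tendsto (fun N : ℕ => ‖μ‖⁻¹ * θ ^ N) atTop (𝓝 (‖μ‖⁻¹ * 0)) :=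
    (tendsto_pow_atTop_nhds_zero_of_lt_one h1.le h2).const_mul _
  rw [mul_zero] at h4
  obtain ⟨N₀, hN₀⟩ := eventually_atTop.1 (h4.eventually (gt_mem_nhds one_pos))
  refine ⟨N₀, fun N hN h hh hv => ?_⟩
  refine exists_functional_solution H.analytic h3 h1 h2.le
    (B := ContinuousLinearMap.mul ℂ ℂ μ⁻¹) (D := ContinuousLinearMap.mul ℂ ℂ μ)
    (fun y => by simp [hμ]) hh hv ?_
  rw [ContinuousLinearMap.opNorm_mul_apply, norm_inv]
  exact hN₀ N hN

end ResonantCoordinates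

/-! ### Triangular resonant form. -/

section PoincareDulac

open Module

variable {d : ℕ} {f : (Fin d → ℂ) → (Fin d → ℂ)} {lam : Fin d → ℂ}

theorem LinearIndependent.coeff_of_triangular {V : Type*} [AddCommGroup V] [Module ℂ V]
    {b : Fin d → V} (hb : LinearIndependent ℂ b) {c : Fin d → ℂ} {i : Fin d} {μ : ℂ}
    (h : ∑ j, c j • b j - μ • b i ∈ Submodule.span ℂ (b '' {j | j < i})) :
    c i = μ ∧ ∀ j, i < j → c j = 0 := by
  rw [Finsupp.mem_span_image_iff_linearCombination] at h
  obtain ⟨l, hl, hlb⟩ := h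
  rw [Finsupp.mem_supported] at hl
  have hl' : ∀ j, ¬ j < i → l j = 0 := fun j hj => by
    by_contra hne
    exact hj (hl (Finsupp.mem_support_iff.2 hne))
  rw [Finsupp.linearCombination_apply, Finsupp.sum_fintype _ _ (by simp)] at hlb
  have h1 : ∑ j, (c j - (if j = i then μ else 0) - l j) • b j = 0 := by
    simp only [sub_smul, Finset.sum_sub_distrib, hlb, ite_smul, zero_smul, Finset.sum_ite_eq',
      Finset.mem_univ, if_true, sub_self]
  have h2 := Fintype.linearIndependent_iff.1 hb _ h1
  constructor
  · simpa [hl' i (lt_irrefl i), sub_eq_zero] using h2 i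
  · intro j hj
    simpa [hl' j hj.not_gt, hj.ne'] using h2 j

theorem norm_prod_pow_lt_one (hlt : ∀ i, ‖lam i‖ < 1) {a : Fin d →₀ ℕ} (ha : a ≠ 0) :
    ‖∏ i, lam i ^ a i‖ < 1 := by
  obtain ⟨k, hk⟩ := Finsupp.ne_iff.1 ha
  rw [norm_prod, ← Finset.mul_prod_erase _ _ (Finset.mem_univ k)]
  refine (mul_le_of_le_one_right (norm_nonneg _) (Finset.prod_le_one (fun _ _ => norm_nonneg _)
    fun j _ => ?_)).trans_lt ?_
  · rw [norm_pow]; exact pow_le_one₀ (norm_nonneg _) (hlt j).le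
  · rw [norm_pow]; exact pow_lt_one₀ (norm_nonneg _) (hlt k) hk

/-- In a resonance `lam ^ a = lam i ≠ 0`, an eigenvalue which is not larger than `lam i` can only
occur alone. -/
theorem eq_single_of_resonance (hlt : ∀ i, ‖lam i‖ < 1) {a : Fin d →₀ ℕ} {i k : Fin d}
    (h : ∏ j, lam j ^ a j = lam i) (h0 : lam i ≠ 0) (hki : ‖lam k‖ ≤ ‖lam i‖) (hk : a k ≠ 0) :
    a = Finsupp.single k 1 := by
  obtain ⟨b, rfl⟩ : ∃ b, a = Finsupp.single k 1 + b :=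
    ⟨a - Finsupp.single k 1, (add_tsub_cancel_of_le
      (Finsupp.single_le_iff.2 (Nat.one_le_iff_ne_zero.2 hk))).symm⟩
  by_contra hne
  have hb : b ≠ 0 := fun hb => hne (by rw [hb, add_zero])
  have h1 : ∏ j, lam j ^ (Finsupp.single k 1 + b : Fin d →₀ ℕ) j = lam k * ∏ j, lam j ^ b j := by
    simp only [Finsupp.add_apply, pow_add, Finset.prod_mul_distrib]
    congr 1
    rw [Finset.prod_eq_single k] <;> simp +contextual [eq_comm]
  rw [h1] at h
  have hk0 : 0 < ‖lam k‖ := norm_pos_iff.2 fun h2 => h0 (by rw [← h, h2, zero_mul])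
  have h2 : ‖lam i‖ < ‖lam k‖ := by
    rw [← h, norm_mul]
    exact mul_lt_of_lt_one_right hk0 (norm_prod_pow_lt_one hlt hb)
  exact absurd hki h2.not_ge

/-- Triangular resonant form of `f`, up to terms of order `N`, in coordinates whose jets are
generalized eigenvectors. -/
theorem IsContractingWithEigenvalues.exists_resonant_form (H : IsContractingWithEigenvalues f lam)
    (hord : ∀ i j, i ≤ j → ‖lam j‖ ≤ ‖lam i‖) {N : ℕ} (hN : 2 ≤ N)
    {e : (Fin d → ℂ) → (Fin d → ℂ)} (heb : IsLocalBiholomorphism e)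
    (he : ∀ i, AnalyticAt ℂ (fun x => e x i) 0)
    (hjet : ∀ i, jet N (he i) ∈
      End.maxGenEigenspace (jetHom H.analytic H.apply_zero N).toLinearMap (lam i))
    (htri : ∀ i, codifferential f (covector fun x => e x i) - lam i • (covector fun x => e x i) ∈
      Submodule.span ℂ ((fun i => covector fun x => e x i) '' {j | j < i}))
    {i : Fin d} (hi : lam i ≠ 0) :
    ∃ R : MvPolynomial (Fin d) ℂ,
      (∀ a ∈ R.support, a ≠ 0 ∧ (∀ k, i ≤ k → a k = 0) ∧ ∏ j, lam j ^ a j = lam i) ∧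
      VanishesToOrder N fun x => e (f x) i - (lam i * e x i + MvPolynomial.eval (e x) R) := by
  have hu : AnalyticAt ℂ (fun x => e (f x) i) 0 :=
    AnalyticAt.fun_comp (g := fun x => e x i) (by rw [H.apply_zero]; exact he i) H.analytic
  have hju : jet N hu ∈
      End.maxGenEigenspace (jetHom H.analytic H.apply_zero N).toLinearMap (lam i) :=
    End.mapsTo_maxGenEigenspace_of_comm (Commute.refl _) (lam i) (hjet i)
  obtain ⟨P, hP, hPu⟩ := exists_resonant_polynomial H.analytic H.apply_zero heb he hjet hu hju
  have hcov : codifferential f (covector fun x => e x i)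
      = ∑ j, P.coeff (Finsupp.single j 1) • covector fun x => e x j := by
    rw [codifferential_covector H.analytic H.apply_zero (he i), ← covector_mvPolynomial he heb.map_zero]
    exact (hPu.mono hN).covector_eq hu (analyticAt_mvPolynomial P he)
  have hti := htri i
  rw [hcov] at hti
  obtain ⟨hc1, hc2⟩ := heb.linearIndependent.coeff_of_triangular hti
  refine ⟨P - MvPolynomial.monomial (Finsupp.single i 1) (lam i), fun a ha => ?_, ?_⟩
  · have hai : a ≠ Finsupp.single i 1 := by
      rintro rfl
      rw [MvPolynomial.mem_support_iff, MvPolynomial.coeff_sub, MvPolynomial.coeff_monomial,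
        if_pos rfl, hc1, sub_self] at ha
      exact ha rfl
    have haP : a ∈ P.support := by
      rw [MvPolynomial.mem_support_iff] at ha ⊢
      rwa [MvPolynomial.coeff_sub, MvPolynomial.coeff_monomial, if_neg hai.symm, sub_zero] at ha
    have hres := hP a haP
    refine ⟨?_, fun k hk => ?_, hres⟩
    · rintro rfl
      have h1 := H.norm_lt_one i
      rw [← hres] at h1
      simp at h1
    -- A variable of index k ≥ i has an eigenvalue no larger than lam i, so in a resonance it can
    -- only occur as a linear monomial. For k = i that monomial was subtracted; for k > i
    -- triangularity of the linear part excludes it.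
    · by_contra hak
      have h1 := eq_single_of_resonance H.norm_lt_one hres hi (hord i k hk) hak
      rcases hk.eq_or_lt with rfl | hlt
      · exact hai h1
      · rw [h1, MvPolynomial.mem_support_iff, hc2 k hlt] at haP
        exact haP rfl
  · refine hPu.congr (Eventually.of_forall fun x => ?_)
    rw [map_sub, MvPolynomial.eval_monomial, Finsupp.prod_single_index (by simp)]
    ring

theorem IsContractingWithEigenvalues.exists_coordinates (H : IsContractingWithEigenvalues f lam)
    {N : ℕ} (hN : 2 ≤ N) {b : Fin d → Dual ℂ (Fin d → ℂ)} (hb : LinearIndependent ℂ b)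
    (hbg : ∀ i, b i ∈ (codifferential f).maxGenEigenspace (lam i)) :
    ∃ (e : (Fin d → ℂ) → (Fin d → ℂ)) (he : ∀ i, AnalyticAt ℂ (fun x => e x i) 0),
      IsLocalBiholomorphism e ∧ (∀ i, (covector fun x => e x i) = b i) ∧
      ∀ i, jet N (he i) ∈
        End.maxGenEigenspace (jetHom H.analytic H.apply_zero N).toLinearMap (lam i) := by
  have h1 : ∀ i, lam i ≠ 1 := fun i h => by
    have := H.norm_lt_one i
    rw [h] at this
    simp at this
  choose u hu hu0 hub huj using fun i =>
    exists_jet_mem_maxGenEigenspace H.analytic H.apply_zero hN (h1 i) (hbg i)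
  refine ⟨fun x i => u i x, hu, isLocalBiholomorphism_of_linearIndependent hu
    (funext fun i => hu0 i) ?_, hub, huj⟩
  simp only [hub]
  exact hb

end PoincareDulac

/-! ### Poincaré–Dulac normal form in dimension three. -/

section PoincareDulacThree

open Module

variable {f : (Fin 3 → ℂ) → (Fin 3 → ℂ)} {lam : Fin 3 → ℂ}

/-- A dominating non-zero eigenvalue has a holomorphic eigenfunction. -/
theorem IsContractingWithEigenvalues.exists_eigenfunction (H : IsContractingWithEigenvalues f lam)
    (hord : ∀ i j, i ≤ j → ‖lam j‖ ≤ ‖lam i‖) (hlam : lam 0 ≠ 0) :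
    ∃ w : (Fin 3 → ℂ) → ℂ, AnalyticAt ℂ w 0 ∧ w 0 = 0 ∧ covector w ≠ 0 ∧
      ∀ᶠ x in 𝓝 0, w (f x) = lam 0 * w x := by
  obtain ⟨N₀, hN₀⟩ := H.exists_order hlam
  set N := max 2 N₀
  have hN : 2 ≤ N := le_max_left _ _
  obtain ⟨b, hb, hbt⟩ := exists_triangular_family _ (codifferential f) lam H.det_sub
  obtain ⟨e, he, heb, hec, hej⟩ := H.exists_coordinates hN hb fun i => (hbt i).1
  obtain ⟨R, hR, hRe⟩ := H.exists_resonant_form hord hN heb he hej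
    (fun i => by simp only [hec]; exact (hbt i).2) hlam
  -- For the first eigenvalue no earlier variables are available, and the zero exponent is not
  -- resonant.
  have hR0 : R = 0 := by
    rw [← MvPolynomial.support_eq_empty, Finset.eq_empty_iff_forall_notMem]
    intro a ha
    exact (hR a ha).1 (Finsupp.ext fun k => (hR a ha).2.1 k (Fin.zero_le k))
  have hu : AnalyticAt ℂ (fun x => e (f x) 0) 0 :=
    AnalyticAt.fun_comp (g := fun x => e x 0) (by rw [H.apply_zero]; exact he 0) H.analytic
  obtain ⟨v, hv, hvN, hvf⟩ := hN₀ N (le_max_right _ _) (fun x => lam 0 * e x 0 - e (f x) 0)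
    ((analyticAt_const.fun_mul (he 0)).fun_sub hu) (by
      refine (hRe.const_mul (-1)).congr (Eventually.of_forall fun x => ?_)
      rw [hR0, map_zero]; ring)
  refine ⟨fun x => e x 0 + v x, (he 0).fun_add hv, ?_, ?_, ?_⟩
  · simp [heb.map_zero, hvN.eq_zero (by omega)]
  · rw [covector_add (he 0) hv, (hvN.mono hN).covector_eq_zero, add_zero, hec]
    exact hb.ne_zero 0
  · filter_upwards [hvf] with x hx
    rw [hx]; ring

theorem vanishesToOrder_eval_sub {N : ℕ} {e e' : (Fin 3 → ℂ) → (Fin 3 → ℂ)}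
    (he : ∀ i, AnalyticAt ℂ (fun x => e x i) 0) (he' : ∀ i, AnalyticAt ℂ (fun x => e' x i) 0)
    (h : ∀ i, VanishesToOrder N fun x => e x i - e' x i) (P : MvPolynomial (Fin 3) ℂ) :
    VanishesToOrder N fun x => MvPolynomial.eval (e x) P - MvPolynomial.eval (e' x) P := by
  induction P using MvPolynomial.induction_on with
  | C a => simpa using vanishesToOrder_zero (E := Fin 3 → ℂ) N
  | add p q hp hq =>
    refine (hp.add hq).congr (Eventually.of_forall fun x => ?_)
    simp only [map_add]; ring
  | mul_X p i hp =>
    have h1 := hp.mul (vanishesToOrder_of_continuousAt (he i).continuousAt)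
    have h2 := (vanishesToOrder_of_continuousAt
      (analyticAt_mvPolynomial p he').continuousAt).mul (h i)
    rw [add_zero] at h1
    rw [zero_add] at h2
    refine (h1.add h2).congr (Eventually.of_forall fun x => ?_)
    simp only [map_mul, MvPolynomial.eval_X]; ring

/-- The polynomial in the first variable with the same coefficients. -/
def univariatePart (R : MvPolynomial (Fin 3) ℂ) : Polynomial ℂ :=
  ∑ a ∈ R.support, Polynomial.monomial (a 0) (R.coeff a)

theorem eval_univariatePart {R : MvPolynomial (Fin 3) ℂ}
    (hR : ∀ a ∈ R.support, ∀ k, 1 ≤ k → a k = 0) (y : Fin 3 → ℂ) :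
    (univariatePart R).eval (y 0) = MvPolynomial.eval y R := by
  rw [univariatePart, Polynomial.eval_finsetSum, MvPolynomial.eval_eq]
  refine Finset.sum_congr rfl fun a ha => ?_
  rw [Polynomial.eval_monomial, ← Finsupp.prod, Finsupp.prod_fintype _ _ (by simp),
    Fin.prod_univ_three, hR a ha 1 le_rfl, hR a ha 2 (by decide)]
  simp

theorem exists_mem_support_of_univariatePart {R : MvPolynomial (Fin 3) ℂ} {n : ℕ}
    (hn : n ∈ (univariatePart R).support) : ∃ a ∈ R.support, a 0 = n := by
  rw [univariatePart, Polynomial.mem_support_iff, Polynomial.finsetSum_coeff] at hn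
  obtain ⟨a, ha, hna⟩ := Finset.exists_ne_zero_of_sum_ne_zero hn
  rw [Polynomial.coeff_monomial] at hna
  split_ifs at hna with h
  · exact ⟨a, ha, h⟩
  · exact absurd rfl hna

/-- The polynomial in the first two variables with the same coefficients. -/
def bivariatePart (R : MvPolynomial (Fin 3) ℂ) : MvPolynomial (Fin 2) ℂ :=
  ∑ a ∈ R.support, MvPolynomial.monomial (Finsupp.equivFunOnFinite.symm ![a 0, a 1]) (R.coeff a)

theorem eval_bivariatePart {R : MvPolynomial (Fin 3) ℂ}
    (hR : ∀ a ∈ R.support, ∀ k, 2 ≤ k → a k = 0) (y : Fin 3 → ℂ) :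
    MvPolynomial.eval ![y 0, y 1] (bivariatePart R) = MvPolynomial.eval y R := by
  rw [bivariatePart, map_sum, MvPolynomial.eval_eq]
  refine Finset.sum_congr rfl fun a ha => ?_
  rw [MvPolynomial.eval_monomial, ← Finsupp.prod, Finsupp.prod_fintype _ _ (by simp),
    Finsupp.prod_fintype _ _ (by simp), Fin.prod_univ_three, Fin.prod_univ_two,
    hR a ha 2 le_rfl]
  simp

theorem exists_mem_support_of_bivariatePart {R : MvPolynomial (Fin 3) ℂ} {n : Fin 2 →₀ ℕ}
    (hn : n ∈ (bivariatePart R).support) : ∃ a ∈ R.support, a 0 = n 0 ∧ a 1 = n 1 := by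
  rw [bivariatePart, MvPolynomial.mem_support_iff, MvPolynomial.coeff_sum] at hn
  obtain ⟨a, ha, hna⟩ := Finset.exists_ne_zero_of_sum_ne_zero hn
  rw [MvPolynomial.coeff_monomial] at hna
  split_ifs at hna with h
  · exact ⟨a, ha, by simp [← h], by simp [← h]⟩
  · exact absurd rfl hna

/-- **Poincaré-Dulac normal form**, with a prescribed first coordinate, for the part of the spectrum
which is not zero. -/
theorem IsContractingWithEigenvalues.poincareDulac (H : IsContractingWithEigenvalues f lam)
    (hord : ∀ i j, i ≤ j → ‖lam j‖ ≤ ‖lam i‖) {w : (Fin 3 → ℂ) → ℂ} (hw : AnalyticAt ℂ w 0)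
    (hw0 : w 0 = 0) (hwc : covector w ≠ 0) (hwf : ∀ᶠ x in 𝓝 0, w (f x) = lam 0 * w x) :
    ∃ e : (Fin 3 → ℂ) → (Fin 3 → ℂ), IsLocalBiholomorphism e ∧ (∀ x, e x 0 = w x) ∧
      (lam 1 ≠ 0 → ∃ ρ₁ : Polynomial ℂ,
        (∀ n ∈ ρ₁.support, n ≠ 0 ∧ lam 0 ^ n = lam 1) ∧
        ∀ᶠ x in 𝓝 0, e (f x) 1 = lam 1 * e x 1 + ρ₁.eval (e x 0)) ∧
      (lam 2 ≠ 0 → ∃ ρ₂ : MvPolynomial (Fin 2) ℂ,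
        (∀ n ∈ ρ₂.support, lam 0 ^ n 0 * lam 1 ^ n 1 = lam 2) ∧
        ∀ᶠ x in 𝓝 0, e (f x) 2 = lam 2 * e x 2 + MvPolynomial.eval ![e x 0, e x 1] ρ₂) := by
  obtain ⟨N₁, hN₁⟩ : ∃ N₁ : ℕ, lam 1 ≠ 0 → ∀ N, N₁ ≤ N → ∀ h : (Fin 3 → ℂ) → ℂ,
      AnalyticAt ℂ h 0 → VanishesToOrder N h → ∃ v : (Fin 3 → ℂ) → ℂ, AnalyticAt ℂ v 0 ∧
        VanishesToOrder N v ∧ ∀ᶠ x in 𝓝 0, v (f x) = lam 1 * v x + h x := by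
    by_cases h1 : lam 1 = 0
    · exact ⟨0, fun h => absurd h1 h⟩
    · obtain ⟨N, hN⟩ := H.exists_order h1
      exact ⟨N, fun _ => hN⟩
  obtain ⟨N₂, hN₂⟩ : ∃ N₂ : ℕ, lam 2 ≠ 0 → ∀ N, N₂ ≤ N → ∀ h : (Fin 3 → ℂ) → ℂ,
      AnalyticAt ℂ h 0 → VanishesToOrder N h → ∃ v : (Fin 3 → ℂ) → ℂ, AnalyticAt ℂ v 0 ∧
        VanishesToOrder N v ∧ ∀ᶠ x in 𝓝 0, v (f x) = lam 2 * v x + h x := by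
    by_cases h1 : lam 2 = 0
    · exact ⟨0, fun h => absurd h1 h⟩
    · obtain ⟨N, hN⟩ := H.exists_order h1
      exact ⟨N, fun _ => hN⟩
  set N := max 2 (max N₁ N₂)
  have hN : 2 ≤ N := le_max_left _ _
  have hNN₁ : N₁ ≤ N := (le_max_left _ _).trans (le_max_right _ _)
  have hNN₂ : N₂ ≤ N := (le_max_right _ _).trans (le_max_right _ _)
  have hSw : codifferential f (covector w) = lam 0 • covector w := by
    rw [codifferential_covector H.analytic H.apply_zero hw, covector_congr hwf, covector_const_mul hw]
  obtain ⟨b, hb0, hb, hbt⟩ := exists_triangular_step (codifferential f) lam H.det_sub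
    (fun W _ _ _ S lam h => exists_triangular_family W S lam h) hwc hSw
  obtain ⟨e₀, he₀, heb₀, hec₀, hej₀⟩ := H.exists_coordinates hN hb fun i => (hbt i).1
  -- The approximate first coordinate is replaced by w, which has the same covector and whose jet is
  -- an exact eigenvector, so the resonant form still applies.
  set e : (Fin 3 → ℂ) → (Fin 3 → ℂ) := fun x => ![w x, e₀ x 1, e₀ x 2] with hedef
  have he : ∀ i, AnalyticAt ℂ (fun x => e x i) 0 := by
    intro i; fin_cases i
    · exact hw
    · exact he₀ 1
    · exact he₀ 2
  have hec : ∀ i, (covector fun x => e x i) = b i := by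
    intro i; fin_cases i
    · exact hb0.symm
    · exact hec₀ 1
    · exact hec₀ 2
  have he0 : e 0 = 0 := by
    ext i; fin_cases i
    · exact hw0
    · exact congrFun heb₀.map_zero 1
    · exact congrFun heb₀.map_zero 2
  have heb : IsLocalBiholomorphism e :=
    isLocalBiholomorphism_of_linearIndependent he he0 (by simp only [hec]; exact hb)
  have hwj : jet N hw ∈
      End.maxGenEigenspace (jetHom H.analytic H.apply_zero N).toLinearMap (lam 0) := by
    rw [End.mem_maxGenEigenspace]
    refine ⟨1, ?_⟩
    rw [pow_one, LinearMap.sub_apply, AlgHom.toLinearMap_apply, jetHom_jet, sub_eq_zero]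
    refine (jet_eq_jet_iff _ (analyticAt_const.fun_mul hw : AnalyticAt ℂ (fun x => lam 0 * w x) 0)).2
      ((vanishesToOrder_zero N).congr ?_)
    filter_upwards [hwf] with x hx
    rw [hx, sub_self]
  have hej : ∀ i, jet N (he i) ∈
      End.maxGenEigenspace (jetHom H.analytic H.apply_zero N).toLinearMap (lam i) := by
    intro i; fin_cases i
    · exact hwj
    · exact hej₀ 1
    · exact hej₀ 2
  have hform := fun i (hi : lam i ≠ 0) => H.exists_resonant_form hord hN heb he hej
    (fun i => by simp only [hec]; exact (hbt i).2) hi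
  have huf : ∀ i, AnalyticAt ℂ (fun x => e (f x) i) 0 := fun i =>
    AnalyticAt.fun_comp (g := fun x => e x i) (by rw [H.apply_zero]; exact he i) H.analytic
  obtain ⟨e₁, he₁, hee₁, hρ₁⟩ : ∃ e₁ : (Fin 3 → ℂ) → ℂ, AnalyticAt ℂ e₁ 0 ∧
      (VanishesToOrder N fun x => e₁ x - e x 1) ∧
      (lam 1 ≠ 0 → ∃ ρ₁ : Polynomial ℂ,
        (∀ n ∈ ρ₁.support, n ≠ 0 ∧ lam 0 ^ n = lam 1) ∧
        ∀ᶠ x in 𝓝 0, e₁ (f x) = lam 1 * e₁ x + ρ₁.eval (w x)) := by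
    by_cases h1 : lam 1 = 0
    · exact ⟨fun x => e x 1, he 1, by simpa using vanishesToOrder_zero (E := Fin 3 → ℂ) N,
        fun h => absurd h1 h⟩
    · obtain ⟨R, hR, hRe⟩ := hform 1 h1
      obtain ⟨v, hv, hvN, hvf⟩ := hN₁ h1 N hNN₁
        (fun x => lam 1 * e x 1 + MvPolynomial.eval (e x) R - e (f x) 1)
        (((analyticAt_const.fun_mul (he 1)).fun_add (analyticAt_mvPolynomial R he)).fun_sub (huf 1))
        ((hRe.const_mul (-1)).congr (Eventually.of_forall fun x => by ring))
      refine ⟨fun x => e x 1 + v x, (he 1).fun_add hv, by simpa using hvN, fun _ =>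
        ⟨univariatePart R, fun n hn => ?_, ?_⟩⟩
      · obtain ⟨a, ha, rfl⟩ := exists_mem_support_of_univariatePart hn
        obtain ⟨h2, h3, h4⟩ := hR a ha
        have h5 := h3 1 le_rfl
        have h6 := h3 2 (by decide)
        refine ⟨fun h => h2 (Finsupp.ext fun k => ?_), ?_⟩
        · fin_cases k
          · exact h
          · exact h5
          · exact h6
        · rw [Fin.prod_univ_three, h5, h6] at h4
          simpa using h4
      · filter_upwards [hvf] with x hx
        have h2 := eval_univariatePart (fun a ha => (hR a ha).2.1) (e x)
        rw [hx, show w x = e x 0 from rfl, h2]; ring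
  -- The third equation must be resonant in the corrected second coordinate. The correction vanishes
  -- to order N, so replacing e by e' inside a polynomial only produces terms of order N, which the
  -- next correction removes.
  set e' : (Fin 3 → ℂ) → (Fin 3 → ℂ) := fun x => ![w x, e₁ x, e x 2] with hedef'
  have he' : ∀ i, AnalyticAt ℂ (fun x => e' x i) 0 := by
    intro i; fin_cases i
    · exact hw
    · exact he₁
    · exact he 2
  have hee' : ∀ i, VanishesToOrder N fun x => e x i - e' x i := by
    intro i; fin_cases i
    · simpa [hedef, hedef'] using vanishesToOrder_zero (E := Fin 3 → ℂ) N
    · exact (hee₁.const_mul (-1)).congr (Eventually.of_forall fun x => by simp [hedef'])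
    · simpa [hedef, hedef'] using vanishesToOrder_zero (E := Fin 3 → ℂ) N
  obtain ⟨e₂, he₂, hee₂, hρ₂⟩ : ∃ e₂ : (Fin 3 → ℂ) → ℂ, AnalyticAt ℂ e₂ 0 ∧
      (VanishesToOrder N fun x => e₂ x - e x 2) ∧
      (lam 2 ≠ 0 → ∃ ρ₂ : MvPolynomial (Fin 2) ℂ,
        (∀ n ∈ ρ₂.support, lam 0 ^ n 0 * lam 1 ^ n 1 = lam 2) ∧
        ∀ᶠ x in 𝓝 0, e₂ (f x) = lam 2 * e₂ x + MvPolynomial.eval ![w x, e₁ x] ρ₂) := by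
    by_cases h1 : lam 2 = 0
    · exact ⟨fun x => e x 2, he 2, by simpa using vanishesToOrder_zero (E := Fin 3 → ℂ) N,
        fun h => absurd h1 h⟩
    · obtain ⟨R, hR, hRe⟩ := hform 2 h1
      obtain ⟨v, hv, hvN, hvf⟩ := hN₂ h1 N hNN₂
        (fun x => lam 2 * e x 2 + MvPolynomial.eval (e' x) R - e (f x) 2)
        (((analyticAt_const.fun_mul (he 2)).fun_add (analyticAt_mvPolynomial R he')).fun_sub (huf 2))
        (((hRe.add (vanishesToOrder_eval_sub he he' hee' R)).const_mul (-1)).congr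
          (Eventually.of_forall fun x => by ring))
      refine ⟨fun x => e x 2 + v x, (he 2).fun_add hv, by simpa using hvN, fun _ =>
        ⟨bivariatePart R, fun n hn => ?_, ?_⟩⟩
      · obtain ⟨a, ha, h5, h6⟩ := exists_mem_support_of_bivariatePart hn
        obtain ⟨_, h3, h4⟩ := hR a ha
        rw [Fin.prod_univ_three, h3 2 le_rfl, h5, h6] at h4
        simpa using h4
      · filter_upwards [hvf] with x hx
        have h2 := eval_bivariatePart (fun a ha => (hR a ha).2.1) (e' x)
        rw [hx, show ![w x, e₁ x] = ![e' x 0, e' x 1] from rfl, h2]; ring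
  have hfin : ∀ i, AnalyticAt ℂ (fun x => (![w x, e₁ x, e₂ x] : Fin 3 → ℂ) i) 0 := by
    intro i; fin_cases i
    · exact hw
    · exact he₁
    · exact he₂
  refine ⟨fun x => ![w x, e₁ x, e₂ x], isLocalBiholomorphism_of_linearIndependent hfin ?_ ?_,
    fun _ => rfl, hρ₁, hρ₂⟩
  · ext i; fin_cases i
    · exact hw0
    · have := hee₁.eq_zero (by omega)
      rw [he0, Pi.zero_apply, sub_zero] at this
      exact this
    · have := hee₂.eq_zero (by omega)
      rw [he0, Pi.zero_apply, sub_zero] at this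
      exact this
  · have : (fun i => covector fun x => (![w x, e₁ x, e₂ x] : Fin 3 → ℂ) i) = b := by
      ext1 i
      rw [← hec i]
      fin_cases i
      · rfl
      · exact (hee₁.mono hN).covector_eq he₁ (he 1)
      · exact (hee₂.mono hN).covector_eq he₂ (he 2)
    rw [this]; exact hb

end PoincareDulacThree

/-! ### The kernel directions of df₀ along orbits. -/

section NilpotentPart

open Module

variable {f : (Fin 3 → ℂ) → (Fin 3 → ℂ)} {lam : Fin 3 → ℂ}

theorem jetHom_pow_jet {d : ℕ} {f : (Fin d → ℂ) → (Fin d → ℂ)} (hf : AnalyticAt ℂ f 0)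
    (h0 : f 0 = 0) (N k : ℕ) {u : (Fin d → ℂ) → ℂ} (hu : AnalyticAt ℂ u 0)
    (hk : AnalyticAt ℂ (fun x => u (f^[k] x)) 0) :
    ((jetHom hf h0 N).toLinearMap ^ k) (jet N hu) = jet N hk := by
  induction k generalizing u with
  | zero => rfl
  | succ k ih =>
    have h1 : AnalyticAt ℂ (fun x => u (f x)) 0 :=
      AnalyticAt.fun_comp (g := u) (by rwa [h0]) hf
    rw [pow_succ, End.mul_apply, AlgHom.toLinearMap_apply, jetHom_jet,
      ih h1 (by simpa only [← Function.iterate_succ_apply'] using hk)]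
    refine congrArg (Ideal.Quotient.mk (vanishingIdeal d N)) (Subtype.ext (funext fun x => ?_))
    simp only [Function.iterate_succ_apply']

theorem iterate_apply_zero {d : ℕ} {f : (Fin d → ℂ) → (Fin d → ℂ)} (h0 : f 0 = 0) (k : ℕ) :
    f^[k] 0 = 0 := Function.iterate_fixed h0 k

/-- A generalized eigenvector for 0 is killed by a power of the pull-back, which on germs means
vanishing to order N after composition with that iterate. Further composition with f preserves the
order. -/
theorem exists_vanishesToOrder_iterate {d : ℕ} {f : (Fin d → ℂ) → (Fin d → ℂ)}
    (hf : AnalyticAt ℂ f 0) (h0 : f 0 = 0) {N : ℕ} {u : (Fin d → ℂ) → ℂ} (hu : AnalyticAt ℂ u 0)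
    (hj : jet N hu ∈ End.maxGenEigenspace (jetHom hf h0 N).toLinearMap 0) :
    ∃ k, ∀ m, k ≤ m → VanishesToOrder N fun x => u (f^[m] x) := by
  rw [End.mem_maxGenEigenspace] at hj
  obtain ⟨k, hk⟩ := hj
  rw [zero_smul, sub_zero] at hk
  have h1 : AnalyticAt ℂ (fun x => u (f^[k] x)) 0 :=
    AnalyticAt.fun_comp (g := u) (by rwa [iterate_apply_zero h0]) (analyticAt_iterate hf h0 k)
  rw [jetHom_pow_jet hf h0 N k hu h1] at hk
  have h2 : VanishesToOrder N fun x => u (f^[k] x) := Ideal.Quotient.eq_zero_iff_mem.1 hk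
  refine ⟨k, fun m hm => ?_⟩
  obtain ⟨j, rfl⟩ := Nat.exists_eq_add_of_le hm
  refine (h2.comp (f := f^[j]) (analyticAt_iterate hf h0 j).differentiableAt
    (iterate_apply_zero h0 j)).congr (Eventually.of_forall fun x => ?_)
  simp only [Function.iterate_add_apply]

/-- If `df₀` has only one non-zero eigenvalue, with eigenfunction `w`, then any germ is
asymptotically a function of `w` along the orbits of `f`. -/
theorem IsContractingWithEigenvalues.exists_polynomial_iterate
    (H : IsContractingWithEigenvalues f lam) (h1 : lam 1 = 0) (h2 : lam 2 = 0)
    {w : (Fin 3 → ℂ) → ℂ} (hw : AnalyticAt ℂ w 0)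
    (hw0 : w 0 = 0) (hwc : covector w ≠ 0) (hwf : ∀ᶠ x in 𝓝 0, w (f x) = lam 0 * w x)
    {N : ℕ} (hN : N ≠ 0) : ∃ m, ∀ h : (Fin 3 → ℂ) → ℂ, AnalyticAt ℂ h 0 → h 0 = 0 →
      ∃ p : Polynomial ℂ, p.coeff 0 = 0 ∧
        VanishesToOrder N fun x => h (f^[m] x) - p.eval (w (f^[m] x)) := by
  have hSw : codifferential f (covector w) = lam 0 • covector w := by
    rw [codifferential_covector H.analytic H.apply_zero hw, covector_congr hwf,
      covector_const_mul hw]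
  obtain ⟨b, hb0, hb, hbt⟩ := exists_triangular_step (codifferential f) lam H.det_sub
    (fun W _ _ _ S lam h => exists_triangular_family W S lam h) hwc hSw
  set N' := max 2 N
  have hN' : N ≤ N' := le_max_right _ _
  have key : ∀ i, lam i = 0 → ∃ (u : (Fin 3 → ℂ) → ℂ), AnalyticAt ℂ u 0 ∧ u 0 = 0 ∧
      covector u = b i ∧ ∃ k, ∀ m, k ≤ m → VanishesToOrder N fun x => u (f^[m] x) := by
    intro i hi
    have h3 := (hbt i).1
    rw [hi] at h3
    obtain ⟨u, hu, hu0, hub, huj⟩ := exists_jet_mem_maxGenEigenspace H.analytic H.apply_zero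
      (le_max_left 2 N) zero_ne_one h3
    obtain ⟨k, hk⟩ := exists_vanishesToOrder_iterate H.analytic H.apply_zero hu huj
    exact ⟨u, hu, hu0, hub, k, fun m hm => (hk m hm).mono hN'⟩
  obtain ⟨e₁, he₁, he₁0, he₁b, k₁, hk₁⟩ := key 1 h1
  obtain ⟨e₂, he₂, he₂0, he₂b, k₂, hk₂⟩ := key 2 h2
  -- After m iterates the two coordinates with eigenvalue 0 vanish to order N, and only powers of w
  -- survive in a polynomial. The number m depends on these coordinates alone, so it serves all
  -- germs h.
  set m := max k₁ k₂
  set e : (Fin 3 → ℂ) → (Fin 3 → ℂ) := fun x => ![w x, e₁ x, e₂ x] with hedef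
  have he : ∀ i, AnalyticAt ℂ (fun x => e x i) 0 := by
    intro i; fin_cases i
    · exact hw
    · exact he₁
    · exact he₂
  have hec : (fun i => covector fun x => e x i) = b := by
    ext1 i; fin_cases i
    · exact hb0.symm
    · exact he₁b
    · exact he₂b
  have he0 : e 0 = 0 := by
    ext i; fin_cases i
    · exact hw0
    · exact he₁0
    · exact he₂0
  have heb : IsLocalBiholomorphism e :=
    isLocalBiholomorphism_of_linearIndependent he he0 (by rw [hec]; exact hb)
  have hfm := analyticAt_iterate H.analytic H.apply_zero m
  have hm0 : f^[m] 0 = 0 := iterate_apply_zero H.apply_zero m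
  have hpoly : ∀ P : MvPolynomial (Fin 3) ℂ, ∃ p : Polynomial ℂ,
      p.coeff 0 = MvPolynomial.eval 0 P ∧
      VanishesToOrder N fun x => MvPolynomial.eval (e (f^[m] x)) P - p.eval (w (f^[m] x)) := by
    intro P
    induction P using MvPolynomial.induction_on with
    | C a => exact ⟨Polynomial.C a, by simp, by simpa using vanishesToOrder_zero (E := Fin 3 → ℂ) N⟩
    | add P Q hP hQ =>
      obtain ⟨p, hp0, hp⟩ := hP
      obtain ⟨q, hq0, hq⟩ := hQ
      refine ⟨p + q, by simp [hp0, hq0], (hp.add hq).congr (Eventually.of_forall fun x => ?_)⟩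
      simp only [map_add, Polynomial.eval_add]; ring
    | mul_X P i hP =>
      have hcont : ∀ u : (Fin 3 → ℂ) → ℂ, AnalyticAt ℂ u 0 →
          VanishesToOrder 0 fun x => u (f^[m] x) := fun u hu =>
        (vanishesToOrder_of_continuousAt hu.continuousAt).comp hfm.differentiableAt hm0
      have hsmall : ∀ j, (VanishesToOrder N fun x => e (f^[m] x) j) → j = i →
          ∃ p : Polynomial ℂ, p.coeff 0 = MvPolynomial.eval 0 (P * MvPolynomial.X i) ∧
          VanishesToOrder N fun x =>
            MvPolynomial.eval (e (f^[m] x)) (P * MvPolynomial.X i) - p.eval (w (f^[m] x)) := by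
        rintro j hj rfl
        refine ⟨0, by simp, ?_⟩
        have := (hcont _ (analyticAt_mvPolynomial P he)).mul hj
        rw [zero_add] at this
        simpa using this
      fin_cases i
      · obtain ⟨p, hp0, hp⟩ := hP
        refine ⟨p * Polynomial.X, by simp, ?_⟩
        have := hp.mul (hcont _ hw)
        rw [add_zero] at this
        refine this.congr (Eventually.of_forall fun x => ?_)
        simp [hedef]; ring
      · exact hsmall 1 (hk₁ m (le_max_left _ _)) rfl
      · exact hsmall 2 (hk₂ m (le_max_right _ _)) rfl
  refine ⟨m, fun h hh hh0 => ?_⟩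
  obtain ⟨P, hP⟩ := exists_polynomial heb N hh
  obtain ⟨p, hp0, hp⟩ := hpoly P
  refine ⟨p, ?_, ?_⟩
  · have := hP.eq_zero hN
    rw [hh0, he0, zero_sub, neg_eq_zero] at this
    rw [hp0, this]
  · refine ((hP.comp (f := f^[m]) hfm.differentiableAt hm0).add hp).congr
      (Eventually.of_forall fun x => ?_)
    ring

/-- The elementary symmetric functions of the eigenvalues in terms of the matrix of the
codifferential. -/
theorem IsContractingWithEigenvalues.eigenvalue_identities
    (H : IsContractingWithEigenvalues f lam) {b : Fin 3 → Dual ℂ (Fin 3 → ℂ)}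
    (hb : LinearIndependent ℂ b) {M : Matrix (Fin 3) (Fin 3) ℂ}
    (hM : ∀ i, codifferential f (b i) = ∑ j, M i j • b j) :
    lam 0 + lam 1 + lam 2 = M 0 0 + M 1 1 + M 2 2 ∧
    lam 0 * lam 1 + lam 0 * lam 2 + lam 1 * lam 2 = M 0 0 * M 1 1 - M 0 1 * M 1 0
      + (M 0 0 * M 2 2 - M 0 2 * M 2 0) + (M 1 1 * M 2 2 - M 1 2 * M 2 1) ∧
    lam 0 * lam 1 * lam 2 = M.det := by
  let B := basisOfLinearIndependentOfCardEqFinrank hb (by simp)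
  have hB : ∀ i, B i = b i := fun i => by simp [B]
  have hMat : LinearMap.toMatrix B B (codifferential f) = M.transpose := by
    ext i j
    rw [LinearMap.toMatrix_apply, hB, hM, Matrix.transpose_apply]
    simp only [← hB, map_sum, map_smul, Basis.repr_self]
    simp [Finsupp.single_apply]
  have key : ∀ z : ℂ, (z - lam 0) * (z - lam 1) * (z - lam 2)
      = (Matrix.scalar (Fin 3) z - M).det := by
    intro z
    have h1 := H.det_sub z
    rw [← LinearMap.eval_charpoly, ← LinearMap.charpoly_toMatrix _ B, hMat,
      Matrix.charpoly_transpose, Matrix.eval_charpoly, Fin.prod_univ_three] at h1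
    exact h1.symm
  simp only [Matrix.det_fin_three, Matrix.sub_apply, Matrix.scalar_apply, Matrix.diagonal_apply_eq,
    Matrix.diagonal_apply_ne, ne_eq, Fin.reduceEq, not_false_eq_true] at key ⊢
  -- The values at 0, 1 and -1 determine the three lower coefficients of a monic cubic.
  have k0 := key 0
  have k1 := key 1
  have k2 := key (-1)
  refine ⟨?_, ?_, ?_⟩
  · linear_combination (-1 / 2) * k1 + (-1 / 2) * k2 + k0
  · linear_combination (1 / 2) * k1 - (1 / 2) * k2
  · linear_combination -k0

end NilpotentPart

/-! ### Absorbing units into the coordinates. -/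

section Normalisation

variable {f : (Fin 3 → ℂ) → (Fin 3 → ℂ)} {lam : Fin 3 → ℂ}

/-- Solution of the scalar equation `v ∘ f = μ v + h` when `μ` is not contracting. -/
theorem IsContractingWithEigenvalues.exists_solution_of_one_le
    (H : IsContractingWithEigenvalues f lam) {μ : ℂ} (hμ : 1 ≤ ‖μ‖) {h : (Fin 3 → ℂ) → ℂ}
    (hh : AnalyticAt ℂ h 0) (hh0 : h 0 = 0) :
    ∃ v : (Fin 3 → ℂ) → ℂ, AnalyticAt ℂ v 0 ∧ v 0 = 0 ∧
      ∀ᶠ x in 𝓝 0, v (f x) = μ * v x + h x := by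
  obtain ⟨θ, h1, h2, h3⟩ := H.exists_contractsAt
  have hμ0 : μ ≠ 0 := norm_pos_iff.1 (one_pos.trans_le hμ)
  obtain ⟨v, hv, hv1, hvf⟩ := exists_functional_solution H.analytic h3 h1 h2.le
    (B := ContinuousLinearMap.mul ℂ ℂ μ⁻¹) (D := ContinuousLinearMap.mul ℂ ℂ μ)
    (fun y => by simp [hμ0]) hh (vanishesToOrder_one hh.differentiableAt hh0) (by
      rw [ContinuousLinearMap.opNorm_mul_apply, norm_inv, pow_one]
      exact (mul_le_of_le_one_left h1.le (inv_le_one_of_one_le₀ hμ)).trans_lt h2)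
  exact ⟨v, hv, VanishesToOrder.eq_zero hv1 one_ne_zero, hvf⟩

/-- The linear map on tuples given by an integer matrix. -/
def natMatrixMap {ι : Type*} [Fintype ι] [DecidableEq ι] (D : Matrix ι ι ℕ) :
    (ι → ℂ) →L[ℂ] (ι → ℂ) :=
  LinearMap.toContinuousLinearMap (Matrix.toLin' (D.transpose.map (Nat.cast : ℕ → ℂ)))

theorem natMatrixMap_apply {ι : Type*} [Fintype ι] [DecidableEq ι] (D : Matrix ι ι ℕ) (y : ι → ℂ)
    (k : ι) : natMatrixMap D y k = ∑ l, D l k * y l := by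
  simp [natMatrixMap, Matrix.mulVec, dotProduct]

theorem exists_inverse_natMatrixMap {ι : Type*} [Fintype ι] [DecidableEq ι] {D : Matrix ι ι ℕ}
    (hD : (D.map (Nat.cast : ℕ → ℤ)).det ≠ 0) : ∃ B : (ι → ℂ) →L[ℂ] (ι → ℂ),
      (∀ y, natMatrixMap D (B y) = y) ∧ ∀ y, B (natMatrixMap D y) = y := by
  have h1 : IsUnit (D.transpose.map (Nat.cast : ℕ → ℂ)).det := by
    have h2 : (D.transpose.map (Nat.cast : ℕ → ℂ)).det
        = (((D.map (Nat.cast : ℕ → ℤ)).det : ℤ) : ℂ) := by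
      change (D.map (Nat.cast : ℕ → ℂ)).transpose.det = _
      rw [Matrix.det_transpose]
      have h3 : D.map (Nat.cast : ℕ → ℂ)
          = (Int.castRingHom ℂ).mapMatrix (D.map (Nat.cast : ℕ → ℤ)) := by
        ext i j; simp
      rw [h3, ← RingHom.map_det]; rfl
    rw [h2, isUnit_iff_ne_zero]
    exact_mod_cast hD
  refine ⟨LinearMap.toContinuousLinearMap
    (Matrix.toLin' (D.transpose.map (Nat.cast : ℕ → ℂ))⁻¹), fun y => ?_, fun y => ?_⟩
  · simp only [natMatrixMap, LinearMap.coe_toContinuousLinearMap', Matrix.toLin'_apply,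
      Matrix.mulVec_mulVec, Matrix.mul_nonsing_inv _ h1, Matrix.one_mulVec]
  · simp only [natMatrixMap, LinearMap.coe_toContinuousLinearMap', Matrix.toLin'_apply,
      Matrix.mulVec_mulVec, Matrix.nonsing_inv_mul _ h1, Matrix.one_mulVec]

/-- Solution of `v ∘ f = D v + h` for a germ with nilpotent differential. -/
theorem IsContractingWithEigenvalues.exists_solution_of_nilpotent
    (H : IsContractingWithEigenvalues f lam) (hlam : ∀ i, lam i = 0) {ι : Type*} [Fintype ι]
    [DecidableEq ι] {D : Matrix ι ι ℕ} (hD : (D.map (Nat.cast : ℕ → ℤ)).det ≠ 0)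
    {h : ι → (Fin 3 → ℂ) → ℂ} (hh : ∀ k, AnalyticAt ℂ (h k) 0) (hh0 : ∀ k, h k 0 = 0) :
    ∃ v : ι → (Fin 3 → ℂ) → ℂ, (∀ k, AnalyticAt ℂ (v k) 0) ∧ (∀ k, v k 0 = 0) ∧
      ∀ᶠ x in 𝓝 0, ∀ k, v k (f x) = ∑ l, D l k * v l x + h k x := by
  obtain ⟨B, hDB, _⟩ := exists_inverse_natMatrixMap hD
  -- All eigenvalues vanish, so f contracts at every positive rate. This rate makes ‖B‖θ < 1, so
  -- vanishing of h to first order is enough for any invertible exponent matrix.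
  set θ : ℝ := (‖B‖ + 1)⁻¹ with hθ
  have hB0 : 0 ≤ ‖B‖ := norm_nonneg _
  have hθ0 : 0 < θ := by positivity
  have hθ1 : θ ≤ 1 := inv_le_one_of_one_le₀ (by linarith)
  have hc := H.contractsAt hθ0 hθ1 (fun i => by rw [hlam, norm_zero]; exact hθ0)
  have hha : AnalyticAt ℂ (fun x k => h k x) 0 := analyticAt_pi_iff.2 hh
  have hhO : (fun x k => h k x) =O[𝓝 0] fun x : Fin 3 → ℂ => ‖x‖ ^ 1 := by
    rw [Asymptotics.isBigO_pi]
    exact fun k => vanishesToOrder_one (hh k).differentiableAt (hh0 k)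
  obtain ⟨v, hv, hvO, hvf⟩ := exists_functional_solution H.analytic hc hθ0 hθ1 hDB hha hhO (by
    rw [hθ, pow_one, ← div_eq_mul_inv, div_lt_one (by linarith)]; linarith)
  refine ⟨fun k x => v x k, analyticAt_pi_iff.1 hv,
    fun k => VanishesToOrder.eq_zero (Asymptotics.isBigO_pi.1 hvO k) one_ne_zero, ?_⟩
  filter_upwards [hvf] with x hx k
  rw [hx, Pi.add_apply, natMatrixMap_apply]

/-- Absorption of the units `u k` in the coordinates `y k`, by means of a solution of the linearised
equation. -/
theorem exp_normalisation {ι : Type*} [Fintype ι] {D : Matrix ι ι ℕ} {c Pf u' yf y u h v vf : ι → ℂ}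
    (hy : ∀ k, yf k = Pf k * (∏ l, y l ^ D l k) * u k)
    (hu : ∀ k, u k = c k * u' k * Complex.exp (h k))
    (hv : ∀ k, vf k = ∑ l, D l k * v l - h k) (k : ι) :
    yf k * Complex.exp (vf k) =
      c k * Pf k * u' k * ∏ l, (y l * Complex.exp (v l)) ^ D l k := by
  have h1 : Complex.exp (vf k) * Complex.exp (h k) = ∏ l, Complex.exp (v l) ^ D l k := by
    rw [← Complex.exp_add, hv, sub_add_cancel, Complex.exp_sum]
    exact Finset.prod_congr rfl fun l _ => by rw [← Complex.exp_nat_mul]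
  simp only [mul_pow, Finset.prod_mul_distrib, ← h1]
  rw [hy, hu]; ring

/-- Normalisation of a single equation `y ∘ f = P y ^ d u`. -/
theorem IsContractingWithEigenvalues.exists_normalisation
    (H : IsContractingWithEigenvalues f lam) {y P u : (Fin 3 → ℂ) → ℂ} {d : ℕ} (hd : 1 ≤ d)
    (hu : AnalyticAt ℂ u 0) (hu0 : u 0 ≠ 0)
    (hy : ∀ᶠ x in 𝓝 0, y (f x) = P x * y x ^ d * u x) :
    ∃ v : (Fin 3 → ℂ) → ℂ, AnalyticAt ℂ v 0 ∧ v 0 = 0 ∧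
      ∀ᶠ x in 𝓝 0, y (f x) * Complex.exp (v (f x)) =
        u 0 * P x * (y x * Complex.exp (v x)) ^ d := by
  obtain ⟨h, hh, hh0, huh⟩ := exists_log hu hu0
  obtain ⟨v, hv, hv0, hvf⟩ := H.exists_solution_of_one_le (μ := d) (by simpa using hd)
    (h := fun x => -h x) hh.neg (by simp [hh0])
  refine ⟨v, hv, hv0, ?_⟩
  filter_upwards [hy, huh, hvf] with x h1 h2 h3
  have := exp_normalisation (ι := Unit) (D := fun _ _ => d) (c := fun _ => u 0) (Pf := fun _ => P x)
    (u' := fun _ => 1) (yf := fun _ => y (f x)) (y := fun _ => y x) (u := fun _ => u x)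
    (h := fun _ => h x) (v := fun _ => v x) (vf := fun _ => v (f x)) (by simpa using h1)
    (by simpa using h2) (by simp [h3, sub_eq_add_neg]) ()
  simpa using this

/-- Normalisation of the equations `y₀ ∘ f = y₁ u₀`, `y₁ ∘ f = y₀ u₁`. -/
theorem IsContractingWithEigenvalues.exists_normalisation_swap
    (H : IsContractingWithEigenvalues f lam) {y₀ y₁ u₀ u₁ : (Fin 3 → ℂ) → ℂ}
    (hu₀ : AnalyticAt ℂ u₀ 0) (hu₀0 : u₀ 0 ≠ 0) (hu₁ : AnalyticAt ℂ u₁ 0) (hu₁0 : u₁ 0 ≠ 0)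
    (hy₀ : ∀ᶠ x in 𝓝 0, y₀ (f x) = y₁ x * u₀ x) (hy₁ : ∀ᶠ x in 𝓝 0, y₁ (f x) = y₀ x * u₁ x) :
    ∃ v₀ v₁ : (Fin 3 → ℂ) → ℂ, AnalyticAt ℂ v₀ 0 ∧ v₀ 0 = 0 ∧ AnalyticAt ℂ v₁ 0 ∧ v₁ 0 = 0 ∧
      (∀ᶠ x in 𝓝 0, y₀ (f x) * Complex.exp (v₀ (f x)) = u₀ 0 * (y₁ x * Complex.exp (v₁ x))) ∧
      ∀ᶠ x in 𝓝 0, y₁ (f x) * Complex.exp (v₁ (f x)) = u₁ 0 * (y₀ x * Complex.exp (v₀ x)) := by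
  obtain ⟨h₀, hh₀, hh₀0, huh₀⟩ := exists_log hu₀ hu₀0
  obtain ⟨h₁, hh₁, hh₁0, huh₁⟩ := exists_log hu₁ hu₁0
  -- The system v₀ ∘ f = v₁ - h₀, v₁ ∘ f = v₀ - h₁ decouples: s = v₀ + v₁ and t = v₀ - v₁ satisfy
  -- scalar equations with multipliers 1 and -1.
  obtain ⟨s, hs, hs0, hsf⟩ := H.exists_solution_of_one_le (μ := 1) (by simp)
    (h := fun x => -(h₀ x + h₁ x)) (hh₀.fun_add hh₁).neg (by simp [hh₀0, hh₁0])
  obtain ⟨t, ht, ht0, htf⟩ := H.exists_solution_of_one_le (μ := -1) (by simp)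
    (h := fun x => -(h₀ x - h₁ x)) (hh₀.fun_sub hh₁).neg (by simp [hh₀0, hh₁0])
  refine ⟨fun x => (s x + t x) * (1 / 2), fun x => (s x - t x) * (1 / 2),
    (hs.fun_add ht).fun_mul analyticAt_const, by simp [hs0, ht0],
    (hs.fun_sub ht).fun_mul analyticAt_const, by simp [hs0, ht0], ?_, ?_⟩
  · filter_upwards [hy₀, huh₀, hsf, htf] with x h1 h2 h3 h4
    have h5 : (s (f x) + t (f x)) * (1 / 2) = (s x - t x) * (1 / 2) - h₀ x := by
      rw [h3, h4]; ring
    rw [h1, h2, h5, Complex.exp_sub]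
    field_simp [Complex.exp_ne_zero]
  · filter_upwards [hy₁, huh₁, hsf, htf] with x h1 h2 h3 h4
    have h5 : (s (f x) - t (f x)) * (1 / 2) = (s x + t x) * (1 / 2) - h₁ x := by
      rw [h3, h4]; ring
    rw [h1, h2, h5, Complex.exp_sub]
    field_simp [Complex.exp_ne_zero]

/-- Simultaneous normalisation for a germ with nilpotent differential. -/
theorem IsContractingWithEigenvalues.exists_normalisation_of_nilpotent
    (H : IsContractingWithEigenvalues f lam) (hlam : ∀ i, lam i = 0) {ι : Type*} [Fintype ι]
    [DecidableEq ι] {D : Matrix ι ι ℕ} (hD : (D.map (Nat.cast : ℕ → ℤ)).det ≠ 0)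
    {y u : ι → (Fin 3 → ℂ) → ℂ} (hu : ∀ k, AnalyticAt ℂ (u k) 0) (hu0 : ∀ k, u k 0 ≠ 0)
    (hy : ∀ k, ∀ᶠ x in 𝓝 0, y k (f x) = (∏ l, y l x ^ D l k) * u k x) :
    ∃ v : ι → (Fin 3 → ℂ) → ℂ, (∀ k, AnalyticAt ℂ (v k) 0) ∧ (∀ k, v k 0 = 0) ∧
      ∀ᶠ x in 𝓝 0, ∀ k, y k (f x) * Complex.exp (v k (f x)) =
        u k 0 * ∏ l, (y l x * Complex.exp (v l x)) ^ D l k := by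
  choose h hh hh0 huh using fun k => exists_log (hu k) (hu0 k)
  obtain ⟨v, hv, hv0, hvf⟩ := H.exists_solution_of_nilpotent hlam hD (h := fun k x => -h k x)
    (fun k => (hh k).neg) (fun k => by simp [hh0])
  refine ⟨v, hv, hv0, ?_⟩
  filter_upwards [eventually_all.2 hy, eventually_all.2 huh, hvf] with x h1 h2 h3 k
  have := exp_normalisation (D := D) (c := fun k => u k 0) (Pf := fun _ => 1)
    (u' := fun _ => 1) (yf := fun k => y k (f x)) (y := fun k => y k x) (u := fun k => u k x)
    (h := fun k => h k x) (v := fun k => v k x) (vf := fun k => v k (f x)) (by simpa using h1)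
    (by simpa using h2) (by simpa [sub_eq_add_neg] using h3) k
  simpa using this

end Normalisation

/-! ### Normalisation over an eigenfunction, with at most one resonance. -/

section ResonantNormalisation

variable {f : (Fin 3 → ℂ) → (Fin 3 → ℂ)} {lam : Fin 3 → ℂ}

/-- The Taylor polynomial of `log (1 + g X ^ n)`. -/
def logPolynomial (N n : ℕ) (g : ℂ) : Polynomial ℂ :=
  ∑ j ∈ Finset.range (N + 1), Polynomial.monomial (n * j) ((-1) ^ (j + 1) * g ^ j / j)

theorem logPolynomial_eval (N n : ℕ) (g t : ℂ) :
    (logPolynomial N n g).eval t = Complex.logTaylor (N + 1) (g * t ^ n) := by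
  simp only [logPolynomial, Polynomial.eval_finsetSum, Polynomial.eval_monomial, Complex.logTaylor]
  refine Finset.sum_congr rfl fun j _ => ?_
  rw [mul_pow, ← pow_mul]; ring

theorem logPolynomial_coeff_zero (N : ℕ) {n : ℕ} (hn : n ≠ 0) (g : ℂ) :
    (logPolynomial N n g).coeff 0 = 0 := by
  rw [logPolynomial, Polynomial.finsetSum_coeff]
  refine Finset.sum_eq_zero fun j _ => ?_
  rw [Polynomial.coeff_monomial]
  split_ifs with h
  · obtain rfl : j = 0 := by simpa [hn] using h
    simp
  · rfl

theorem logPolynomial_coeff_self {N n : ℕ} (hN : N ≠ 0) (hn : n ≠ 0) (g : ℂ) :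
    (logPolynomial N n g).coeff n = g := by
  rw [logPolynomial, Polynomial.finsetSum_coeff, Finset.sum_eq_single 1]
  · simp
  · intro j _ hj
    rw [Polynomial.coeff_monomial, if_neg]
    intro h
    exact hj (Nat.eq_of_mul_eq_mul_left (Nat.pos_of_ne_zero hn) (by rw [h, mul_one]))
  · intro h
    exact absurd (Finset.mem_range.2 (by omega)) h

theorem vanishesToOrder_log_sub {w : (Fin 3 → ℂ) → ℂ} (hw : AnalyticAt ℂ w 0) (hw0 : w 0 = 0)
    (N : ℕ) {n : ℕ} (hn : n ≠ 0) (g : ℂ) :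
    VanishesToOrder N fun x => Complex.log (1 + g * w x ^ n) - (logPolynomial N n g).eval (w x) := by
  have hz : AnalyticAt ℂ (fun x => g * w x ^ n) 0 := analyticAt_const.fun_mul (hw.fun_pow n)
  have hz1 : VanishesToOrder 1 fun x => g * w x ^ n :=
    vanishesToOrder_one hz.differentiableAt (by simp [hw0, hn])
  have hzN := (hz1.pow (N + 1)).mono (M := N) (by omega)
  refine Asymptotics.IsBigO.trans (Asymptotics.IsBigO.of_bound 2 ?_) hzN
  have hlim : Tendsto (fun x => ‖g * w x ^ n‖) (𝓝 0) (𝓝 0) := by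
    have := hz.continuousAt.norm.tendsto
    simpa [hw0, hn] using this
  filter_upwards [hlim.eventually (gt_mem_nhds (by norm_num : (0 : ℝ) < 1 / 2))] with x hx
  rw [logPolynomial_eval]
  refine (Complex.norm_log_sub_logTaylor_le N (hx.trans (by norm_num))).trans ?_
  rw [norm_pow, mul_comm (2 : ℝ)]
  have h1 : (1 - ‖g * w x ^ n‖)⁻¹ ≤ 2 := by
    rw [inv_le_comm₀ (by linarith) two_pos]; linarith
  have h2 : (0 : ℝ) ≤ (1 - ‖g * w x ^ n‖)⁻¹ := inv_nonneg.2 (by linarith)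
  refine (div_le_self (by positivity) ?_).trans (by gcongr)
  have : (0 : ℝ) ≤ N := Nat.cast_nonneg N
  linarith

/-- The characteristic equation of `D`, at `z`. -/
def characteristicValue (D : Matrix (Fin 2) (Fin 2) ℕ) (z : ℂ) : ℂ :=
  (z - D 0 0) * (z - D 1 1) - D 0 1 * D 1 0

theorem exists_solution_of_characteristicValue_ne_zero {D : Matrix (Fin 2) (Fin 2) ℕ} {z : ℂ}
    (h : characteristicValue D z ≠ 0) (q₀ q₁ : ℂ) :
    ∃ a₀ a₁ : ℂ, z * a₀ = D 0 0 * a₀ + D 1 0 * a₁ - q₀ ∧ z * a₁ = D 0 1 * a₀ + D 1 1 * a₁ - q₁ := by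
  refine ⟨-((z - D 1 1) * q₀ + D 1 0 * q₁) / characteristicValue D z,
    -(D 0 1 * q₀ + (z - D 0 0) * q₁) / characteristicValue D z, ?_, ?_⟩
  · field_simp
    rw [characteristicValue]; ring
  · field_simp
    rw [characteristicValue]; ring

theorem ne_natCast_of_norm_lt_one {z : ℂ} (h0 : z ≠ 0) (h1 : ‖z‖ < 1) (n : ℕ) : z ≠ n := by
  rintro rfl
  rw [Complex.norm_natCast] at h1
  have h2 : n < 1 := by exact_mod_cast h1
  obtain rfl : n = 0 := by omega
  simp at h0

/-- Two distinct roots in the open unit disc would be both roots of the quadratic, so their product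
would be det D. That is a non-zero integer and cannot have modulus < 1. -/
theorem characteristicValue_ne_zero_of_ne {D : Matrix (Fin 2) (Fin 2) ℕ}
    (hD : D 0 0 * D 1 1 ≠ D 0 1 * D 1 0) {z w : ℂ} (hz : ‖z‖ < 1) (hw : ‖w‖ < 1) (hzw : z ≠ w)
    (h : characteristicValue D z = 0) : characteristicValue D w ≠ 0 := by
  intro h'
  rw [characteristicValue] at h h'
  have h1 : z + w = D 0 0 + D 1 1 := by
    apply mul_left_cancel₀ (sub_ne_zero.2 hzw)
    linear_combination h - h'
  have h2 : z * w = (((D 0 0 : ℤ) * D 1 1 - D 0 1 * D 1 0 : ℤ) : ℂ) := by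
    push_cast
    linear_combination z * h1 - h
  have h3 : ‖z * w‖ < 1 := by
    rw [norm_mul]
    exact mul_lt_one_of_nonneg_of_lt_one_left (norm_nonneg _) hz hw.le
  rw [h2, Complex.norm_intCast] at h3
  have h4 : |((D 0 0 : ℤ) * D 1 1 - D 0 1 * D 1 0)| < 1 := by exact_mod_cast h3
  rw [Int.abs_lt_one_iff, sub_eq_zero] at h4
  exact hD (by exact_mod_cast h4)

theorem pow_ne_pow_of_norm_lt_one {z : ℂ} (h0 : z ≠ 0) (h1 : ‖z‖ < 1) {m n : ℕ} (h : m ≠ n) :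
    z ^ m ≠ z ^ n := by
  intro h2
  have h3 := congrArg norm h2
  rw [norm_pow, norm_pow] at h3
  exact h (pow_right_injective₀ (norm_pos_iff.2 h0) h1.ne h3)

/-- Solution of the linearised normalisation equation for two components, over an eigenfunction
`w`, up to a resonant term. -/
theorem IsContractingWithEigenvalues.exists_solution_of_eigenfunction
    (H : IsContractingWithEigenvalues f lam) (h0 : lam 0 ≠ 0) (h1 : lam 1 = 0) (h2 : lam 2 = 0)
    {w : (Fin 3 → ℂ) → ℂ} (hw : AnalyticAt ℂ w 0)
    (hw0 : w 0 = 0) (hwc : covector w ≠ 0) (hwf : ∀ᶠ x in 𝓝 0, w (f x) = lam 0 * w x)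
    {D : Matrix (Fin 2) (Fin 2) ℕ} (hD : D 0 0 * D 1 1 ≠ D 0 1 * D 1 0)
    {h : Fin 2 → (Fin 3 → ℂ) → ℂ} (hh : ∀ k, AnalyticAt ℂ (h k) 0) (hh0 : ∀ k, h k 0 = 0) :
    ∃ (n : ℕ) (g : ℂ), 1 ≤ n ∧ (g = 0 ∨ characteristicValue D (lam 0 ^ n) = 0) ∧
      ∃ v : Fin 2 → (Fin 3 → ℂ) → ℂ, (∀ k, AnalyticAt ℂ (v k) 0) ∧ (∀ k, v k 0 = 0) ∧
        (∀ᶠ x in 𝓝 0, v 0 (f x) = D 0 0 * v 0 x + D 1 0 * v 1 x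
          - (h 0 x - Complex.log (1 + g * w x ^ n))) ∧
        ∀ᶠ x in 𝓝 0, v 1 (f x) = D 0 1 * v 0 x + D 1 1 * v 1 x - h 1 x := by
  have hDdet : (D.map (Nat.cast : ℕ → ℤ)).det ≠ 0 := by
    rw [Matrix.det_fin_two, sub_ne_zero]
    simp only [Matrix.map_apply]
    exact_mod_cast hD
  obtain ⟨B, hDB, hBD⟩ := exists_inverse_natMatrixMap hDdet
  obtain ⟨θ, hθ0, hθ1, hc⟩ := H.exists_contractsAt
  obtain ⟨N, hN0, hNB⟩ : ∃ N : ℕ, N ≠ 0 ∧ ‖B‖ * θ ^ N < 1 := by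
    have h4 : Tendsto (fun N : ℕ => ‖B‖ * θ ^ N) atTop (𝓝 (‖B‖ * 0)) :=
      (tendsto_pow_atTop_nhds_zero_of_lt_one hθ0.le hθ1).const_mul _
    rw [mul_zero] at h4
    obtain ⟨N, h5, h6⟩ := ((h4.eventually (gt_mem_nhds one_pos)).and
      (eventually_ge_atTop 1)).exists
    exact ⟨N, by omega, h5⟩
  obtain ⟨m, hm⟩ := H.exists_polynomial_iterate h1 h2 hw hw0 hwc hwf hN0
  choose p hp0 hp using fun k => hm (h k) (hh k) (hh0 k)
  have hlt := H.norm_lt_one 0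
  have hpow : ∀ j : ℕ, 1 ≤ j → ‖lam 0 ^ j‖ < 1 := fun j hj => by
    rw [norm_pow]; exact pow_lt_one₀ (norm_nonneg _) hlt (by omega)
  -- the resonant term, and the formal solution
  obtain ⟨n, g, hn, hg, hsol⟩ : ∃ (n : ℕ) (g : ℂ), 1 ≤ n ∧
      (g = 0 ∨ characteristicValue D (lam 0 ^ n) = 0) ∧ ∀ j : ℕ, 1 ≤ j → ∃ a₀ a₁ : ℂ,
        lam 0 ^ j * a₀ = D 0 0 * a₀ + D 1 0 * a₁ - (p 0 - logPolynomial N n g).coeff j ∧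
        lam 0 ^ j * a₁ = D 0 1 * a₀ + D 1 1 * a₁ - (p 1).coeff j := by
    by_cases hres : ∃ n, 1 ≤ n ∧ characteristicValue D (lam 0 ^ n) = 0
    · obtain ⟨n, hn, hnr⟩ := hres
      have hz : lam 0 ^ n - D 1 1 ≠ 0 :=
        sub_ne_zero.2 (ne_natCast_of_norm_lt_one (pow_ne_zero n h0) (hpow n hn) _)
      -- In degree n the linear system is singular. With a₀ = 0 the second equation determines a₁,
      -- since lam 0 ^ n is not an integer. The first then dictates g, because log(1 + gw^n)
      -- contributes exactly g in degree n. All other degrees are non-resonant.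
      refine ⟨n, (p 0).coeff n + D 1 0 * ((p 1).coeff n / (lam 0 ^ n - D 1 1)), hn, Or.inr hnr,
        fun j hj => ?_⟩
      by_cases hjn : j = n
      · subst hjn
        refine ⟨0, -(p 1).coeff j / (lam 0 ^ j - D 1 1), ?_, ?_⟩
        · rw [Polynomial.coeff_sub, logPolynomial_coeff_self hN0 (by omega)]; ring
        · field_simp; ring
      · exact exists_solution_of_characteristicValue_ne_zero (characteristicValue_ne_zero_of_ne hD
          (hpow n hn) (hpow j hj) (pow_ne_pow_of_norm_lt_one h0 hlt (Ne.symm hjn)) hnr) _ _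
    · push Not at hres
      exact ⟨1, 0, le_rfl, Or.inl rfl, fun j hj =>
        exists_solution_of_characteristicValue_ne_zero (hres j hj) _ _⟩
  refine ⟨n, g, hn, hg, ?_⟩
  set q : Fin 2 → Polynomial ℂ := ![p 0 - logPolynomial N n g, p 1] with hq
  have hq0 : ∀ k, (q k).coeff 0 = 0 := by
    intro k; fin_cases k
    · simp [hq, hp0, logPolynomial_coeff_zero N (by omega : n ≠ 0)]
    · simp [hq, hp0]
  obtain ⟨α, hα0, hα⟩ : ∃ α : Fin 2 → Polynomial ℂ, (∀ k, (α k).coeff 0 = 0) ∧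
      ∀ k t, (α k).eval (lam 0 * t) = ∑ l, D l k * (α l).eval t - (q k).eval t := by
    -- Choosing the zero solution wherever the right-hand side vanishes leaves finitely many
    -- non-zero coefficients, so the formal solution is a polynomial in w.
    have hsol' : ∀ j : ℕ, ∃ a : Fin 2 → ℂ, (∀ k, lam 0 ^ j * a k =
        ∑ l, D l k * a l - (q k).coeff j) ∧ (j = 0 ∨ (∀ k, (q k).coeff j = 0) → a = 0) := by
      intro j
      by_cases hj : j = 0 ∨ ∀ k, (q k).coeff j = 0
      · refine ⟨0, fun k => ?_, fun _ => rfl⟩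
        have : (q k).coeff j = 0 := hj.elim (fun h => h ▸ hq0 k) fun h => h k
        simp [this]
      · obtain ⟨a₀, a₁, e0, e1⟩ := hsol j (Nat.one_le_iff_ne_zero.2 fun h => hj (Or.inl h))
        refine ⟨![a₀, a₁], fun k => ?_, fun h => absurd h hj⟩
        rw [Fin.sum_univ_two]
        fin_cases k
        · exact e0
        · exact e1
    choose a ha ha' using hsol'
    set M := max (q 0).natDegree (q 1).natDegree + 1 with hM
    have haM : ∀ j, M ≤ j → a j = 0 := fun j hj => ha' j (Or.inr fun k => by
      apply Polynomial.coeff_eq_zero_of_natDegree_lt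
      have h3 := le_max_left (q 0).natDegree (q 1).natDegree
      have h4 := le_max_right (q 0).natDegree (q 1).natDegree
      fin_cases k
      · exact (h3.trans_lt (Nat.lt_succ_self _)).trans_le hj
      · exact (h4.trans_lt (Nat.lt_succ_self _)).trans_le hj)
    obtain ⟨α, hα⟩ : ∃ α : Fin 2 → Polynomial ℂ, ∀ k j, (α k).coeff j = a j k := by
      refine ⟨fun k => ∑ i ∈ Finset.range M, Polynomial.monomial i (a i k), fun k j => ?_⟩
      rw [Polynomial.finsetSum_coeff]
      simp only [Polynomial.coeff_monomial]
      rw [Finset.sum_ite_eq']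
      split_ifs with h
      · rfl
      · rw [haM j (by simpa using h)]; rfl
    refine ⟨α, fun k => by rw [hα, ha' 0 (Or.inl rfl)]; rfl, fun k t => ?_⟩
    have hpol : (α k).comp (Polynomial.C (lam 0) * Polynomial.X)
        = ∑ l, Polynomial.C (D l k : ℂ) * α l - q k := by
      ext j
      rw [Polynomial.comp_C_mul_X_coeff, hα, Polynomial.coeff_sub, Polynomial.finsetSum_coeff]
      simp only [Polynomial.coeff_C_mul, hα]
      rw [mul_comm, ha]
    have := congrArg (Polynomial.eval t) hpol
    rw [Polynomial.eval_comp, Polynomial.eval_sub, Polynomial.eval_finsetSum] at this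
    simpa only [Polynomial.eval_mul, Polynomial.eval_C, Polynomial.eval_X] using this
  -- the remainder
  have hlog : AnalyticAt ℂ (fun x => Complex.log (1 + g * w x ^ n)) 0 := by
    refine AnalyticAt.clog (analyticAt_const.fun_add
      (analyticAt_const.fun_mul (hw.fun_pow n))) ?_
    rw [hw0, zero_pow (by omega), mul_zero, add_zero]
    exact Complex.one_mem_slitPlane
  have hpolyan : ∀ P : Polynomial ℂ, AnalyticAt ℂ (fun x => P.eval (w x)) 0 := fun P => by
    have := AnalyticAt.aeval_polynomial hw P
    simpa [Polynomial.aeval_def, Polynomial.eval₂_eq_eval_map] using this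
  set r : (Fin 3 → ℂ) → Fin 2 → ℂ := fun x =>
    ![-(h 0 x - Complex.log (1 + g * w x ^ n) - (q 0).eval (w x)),
      -(h 1 x - (q 1).eval (w x))] with hr
  have hran : AnalyticAt ℂ r 0 := by
    refine analyticAt_pi_iff.2 fun k => ?_
    fin_cases k
    · exact (((hh 0).fun_sub hlog).fun_sub (hpolyan _)).neg
    · exact ((hh 1).fun_sub (hpolyan _)).neg
  have heval0 : ∀ P : Polynomial ℂ, P.coeff 0 = 0 → P.eval 0 = 0 := fun P hP => by
    rw [← Polynomial.coeff_zero_eq_eval_zero, hP]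
  have hr0 : r 0 = 0 := by
    ext k; fin_cases k
    · simp [hr, hh0, hw0, heval0 _ (hq0 0), zero_pow (by omega : n ≠ 0)]
    · simp [hr, hh0, hw0, heval0 _ (hq0 1)]
  have hrO : (fun x => r (f^[m] x)) =O[𝓝 0] fun x => ‖x‖ ^ N := by
    rw [Asymptotics.isBigO_pi]
    have hlogm := (vanishesToOrder_log_sub hw hw0 N (by omega : n ≠ 0) g).comp (f := f^[m])
      (analyticAt_iterate H.analytic H.apply_zero m).differentiableAt
      (iterate_apply_zero H.apply_zero m)
    intro k; fin_cases k
    · refine VanishesToOrder.congr (((hp 0).sub hlogm).const_mul (-1))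
        (Eventually.of_forall fun x => ?_)
      simp [hr, hq]; ring
    · refine VanishesToOrder.congr ((hp 1).const_mul (-1)) (Eventually.of_forall fun x => ?_)
      simp [hr, hq]
  -- The polynomial part has been solved exactly. The remainder r is small only after m iterates,
  -- hence this version of the functional equation.
  obtain ⟨v, hv, hv0, hvf⟩ := exists_functional_solution_of_iterate H.analytic H.apply_zero hc hθ0
    hθ1.le hDB hBD hN0 hNB m hran hr0 hrO
  refine ⟨fun k x => (α k).eval (w x) + v x k, fun k => (hpolyan _).fun_add
    (analyticAt_pi_iff.1 hv k), fun k => by simp [hw0, heval0 _ (hα0 k), hv0], ?_, ?_⟩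
  · filter_upwards [hvf, hwf] with x hx hwx
    have h3 := congrFun hx 0
    have h4 := hα 0 (w x)
    rw [Pi.add_apply, natMatrixMap_apply] at h3
    simp only [Fin.sum_univ_two, hr, Matrix.cons_val_zero] at h3 h4
    rw [hwx, h3, h4]; ring
  · filter_upwards [hvf, hwf] with x hx hwx
    have h3 := congrFun hx 1
    have h4 := hα 1 (w x)
    rw [Pi.add_apply, natMatrixMap_apply] at h3
    simp only [Fin.sum_univ_two, hr, Matrix.cons_val_one, Matrix.cons_val_zero] at h3 h4
    rw [hwx, h3, h4]; ring

end ResonantNormalisation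

/-! ### Making the third component affine along the fibres. -/

section FibreForm

theorem fderiv_single_eq_zero_of_eventually {F : (Fin 3 → ℂ) → ℂ} {v : Fin 3 → ℂ}
    (hF : DifferentiableAt ℂ F v) {Q : ℂ → ℂ → ℂ} (h : ∀ᶠ y in 𝓝 v, F y = Q (y 0) (y 1)) :
    fderiv ℂ F v (Pi.single 2 1) = 0 := by
  have h1 : HasDerivAt (fun t : ℂ => v + t • (Pi.single 2 1 : Fin 3 → ℂ)) (Pi.single 2 1) 0 := by
    simpa using ((hasDerivAt_id (0 : ℂ)).smul_const (Pi.single 2 1 : Fin 3 → ℂ)).const_add v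
  have h2 : HasFDerivAt F (fderiv ℂ F v) (v + (0 : ℂ) • (Pi.single 2 1 : Fin 3 → ℂ)) := by
    simpa using hF.hasFDerivAt
  have h3 := h2.comp_hasDerivAt (0 : ℂ) h1
  refine h3.unique ((hasDerivAt_const (0 : ℂ) (Q (v 0) (v 1))).congr_of_eventuallyEq ?_)
  have h4 : Tendsto (fun t : ℂ => v + t • (Pi.single 2 1 : Fin 3 → ℂ)) (𝓝 0) (𝓝 v) := by
    simpa using h1.continuousAt.tendsto
  filter_upwards [h4.eventually h] with t ht
  simpa using ht

theorem eventually_eq_comp_hyperProj {d : ℕ} {F : (Fin d → ℂ) → ℂ} (hF : AnalyticAt ℂ F 0)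
    {l : Fin d} (h : ∀ᶠ v in 𝓝 0, fderiv ℂ F v (Pi.single l 1) = 0) :
    ∀ᶠ v in 𝓝 0, F v = F (hyperProj l v) := by
  obtain ⟨R, hR, hb⟩ := Metric.eventually_nhds_iff_ball.1 (hF.eventually_analyticAt.and h)
  filter_upwards [Metric.ball_mem_nhds (0 : Fin d → ℂ) hR] with v hv
  rw [mem_ball_zero_iff] at hv
  have hmem : ∀ t ∈ Set.Icc (0 : ℝ) 1,
      hyperProj l v + (t : ℂ) • axisProj l v ∈ Metric.ball (0 : Fin d → ℂ) R := by
    intro t ht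
    rw [mem_ball_zero_iff]
    refine ((pi_norm_le_iff_of_nonneg (norm_nonneg v)).2 fun i => ?_).trans_lt hv
    refine le_trans ?_ (norm_le_pi_norm v i)
    rw [Pi.add_apply, Pi.smul_apply, axisProj_apply]
    by_cases hi : i = l
    · subst hi
      rw [hyperProj_apply_same, zero_add, Pi.smul_apply, Pi.single_eq_same, smul_eq_mul,
        smul_eq_mul, mul_one, norm_mul, Complex.norm_real, Real.norm_eq_abs, abs_of_nonneg ht.1]
      exact mul_le_of_le_one_left (norm_nonneg _) ht.2
    · rw [hyperProj_apply_ne hi, Pi.smul_apply, Pi.single_eq_of_ne hi, smul_zero, smul_zero,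
        add_zero]
  have hder : ∀ t ∈ Set.Icc (0 : ℝ) 1,
      HasDerivAt (fun t : ℝ => F (hyperProj l v + (t : ℂ) • axisProj l v)) 0 t := by
    intro t ht
    obtain ⟨h1, h2⟩ := hb _ (hmem t ht)
    have h3 : HasDerivAt (fun t : ℝ => hyperProj l v + (t : ℂ) • axisProj l v)
        (axisProj l v) t := by
      simpa using ((hasDerivAt_id t).ofReal_comp.smul_const (axisProj l v)).const_add
        (hyperProj l v)
    have h4 := (h1.differentiableAt.hasFDerivAt.restrictScalars ℝ).comp_hasDerivAt t h3
    have h5 : fderiv ℂ F (hyperProj l v + (t : ℂ) • axisProj l v) (axisProj l v) = 0 := by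
      conv_lhs => rw [axisProj_apply (v := v), map_smul]
      rw [← axisProj_apply, h2, smul_zero]
    exact h5 ▸ h4
  have h6 := constant_of_has_deriv_right_zero
    (fun t ht => (hder t ht).continuousAt.continuousWithinAt)
    (fun t ht => (hder t (Set.Ico_subset_Icc_self ht)).hasDerivWithinAt) 1
    (Set.right_mem_Icc.2 zero_le_one)
  simpa [hyperProj_add_axisProj] using h6

theorem hyperProj_two (v : Fin 3 → ℂ) : hyperProj 2 v = ![v 0, v 1, 0] := by
  ext i; fin_cases i
  · exact hyperProj_apply_ne (by decide) v
  · exact hyperProj_apply_ne (by decide) v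
  · exact hyperProj_apply_same 2 v

theorem analyticAt_planeEmbedding : AnalyticAt ℂ (fun z : ℂ × ℂ => ![z.1, z.2, (0 : ℂ)]) 0 := by
  refine analyticAt_pi_iff.2 fun i => ?_
  fin_cases i
  · exact analyticAt_fst
  · exact analyticAt_snd
  · exact analyticAt_const

theorem prod_pow_eq_of_subset {K : Finset (Fin 3)} (hK : 2 ∉ K) (a : Fin 3 → ℕ) (v : Fin 3 → ℂ) :
    ∏ k ∈ K, v k ^ a k = v 0 ^ (if 0 ∈ K then a 0 else 0) * v 1 ^ (if 1 ∈ K then a 1 else 0) := by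
  have h1 : ∏ k ∈ K, v k ^ a k = ∏ k, v k ^ (if k ∈ K then a k else 0) := by
    rw [← Finset.prod_subset (Finset.subset_univ K)]
    · exact Finset.prod_congr rfl fun k hk => by rw [if_pos hk]
    · intro k _ hk; rw [if_neg hk, pow_zero]
  rw [h1, Fin.prod_univ_three, if_neg hK, pow_zero, mul_one]

variable {f : (Fin 3 → ℂ) → (Fin 3 → ℂ)} {lam : Fin 3 → ℂ}

/-- If the first two components of `f` in the coordinates `c` depend on the first two coordinates
only, then the third coordinate can be chosen so that the third component is affine in it. -/
theorem IsContractingWithEigenvalues.exists_affine_fibre (H : IsContractingWithEigenvalues f lam)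
    {c : (Fin 3 → ℂ) → (Fin 3 → ℂ)} (hc : IsLocalBiholomorphism c) {G₁ G₂ : ℂ × ℂ → ℂ}
    (h₁ : ∀ᶠ x in 𝓝 0, c (f x) 0 = G₁ (c x 0, c x 1))
    (h₂ : ∀ᶠ x in 𝓝 0, c (f x) 1 = G₂ (c x 0, c x 1)) {K : Finset (Fin 3)} (hK : 2 ∉ K)
    (hcrit : ∀ᶠ x in 𝓝 0, x ∈ genCritSet f → ∃ k ∈ K, c x k = 0) :
    ∃ (l m : ℕ) (ν : ℂ) (Z : (Fin 3 → ℂ) → ℂ) (ω : ℂ × ℂ → ℂ),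
      (0 ∉ K → l = 0) ∧ (1 ∉ K → m = 0) ∧ ν ≠ 0 ∧ AnalyticAt ℂ Z 0 ∧ Z 0 = 0 ∧
      LinearIndependent ℂ ![covector fun x => c x 0, covector fun x => c x 1, covector Z] ∧
      AnalyticAt ℂ ω 0 ∧ ω 0 = 0 ∧
      ∀ᶠ x in 𝓝 0, Z (f x) = ν * c x 0 ^ l * c x 1 ^ m * Z x + ω (c x 0, c x 1) := by
  obtain ⟨Ψ, hΨ, hΨr, hΨl⟩ := hc.exists_inverse
  set g : (Fin 3 → ℂ) → (Fin 3 → ℂ) := fun v => c (f (Ψ v)) with hg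
  have hft : Tendsto f (𝓝 0) (𝓝 0) := by
    simpa [H.apply_zero] using H.analytic.continuousAt.tendsto
  have hconj : ∀ᶠ x in 𝓝 0, c (f x) = g (c x) := by
    filter_upwards [hΨl] with x hx
    simp only [hg, hx]
  have hga := analyticAt_of_conj H.analytic H.apply_zero hc hconj
  have hg0 := map_zero_of_conj H.apply_zero hc hconj
  have hgt : Tendsto g (𝓝 0) (𝓝 0) := by simpa [hg0] using hga.continuousAt.tendsto
  have hg1 : ∀ᶠ v in 𝓝 0, g v 0 = G₁ (v 0, v 1) := by
    filter_upwards [hΨ.tendsto.eventually h₁, hΨr] with v h3 h4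
    rw [h4] at h3; exact h3
  have hg2 : ∀ᶠ v in 𝓝 0, g v 1 = G₂ (v 0, v 1) := by
    filter_upwards [hΨ.tendsto.eventually h₂, hΨr] with v h3 h4
    rw [h4] at h3; exact h3
  have hgi : ∀ i, AnalyticAt ℂ (fun v => g v i) 0 := analyticAt_pi_iff.1 hga
  -- The first two components do not involve the third variable, so dg maps the fibre direction to p
  -- times itself. Zeros of p are therefore critical and lie on the hyperplanes of K; p is a
  -- monomial in the first two variables times a unit.
  set p : (Fin 3 → ℂ) → ℂ := fun v => fderiv ℂ (fun v => g v 2) v (Pi.single 2 1) with hp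
  have hpa : AnalyticAt ℂ p 0 :=
    ((ContinuousLinearMap.apply ℂ ℂ (Pi.single 2 1 : Fin 3 → ℂ)).analyticAt _).fun_comp
      (hgi 2).fderiv
  have hdg : ∀ᶠ v in 𝓝 0, fderiv ℂ g v (Pi.single 2 1) = p v • (Pi.single 2 1 : Fin 3 → ℂ) := by
    filter_upwards [hga.eventually_analyticAt, hg1.eventually_nhds, hg2.eventually_nhds] with v
      h3 h4 h5
    have h6 := hasFDerivAt_pi'.1 h3.differentiableAt.hasFDerivAt
    have h7 : ∀ i, fderiv ℂ g v (Pi.single 2 1) i = fderiv ℂ (fun v => g v i) v (Pi.single 2 1) := by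
      intro i
      rw [(h6 i).fderiv]; rfl
    ext i
    rw [h7]
    fin_cases i
    · refine (fderiv_single_eq_zero_of_eventually (h6 0).differentiableAt
        (Q := fun a b => G₁ (a, b)) h4).trans ?_
      simp
    · refine (fderiv_single_eq_zero_of_eventually (h6 1).differentiableAt
        (Q := fun a b => G₂ (a, b)) h5).trans ?_
      simp
    · simp [hp]
  have hpz : ∀ᶠ v in 𝓝 0, p v = 0 → ∃ k ∈ K, v k = 0 := by
    have h3 : ∀ᶠ v in 𝓝 0, v ∈ genCritSet g → ∃ k ∈ K, v k = 0 := by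
      rw [hc.eventually_iff]
      filter_upwards [genCritSet_conj H.analytic H.apply_zero H.orbitStable hc hconj, hcrit] with
        x h4 h5 h6
      exact h5 (h4.2 h6)
    filter_upwards [h3, hdg] with v h4 h5 h6
    refine h4 ⟨0, ?_⟩
    by_contra hne
    have := (det_ne_zero_iff _).1 hne (Pi.single 2 1) (by
      rw [Function.iterate_zero, id, h5, h6, zero_smul])
    simpa using congrFun this 2
  obtain ⟨a, u, hu, hu0, hpu⟩ := exists_monomial_mul_unit hpa K hpz
  set l := if 0 ∈ K then a 0 else 0 with hl
  set m := if 1 ∈ K then a 1 else 0 with hm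
  obtain ⟨ℓ, hℓ, hℓ0, huℓ⟩ := exists_log hu hu0
  -- With W ∘ g = W - ℓ and ψ a fibre primitive of exp(W), the fibre derivative of ψ ∘ g is exp(W -
  -- ℓ)·p = u(0)·M·exp(W), which is that of u(0)Mψ. The difference F of the two thus depends only on
  -- the first two coordinates and becomes ω.
  obtain ⟨w, hw, hw0, hwf⟩ := H.exists_solution_of_one_le (μ := 1) (by simp)
    (h := fun x => -ℓ (c x))
    (AnalyticAt.fun_comp (g := ℓ) (by rwa [hc.map_zero]) hc.analytic).neg
    (by simp [hc.map_zero, hℓ0])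
  have hW : AnalyticAt ℂ (fun v => w (Ψ v)) 0 :=
    AnalyticAt.fun_comp (g := w) (by rwa [hΨ.map_zero]) hΨ.analytic
  have hWg : ∀ᶠ v in 𝓝 0, w (Ψ (g v)) = w (Ψ v) - ℓ v := by
    filter_upwards [hΨ.tendsto.eventually hwf, hΨr,
      hΨ.tendsto.eventually (hft.eventually hΨl)] with v h3 h4 h5
    rw [hg]
    simp only [h5, h3, h4]; ring
  obtain ⟨ψ, hψ, hψ0, _, hψd⟩ := exists_primitive hW.cexp 2
  set M : (Fin 3 → ℂ) → ℂ := fun v => v 0 ^ l * v 1 ^ m with hM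
  have hMa : ∀ v, AnalyticAt ℂ M v := fun v =>
    ((analyticAt_coord 0 v).fun_pow l).fun_mul ((analyticAt_coord 1 v).fun_pow m)
  have hψg : AnalyticAt ℂ (fun v => ψ (g v)) 0 :=
    AnalyticAt.fun_comp (g := ψ) (by rwa [hg0]) hga
  set F : (Fin 3 → ℂ) → ℂ := fun v => ψ (g v) - u 0 * (M v * ψ v) with hF
  have hFa : AnalyticAt ℂ F 0 := hψg.fun_sub (analyticAt_const.fun_mul ((hMa 0).fun_mul hψ))
  have hFd : ∀ᶠ v in 𝓝 0, fderiv ℂ F v (Pi.single 2 1) = 0 := by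
    filter_upwards [hψd, hgt.eventually hψd, hψ.eventually_analyticAt,
      hgt.eventually hψ.eventually_analyticAt, hga.eventually_analyticAt, hdg, hWg, hpu, huℓ] with
      v e1 e2 e3 e4 e5 e6 e7 e8 e9
    have d1 : HasFDerivAt (fun v => ψ (g v)) ((fderiv ℂ ψ (g v)).comp (fderiv ℂ g v)) v :=
      e4.differentiableAt.hasFDerivAt.comp v e5.differentiableAt.hasFDerivAt
    have d2 := ((hMa v).differentiableAt.hasFDerivAt.fun_mul
      e3.differentiableAt.hasFDerivAt).const_mul (u 0)
    have d3 := d1.fun_sub d2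
    have d4 : fderiv ℂ M v (Pi.single 2 1) = 0 :=
      fderiv_single_eq_zero_of_eventually (hMa v).differentiableAt
        (Q := fun a b => a ^ l * b ^ m) (Eventually.of_forall fun y => rfl)
    rw [hF, d3.fderiv]
    simp only [sub_apply, ContinuousLinearMap.comp_apply, Function.comp_apply, smul_apply, add_apply, smul_eq_mul, e6,
      map_smul, e2, e1, d4, mul_zero, add_zero, e7, Complex.exp_sub]
    rw [e8, prod_pow_eq_of_subset hK, ← hl, ← hm, e9]
    have := Complex.exp_ne_zero (ℓ v)
    field_simp
    simp only [hM]; ring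
  have hFh := eventually_eq_comp_hyperProj hFa hFd
  have hFω : AnalyticAt ℂ (fun z : ℂ × ℂ => F ![z.1, z.2, 0]) 0 := by
    refine AnalyticAt.fun_comp (g := F) ?_ analyticAt_planeEmbedding
    have : (![(0 : ℂ × ℂ).1, (0 : ℂ × ℂ).2, 0] : Fin 3 → ℂ) = 0 := by
      ext i; fin_cases i <;> rfl
    rwa [this]
  have hZ : AnalyticAt ℂ (fun x => ψ (c x)) 0 :=
    AnalyticAt.fun_comp (g := ψ) (by rwa [hc.map_zero]) hc.analytic
  refine ⟨l, m, u 0, fun x => ψ (c x), fun z => F ![z.1, z.2, 0], fun h => if_neg h,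
    fun h => if_neg h, hu0, hZ, by simp [hc.map_zero, hψ0], ?_, hFω, ?_, ?_⟩
  · rw [Fintype.linearIndependent_iff]
    intro s hs
    rw [Fin.sum_univ_three] at hs
    have hk := (det_ne_zero_iff _).1 hc.det_ne_zero
    have hinj : Function.Injective (fderiv ℂ c 0 : (Fin 3 → ℂ) →ₗ[ℂ] (Fin 3 → ℂ)) :=
      (injective_iff_map_eq_zero (fderiv ℂ c 0)).2 hk
    have hev : ∀ v, s 0 * fderiv ℂ c 0 v 0 + s 1 * fderiv ℂ c 0 v 1
        + s 2 * fderiv ℂ ψ 0 (fderiv ℂ c 0 v) = 0 := by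
      intro v
      have h3 := congrArg (fun L : Module.Dual ℂ (Fin 3 → ℂ) => L v) hs
      have h4 := hasFDerivAt_pi'.1 hc.analytic.differentiableAt.hasFDerivAt
      have h5 : HasFDerivAt ψ (fderiv ℂ ψ 0) (c 0) := by
        rw [hc.map_zero]; exact hψ.differentiableAt.hasFDerivAt
      have h6 := h5.comp 0 hc.analytic.differentiableAt.hasFDerivAt
      have h7 : covector (fun x => ψ (c x)) v = fderiv ℂ ψ 0 (fderiv ℂ c 0 v) := by
        rw [covector_apply]
        exact congrArg (fun L : (Fin 3 → ℂ) →L[ℂ] ℂ => L v) h6.fderiv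
      have h8 : ∀ i, covector (fun x => c x i) v = fderiv ℂ c 0 v i := by
        intro i
        rw [covector_apply, (h4 i).fderiv]; rfl
      simpa [LinearMap.add_apply, h7, h8] using h3
    have hev' : ∀ y : Fin 3 → ℂ, s 0 * y 0 + s 1 * y 1 + s 2 * fderiv ℂ ψ 0 y = 0 := by
      intro y
      obtain ⟨v, hv⟩ := LinearMap.surjective_of_injective hinj y
      have hv' : fderiv ℂ c 0 v = y := hv
      rw [← hv']; exact hev v
    have h2 : s 2 = 0 := by
      have := hev' (Pi.single 2 1)
      rw [hψd.self_of_nhds] at this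
      simpa [Complex.exp_ne_zero] using this
    intro i; fin_cases i
    · simpa [h2] using hev' (Pi.single 0 1)
    · simpa [h2] using hev' (Pi.single 1 1)
    · exact h2
  · have : (![(0 : ℂ × ℂ).1, (0 : ℂ × ℂ).2, 0] : Fin 3 → ℂ) = 0 := by
      ext i; fin_cases i <;> rfl
    simp only [this, hF, hg0, hψ0]; simp
  · filter_upwards [hc.tendsto.eventually hFh, hconj] with x h3 h4
    rw [hyperProj_two] at h3
    rw [← h3, h4, hF]
    simp only [hM]; ring

end FibreForm

/-! ### Linear parts of ω and the remaining freedom in the fibre coordinate. -/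

section LinearParts

theorem IsGermWithLinearPart.hasFDerivAt {ω : ℂ × ℂ → ℂ} {a b : ℂ}
    (h : IsGermWithLinearPart ω a b) :
    HasFDerivAt ω (a • ContinuousLinearMap.fst ℂ ℂ ℂ + b • ContinuousLinearMap.snd ℂ ℂ ℂ) 0 := by
  have h1 : fderiv ℂ ω 0 = a • ContinuousLinearMap.fst ℂ ℂ ℂ + b • ContinuousLinearMap.snd ℂ ℂ ℂ := by
    ext
    · simp [h.deriv_fst]
    · simp [h.deriv_snd]
  rw [← h1]
  exact h.analytic.differentiableAt.hasFDerivAt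

theorem isGermWithLinearPart_of_hasFDerivAt {ω : ℂ × ℂ → ℂ} {a b : ℂ} (h : AnalyticAt ℂ ω 0)
    (h0 : ω 0 = 0) (hd : HasFDerivAt ω
      (a • ContinuousLinearMap.fst ℂ ℂ ℂ + b • ContinuousLinearMap.snd ℂ ℂ ℂ) 0) :
    IsGermWithLinearPart ω a b :=
  ⟨h, h0, by rw [hd.fderiv]; simp, by rw [hd.fderiv]; simp⟩

theorem isGermWithLinearPart_self {ω : ℂ × ℂ → ℂ} (h : AnalyticAt ℂ ω 0) (h0 : ω 0 = 0) :
    IsGermWithLinearPart ω (fderiv ℂ ω 0 (1, 0)) (fderiv ℂ ω 0 (0, 1)) := ⟨h, h0, rfl, rfl⟩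

theorem IsGermWithLinearPart.add {ω ω' : ℂ × ℂ → ℂ} {a b a' b' : ℂ}
    (h : IsGermWithLinearPart ω a b) (h' : IsGermWithLinearPart ω' a' b') :
    IsGermWithLinearPart (fun z => ω z + ω' z) (a + a') (b + b') := by
  refine isGermWithLinearPart_of_hasFDerivAt (h.analytic.fun_add h'.analytic)
    (by simp [h.map_zero, h'.map_zero]) ?_
  convert! h.hasFDerivAt.add h'.hasFDerivAt using 1
  module

theorem IsGermWithLinearPart.const_mul {ω : ℂ × ℂ → ℂ} {a b : ℂ}
    (h : IsGermWithLinearPart ω a b) (t : ℂ) :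
    IsGermWithLinearPart (fun z => t * ω z) (t * a) (t * b) := by
  refine isGermWithLinearPart_of_hasFDerivAt (analyticAt_const.fun_mul h.analytic)
    (by simp [h.map_zero]) ?_
  convert! h.hasFDerivAt.const_mul t using 1
  module

theorem isGermWithLinearPart_linear (α β : ℂ) :
    IsGermWithLinearPart (fun z => α * z.1 + β * z.2) α β := by
  refine isGermWithLinearPart_of_hasFDerivAt ((analyticAt_const.fun_mul analyticAt_fst).fun_add
    (analyticAt_const.fun_mul analyticAt_snd)) (by simp) ?_
  exact (hasFDerivAt_fst.const_mul α).add (hasFDerivAt_snd.const_mul β)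

theorem IsGermWithLinearPart.mul {ω ω' : ℂ × ℂ → ℂ} {a b a' b' : ℂ}
    (h : IsGermWithLinearPart ω a b) (h' : IsGermWithLinearPart ω' a' b') :
    IsGermWithLinearPart (fun z => ω z * ω' z) 0 0 := by
  refine isGermWithLinearPart_of_hasFDerivAt (h.analytic.fun_mul h'.analytic)
    (by simp [h.map_zero]) ?_
  have hd := h.hasFDerivAt.fun_mul h'.hasFDerivAt
  rw [h.map_zero, h'.map_zero] at hd
  refine hd.congr_fderiv ?_
  ext <;> simp

theorem isGermWithLinearPart_monomial {l m : ℕ} (hlm : 2 ≤ l + m) (c : ℂ) :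
    IsGermWithLinearPart (fun z => c * z.1 ^ l * z.2 ^ m) 0 0 := by
  have hfst : IsGermWithLinearPart (fun z => z.1) 1 0 := by
    simpa using isGermWithLinearPart_linear 1 0
  have hsnd : IsGermWithLinearPart (fun z => z.2) 0 1 := by
    simpa using isGermWithLinearPart_linear 0 1
  have han : ∀ i j : ℕ, AnalyticAt ℂ (fun z : ℂ × ℂ => c * z.1 ^ i * z.2 ^ j) 0 := fun i j =>
    (analyticAt_const.fun_mul (analyticAt_fst.fun_pow i)).fun_mul (analyticAt_snd.fun_pow j)
  have hself : ∀ i j : ℕ, 1 ≤ i + j → ∃ a b,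
      IsGermWithLinearPart (fun z : ℂ × ℂ => c * z.1 ^ i * z.2 ^ j) a b := fun i j hij =>
    ⟨_, _, isGermWithLinearPart_self (han i j) (by
      rcases Nat.eq_zero_or_pos i with rfl | hi
      · simp [show j ≠ 0 by omega]
      · simp [hi.ne'])⟩
  rcases Nat.eq_zero_or_pos l with rfl | hl
  · obtain ⟨j, rfl⟩ : ∃ j, m = j + 1 := ⟨m - 1, by omega⟩
    obtain ⟨a, b, h⟩ := hself 0 j (by omega)
    have := h.mul hsnd
    simpa only [pow_succ, mul_assoc] using this
  · obtain ⟨i, rfl⟩ : ∃ i, l = i + 1 := ⟨l - 1, by omega⟩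
    obtain ⟨a, b, h⟩ := hself i m (by omega)
    have := hfst.mul h
    have e : (fun z : ℂ × ℂ => c * z.1 ^ (i + 1) * z.2 ^ m) =
        fun z => z.1 * (c * z.1 ^ i * z.2 ^ m) := by
      funext z; ring
    rw [e]; exact this

theorem covector_comp_pair {d : ℕ} {ω : ℂ × ℂ → ℂ} {a b : ℂ} (h : IsGermWithLinearPart ω a b)
    {X Y : (Fin d → ℂ) → ℂ} (hX : AnalyticAt ℂ X 0) (hX0 : X 0 = 0) (hY : AnalyticAt ℂ Y 0)
    (hY0 : Y 0 = 0) :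
    (covector fun x => ω (X x, Y x)) = a • covector X + b • covector Y := by
  have h1 := hX.differentiableAt.hasFDerivAt.prodMk hY.differentiableAt.hasFDerivAt
  have h2 : HasFDerivAt ω (a • ContinuousLinearMap.fst ℂ ℂ ℂ + b • ContinuousLinearMap.snd ℂ ℂ ℂ)
      (X 0, Y 0) := by
    rw [hX0, hY0]; exact h.hasFDerivAt
  have h3 := h2.comp 0 h1
  refine LinearMap.ext fun v => ?_
  exact congrArg (fun L : (Fin d → ℂ) →L[ℂ] ℂ => L v) h3.fderiv

theorem analyticAt_comp_pair {d : ℕ} {ω : ℂ × ℂ → ℂ} (h : AnalyticAt ℂ ω 0)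
    {X Y : (Fin d → ℂ) → ℂ} (hX : AnalyticAt ℂ X 0) (hX0 : X 0 = 0) (hY : AnalyticAt ℂ Y 0)
    (hY0 : Y 0 = 0) : AnalyticAt ℂ (fun x => ω (X x, Y x)) 0 :=
  AnalyticAt.fun_comp (g := ω) (f := fun x => (X x, Y x)) (by rw [hX0, hY0]; exact h) (hX.prod hY)

variable {f : (Fin 3 → ℂ) → (Fin 3 → ℂ)} {lam : Fin 3 → ℂ}

theorem isLocalBiholomorphism_triple {X Y Z : (Fin 3 → ℂ) → ℂ} (hX : AnalyticAt ℂ X 0)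
    (hX0 : X 0 = 0) (hY : AnalyticAt ℂ Y 0) (hY0 : Y 0 = 0) (hZ : AnalyticAt ℂ Z 0) (hZ0 : Z 0 = 0)
    (hi : LinearIndependent ℂ ![covector X, covector Y, covector Z]) :
    IsLocalBiholomorphism fun x => ![X x, Y x, Z x] := by
  refine isLocalBiholomorphism_of_linearIndependent (fun i => ?_) ?_ ?_
  · fin_cases i
    · exact hX
    · exact hY
    · exact hZ
  · ext i; fin_cases i
    · exact hX0
    · exact hY0
    · exact hZ0
  · have e : (fun i => covector fun x => ![X x, Y x, Z x] i) =
        ![covector X, covector Y, covector Z] := by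
      ext1 i; fin_cases i <;> rfl
    rw [e]; exact hi

/-- The two alternatives serve different purposes. If l = m = 0, the codifferential is block
triangular with ν on the diagonal, and the symmetric functions of the eigenvalues can be compared to
exclude this case. If l + m ≥ 1, replacing Z by tZ + αX + βY adds multiples of the linear parts of
G₁ and G₂ to that of ω, which is the freedom used to simplify it. -/
theorem IsContractingWithEigenvalues.exists_fibre_form (H : IsContractingWithEigenvalues f lam)
    {X Y T : (Fin 3 → ℂ) → ℂ} (hX : AnalyticAt ℂ X 0)
    (hX0 : X 0 = 0) (hY : AnalyticAt ℂ Y 0) (hY0 : Y 0 = 0) (hT : AnalyticAt ℂ T 0) (hT0 : T 0 = 0)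
    (hi : LinearIndependent ℂ ![covector X, covector Y, covector T]) {G₁ G₂ : ℂ × ℂ → ℂ}
    {a₁ b₁ a₂ b₂ : ℂ} (hG₁ : IsGermWithLinearPart G₁ a₁ b₁) (hG₂ : IsGermWithLinearPart G₂ a₂ b₂)
    (h₁ : ∀ᶠ x in 𝓝 0, X (f x) = G₁ (X x, Y x)) (h₂ : ∀ᶠ x in 𝓝 0, Y (f x) = G₂ (X x, Y x))
    {K : Finset (Fin 3)} (hK : 2 ∉ K)
    (hcrit : ∀ᶠ x in 𝓝 0, x ∈ genCritSet f → ∃ k ∈ K, ![X x, Y x, T x] k = 0) :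
    ∃ (l m : ℕ) (ν a b : ℂ), ν ≠ 0 ∧ (0 ∉ K → l = 0) ∧ (1 ∉ K → m = 0) ∧
      (l + m = 0 → lam 0 + lam 1 + lam 2 = a₁ + b₂ + ν ∧
        lam 0 * lam 1 + lam 0 * lam 2 + lam 1 * lam 2 = a₁ * b₂ - b₁ * a₂ + (a₁ + b₂) * ν ∧
        lam 0 * lam 1 * lam 2 = (a₁ * b₂ - b₁ * a₂) * ν) ∧
      (1 ≤ l + m → ∀ t α β : ℂ, t ≠ 0 → ∃ (Z : (Fin 3 → ℂ) → ℂ) (ω : ℂ × ℂ → ℂ),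
        IsGermWithLinearPart ω (t * a + α * a₁ + β * a₂) (t * b + α * b₁ + β * b₂) ∧
        AnalyticAt ℂ Z 0 ∧ Z 0 = 0 ∧
        LinearIndependent ℂ ![covector X, covector Y, covector Z] ∧
        ∀ᶠ x in 𝓝 0, Z (f x) = ν * X x ^ l * Y x ^ m * Z x + ω (X x, Y x)) := by
  obtain ⟨l, m, ν, Z, ω, hl, hm, hν, hZ, hZ0, hZi, hω, hω0, hZf⟩ := H.exists_affine_fibre
    (isLocalBiholomorphism_triple hX hX0 hY hY0 hT hT0 hi) (by simpa using h₁) (by simpa using h₂)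
    hK hcrit
  simp only [Matrix.cons_val_zero, Matrix.cons_val_one] at hZi hZf
  have hωl := isGermWithLinearPart_self hω hω0
  refine ⟨l, m, ν, fderiv ℂ ω 0 (1, 0), fderiv ℂ ω 0 (0, 1), hν, hl, hm, fun hlm => ?_, fun hlm t α β ht => ?_⟩
  · obtain ⟨rfl, rfl⟩ : l = 0 ∧ m = 0 := by omega
    have hM : ∀ i, codifferential f (![covector X, covector Y, covector Z] i) =
        ∑ j, !![a₁, b₁, 0; a₂, b₂, 0; fderiv ℂ ω 0 (1, 0), fderiv ℂ ω 0 (0, 1), ν] i j •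
          ![covector X, covector Y, covector Z] j := by
      intro i
      rw [Fin.sum_univ_three]
      fin_cases i
      · change codifferential f (covector X) = _
        rw [codifferential_covector H.analytic H.apply_zero hX, covector_congr h₁,
          covector_comp_pair hG₁ hX hX0 hY hY0]
        simp
      · change codifferential f (covector Y) = _
        rw [codifferential_covector H.analytic H.apply_zero hY, covector_congr h₂,
          covector_comp_pair hG₂ hX hX0 hY hY0]
        simp
      · change codifferential f (covector Z) = _
        rw [codifferential_covector H.analytic H.apply_zero hZ, covector_congr
          (w := fun x => ν * Z x + ω (X x, Y x)) (by simpa using hZf),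
          covector_add (analyticAt_const.fun_mul hZ) (analyticAt_comp_pair hω hX hX0 hY hY0),
          covector_const_mul hZ, covector_comp_pair hωl hX hX0 hY hY0]
        simp
        abel
    obtain ⟨e1, e2, e3⟩ := H.eigenvalue_identities hZi hM
    rw [Matrix.det_fin_three] at e3
    simp at e1 e2 e3
    refine ⟨e1, ?_, ?_⟩
    · rw [e2]; ring
    · rw [e3]; ring
  · have hlin : AnalyticAt ℂ (fun x => α * X x + β * Y x) 0 :=
      (analyticAt_const.fun_mul hX).fun_add (analyticAt_const.fun_mul hY)
    refine ⟨fun x => t * Z x + (α * X x + β * Y x),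
      -- The last two terms compensate the factor νX^lY^m applied to αX + βY. They have degree at
      -- least 2, so they do not affect the linear part.
      fun z => t * ω z + α * G₁ z + β * G₂ z +
        (-ν * α * z.1 ^ (l + 1) * z.2 ^ m + -ν * β * z.1 ^ l * z.2 ^ (m + 1)), ?_,
      (analyticAt_const.fun_mul hZ).fun_add hlin, by simp [hX0, hY0, hZ0], ?_, ?_⟩
    · have h3 := (((hωl.const_mul t).add (hG₁.const_mul α)).add (hG₂.const_mul β)).add
        ((isGermWithLinearPart_monomial (l := l + 1) (m := m) (by omega) (-ν * α)).add
          (isGermWithLinearPart_monomial (l := l) (m := m + 1) (by omega) (-ν * β)))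
      simpa only [add_zero] using h3
    · rw [covector_add (analyticAt_const.fun_mul hZ) hlin, covector_const_mul hZ,
        covector_add (analyticAt_const.fun_mul hX) (analyticAt_const.fun_mul hY),
        covector_const_mul hX, covector_const_mul hY]
      rw [Fintype.linearIndependent_iff] at hZi ⊢
      intro s hs
      simp only [Fin.sum_univ_three, Matrix.cons_val_zero, Matrix.cons_val_one,
        Matrix.cons_val_two, Matrix.tail_cons, Matrix.head_cons] at hs
      have h3 := hZi ![s 0 + s 2 * α, s 1 + s 2 * β, s 2 * t] (by
        simp only [Fin.sum_univ_three, Matrix.cons_val_zero, Matrix.cons_val_one,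
          Matrix.cons_val_two, Matrix.tail_cons, Matrix.head_cons]
        rw [← hs]; module)
      have h4 : s 2 = 0 := by simpa [ht] using h3 2
      intro i; fin_cases i
      · simpa [h4] using h3 0
      · simpa [h4] using h3 1
      · exact h4
    · filter_upwards [h₁, h₂, hZf] with x e1 e2 e3
      rw [e1, e2, e3]; ring

end LinearParts

/-! ### Equations of the critical components and their pull-backs. -/

section NormalCrossings

variable {f : (Fin 3 → ℂ) → (Fin 3 → ℂ)}

/-- Equations `y k` of the components of the generalized critical set of `f`, which are part of a
coordinate system, together with the exponents `A l k` of `y l` in `y k ∘ f`. -/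
structure NormalCrossingData (f : (Fin 3 → ℂ) → (Fin 3 → ℂ)) {q : ℕ}
    (y : Fin q → (Fin 3 → ℂ) → ℂ) (A : Matrix (Fin q) (Fin q) ℕ) : Prop where
  analytic : ∀ k, AnalyticAt ℂ (y k) 0
  apply_zero : ∀ k, y k 0 = 0
  indep : LinearIndependent ℂ fun k => covector (y k)
  crit : ∀ᶠ x in 𝓝 0, x ∈ genCritSet f ↔ ∃ k, y k x = 0
  pullback : ∀ k, ∃ u : (Fin 3 → ℂ) → ℂ, AnalyticAt ℂ u 0 ∧ u 0 ≠ 0 ∧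
    ∀ᶠ x in 𝓝 0, y k (f x) = (∏ l, y l x ^ A l k) * u x

theorem covector_mul_of_zero {d : ℕ} {u w : (Fin d → ℂ) → ℂ} (hu : AnalyticAt ℂ u 0)
    (hw : AnalyticAt ℂ w 0) (hw0 : w 0 = 0) : (covector fun x => w x * u x) = u 0 • covector w := by
  rw [covector_mul hw hu, hw0]; simp

theorem analyticAt_mul_exp {d : ℕ} {y v : (Fin d → ℂ) → ℂ} (hy : AnalyticAt ℂ y 0)
    (hv : AnalyticAt ℂ v 0) : AnalyticAt ℂ (fun x => y x * Complex.exp (v x)) 0 :=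
  hy.fun_mul hv.cexp'

theorem covector_mul_exp {d : ℕ} {y v : (Fin d → ℂ) → ℂ} (hy : AnalyticAt ℂ y 0) (hy0 : y 0 = 0)
    (hv : AnalyticAt ℂ v 0) (hv0 : v 0 = 0) :
    (covector fun x => y x * Complex.exp (v x)) = covector y := by
  rw [covector_mul_of_zero hv.cexp' hy hy0, hv0]; simp

theorem genCritSet_of_apply {d : ℕ} {f : (Fin d → ℂ) → (Fin d → ℂ)} {x : Fin d → ℂ}
    (h : f x ∈ genCritSet f) : x ∈ genCritSet f := by
  obtain ⟨n, hn⟩ := h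
  exact ⟨n + 1, by rwa [Function.iterate_succ_apply]⟩

theorem tendsto_of_analyticAt {d : ℕ} {f : (Fin d → ℂ) → (Fin d → ℂ)} (hf : AnalyticAt ℂ f 0)
    (h0 : f 0 = 0) : Tendsto f (𝓝 0) (𝓝 0) := by
  simpa [ContinuousAt, h0] using hf.continuousAt

/-- If a higher power of φ l divided g, cancelling φ l ^ a l would leave an identity that fails on
the hyperplane φ l = 0: one side vanishes there, while the other is a unit times powers of the other
coordinates, non-zero at points where these are equal and non-zero. -/
theorem multAlong_eq {d : ℕ} {φ : (Fin d → ℂ) → (Fin d → ℂ)} (hφ : IsLocalBiholomorphism φ)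
    {K : Finset (Fin d)} {g u : (Fin d → ℂ) → ℂ} {a : Fin d → ℕ} (hu : AnalyticAt ℂ u 0)
    (hu0 : u 0 ≠ 0) (hg : ∀ᶠ x in 𝓝 0, g x = (∏ k ∈ K, φ x k ^ a k) * u x) {l : Fin d}
    (hl : l ∈ K) : multAlong g (fun x => φ x l) = a l := by
  classical
  have hφa : ∀ i, AnalyticAt ℂ (fun x => φ x i) 0 := fun i => analyticAt_pi_iff.1 hφ.analytic i
  have hsplit : ∀ x, ∏ k ∈ K, φ x k ^ a k = φ x l ^ a l * ∏ k ∈ K.erase l, φ x k ^ a k :=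
    fun x => (Finset.mul_prod_erase K (fun k => φ x k ^ a k) hl).symm
  have hR : AnalyticAt ℂ (fun x => (∏ k ∈ K.erase l, φ x k ^ a k) * u x) 0 :=
    (Finset.analyticAt_fun_prod _ fun k _ => (hφa k).fun_pow _).fun_mul hu
  refine IsGreatest.csSup_eq ⟨⟨_, hR, ?_⟩, ?_⟩
  · filter_upwards [hg] with x hx
    rw [hx, hsplit, mul_assoc]
  · rintro n ⟨h, hh, he⟩
    by_contra! hn
    obtain ⟨ψ, hψ, hφψ, -⟩ := hφ.exists_inverse
    have hne : ¬ ∀ᶠ x in 𝓝 0, φ x l ^ a l = 0 := by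
      intro h0
      have h1 : ∀ᶠ t : ℂ in 𝓝 0, t ^ a l = 0 := by
        have hd : Tendsto (fun t : ℂ => ψ (diagLine d t)) (𝓝 0) (𝓝 0) :=
          hψ.tendsto.comp (by simpa [diagLine_zero] using (continuous_diagLine (d := d)).tendsto 0)
        have hd' : Tendsto (diagLine d) (𝓝 0) (𝓝 0) := by
          simpa [diagLine_zero] using (continuous_diagLine (d := d)).tendsto 0
        filter_upwards [hd.eventually h0, hd'.eventually hφψ] with t h2 h3
        rw [h3] at h2
        exact h2
      obtain ⟨t, ht, ht0⟩ := ((h1.filter_mono nhdsWithin_le_nhds).and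
        (self_mem_nhdsWithin : {(0 : ℂ)}ᶜ ∈ 𝓝[≠] 0)).exists
      exact ht0 (eq_zero_of_pow_eq_zero ht)
    have hc := eventually_eq_of_mul_eq (a := fun x => φ x l ^ a l)
      (b := fun x => φ x l ^ (n - a l) * h x)
      (c := fun x => (∏ k ∈ K.erase l, φ x k ^ a k) * u x) ((hφa l).fun_pow _)
      (((hφa l).fun_pow _).fun_mul hh) hR hne (by
        filter_upwards [hg, he] with x h1 h2
        rw [← mul_assoc, ← mul_assoc, ← pow_add, Nat.add_sub_cancel' hn.le, ← hsplit, ← h1, h2])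
    have hcont : Continuous fun t : ℂ => Function.update (diagLine d t) l 0 :=
      continuous_diagLine.update l continuous_const
    have hd' : Tendsto (fun t : ℂ => Function.update (diagLine d t) l 0) (𝓝 0) (𝓝 0) := by
      have := hcont.tendsto 0
      rwa [diagLine_zero, show Function.update (0 : Fin d → ℂ) l 0 = 0 from
        Function.update_eq_self l 0] at this
    have hd : Tendsto (fun t : ℂ => ψ (Function.update (diagLine d t) l 0)) (𝓝 0) (𝓝 0) :=
      hψ.tendsto.comp hd'
    obtain ⟨t, ⟨⟨h1, h2⟩, h3⟩, ht0⟩ := ((((hd.eventually hc).and (hd'.eventually hφψ)).and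
      (hd.eventually (hu.continuousAt.eventually_ne hu0))).filter_mono nhdsWithin_le_nhds |>.and
      (self_mem_nhdsWithin : {(0 : ℂ)}ᶜ ∈ 𝓝[≠] 0)).exists
    rw [h2, Function.update_self, zero_pow (by omega), zero_mul, eq_comm, mul_eq_zero,
      Finset.prod_eq_zero_iff] at h1
    rcases h1 with ⟨k, hk, hk0⟩ | h1
    · rw [Function.update_of_ne (Finset.ne_of_mem_erase hk)] at hk0
      exact ht0 (eq_zero_of_pow_eq_zero hk0)
    · exact h3 h1

/-- A zero of φ k ∘ f is mapped into the generalized critical set, hence lies in it by backward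
invariance. So φ k ∘ f vanishes only on the hyperplanes of K and is a monomial times a unit; its
exponents are the multiplicities that define the internal action. -/
theorem IsRigidWith.exists_pullback {d : ℕ} {f φ : (Fin d → ℂ) → (Fin d → ℂ)} {K : Finset (Fin d)}
    (h : IsRigidWith f φ K) (hf : AnalyticAt ℂ f 0) (h0 : f 0 = 0) (k : K) :
    ∃ u : (Fin d → ℂ) → ℂ, AnalyticAt ℂ u 0 ∧ u 0 ≠ 0 ∧
      ∀ᶠ x in 𝓝 0, φ (f x) k = (∏ l : K, φ x l ^ internalAction f φ K l k) * u x := by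
  obtain ⟨ψ, hψ, hφψ, hψφ⟩ := h.coord.exists_inverse
  have hfψ : AnalyticAt ℂ (fun v => f (ψ v)) 0 :=
    AnalyticAt.fun_comp (g := f) (f := ψ) (by rwa [hψ.map_zero]) hψ.analytic
  have hft := tendsto_of_analyticAt hf h0
  have hg : AnalyticAt ℂ (fun v => φ (f (ψ v)) k) 0 := by
    refine AnalyticAt.fun_comp (g := fun x => φ x k) (f := fun v => f (ψ v)) ?_ hfψ
    rw [hψ.map_zero, h0]
    exact analyticAt_pi_iff.1 h.coord.analytic k
  obtain ⟨a, u, hu, hu0, he⟩ := exists_monomial_mul_unit hg K (by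
    filter_upwards [hψ.tendsto.eventually h.genCrit, hψ.tendsto.eventually (hft.eventually h.genCrit),
      hφψ] with v h1 h2 h3 h4
    have := h1.1 (genCritSet_of_apply (h2.2 ⟨k, k.2, h4⟩))
    rwa [h3] at this)
  have hu' : AnalyticAt ℂ (fun x => u (φ x)) 0 :=
    AnalyticAt.fun_comp (g := u) (f := φ) (by rwa [h.coord.map_zero]) h.coord.analytic
  have hu0' : u (φ 0) ≠ 0 := by rwa [h.coord.map_zero]
  have he' : ∀ᶠ x in 𝓝 0, φ (f x) k = (∏ k ∈ K, φ x k ^ a k) * u (φ x) := by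
    filter_upwards [h.coord.tendsto.eventually he, hψφ] with x h1 h2
    rwa [h2] at h1
  refine ⟨_, hu', hu0', ?_⟩
  filter_upwards [he'] with x hx
  rw [hx, ← Finset.prod_coe_sort K fun l => φ x l ^ a l]
  congr 1
  refine Finset.prod_congr rfl fun l _ => ?_
  rw [show internalAction f φ K l k = a l from
    multAlong_eq h.coord (g := fun x => φ (f x) k) hu' hu0' he' l.2]

theorem IsRigidWith.normalCrossingData {f φ : (Fin 3 → ℂ) → (Fin 3 → ℂ)} {K : Finset (Fin 3)}
    (h : IsRigidWith f φ K) (hf : AnalyticAt ℂ f 0) (h0 : f 0 = 0) {q : ℕ} (e : Fin q ≃ K) :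
    NormalCrossingData f (fun k x => φ x (e k)) ((internalAction f φ K).submatrix e e) where
  analytic k := analyticAt_pi_iff.1 h.coord.analytic _
  apply_zero k := by simp [h.coord.map_zero]
  indep := h.coord.linearIndependent.comp (fun k => (e k : Fin 3))
    (Subtype.val_injective.comp e.injective)
  crit := by
    filter_upwards [h.genCrit] with x hx
    rw [hx]
    constructor
    · rintro ⟨k, hk, hk0⟩
      exact ⟨e.symm ⟨k, hk⟩, by simpa using hk0⟩
    · rintro ⟨k, hk⟩
      exact ⟨e k, (e k).2, hk⟩
  pullback k := by
    obtain ⟨u, hu, hu0, he⟩ := h.exists_pullback hf h0 (e k)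
    refine ⟨u, hu, hu0, ?_⟩
    filter_upwards [he] with x hx
    rw [hx, ← e.prod_comp]
    rfl

variable {q : ℕ} {y : Fin q → (Fin 3 → ℂ) → ℂ} {A : Matrix (Fin q) (Fin q) ℕ}

theorem NormalCrossingData.codifferential_eq_smul (R : NormalCrossingData f y A)
    (hf : AnalyticAt ℂ f 0) (h0 : f 0 = 0) {k l : Fin q} (h : ∀ i, A i k = if i = l then 1 else 0) :
    ∃ c : ℂ, c ≠ 0 ∧ codifferential f (covector (y k)) = c • covector (y l) := by
  obtain ⟨u, hu, hu0, he⟩ := R.pullback k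
  refine ⟨u 0, hu0, ?_⟩
  rw [codifferential_covector hf h0 (R.analytic k), covector_congr he,
    ← covector_mul_of_zero hu (R.analytic l) (R.apply_zero l)]
  congr 1
  funext x
  simp [h]

/-- The pull-back is a product of at least two functions vanishing at 0, so it has no linear part.
-/
theorem NormalCrossingData.codifferential_eq_zero (R : NormalCrossingData f y A)
    (hf : AnalyticAt ℂ f 0) (h0 : f 0 = 0) {k : Fin q} (h : 2 ≤ ∑ i, A i k) :
    codifferential f (covector (y k)) = 0 := by
  obtain ⟨u, hu, hu0, he⟩ := R.pullback k
  rw [codifferential_covector hf h0 (R.analytic k), covector_congr he]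
  refine VanishesToOrder.covector_eq_zero ?_
  have h1 : ∀ s : Finset (Fin q), VanishesToOrder (∑ i ∈ s, A i k) fun x => ∏ i ∈ s, y i x ^ A i k := by
    intro s
    induction s using Finset.cons_induction with
    | empty => simpa using! vanishesToOrder_of_continuousAt (continuousAt_const (y := (1 : ℂ)))
    | cons i s hi ih =>
      simp only [Finset.sum_cons, Finset.prod_cons]
      refine VanishesToOrder.mul ?_ ih
      simpa using (vanishesToOrder_one (R.analytic i).differentiableAt (R.apply_zero i)).pow (A i k)
  exact ((h1 Finset.univ).mul (vanishesToOrder_of_continuousAt hu.continuousAt)).mono (by simpa using h)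

/-- The origin lies on every component, so some point of its orbit is critical. It is fixed, so df₀
is singular, and the eigenvalue of smallest modulus vanishes. -/
theorem NormalCrossingData.lam_two_eq_zero {lam : Fin 3 → ℂ} (R : NormalCrossingData f y A)
    (H : IsContractingWithEigenvalues f lam) (hord : ∀ i j, i ≤ j → ‖lam j‖ ≤ ‖lam i‖)
    (k : Fin q) : lam 2 = 0 := by
  obtain ⟨n, hn⟩ := R.crit.self_of_nhds.2 ⟨k, R.apply_zero k⟩
  rw [iterate_apply_zero H.apply_zero] at hn
  have h1 := H.det_sub 0
  rw [det_codifferential] at h1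
  simp only [map_zero, zero_sub, Fin.prod_univ_three] at h1
  have h2 : LinearMap.det (-(fderiv ℂ f 0 : (Fin 3 → ℂ) →ₗ[ℂ] (Fin 3 → ℂ))) = 0 := by
    rw [← neg_one_smul ℂ, LinearMap.det_smul]
    rw [show LinearMap.det (fderiv ℂ f 0 : (Fin 3 → ℂ) →ₗ[ℂ] (Fin 3 → ℂ)) = 0 from hn, mul_zero]
  rw [h2] at h1
  have h3 : lam 0 * lam 1 * lam 2 = 0 := by linear_combination h1
  rcases mul_eq_zero.1 h3 with h4 | h4
  · rcases mul_eq_zero.1 h4 with h5 | h5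
    · simpa [h5] using hord 0 2 (by decide)
    · simpa [h5] using hord 1 2 (by decide)
  · exact h4

theorem IsContractingWithEigenvalues.eq_or_eq_of_covector {lam : Fin 3 → ℂ}
    (H : IsContractingWithEigenvalues f lam) {b : Module.Dual ℂ (Fin 3 → ℂ)} (hb : b ≠ 0) {c : ℂ}
    (h : codifferential f b = c • b) : c = lam 0 ∨ c = lam 1 ∨ c = lam 2 := by
  have h1 := H.det_sub c
  have h2 : LinearMap.det (algebraMap ℂ (Module.End ℂ (Module.Dual ℂ (Fin 3 → ℂ))) c -
      codifferential f) = 0 := by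
    by_contra h3
    refine hb (((LinearMap.equivOfDetNeZero _ h3)).injective ?_)
    rw [map_zero]
    change (algebraMap ℂ (Module.End ℂ (Module.Dual ℂ (Fin 3 → ℂ))) c - codifferential f) b = 0
    rw [LinearMap.sub_apply, Module.algebraMap_end_apply, h, sub_self]
  rw [h2, eq_comm, Fin.prod_univ_three, mul_eq_zero, mul_eq_zero, sub_eq_zero, sub_eq_zero,
    sub_eq_zero, or_assoc] at h1
  exact h1

theorem exists_coefficients {b : Fin 3 → Module.Dual ℂ (Fin 3 → ℂ)} (hb : LinearIndependent ℂ b)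
    (v : Module.Dual ℂ (Fin 3 → ℂ)) : ∃ c : Fin 3 → ℂ, v = ∑ j, c j • b j := by
  have hcard : Fintype.card (Fin 3) = Module.finrank ℂ (Module.Dual ℂ (Fin 3 → ℂ)) := by
    rw [Subspace.dual_finrank_eq]; simp
  refine ⟨(basisOfLinearIndependentOfCardEqFinrank hb hcard).repr v, ?_⟩
  conv_lhs => rw [← (basisOfLinearIndependentOfCardEqFinrank hb hcard).sum_repr v]
  simp only [coe_basisOfLinearIndependentOfCardEqFinrank]

theorem exists_completion_two {X Y : (Fin 3 → ℂ) → ℂ}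
    (h : LinearIndependent ℂ ![covector X, covector Y]) : ∃ T : (Fin 3 → ℂ) → ℂ,
      AnalyticAt ℂ T 0 ∧ T 0 = 0 ∧ LinearIndependent ℂ ![covector X, covector Y, covector T] := by
  obtain ⟨x, hx⟩ := exists_linearIndependent_snoc_of_lt_finrank h (by
    rw [Subspace.dual_finrank_eq]; simp)
  have hT : covector (fun v => x v) = x := by
    refine LinearMap.ext fun v => ?_
    rw [covector_apply]
    exact congrArg (fun L : (Fin 3 → ℂ) →L[ℂ] ℂ => L v) (LinearMap.toContinuousLinearMap x).fderiv
  refine ⟨fun v => x v, (LinearMap.toContinuousLinearMap x).analyticAt 0, map_zero x, ?_⟩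
  have e : ![covector X, covector Y, x] = Fin.snoc ![covector X, covector Y] x := by
    ext1 i; fin_cases i <;> rfl
  rw [hT, e]
  exact hx

theorem exists_completion_one {X : (Fin 3 → ℂ) → ℂ} (h : covector X ≠ 0) :
    ∃ Y T : (Fin 3 → ℂ) → ℂ, AnalyticAt ℂ Y 0 ∧ Y 0 = 0 ∧ AnalyticAt ℂ T 0 ∧ T 0 = 0 ∧
      LinearIndependent ℂ ![covector X, covector Y, covector T] := by
  obtain ⟨x, hx⟩ := exists_linearIndependent_snoc_of_lt_finrank (R := ℂ) (v := ![covector X])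
    (by simpa [linearIndependent_unique_iff] using h) (by rw [Subspace.dual_finrank_eq]; simp)
  have hT : covector (fun v => x v) = x := by
    refine LinearMap.ext fun v => ?_
    rw [covector_apply]
    exact congrArg (fun L : (Fin 3 → ℂ) →L[ℂ] ℂ => L v) (LinearMap.toContinuousLinearMap x).fderiv
  obtain ⟨T, hTa, hT0, hi⟩ := exists_completion_two (X := X) (Y := fun v => x v) (by
    have e : ![covector X, x] = Fin.snoc ![covector X] x := by
      ext1 i; fin_cases i <;> rfl
    rw [hT, e]
    exact hx)
  exact ⟨_, T, (LinearMap.toContinuousLinearMap x).analyticAt 0, map_zero x, hTa, hT0, hi⟩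

theorem hasNormalForm_of_triple {lam : Fin 3 → ℂ} (H : IsContractingWithEigenvalues f lam)
    {X Y Z : (Fin 3 → ℂ) → ℂ} (hX : AnalyticAt ℂ X 0)
    (hX0 : X 0 = 0) (hY : AnalyticAt ℂ Y 0) (hY0 : Y 0 = 0) (hZ : AnalyticAt ℂ Z 0) (hZ0 : Z 0 = 0)
    (hi : LinearIndependent ℂ ![covector X, covector Y, covector Z])
    {g : (Fin 3 → ℂ) → (Fin 3 → ℂ)}
    (hg : ∀ᶠ x in 𝓝 0, g ![X x, Y x, Z x] = ![X (f x), Y (f x), Z (f x)]) {K : Finset (Fin 3)}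
    (hK : ∀ᶠ x in 𝓝 0, x ∈ genCritSet f ↔ ∃ k ∈ K, ![X x, Y x, Z x] k = 0) :
    HasNormalForm f g K :=
  hasNormalForm_of_conj H.analytic H.apply_zero H.orbitStable
    (isLocalBiholomorphism_triple hX hX0 hY hY0 hZ hZ0 hi) (hg.mono fun _ h => h.symm) hK

end NormalCrossings

/-! ### Combinatorics of the columns of the internal action. -/

section PeriodicColumns

variable {ι : Type*} [Fintype ι] [DecidableEq ι] {A : Matrix ι ι ℕ} {k l m : ι}

/-- The `k`-th column of `A` is the `l`-th basis vector. -/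
def IsUnitColumn (A : Matrix ι ι ℕ) (k l : ι) : Prop :=
  A.mulVec (Pi.single k 1) = Pi.single l 1

theorem isUnitColumn_iff : IsUnitColumn A k l ↔ ∀ i, A i k = if i = l then 1 else 0 := by
  rw [IsUnitColumn, Matrix.mulVec_single_one, funext_iff]
  simp only [Matrix.col_apply, Pi.single_apply]

theorem IsUnitColumn.comp {B : Matrix ι ι ℕ} (h : IsUnitColumn A k l) (h' : IsUnitColumn B l m) :
    IsUnitColumn (B * A) k m := by
  rw [IsUnitColumn] at *
  rw [← Matrix.mulVec_mulVec, h, h']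

theorem IsUnitColumn.unique (h : IsUnitColumn A k l) (h' : IsUnitColumn A k m) : l = m := by
  have h1 : (Pi.single l 1 : ι → ℕ) = Pi.single m 1 := h.symm.trans h'
  by_contra hne
  simpa [hne] using congrFun h1 l

theorem IsUnitColumn.injective (hA : Function.Injective A.mulVec) (h : IsUnitColumn A k m)
    (h' : IsUnitColumn A l m) : k = l := by
  have h1 : (Pi.single k 1 : ι → ℕ) = Pi.single l 1 := hA (h.trans h'.symm)
  by_contra hne
  simpa [hne] using congrFun h1 k

theorem injective_mulVec_of_injective_map {ι : Type*} [Fintype ι] {A : Matrix ι ι ℕ}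
    (hA : Function.Injective (A.map (Nat.cast : ℕ → ℤ)).mulVec) : Function.Injective A.mulVec := by
  intro v w h
  have h1 : ∀ v : ι → ℕ, (A.map (Nat.cast : ℕ → ℤ)).mulVec (fun i => (v i : ℤ)) =
      fun i => ((A.mulVec v i : ℕ) : ℤ) := by
    intro v
    ext i
    simp [Matrix.mulVec, dotProduct]
  have h2 : (fun i => (v i : ℤ)) = fun i => (w i : ℤ) := hA (by rw [h1, h1, h])
  exact funext fun i => Nat.cast_injective (congrFun h2 i)

/-- `k` is a periodic index of `A`. -/
def IsPeriodicIndex (A : Matrix ι ι ℕ) (k : ι) : Prop := ∃ n, 1 ≤ n ∧ IsUnitColumn (A ^ n) k k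

theorem one_le_sum_column (hA : Function.Injective A.mulVec) (k : ι) : 1 ≤ ∑ i, A i k := by
  by_contra! h
  have h1 : ∀ i, A i k = 0 := by simpa using h
  have h2 : A.mulVec (Pi.single k 1) = A.mulVec 0 := by
    rw [Matrix.mulVec_single_one, Matrix.mulVec_zero]
    exact funext h1
  simpa using congrFun (hA h2) k

theorem isUnitColumn_of_sum_eq_one (h : ∑ i, A i k = 1) : ∃ l, IsUnitColumn A k l := by
  obtain ⟨l, hl, h1⟩ : ∃ l, A l k = 1 ∧ ∀ j, j ≠ l → A j k = 0 := by
    obtain ⟨l, -, hl⟩ : ∃ l ∈ Finset.univ, A l k ≠ 0 :=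
      Finset.exists_ne_zero_of_sum_ne_zero (by rw [h]; exact one_ne_zero)
    have h2 := Finset.add_sum_erase Finset.univ (fun i => A i k) (Finset.mem_univ l)
    rw [h] at h2
    have h3 : ∑ i ∈ Finset.univ.erase l, A i k = 0 := by
      have : 1 ≤ A l k := Nat.one_le_iff_ne_zero.2 hl
      change A l k + ∑ i ∈ Finset.univ.erase l, A i k = 1 at h2
      omega
    refine ⟨l, by change A l k + ∑ i ∈ Finset.univ.erase l, A i k = 1 at h2; omega, fun j hj => ?_⟩
    exact Finset.sum_eq_zero_iff.1 h3 j (by simp [hj])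
  refine ⟨l, isUnitColumn_iff.2 fun i => ?_⟩
  split_ifs with hi
  · rw [hi, hl]
  · exact h1 i hi

theorem injective_pow_mulVec (hA : Function.Injective A.mulVec) (n : ℕ) :
    Function.Injective (A ^ n).mulVec := by
  induction n with
  | zero => intro v w h; simpa using h
  | succ n ih =>
    intro v w h
    rw [pow_succ, ← Matrix.mulVec_mulVec, ← Matrix.mulVec_mulVec] at h
    exact hA (ih h)

/-- Powers of A are injective, so all their column sums are at least 1, and applying them does not
decrease the sum of a column. As A^(n+1) fixes the k-th basis vector, the k-th column of A has sum
1. Periodicity of l follows because A commutes with its powers. -/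
theorem IsPeriodicIndex.exists_isUnitColumn (hA : Function.Injective A.mulVec)
    (h : IsPeriodicIndex A k) : ∃ l, IsUnitColumn A k l ∧ IsPeriodicIndex A l := by
  obtain ⟨n, hn, h1⟩ := h
  obtain ⟨n, rfl⟩ : ∃ j, n = j + 1 := ⟨n - 1, by omega⟩
  have h2 : ∑ i, A i k ≤ ∑ i, (A ^ (n + 1)) i k := by
    rw [pow_succ]
    simp only [Matrix.mul_apply]
    rw [Finset.sum_comm]
    refine Finset.sum_le_sum fun j _ => ?_
    rw [← Finset.sum_mul]
    exact Nat.le_mul_of_pos_left _ (one_le_sum_column (injective_pow_mulVec hA n) j)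
  have h3 : ∑ i, (A ^ (n + 1)) i k = 1 := by
    rw [Finset.sum_congr rfl fun i _ => isUnitColumn_iff.1 h1 i]
    simp
  obtain ⟨l, hl⟩ := isUnitColumn_of_sum_eq_one
    (le_antisymm (h2.trans h3.le) (one_le_sum_column hA k))
  refine ⟨l, hl, n + 1, hn, ?_⟩
  have h4 : A.mulVec ((A ^ (n + 1)).mulVec (Pi.single k 1)) = Pi.single l 1 := by rw [h1, hl]
  rw [h1] at h4
  rw [IsUnitColumn]
  nth_rewrite 1 [← h4]
  rw [Matrix.mulVec_mulVec, ← pow_succ, pow_succ', ← Matrix.mulVec_mulVec, h1, h4]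

theorem IsUnitColumn.isPeriodicIndex (hA : Function.Injective A.mulVec) (h : IsUnitColumn A k l)
    (hl : IsPeriodicIndex A l) : IsPeriodicIndex A k := by
  obtain ⟨n, hn, h1⟩ := hl
  refine ⟨n, hn, hA ?_⟩
  rw [h, Matrix.mulVec_mulVec, ← pow_succ', pow_succ, ← Matrix.mulVec_mulVec, h, h1]

theorem IsUnitColumn.isPeriodicIndex_of_self (h : IsUnitColumn A k k) : IsPeriodicIndex A k :=
  ⟨1, le_rfl, by rwa [pow_one]⟩

theorem IsUnitColumn.isPeriodicIndex_of_two (h : IsUnitColumn A k l) (h' : IsUnitColumn A l k) :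
    IsPeriodicIndex A k :=
  ⟨2, by norm_num, by rw [pow_two]; exact h.comp h'⟩

theorem IsUnitColumn.isPeriodicIndex_of_three (h : IsUnitColumn A k l) (h' : IsUnitColumn A l m)
    (h'' : IsUnitColumn A m k) : IsPeriodicIndex A k :=
  ⟨3, by norm_num, by rw [pow_succ', pow_two]; exact (h.comp h').comp h''⟩

/-- Everything about A that decides the case distinction is encoded in finite data: a partial
injective map T, where `none` stands for a column of sum at least 2, and the predicate P of
periodicity. The existence of a good ordering can then be decided by enumeration. -/
theorem exists_column_map (hA : Function.Injective A.mulVec) {q : ℕ} (e : Fin q ≃ ι) :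
    ∃ (T : Fin q → Option (Fin q)) (P : Fin q → Bool),
      (∀ i, P i = true ↔ IsPeriodicIndex A (e i)) ∧
      (∀ i j, T i = some j → IsUnitColumn A (e i) (e j)) ∧
      (∀ i, T i = none → 2 ≤ ∑ j, A j (e i)) ∧
      (∀ i j l, T i = some l → T j = some l → i = j) ∧
      (∀ i, P i = true → ∃ j, T i = some j ∧ P j = true) ∧
      (∀ i j, T i = some j → P j = true → P i = true) ∧
      (∀ i, T i = some i → P i = true) ∧
      (∀ i j, T i = some j → T j = some i → P i = true) ∧
      (∀ i j l, T i = some j → T j = some l → T l = some i → P i = true) := by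
  classical
  have hT : ∀ i : Fin q, ∃ o : Option (Fin q), (∀ j, o = some j ↔ IsUnitColumn A (e i) (e j)) ∧
      (o = none → 2 ≤ ∑ j, A j (e i)) := by
    intro i
    by_cases h : ∃ l, IsUnitColumn A (e i) l
    · obtain ⟨l, hl⟩ := h
      refine ⟨some (e.symm l), fun j => ⟨?_, fun h => ?_⟩, fun h => by simp at h⟩
      · rintro ⟨⟩; simpa using hl
      · rw [hl.unique h]; simp
    · refine ⟨none, fun j => ⟨fun h => by simp at h, fun hj => absurd ⟨_, hj⟩ h⟩, fun _ => ?_⟩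
      have h1 := one_le_sum_column hA (e i)
      by_contra! h2
      exact h (isUnitColumn_of_sum_eq_one (by omega))
  choose T hT1 hT2 using hT
  refine ⟨T, fun i => decide (IsPeriodicIndex A (e i)), ?_⟩
  simp only [decide_eq_true_eq, hT1]
  refine ⟨fun _ => trivial, fun _ _ h => h, hT2, ?_, ?_, ?_, ?_, ?_, ?_⟩
  · exact fun i j l h h' => e.injective (h.injective hA h')
  · intro i h
    obtain ⟨l, hl, hp⟩ := h.exists_isUnitColumn hA
    exact ⟨e.symm l, by simpa using hl, by simpa using hp⟩
  · exact fun i j h hj => h.isPeriodicIndex hA hj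
  · exact fun i h => h.isPeriodicIndex_of_self
  · exact fun i j h h' => h.isPeriodicIndex_of_two h'
  · exact fun i j l h h' h'' => h.isPeriodicIndex_of_three h' h''

set_option synthInstance.maxSize 100000 in
set_option synthInstance.maxHeartbeats 200000 in
set_option maxRecDepth 100000 in
-- A non-periodic chain of basis columns cannot close up, so it ends in a column of sum at least 2;
-- ordering the non-periodic indices along such chains makes the linear part triangular.
theorem column_map_two : ∀ (T : Fin 2 → Option (Fin 2)) (P : Fin 2 → Bool),
      (∀ i j l, T i = some l → T j = some l → i = j) →
      (∀ i, P i = true → ∃ j, T i = some j ∧ P j = true) →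
      (∀ i j, T i = some j → P j = true → P i = true) →
      (∀ i, T i = some i → P i = true) →
      (∀ i j, T i = some j → T j = some i → P i = true) →
      ∃ s : Fin 2 → Fin 2, s 0 ≠ s 1 ∧
      ((P (s 0) = false ∧ P (s 1) = false ∧ T (s 1) = none ∧
          (T (s 0) = none ∨ T (s 0) = some (s 1))) ∨
        (P (s 0) = true ∧ P (s 1) = false ∧ T (s 0) = some (s 0) ∧ T (s 1) = none) ∨
        (P (s 0) = true ∧ P (s 1) = true ∧
          (T (s 0) = some (s 0) ∧ T (s 1) = some (s 1) ∨
            T (s 0) = some (s 1) ∧ T (s 1) = some (s 0)))) := by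
  decide

set_option synthInstance.maxSize 100000 in
set_option synthInstance.maxHeartbeats 200000 in
set_option maxRecDepth 100000 in
-- The same ordering for three indices. The last alternative, that all are periodic, is consistent
-- combinatorially and is excluded later because df₀ is singular.
theorem column_map_three : ∀ (T : Fin 3 → Option (Fin 3)) (P : Fin 3 → Bool),
      (∀ i j l, T i = some l → T j = some l → i = j) →
      (∀ i, P i = true → ∃ j, T i = some j ∧ P j = true) →
      (∀ i j, T i = some j → P j = true → P i = true) →
      (∀ i, T i = some i → P i = true) →
      (∀ i j, T i = some j → T j = some i → P i = true) →
      (∀ i j l, T i = some j → T j = some l → T l = some i → P i = true) →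
      ∃ s : Fin 3 → Fin 3, (s 0 ≠ s 1 ∧ s 0 ≠ s 2 ∧ s 1 ≠ s 2) ∧
      ((P (s 0) = false ∧ P (s 1) = false ∧ P (s 2) = false ∧ T (s 2) = none ∧
          (T (s 1) = none ∨ T (s 1) = some (s 2)) ∧
          (T (s 0) = none ∨ T (s 0) = some (s 1) ∨ T (s 0) = some (s 2))) ∨
        (P (s 0) = true ∧ P (s 1) = false ∧ P (s 2) = false ∧ T (s 0) = some (s 0) ∧
          T (s 2) = none ∧ (T (s 1) = none ∨ T (s 1) = some (s 2))) ∨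
        (P (s 0) = true ∧ P (s 1) = true ∧ P (s 2) = false ∧ T (s 2) = none ∧
          (T (s 0) = some (s 0) ∧ T (s 1) = some (s 1) ∨
            T (s 0) = some (s 1) ∧ T (s 1) = some (s 0))) ∨
        (∀ i, P i = true)) := by
  decide

end PeriodicColumns

/-! ### Inequalities between exponents forced by the critical set. -/

section CriticalConstraints

variable {f g : (Fin 3 → ℂ) → (Fin 3 → ℂ)} {lam : Fin 3 → ℂ} {K : Finset (Fin 3)}

/-- The point with coordinate t on J and 0 elsewhere lies on the hyperplane of index k, hence is in
the generalized critical set. But its orbit never meets the hyperplanes of J, and off these g is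
assumed to be non-critical. -/
theorem HasNormalForm.false_of_invariant (hg : HasNormalForm f g K)
    (H : IsContractingWithEigenvalues f lam) (J : Set (Fin 3)) {k : Fin 3} (hk : k ∈ K)
    (hkJ : k ∉ J)
    (h : ∀ v : Fin 3 → ℂ, DifferentiableAt ℂ g v → (∀ j ∈ J, v j ≠ 0) → (∀ j, ‖v j‖ < 1) →
      (∀ j ∈ J, g v j ≠ 0) ∧ (fderiv ℂ g v).det ≠ 0) : False := by
  classical
  obtain ⟨⟨Φ, hΦ, hconj⟩, hcrit⟩ := hg
  have hst : OrbitStable g := H.orbitStable.conj hΦ hconj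
  have hga := analyticAt_of_conj H.analytic H.apply_zero hΦ hconj
  have h0 : ∀ᶠ v : Fin 3 → ℂ in 𝓝 0, DifferentiableAt ℂ g v ∧ ∀ j, ‖v j‖ < 1 := by
    refine (hga.eventually_analyticAt.mono fun v h => h.differentiableAt).and
      (eventually_all.2 fun j => ?_)
    exact (continuous_apply j).norm.continuousAt.eventually_lt continuousAt_const (by simp)
  have h1 := hst.eventually h0
  have hcont : Continuous fun t : ℂ => fun j : Fin 3 => if j ∈ J then t else 0 :=
    continuous_pi fun j => by split_ifs <;> fun_prop
  have hd : Tendsto (fun t : ℂ => fun j : Fin 3 => if j ∈ J then t else 0) (𝓝 0) (𝓝 0) := by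
    convert hcont.tendsto 0 using 2
    ext j; simp
  obtain ⟨t, ⟨h2, h3⟩, ht0⟩ := (((hd.eventually h1).and (hd.eventually hcrit)).filter_mono
    nhdsWithin_le_nhds |>.and (self_mem_nhdsWithin : {(0 : ℂ)}ᶜ ∈ 𝓝[≠] 0)).exists
  obtain ⟨n, hn⟩ := h3.2 ⟨k, hk, by simp [hkJ]⟩
  have h4 : ∀ m, ∀ j ∈ J, g^[m] (fun j : Fin 3 => if j ∈ J then t else 0) j ≠ 0 := by
    intro m
    induction m with
    | zero => intro j hj; simpa [hj] using ht0
    | succ m ih =>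
      rw [Function.iterate_succ_apply']
      exact (h _ (h2 m).1 ih (h2 m).2).1
  exact (h _ (h2 n).1 (h4 n) (h2 n).2).2 hn

theorem fderiv_apply_single (v : Fin 3 → ℂ) (hg : DifferentiableAt ℂ g v)
    (i j : Fin 3) :
    fderiv ℂ g v (Pi.single j 1) i = deriv (fun t => g (Function.update v j t) i) (v j) := by
  have h1 : HasFDerivAt g (fderiv ℂ g v) (Function.update v j (v j)) := by
    rw [Function.update_eq_self]; exact hg.hasFDerivAt
  have h2 := h1.comp_hasDerivAt (v j) (hasDerivAt_update v j (v j))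
  have h3 := hasDerivAt_pi.1 h2 i
  exact h3.deriv.symm

theorem det_fderiv_eq (v : Fin 3 → ℂ) (hg : DifferentiableAt ℂ g v) :
    (fderiv ℂ g v).det =
      (Matrix.of fun i j => deriv (fun t => g (Function.update v j t) i) (v j)).det := by
  have h1 : (Matrix.of fun i j => deriv (fun t => g (Function.update v j t) i) (v j)) =
      LinearMap.toMatrix' (fderiv ℂ g v : (Fin 3 → ℂ) →ₗ[ℂ] (Fin 3 → ℂ)) := by
    ext i j
    rw [Matrix.of_apply, ← fderiv_apply_single v hg, LinearMap.toMatrix'_apply]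
    congr 2
  rw [h1, LinearMap.det_toMatrix']

theorem det_fderiv_of_triangular {v : Fin 3 → ℂ} (hg : DifferentiableAt ℂ g v)
    (h01 : deriv (fun t => g (Function.update v 1 t) 0) (v 1) = 0)
    (h02 : deriv (fun t => g (Function.update v 2 t) 0) (v 2) = 0)
    (h12 : deriv (fun t => g (Function.update v 2 t) 1) (v 2) = 0) :
    (fderiv ℂ g v).det = deriv (fun t => g (Function.update v 0 t) 0) (v 0) *
      deriv (fun t => g (Function.update v 1 t) 1) (v 1) *
      deriv (fun t => g (Function.update v 2 t) 2) (v 2) := by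
  rw [det_fderiv_eq v hg, Matrix.det_fin_three]
  simp only [Matrix.of_apply, h01, h02, h12]
  ring

theorem det_fderiv_of_swapped {v : Fin 3 → ℂ} (hg : DifferentiableAt ℂ g v)
    (h00 : deriv (fun t => g (Function.update v 0 t) 0) (v 0) = 0)
    (h02 : deriv (fun t => g (Function.update v 2 t) 0) (v 2) = 0)
    (h12 : deriv (fun t => g (Function.update v 2 t) 1) (v 2) = 0) :
    (fderiv ℂ g v).det = -(deriv (fun t => g (Function.update v 1 t) 0) (v 1) *
      deriv (fun t => g (Function.update v 0 t) 1) (v 0) *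
      deriv (fun t => g (Function.update v 2 t) 2) (v 2)) := by
  rw [det_fderiv_eq v hg, Matrix.det_fin_three]
  simp only [Matrix.of_apply, h00, h02, h12]
  ring

/-- If an inequality failed, one hyperplane could be dropped: the complement of the other would be
invariant and free of critical points. The other constraints below follow the same pattern. -/
theorem constraint_2_1_1 (H : IsContractingWithEigenvalues f lam) (h0 : lam 0 ≠ 0)
    {c d l m : ℕ} {ν : ℂ} (hν : ν ≠ 0) (hd : 1 ≤ d) {ω : ℂ × ℂ → ℂ}
    (h : HasNormalForm f (fun v => ![lam 0 * v 0, v 0 ^ c * v 1 ^ d,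
        ν * v 0 ^ l * v 1 ^ m * v 2 + ω (v 0, v 1)]) {0, 1}) : 1 ≤ c + l ∧ 2 ≤ d + m := by
  constructor
  · by_contra! hc
    obtain ⟨rfl, rfl⟩ : c = 0 ∧ l = 0 := by omega
    refine h.false_of_invariant H {1} (k := 0) (by simp) (by simp) fun v hv hJ _ => ?_
    have h1 : v 1 ≠ 0 := hJ 1 rfl
    refine ⟨by simp [h1], ?_⟩
    rw [det_fderiv_of_triangular hv (by simp) (by simp) (by simp)]
    simp [h0, h1, hν]
    omega
  · by_contra! hc
    obtain ⟨rfl, rfl⟩ : d = 1 ∧ m = 0 := by omega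
    refine h.false_of_invariant H {0} (k := 1) (by simp) (by simp) fun v hv hJ _ => ?_
    have h1 : v 0 ≠ 0 := hJ 0 rfl
    refine ⟨by simp [h0, h1], ?_⟩
    rw [det_fderiv_of_triangular hv (by simp) (by simp) (by simp)]
    simp [h0, h1, hν]

theorem constraint_2_2_2 (H : IsContractingWithEigenvalues f lam) (h0 : lam 0 ≠ 0)
    (h1 : lam 1 ≠ 0) {l m : ℕ} {ω : ℂ × ℂ → ℂ}
    (h : HasNormalForm f (fun v => ![lam 0 * v 0, lam 1 * v 1,
        v 0 ^ l * v 1 ^ m * v 2 + ω (v 0, v 1)]) {0, 1}) : 1 ≤ l ∧ 1 ≤ m := by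
  constructor
  · by_contra! hc
    obtain rfl : l = 0 := by omega
    refine h.false_of_invariant H {1} (k := 0) (by simp) (by simp) fun v hv hJ _ => ?_
    have h2 : v 1 ≠ 0 := hJ 1 rfl
    refine ⟨by simp [h1, h2], ?_⟩
    rw [det_fderiv_of_triangular hv (by simp) (by simp) (by simp)]
    simp [h0, h1, h2]
  · by_contra! hc
    obtain rfl : m = 0 := by omega
    refine h.false_of_invariant H {0} (k := 1) (by simp) (by simp) fun v hv hJ _ => ?_
    have h2 : v 0 ≠ 0 := hJ 0 rfl
    refine ⟨by simp [h0, h2], ?_⟩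
    rw [det_fderiv_of_triangular hv (by simp) (by simp) (by simp)]
    simp [h0, h1, h2]

theorem constraint_2_1_2_fst (H : IsContractingWithEigenvalues f lam) (h0 : lam 0 ≠ 0)
    (h1 : lam 1 ≠ 0) {c d n : ℕ} {ρ : ℂ} (hd : 1 ≤ d)
    (h : HasNormalForm f (fun v => ![lam 0 * v 0, lam 1 * v 1 + ρ * v 0 ^ n,
      v 0 ^ c * v 2 ^ d]) {0, 2}) : 1 ≤ c ∧ 2 ≤ d := by
  constructor
  · by_contra! hc
    obtain rfl : c = 0 := by omega
    refine h.false_of_invariant H {2} (k := 0) (by simp) (by simp) fun v hv hJ _ => ?_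
    have h2 : v 2 ≠ 0 := hJ 2 rfl
    refine ⟨by simp [h2], ?_⟩
    rw [det_fderiv_of_triangular hv (by simp) (by simp) (by simp)]
    simp [h0, h1, h2]
    omega
  · by_contra! hc
    obtain rfl : d = 1 := by omega
    refine h.false_of_invariant H {0} (k := 2) (by simp) (by simp) fun v hv hJ _ => ?_
    have h2 : v 0 ≠ 0 := hJ 0 rfl
    refine ⟨by simp [h0, h2], ?_⟩
    rw [det_fderiv_of_triangular hv (by simp) (by simp) (by simp)]
    simp [h0, h1, h2]

theorem constraint_2_1_2_snd (H : IsContractingWithEigenvalues f lam) (h0 : lam 0 ≠ 0)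
    (h1 : lam 1 ≠ 0) {c d : ℕ} (hd : 1 ≤ d)
    (h : HasNormalForm f (fun v => ![lam 0 * v 0, lam 1 * v 1, v 1 ^ c * v 2 ^ d]) {1, 2}) :
    1 ≤ c ∧ 2 ≤ d := by
  constructor
  · by_contra! hc
    obtain rfl : c = 0 := by omega
    refine h.false_of_invariant H {2} (k := 1) (by simp) (by simp) fun v hv hJ _ => ?_
    have h2 : v 2 ≠ 0 := hJ 2 rfl
    refine ⟨by simp [h2], ?_⟩
    rw [det_fderiv_of_triangular hv (by simp) (by simp) (by simp)]
    simp [h0, h1, h2]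
    omega
  · by_contra! hc
    obtain rfl : d = 1 := by omega
    refine h.false_of_invariant H {1} (k := 2) (by simp) (by simp) fun v hv hJ _ => ?_
    have h2 : v 1 ≠ 0 := hJ 1 rfl
    refine ⟨by simp [h1, h2], ?_⟩
    rw [det_fderiv_of_triangular hv (by simp) (by simp) (by simp)]
    simp [h0, h1, h2]

theorem constraint_3_2_2 (H : IsContractingWithEigenvalues f lam) (h0 : lam 0 ≠ 0)
    (h1 : lam 1 ≠ 0) {c₁ c₂ d : ℕ} (hd : 1 ≤ d)
    (h : HasNormalForm f (fun v => ![lam 0 * v 0, lam 1 * v 1,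
      v 0 ^ c₁ * v 1 ^ c₂ * v 2 ^ d]) {0, 1, 2}) : 1 ≤ c₁ ∧ 1 ≤ c₂ ∧ 2 ≤ d := by
  refine ⟨?_, ?_, ?_⟩
  · by_contra! hc
    obtain rfl : c₁ = 0 := by omega
    refine h.false_of_invariant H {1, 2} (k := 0) (by simp) (by simp) fun v hv hJ _ => ?_
    have h2 : v 1 ≠ 0 := hJ 1 (by simp)
    have h3 : v 2 ≠ 0 := hJ 2 (by simp)
    refine ⟨by simp [h1, h2, h3], ?_⟩
    rw [det_fderiv_of_triangular hv (by simp) (by simp) (by simp)]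
    simp [h0, h1, h2, h3]
    omega
  · by_contra! hc
    obtain rfl : c₂ = 0 := by omega
    refine h.false_of_invariant H {0, 2} (k := 1) (by simp) (by simp) fun v hv hJ _ => ?_
    have h2 : v 0 ≠ 0 := hJ 0 (by simp)
    have h3 : v 2 ≠ 0 := hJ 2 (by simp)
    refine ⟨by simp [h0, h2, h3], ?_⟩
    rw [det_fderiv_of_triangular hv (by simp) (by simp) (by simp)]
    simp [h0, h1, h2, h3]
    omega
  · by_contra! hc
    obtain rfl : d = 1 := by omega
    refine h.false_of_invariant H {0, 1} (k := 2) (by simp) (by simp) fun v hv hJ _ => ?_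
    have h2 : v 0 ≠ 0 := hJ 0 (by simp)
    have h3 : v 1 ≠ 0 := hJ 1 (by simp)
    refine ⟨by simp [h0, h1, h2, h3], ?_⟩
    rw [det_fderiv_of_triangular hv (by simp) (by simp) (by simp)]
    simp [h0, h1, h2, h3]

theorem constraint_3_2_2_swapped (H : IsContractingWithEigenvalues f lam) {α₁ α₂ : ℂ}
    (h0 : α₁ ≠ 0) (h1 : α₂ ≠ 0) {c₁ c₂ d : ℕ} (hd : 1 ≤ d)
    (h : HasNormalForm f (fun v => ![α₁ * v 1, α₂ * v 0,
      v 0 ^ c₁ * v 1 ^ c₂ * v 2 ^ d]) {0, 1, 2}) : 1 ≤ c₁ + c₂ ∧ 2 ≤ d := by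
  refine ⟨?_, ?_⟩
  · by_contra! hc
    obtain ⟨rfl, rfl⟩ : c₁ = 0 ∧ c₂ = 0 := by omega
    refine h.false_of_invariant H {2} (k := 0) (by simp) (by simp) fun v hv hJ _ => ?_
    have h3 : v 2 ≠ 0 := hJ 2 (by simp)
    refine ⟨by simp [h3], ?_⟩
    rw [det_fderiv_of_swapped hv (by simp) (by simp) (by simp)]
    simp [h0, h1, h3]
    omega
  · by_contra! hc
    obtain rfl : d = 1 := by omega
    refine h.false_of_invariant H {0, 1} (k := 2) (by simp) (by simp) fun v hv hJ _ => ?_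
    have h2 : v 0 ≠ 0 := hJ 0 (by simp)
    have h3 : v 1 ≠ 0 := hJ 1 (by simp)
    refine ⟨by simp [h0, h1, h2, h3], ?_⟩
    rw [det_fderiv_of_swapped hv (by simp) (by simp) (by simp)]
    simp [h0, h1, h2, h3]

/-- Multiplying by t undoes the lowered exponent; the coefficient a covers the case a = 0, where the
subtraction is truncated. -/
theorem natCast_mul_pow_sub_one_mul (a : ℕ) (t : ℂ) : a * t ^ (a - 1) * t = a * t ^ a := by
  rcases a with _ | a
  · simp
  · rw [Nat.add_sub_cancel, pow_succ]; ring

theorem one_add_mul_pow_ne_zero {t : ℂ} (ht : ‖t‖ < 1) {g : ℂ} (hg : g = 0 ∨ g = 1) {n : ℕ}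
    (hn : n ≠ 0) : 1 + g * t ^ n ≠ 0 := by
  rcases hg with rfl | rfl
  · simp
  · intro h
    have h1 : ‖t ^ n‖ = 1 := by
      rw [show t ^ n = -1 by linear_combination h]; simp
    rw [norm_pow] at h1
    exact absurd h1 (pow_lt_one₀ (norm_nonneg t) ht hn).ne

theorem constraint_3_1_1 (H : IsContractingWithEigenvalues f lam) (h0 : lam 0 ≠ 0)
    {D : Matrix (Fin 2) (Fin 2) ℕ} {c₁ c₂ n : ℕ} {β₁ β₂ γ : ℂ} (hβ₁ : β₁ ≠ 0) (hβ₂ : β₂ ≠ 0)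
    (hD : D 0 0 * D 1 1 ≠ D 0 1 * D 1 0) (hn : 1 ≤ n) (hγ : γ = 0 ∨ γ = 1)
    (h : HasNormalForm f (fun v => ![lam 0 * v 0,
        β₁ * v 0 ^ c₁ * v 1 ^ D 0 0 * v 2 ^ D 1 0 * (1 + γ * v 0 ^ n),
        β₂ * v 0 ^ c₂ * v 1 ^ D 0 1 * v 2 ^ D 1 1]) {0, 1, 2}) : 1 ≤ c₁ + c₂ := by
  by_contra! hc
  obtain ⟨rfl, rfl⟩ : c₁ = 0 ∧ c₂ = 0 := by omega
  refine h.false_of_invariant H {1, 2} (k := 0) (by simp) (by simp) fun v hv hJ hv1 => ?_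
  have h1 : v 1 ≠ 0 := hJ 1 (by simp)
  have h2 : v 2 ≠ 0 := hJ 2 (by simp)
  have h3 := one_add_mul_pow_ne_zero (hv1 0) hγ (show n ≠ 0 by omega)
  refine ⟨by simp [h1, h2, h3, hβ₁, hβ₂], ?_⟩
  rw [det_fderiv_eq v hv, Matrix.det_fin_three]
  simp
  intro h4
  have e00 := natCast_mul_pow_sub_one_mul (D 0 0) (v 1)
  have e01 := natCast_mul_pow_sub_one_mul (D 0 1) (v 1)
  have e10 := natCast_mul_pow_sub_one_mul (D 1 0) (v 2)
  have e11 := natCast_mul_pow_sub_one_mul (D 1 1) (v 2)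
  -- Multiplied by v 1 * v 2, the Jacobian determinant becomes a non-vanishing factor times the
  -- determinant of D.
  have h5 : lam 0 * β₁ * β₂ * (1 + γ * v 0 ^ n) * v 1 ^ D 0 0 * v 1 ^ D 0 1 * v 2 ^ D 1 0 *
      v 2 ^ D 1 1 * ((D 0 0 : ℂ) * D 1 1 - D 0 1 * D 1 0) = 0 := by
    linear_combination v 1 * v 2 * h4 - lam 0 * β₁ * β₂ * (1 + γ * v 0 ^ n) *
      (v 1 ^ D 0 1 * v 2 ^ D 1 0 * ((D 1 1 * v 2 ^ (D 1 1 - 1) * v 2) * e00 +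
        (D 0 0 * v 1 ^ D 0 0) * e11) - v 1 ^ D 0 0 * v 2 ^ D 1 1 *
        ((D 1 0 * v 2 ^ (D 1 0 - 1) * v 2) * e01 + (D 0 1 * v 1 ^ D 0 1) * e10))
  simp only [mul_eq_zero, pow_eq_zero_iff', h0, hβ₁, hβ₂, h1, h2, h3, false_or, false_and,
    sub_eq_zero] at h5
  exact hD (by exact_mod_cast h5)

end CriticalConstraints

/-! ### Scaling, independence of covectors, and planar forms. -/

section Assembly

variable {f : (Fin 3 → ℂ) → (Fin 3 → ℂ)} {lam : Fin 3 → ℂ}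

theorem exists_pow_mul_pow_eq {ν : ℂ} (hν : ν ≠ 0) {l m : ℕ} (h : 1 ≤ l + m) :
    ∃ s t : ℂ, s ≠ 0 ∧ t ≠ 0 ∧ s ^ l * t ^ m = ν := by
  have hroot : ∀ n : ℕ, 1 ≤ n → ∃ s : ℂ, s ≠ 0 ∧ s ^ n = ν := by
    intro n hn
    obtain ⟨s, hs⟩ := IsAlgClosed.exists_pow_nat_eq ν (show 0 < n by omega)
    refine ⟨s, ?_, hs⟩
    rintro rfl
    rw [zero_pow (by omega)] at hs
    exact hν hs.symm
  rcases Nat.eq_zero_or_pos l with rfl | hl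
  · obtain ⟨t, ht, h1⟩ := hroot m (by omega)
    exact ⟨1, t, one_ne_zero, ht, by simpa using h1⟩
  · obtain ⟨s, hs, h1⟩ := hroot l hl
    exact ⟨s, 1, hs, one_ne_zero, by simpa using h1⟩

theorem IsGermWithLinearPart.scale {ω : ℂ × ℂ → ℂ} {a b : ℂ} (h : IsGermWithLinearPart ω a b)
    (s t : ℂ) : IsGermWithLinearPart (fun z => ω (s * z.1, t * z.2)) (s * a) (t * b) := by
  have he0 : (fun z : ℂ × ℂ => (s * z.1, t * z.2)) 0 = 0 := by
    ext <;> simp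
  have h1 : HasFDerivAt (fun z : ℂ × ℂ => (s * z.1, t * z.2))
      ((s • ContinuousLinearMap.fst ℂ ℂ ℂ).prod (t • ContinuousLinearMap.snd ℂ ℂ ℂ)) 0 :=
    (hasFDerivAt_fst.const_mul s).prodMk (hasFDerivAt_snd.const_mul t)
  have h2 : HasFDerivAt ω (a • ContinuousLinearMap.fst ℂ ℂ ℂ + b • ContinuousLinearMap.snd ℂ ℂ ℂ)
      ((fun z : ℂ × ℂ => (s * z.1, t * z.2)) 0) := by
    rw [he0]; exact h.hasFDerivAt
  refine isGermWithLinearPart_of_hasFDerivAt ?_ ((congrArg ω he0).trans h.map_zero)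
    ((h2.comp 0 h1).congr_fderiv ?_)
  · exact AnalyticAt.fun_comp (g := ω) (f := fun z : ℂ × ℂ => (s * z.1, t * z.2))
      (show AnalyticAt ℂ ω ((fun z : ℂ × ℂ => (s * z.1, t * z.2)) 0) by rw [he0]; exact h.analytic)
      ((analyticAt_const.fun_mul analyticAt_fst).prod (analyticAt_const.fun_mul analyticAt_snd))
  · ext <;> simp [mul_comm]

theorem codifferential_eigenfunction (H : IsContractingWithEigenvalues f lam)
    {X : (Fin 3 → ℂ) → ℂ} (hX : AnalyticAt ℂ X 0) {μ : ℂ} (h : ∀ᶠ x in 𝓝 0, X (f x) = μ * X x) :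
    codifferential f (covector X) = μ • covector X := by
  rw [codifferential_covector H.analytic H.apply_zero hX, covector_congr h, covector_const_mul hX]

theorem linearIndependent_of_eigenfunctions {X Y : (Fin 3 → ℂ) → ℂ} {μ ν : ℂ} (hX : codifferential f (covector X) = μ • covector X)
    (hY : codifferential f (covector Y) = ν • covector Y) (hXc : covector X ≠ 0)
    (hYc : covector Y ≠ 0) (h : μ ≠ ν) : LinearIndependent ℂ ![covector X, covector Y] := by
  have h1 := Module.End.eigenvectors_linearIndependent' (codifferential f) ![μ, ν]
    (by intro i j hij; fin_cases i <;> fin_cases j <;> simp_all [eq_comm])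
    ![covector X, covector Y] (by
      intro i
      fin_cases i
      · exact ⟨Module.End.mem_eigenspace_iff.2 hX, hXc⟩
      · exact ⟨Module.End.mem_eigenspace_iff.2 hY, hYc⟩)
  exact h1

/-- The codifferential kills Z and is triangular with non-zero diagonal on the span of X and Y, so
applying it to a relation isolates the coefficients of X and Y. -/
theorem linearIndependent_of_kernel {X Y Z : (Fin 3 → ℂ) → ℂ} {a b c : ℂ}
    (hXY : LinearIndependent ℂ ![covector X, covector Y]) (hZc : covector Z ≠ 0)
    (hX : codifferential f (covector X) = a • covector X)
    (hY : codifferential f (covector Y) = b • covector Y + c • covector X)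
    (hZ : codifferential f (covector Z) = 0) (ha : a ≠ 0) (hb : b ≠ 0) :
    LinearIndependent ℂ ![covector X, covector Y, covector Z] := by
  rw [Fintype.linearIndependent_iff] at hXY ⊢
  intro s hs
  simp only [Fin.sum_univ_three, Matrix.cons_val_zero, Matrix.cons_val_one,
    Matrix.cons_val_two, Matrix.tail_cons, Matrix.head_cons] at hs
  have h1 := congrArg (codifferential f) hs
  simp only [map_add, map_smul, hX, hY, hZ, map_zero, smul_zero, add_zero] at h1
  have h2 := hXY ![s 0 * a + s 1 * c, s 1 * b] (by
    simp only [Fin.sum_univ_two, Matrix.cons_val_zero, Matrix.cons_val_one]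
    rw [← h1]; module)
  have h3 : s 1 = 0 := by simpa [hb] using h2 1
  have h4 : s 0 = 0 := by simpa [h3, ha] using h2 0
  rw [h3, h4] at hs
  have h5 : s 2 = 0 := by simpa [hZc] using hs
  intro i; fin_cases i <;> assumption

/-- The square of the codifferential kills Y and Z but not X, so it isolates the coefficient of X in
a relation. -/
theorem linearIndependent_of_kernel_square {X Y Z : (Fin 3 → ℂ) → ℂ} {a : ℂ}
    (hYZ : LinearIndependent ℂ ![covector Y, covector Z]) (hXc : covector X ≠ 0)
    (hX : codifferential f (covector X) = a • covector X)
    (hY : codifferential f (codifferential f (covector Y)) = 0)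
    (hZ : codifferential f (codifferential f (covector Z)) = 0) (ha : a ≠ 0) :
    LinearIndependent ℂ ![covector X, covector Y, covector Z] := by
  rw [Fintype.linearIndependent_iff] at hYZ ⊢
  intro s hs
  simp only [Fin.sum_univ_three, Matrix.cons_val_zero, Matrix.cons_val_one,
    Matrix.cons_val_two, Matrix.tail_cons, Matrix.head_cons] at hs
  have h1 := congrArg (codifferential f) (congrArg (codifferential f) hs)
  simp only [map_add, map_smul, hX, hY, hZ, map_zero, smul_zero, add_zero, smul_smul] at h1
  have h2 : s 0 = 0 := by simpa [hXc, ha] using h1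
  have h3 := hYZ ![s 1, s 2] (by
    simp only [Fin.sum_univ_two, Matrix.cons_val_zero, Matrix.cons_val_one]
    rw [← hs, h2]; module)
  intro i; fin_cases i
  · exact h2
  · exact h3 0
  · exact h3 1

/-- The span of the two covectors is invariant, so after completion to a basis the codifferential is
block triangular; τ is its third diagonal entry, unknown at this stage. -/
theorem IsContractingWithEigenvalues.planar_identities (H : IsContractingWithEigenvalues f lam)
    (h2 : lam 2 = 0) {X Y : (Fin 3 → ℂ) → ℂ} {a₁ b₁ a₂ b₂ : ℂ}
    (hXY : LinearIndependent ℂ ![covector X, covector Y])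
    (hX : codifferential f (covector X) = a₁ • covector X + b₁ • covector Y)
    (hY : codifferential f (covector Y) = a₂ • covector X + b₂ • covector Y) :
    ∃ τ, lam 0 + lam 1 = a₁ + b₂ + τ ∧ lam 0 * lam 1 = a₁ * b₂ - b₁ * a₂ + (a₁ + b₂) * τ ∧
      (a₁ * b₂ - b₁ * a₂) * τ = 0 := by
  obtain ⟨T, -, -, hi⟩ := exists_completion_two hXY
  obtain ⟨c, hc⟩ := exists_coefficients hi (codifferential f (covector T))
  have hM : ∀ i, codifferential f (![covector X, covector Y, covector T] i) =
      ∑ j, !![a₁, b₁, 0; a₂, b₂, 0; c 0, c 1, c 2] i j •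
        ![covector X, covector Y, covector T] j := by
    intro i
    fin_cases i
    · rw [Fin.sum_univ_three]; simpa using hX
    · rw [Fin.sum_univ_three]; simpa using hY
    · rw [Fin.sum_univ_three] at hc ⊢; simpa using hc
  obtain ⟨e1, e2, e3⟩ := H.eigenvalue_identities hi hM
  rw [Matrix.det_fin_three] at e3
  simp [h2] at e1 e2 e3
  exact ⟨c 2, e1, by rw [e2]; ring, by linear_combination -e3⟩

theorem pow_lam_ne (H : IsContractingWithEigenvalues f lam) {n m : ℕ} (h0 : lam 0 ≠ 0)
    (h : lam 0 ^ n = lam 0 ^ m) : n = m := by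
  by_contra hne
  exact pow_ne_pow_of_norm_lt_one h0 (H.norm_lt_one 0) hne h

/-- Powers of λ¹ are pairwise distinct, so at most one exponent n is resonant with λ² and the
Poincaré–Dulac polynomial is a single monomial, whose coefficient is scaled to 1. Without resonant
term the exponent is arbitrary, and 1 is taken. -/
theorem IsContractingWithEigenvalues.exists_planar_form (H : IsContractingWithEigenvalues f lam)
    (hord : ∀ i j, i ≤ j → ‖lam j‖ ≤ ‖lam i‖) (h0 : lam 0 ≠ 0) (h1 : lam 1 ≠ 0)
    {w : (Fin 3 → ℂ) → ℂ} (hw : AnalyticAt ℂ w 0)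
    (hw0 : w 0 = 0) (hwc : covector w ≠ 0) (hwf : ∀ᶠ x in 𝓝 0, w (f x) = lam 0 * w x) :
    ∃ (n : ℕ) (ρ : ℂ) (Y : (Fin 3 → ℂ) → ℂ), 1 ≤ n ∧ (ρ = 0 ∨ ρ = 1 ∧ lam 0 ^ n = lam 1) ∧
      AnalyticAt ℂ Y 0 ∧ Y 0 = 0 ∧ LinearIndependent ℂ ![covector w, covector Y] ∧
      ∀ᶠ x in 𝓝 0, Y (f x) = lam 1 * Y x + ρ * w x ^ n := by
  obtain ⟨e, he, hew, hρ, -⟩ := H.poincareDulac hord hw hw0 hwc hwf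
  obtain ⟨ρ₁, hs, hY⟩ := hρ h1
  have hYa : AnalyticAt ℂ (fun x => e x 1) 0 := analyticAt_pi_iff.1 he.analytic 1
  have hY0 : e 0 1 = 0 := by rw [he.map_zero]; rfl
  have hi : LinearIndependent ℂ ![covector w, covector fun x => e x 1] := by
    have h2 := he.linearIndependent.comp ![0, 1] (by decide)
    have h3 : ((fun i => covector fun x => e x i) ∘ ![0, 1]) =
        ![covector w, covector fun x => e x 1] := by
      ext1 i; fin_cases i
      · exact congrArg covector (funext hew)
      · rfl
    rwa [h3] at h2
  by_cases hz : ρ₁ = 0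
  · refine ⟨1, 0, _, le_rfl, Or.inl rfl, hYa, hY0, hi, ?_⟩
    filter_upwards [hY] with x hx
    simpa [hz] using hx
  · obtain ⟨n, hn⟩ := Polynomial.support_nonempty.2 hz
    have hmono : ρ₁ = Polynomial.monomial n (ρ₁.coeff n) := by
      ext k
      rw [Polynomial.coeff_monomial]
      split_ifs with hk
      · rw [hk]
      · by_contra hk0
        exact hk (pow_lam_ne H h0 ((hs n hn).2.trans (hs k (Polynomial.mem_support_iff.2 hk0)).2.symm))
    have hc : ρ₁.coeff n ≠ 0 := Polynomial.mem_support_iff.1 hn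
    refine ⟨n, 1, fun x => (ρ₁.coeff n)⁻¹ * e x 1, Nat.one_le_iff_ne_zero.2 (hs n hn).1,
      Or.inr ⟨rfl, (hs n hn).2⟩, analyticAt_const.fun_mul hYa, by simp [hY0], ?_, ?_⟩
    · rw [covector_const_mul hYa]
      have h2 := hi.units_smul ![1, Units.mk0 _ (inv_ne_zero hc)]
      have h3 : (![1, Units.mk0 _ (inv_ne_zero hc)] • ![covector w, covector fun x => e x 1]) =
          ![covector w, (ρ₁.coeff n)⁻¹ • covector fun x => e x 1] := by
        ext1 i; fin_cases i
        · exact one_smul ℂ (covector w)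
        · rfl
      rwa [h3] at h2
    · filter_upwards [hY] with x hx
      rw [hx, hmono, Polynomial.eval_monomial, hew, ← hmono]
      field_simp

theorem exists_normalForm_of_first (H : IsContractingWithEigenvalues f lam)
    {X : (Fin 3 → ℂ) → ℂ} (hX : AnalyticAt ℂ X 0) (hX0 : X 0 = 0) (hXc : covector X ≠ 0)
    {G : ℂ → ℂ} (hG : ∀ᶠ x in 𝓝 0, X (f x) = G (X x))
    (hcrit : ∀ᶠ x in 𝓝 0, x ∈ genCritSet f ↔ X x = 0) :
    ∃ h₁ h₂ : (Fin 3 → ℂ) → ℂ,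
      AnalyticAt ℂ h₁ 0 ∧ h₁ 0 = 0 ∧ AnalyticAt ℂ h₂ 0 ∧ h₂ 0 = 0 ∧
      HasNormalForm f (fun v => ![G (v 0), h₁ v, h₂ v]) {0} := by
  obtain ⟨Y, T, hY, hY0, hT, hT0, hi⟩ := exists_completion_one hXc
  have hΦ := isLocalBiholomorphism_triple hX hX0 hY hY0 hT hT0 hi
  obtain ⟨ψ, hψ, -, hψΦ⟩ := hΦ.exists_inverse
  have key : ∀ {u : (Fin 3 → ℂ) → ℂ}, AnalyticAt ℂ u 0 → u 0 = 0 →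
      AnalyticAt ℂ (fun v => u (f (ψ v))) 0 ∧ u (f (ψ 0)) = 0 := by
    intro u hu hu0
    refine ⟨?_, by rw [hψ.map_zero, H.apply_zero, hu0]⟩
    refine AnalyticAt.fun_comp (g := u) (f := fun v => f (ψ v)) ?_ ?_
    · rw [hψ.map_zero, H.apply_zero]; exact hu
    · exact AnalyticAt.fun_comp (g := f) (f := ψ) (by rw [hψ.map_zero]; exact H.analytic)
        hψ.analytic
  refine ⟨_, _, (key hY hY0).1, (key hY hY0).2, (key hT hT0).1, (key hT hT0).2,
    hasNormalForm_of_triple H hX hX0 hY hY0 hT hT0 hi ?_ ?_⟩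
  · filter_upwards [hG, hψΦ] with x h1 h2
    simp [h1, h2]
  · simpa using hcrit

end Assembly

/-! ### One critical component. -/

section OneComponent

variable {f : (Fin 3 → ℂ) → (Fin 3 → ℂ)} {lam : Fin 3 → ℂ}

theorem NormalCrossingData.covector_ne_zero {q : ℕ} {y : Fin q → (Fin 3 → ℂ) → ℂ}
    {A : Matrix (Fin q) (Fin q) ℕ} (R : NormalCrossingData f y A) (k : Fin q) :
    covector (y k) ≠ 0 := R.indep.ne_zero k

/-- The equation of a single component, normalised. -/
theorem NormalCrossingData.exists_power_form {y : Fin 1 → (Fin 3 → ℂ) → ℂ}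
    {A : Matrix (Fin 1) (Fin 1) ℕ} (R : NormalCrossingData f y A)
    (H : IsContractingWithEigenvalues f lam) (hA : 1 ≤ A 0 0) :
    ∃ (c : ℂ) (Y : (Fin 3 → ℂ) → ℂ), c ≠ 0 ∧ AnalyticAt ℂ Y 0 ∧ Y 0 = 0 ∧ covector Y ≠ 0 ∧
      (∀ᶠ x in 𝓝 0, Y (f x) = c * Y x ^ A 0 0) ∧
      ∀ᶠ x in 𝓝 0, x ∈ genCritSet f ↔ Y x = 0 := by
  obtain ⟨u, hu, hu0, he⟩ := R.pullback 0
  obtain ⟨v, hv, hv0, hv1⟩ := H.exists_normalisation (y := y 0) (P := fun _ => 1) hA hu hu0 (by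
    filter_upwards [he] with x hx
    rw [hx]; simp)
  refine ⟨u 0, _, hu0, analyticAt_mul_exp (R.analytic 0) hv, by simp [R.apply_zero], ?_, ?_, ?_⟩
  · rw [covector_mul_exp (R.analytic 0) (R.apply_zero 0) hv hv0]
    exact R.covector_ne_zero 0
  · filter_upwards [hv1] with x hx
    rw [hx]; ring
  · filter_upwards [R.crit] with x hx
    rw [hx]; simp

/-- The equation of a single component, normalised with leading coefficient one. -/
theorem NormalCrossingData.exists_monic_power_form {y : Fin 1 → (Fin 3 → ℂ) → ℂ}
    {A : Matrix (Fin 1) (Fin 1) ℕ} (R : NormalCrossingData f y A)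
    (H : IsContractingWithEigenvalues f lam) (hA : 2 ≤ A 0 0) :
    ∃ (Y : (Fin 3 → ℂ) → ℂ), AnalyticAt ℂ Y 0 ∧ Y 0 = 0 ∧ covector Y ≠ 0 ∧
      (∀ᶠ x in 𝓝 0, Y (f x) = Y x ^ A 0 0) ∧
      (∀ᶠ x in 𝓝 0, x ∈ genCritSet f ↔ Y x = 0) ∧ codifferential f (covector Y) = 0 := by
  obtain ⟨c, Y, hc, hY, hY0, hYc, hYf, hcrit⟩ := R.exists_power_form H (by omega)
  -- Scaling Y by t turns the coefficient c into c/t^(d-1), so t is a (d-1)-th root of c.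
  obtain ⟨s, t, _, ht, hst⟩ := exists_pow_mul_pow_eq hc (l := 0) (m := A 0 0 - 1) (by omega)
  have hYa : AnalyticAt ℂ (fun x => t * Y x) 0 := analyticAt_const.fun_mul hY
  have hYf' : ∀ᶠ x in 𝓝 0, t * Y (f x) = (t * Y x) ^ A 0 0 := by
    filter_upwards [hYf] with x hx
    rw [hx, ← hst, mul_pow]
    obtain ⟨d, hd⟩ : ∃ d, A 0 0 = d + 1 := ⟨A 0 0 - 1, by omega⟩
    rw [hd, Nat.add_sub_cancel]
    ring
  refine ⟨_, hYa, by simp [hY0], ?_, hYf', ?_, ?_⟩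
  · rw [covector_const_mul hY]
    exact smul_ne_zero ht hYc
  · filter_upwards [hcrit] with x hx
    rw [hx]; simp [ht]
  · rw [codifferential_covector H.analytic H.apply_zero hYa, covector_congr hYf']
    have h1 := (vanishesToOrder_one hYa.differentiableAt (by simp [hY0])).pow (A 0 0)
    exact (h1.mono (by omega)).covector_eq_zero

theorem normalForm_1_0_0_of_data {y : Fin 1 → (Fin 3 → ℂ) → ℂ}
    {A : Matrix (Fin 1) (Fin 1) ℕ} (R : NormalCrossingData f y A)
    (H : IsContractingWithEigenvalues f lam) (hA : 2 ≤ A 0 0) : NormalForm_1_0_0 f := by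
  obtain ⟨c, Y, hc, hY, hY0, hYc, hYf, hcrit⟩ := R.exists_power_form H (by omega)
  obtain ⟨h₁, h₂, a1, a2, a3, a4, h⟩ := exists_normalForm_of_first H hY hY0 hYc
    (G := fun z => c * z ^ A 0 0) hYf hcrit
  exact ⟨c, A 0 0, h₁, h₂, hc, hA, a1, a2, a3, a4, h⟩

theorem NormalCrossingData.exists_linear_form {y : Fin 1 → (Fin 3 → ℂ) → ℂ}
    {A : Matrix (Fin 1) (Fin 1) ℕ} (R : NormalCrossingData f y A)
    (H : IsContractingWithEigenvalues f lam) (hA : A 0 0 = 1) (h2 : lam 2 = 0) :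
    ∃ (c : ℂ) (Y : (Fin 3 → ℂ) → ℂ), (c = lam 0 ∨ c = lam 1) ∧ c ≠ 0 ∧ AnalyticAt ℂ Y 0 ∧ Y 0 = 0 ∧
      covector Y ≠ 0 ∧ (∀ᶠ x in 𝓝 0, Y (f x) = c * Y x) ∧
      ∀ᶠ x in 𝓝 0, x ∈ genCritSet f ↔ Y x = 0 := by
  obtain ⟨c, Y, hc, hY, hY0, hYc, hYf, hcrit⟩ := R.exists_power_form H hA.ge
  simp only [hA, pow_one] at hYf
  refine ⟨c, Y, ?_, hc, hY, hY0, hYc, hYf, hcrit⟩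
  rcases H.eq_or_eq_of_covector hYc (codifferential_eigenfunction H hY hYf) with h | h | h
  · exact Or.inl h
  · exact Or.inr h
  · exact absurd (h.trans h2) hc

theorem normalForm_1_1_1_of_data {y : Fin 1 → (Fin 3 → ℂ) → ℂ}
    {A : Matrix (Fin 1) (Fin 1) ℕ} (R : NormalCrossingData f y A)
    (H : IsContractingWithEigenvalues f lam) (hA : A 0 0 = 1) (h1 : lam 1 = 0) (h2 : lam 2 = 0) :
    NormalForm_1_1_1 f lam := by
  obtain ⟨c, Y, hcl, hc, hY, hY0, hYc, hYf, hcrit⟩ := R.exists_linear_form H hA h2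
  obtain rfl : c = lam 0 := hcl.resolve_right fun h => hc (h.trans h1)
  obtain ⟨h₁, h₂, a1, a2, a3, a4, h⟩ := exists_normalForm_of_first H hY hY0 hYc
    (G := fun z => lam 0 * z) hYf hcrit
  exact ⟨h₁, h₂, a1, a2, a3, a4, h⟩

theorem isGermWithLinearPart_planar (μ ρ : ℂ) {n : ℕ} (hn : n ≠ 0) :
    IsGermWithLinearPart (fun z => μ * z.2 + ρ * z.1 ^ n) (if n = 1 then ρ else 0) μ := by
  have h1 := isGermWithLinearPart_linear 0 μ
  by_cases h : n = 1
  · rw [if_pos h, h]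
    convert isGermWithLinearPart_linear ρ μ using 1
    funext z; ring
  · rw [if_neg h]
    convert h1.add (isGermWithLinearPart_monomial (l := n) (m := 0) (by omega) ρ) using 1
    · funext z; simp
    · simp
    · simp

theorem codifferential_of_planar (H : IsContractingWithEigenvalues f lam)
    {X Y : (Fin 3 → ℂ) → ℂ} (hX : AnalyticAt ℂ X 0) (hX0 : X 0 = 0) (hY : AnalyticAt ℂ Y 0)
    (hY0 : Y 0 = 0) {μ ρ : ℂ} {n : ℕ} (h : ∀ᶠ x in 𝓝 0, Y (f x) = μ * Y x + ρ * X x ^ n)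
    (hn : n ≠ 0) :
    codifferential f (covector Y) = μ • covector Y + (if n = 1 then ρ else 0) • covector X := by
  rw [codifferential_covector H.analytic H.apply_zero hY, covector_congr h,
    covector_comp_pair (isGermWithLinearPart_planar μ ρ hn) hX hX0 hY hY0, add_comm]

theorem normalForm_1_0_2_of_data {y : Fin 1 → (Fin 3 → ℂ) → ℂ}
    {A : Matrix (Fin 1) (Fin 1) ℕ} (R : NormalCrossingData f y A)
    (H : IsContractingWithEigenvalues f lam) (hord : ∀ i j, i ≤ j → ‖lam j‖ ≤ ‖lam i‖)
    (hA : 2 ≤ A 0 0) (h0 : lam 0 ≠ 0) (h1 : lam 1 ≠ 0) : NormalForm_1_0_2 f lam := by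
  obtain ⟨Z, hZ, hZ0, hZc, hZf, hcrit, hSZ⟩ := R.exists_monic_power_form H hA
  obtain ⟨X, hX, hX0, hXc, hXf⟩ := H.exists_eigenfunction hord h0
  obtain ⟨n, ρ, Y, hn, hρ, hY, hY0, hXY, hYf⟩ := H.exists_planar_form hord h0 h1 hX hX0 hXc hXf
  refine ⟨n, A 0 0, ρ, hn, hA, hρ, hasNormalForm_of_triple H hX hX0 hY hY0 hZ hZ0
    (linearIndependent_of_kernel hXY hZc (codifferential_eigenfunction H hX hXf)
      (codifferential_of_planar H hX hX0 hY hY0 hYf (by omega)) hSZ h0 h1) ?_ ?_⟩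
  · filter_upwards [hXf, hYf, hZf] with x e1 e2 e3
    simp [e1, e2, e3]
  · simpa using hcrit

theorem exists_unit_linear_coefficient (b : ℂ) : ∃ t : ℂ, t ≠ 0 ∧ (t * b = 0 ∨ t * b = 1) := by
  by_cases hb : b = 0
  · exact ⟨1, one_ne_zero, by simp [hb]⟩
  · exact ⟨b⁻¹, inv_ne_zero hb, by simp [hb]⟩

theorem normalForm_1_0_1_of_data {y : Fin 1 → (Fin 3 → ℂ) → ℂ}
    {A : Matrix (Fin 1) (Fin 1) ℕ} (R : NormalCrossingData f y A)
    (H : IsContractingWithEigenvalues f lam) (hord : ∀ i j, i ≤ j → ‖lam j‖ ≤ ‖lam i‖)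
    (hA : 2 ≤ A 0 0) (h0 : lam 0 ≠ 0) (h1 : lam 1 = 0) (h2 : lam 2 = 0) :
    NormalForm_1_0_1 f lam := by
  obtain ⟨Y, hY, hY0, hYc, hYf, hcrit, hSY⟩ := R.exists_monic_power_form H hA
  obtain ⟨X, hX, hX0, hXc, hXf⟩ := H.exists_eigenfunction hord h0
  have hXY := linearIndependent_of_eigenfunctions (codifferential_eigenfunction H hX hXf)
    (show codifferential f (covector Y) = (0 : ℂ) • covector Y by rw [hSY, zero_smul]) hXc hYc h0
  obtain ⟨T, hT, hT0, hi⟩ := exists_completion_two hXY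
  obtain ⟨l, m, ν, a, b, hν, hl, -, hid, hZ⟩ := H.exists_fibre_form hX hX0 hY hY0 hT hT0 hi
    (K := {1}) (isGermWithLinearPart_linear (lam 0) 0)
    (isGermWithLinearPart_monomial (l := 0) (m := A 0 0) (by omega) 1)
    (by simpa using hXf) (by simpa using hYf) (by decide)
    (by filter_upwards [hcrit] with x hx h; exact ⟨1, by simp, hx.1 h⟩)
  obtain rfl : l = 0 := hl (by decide)
  -- If m = 0, the second symmetric function of the eigenvalues would be λ¹ν ≠ 0, although two
  -- eigenvalues vanish.
  have hm : 1 ≤ m := by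
    by_contra! hm
    have := (hid (by omega)).2.1
    simp [h1, h2, h0, hν] at this
  obtain ⟨t, ht, htb⟩ := exists_unit_linear_coefficient b
  -- Adding a multiple of X to Z removes the X-term of ω, since X is an eigenfunction with λ¹ ≠ 0.
  -- The Y-term cannot be changed in this way, as Y ∘ f has no linear part; t only scales it to 0 or
  -- 1.
  obtain ⟨Z, ω, hω, hZa, hZ0, hi', hZf⟩ := hZ (by omega) t (-(t * a) / lam 0) 0 ht
  refine ⟨A 0 0, m, ν, t * b, ω, hA, hm, hν, htb, ?_,
    hasNormalForm_of_triple H hX hX0 hY hY0 hZa hZ0 hi' ?_ ?_⟩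
  · convert hω using 1
    · field_simp; ring
    · ring
  · filter_upwards [hXf, hYf, hZf] with x e1 e2 e3
    simp [e1, e2, e3]
  · simpa using hcrit

end OneComponent

/-! ### Fibre forms over an invertible planar map. -/

section InvertibleBase

variable {f : (Fin 3 → ℂ) → (Fin 3 → ℂ)} {lam : Fin 3 → ℂ}

/-- When the linear part of the base is invertible, Cramer's rule gives α and β that remove the
whole linear part of ω. The case l = m = 0 would make df₀ invertible, against λ³ = 0. -/
theorem IsContractingWithEigenvalues.exists_fibre_form_of_det_ne_zero
    (H : IsContractingWithEigenvalues f lam) (hlam : lam 2 = 0)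
    {X Y : (Fin 3 → ℂ) → ℂ} (hX : AnalyticAt ℂ X 0)
    (hX0 : X 0 = 0) (hY : AnalyticAt ℂ Y 0) (hY0 : Y 0 = 0)
    (hXY : LinearIndependent ℂ ![covector X, covector Y]) {G₁ G₂ : ℂ × ℂ → ℂ}
    {a₁ b₁ a₂ b₂ : ℂ} (hG₁ : IsGermWithLinearPart G₁ a₁ b₁) (hG₂ : IsGermWithLinearPart G₂ a₂ b₂)
    (h₁ : ∀ᶠ x in 𝓝 0, X (f x) = G₁ (X x, Y x)) (h₂ : ∀ᶠ x in 𝓝 0, Y (f x) = G₂ (X x, Y x))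
    (hdet : a₁ * b₂ - b₁ * a₂ ≠ 0) (K : Finset (Fin 3)) (hK : 2 ∉ K)
    (hcrit : ∀ᶠ x in 𝓝 0, x ∈ genCritSet f → ∃ k ∈ K, ![X x, Y x, 0] k = 0) :
    ∃ (l m : ℕ) (ν : ℂ) (Z : (Fin 3 → ℂ) → ℂ) (ω : ℂ × ℂ → ℂ), ν ≠ 0 ∧ (0 ∉ K → l = 0) ∧
      (1 ∉ K → m = 0) ∧ 1 ≤ l + m ∧ IsGermWithLinearPart ω 0 0 ∧ AnalyticAt ℂ Z 0 ∧ Z 0 = 0 ∧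
      LinearIndependent ℂ ![covector X, covector Y, covector Z] ∧
      ∀ᶠ x in 𝓝 0, Z (f x) = ν * X x ^ l * Y x ^ m * Z x + ω (X x, Y x) := by
  obtain ⟨T, hT, hT0, hi⟩ := exists_completion_two hXY
  obtain ⟨l, m, ν, a, b, hν, hl, hm, hid, hZ⟩ := H.exists_fibre_form hX hX0 hY hY0 hT hT0 hi
    hG₁ hG₂ h₁ h₂ hK (by
      filter_upwards [hcrit] with x hx h
      obtain ⟨k, hk, hk0⟩ := hx h
      refine ⟨k, hk, ?_⟩
      fin_cases k
      · exact hk0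
      · exact hk0
      · exact absurd hk hK)
  have hlm : 1 ≤ l + m := by
    by_contra! h
    have := (hid (by omega)).2.2
    rw [hlam, mul_zero] at this
    exact mul_ne_zero hdet hν this.symm
  obtain ⟨Z, ω, hω, hZa, hZ0, hi', hZf⟩ := hZ hlm 1 ((b * a₂ - a * b₂) / (a₁ * b₂ - b₁ * a₂))
    ((a * b₁ - b * a₁) / (a₁ * b₂ - b₁ * a₂)) one_ne_zero
  refine ⟨l, m, ν, Z, ω, hν, hl, hm, hlm, ?_, hZa, hZ0, hi', hZf⟩
  have hΔ := mul_inv_cancel₀ hdet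
  convert hω using 1
  · linear_combination a * hΔ
  · linear_combination b * hΔ

theorem linearIndependent_scale {X Y Z : (Fin 3 → ℂ) → ℂ} (hX : AnalyticAt ℂ X 0)
    (hY : AnalyticAt ℂ Y 0) (hZ : AnalyticAt ℂ Z 0)
    (hi : LinearIndependent ℂ ![covector X, covector Y, covector Z]) {s t r : ℂ} (hs : s ≠ 0)
    (ht : t ≠ 0) (hr : r ≠ 0) : LinearIndependent ℂ ![covector fun x => s * X x,
      covector fun x => t * Y x, covector fun x => r * Z x] := by
  rw [covector_const_mul hX, covector_const_mul hY, covector_const_mul hZ]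
  have h2 := hi.units_smul ![Units.mk0 s hs, Units.mk0 t ht, Units.mk0 r hr]
  have h3 : (![Units.mk0 s hs, Units.mk0 t ht, Units.mk0 r hr] •
      ![covector X, covector Y, covector Z]) =
      ![s • covector X, t • covector Y, r • covector Z] := by
    ext1 i; fin_cases i <;> rfl
  rwa [h3] at h2

theorem linearIndependent_scale_two {X Y Z : (Fin 3 → ℂ) → ℂ} (hX : AnalyticAt ℂ X 0)
    (hY : AnalyticAt ℂ Y 0) (hZ : AnalyticAt ℂ Z 0)
    (hi : LinearIndependent ℂ ![covector X, covector Y, covector Z]) {s t : ℂ} (hs : s ≠ 0)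
    (ht : t ≠ 0) : LinearIndependent ℂ ![covector fun x => s * X x,
      covector fun x => t * Y x, covector Z] := by
  have := linearIndependent_scale hX hY hZ hi hs ht one_ne_zero
  simpa only [one_mul] using this

theorem normalForm_1_1_2_of_data {y : Fin 1 → (Fin 3 → ℂ) → ℂ}
    {A : Matrix (Fin 1) (Fin 1) ℕ} (R : NormalCrossingData f y A)
    (H : IsContractingWithEigenvalues f lam) (hord : ∀ i j, i ≤ j → ‖lam j‖ ≤ ‖lam i‖)
    (hA : A 0 0 = 1) (h0 : lam 0 ≠ 0) (h1 : lam 1 ≠ 0) (h2 : lam 2 = 0) :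
    NormalForm_1_1_2 f lam := by
  obtain ⟨c, X, hcl, hc, hX, hX0, hXc, hXf, hcrit⟩ := R.exists_linear_form H hA h2
  -- The critical component may belong to either non-zero eigenvalue. If it belongs to λ² ≠ λ¹, its
  -- equation is already an exact eigenfunction and no resonant term is needed.
  by_cases hcl0 : c = lam 0
  · subst hcl0
    obtain ⟨n, ρ, Y, hn, hρ, hY, hY0, hXY, hYf⟩ := H.exists_planar_form hord h0 h1 hX hX0 hXc hXf
    obtain ⟨l, m, ν, Z, ω, hν, -, hm, hlm, hω, hZ, hZ0, hi, hZf⟩ :=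
      H.exists_fibre_form_of_det_ne_zero h2 hX hX0 hY hY0 hXY
      (isGermWithLinearPart_linear (lam 0) 0)
      (isGermWithLinearPart_planar (lam 1) ρ (show n ≠ 0 by omega)) (by simpa using hXf) hYf
      (by simp [h0, h1]) {0} (by decide)
      (by filter_upwards [hcrit] with x hx h; exact ⟨0, by simp, hx.1 h⟩)
    obtain rfl : m = 0 := hm (by decide)
    obtain ⟨s, -, hs, -, hst⟩ : ∃ s t : ℂ, s ≠ 0 ∧ t ≠ 0 ∧ s ^ l = ν := by
      obtain ⟨s, t, hs, ht, hst⟩ := exists_pow_mul_pow_eq hν hlm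
      exact ⟨s, t, hs, ht, by simpa using hst⟩
    -- Scaling X by s normalises ν to 1; scaling Y by s^n at the same time preserves the coefficient
    -- ρ.
    refine ⟨l, _, by omega, by simpa using hω.scale s⁻¹ (s ^ n)⁻¹, Or.inl ⟨n, ρ, hn, hρ,
      hasNormalForm_of_triple H (X := fun x => s * X x) (Y := fun x => s ^ n * Y x)
        (analyticAt_const.fun_mul hX) (by simp [hX0]) (analyticAt_const.fun_mul hY) (by simp [hY0])
        hZ hZ0 (linearIndependent_scale_two hX hY hZ hi hs (pow_ne_zero n hs)) ?_ ?_⟩⟩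
    · filter_upwards [hXf, hYf, hZf] with x e1 e2 e3
      simp [e1, e2, e3, hs, mul_pow, hst]
      constructor <;> ring
    · simpa [hs] using hcrit
  · obtain rfl : c = lam 1 := hcl.resolve_left hcl0
    obtain ⟨w, hw, hw0, hwc, hwf⟩ := H.exists_eigenfunction hord h0
    obtain ⟨l, m, ν, Z, ω, hν, hl, -, hlm, hω, hZ, hZ0, hi, hZf⟩ :=
      H.exists_fibre_form_of_det_ne_zero h2 hw hw0 hX hX0
      (linearIndependent_of_eigenfunctions (codifferential_eigenfunction H hw hwf)
        (codifferential_eigenfunction H hX hXf) hwc hXc (Ne.symm hcl0))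
      (isGermWithLinearPart_linear (lam 0) 0)
      (isGermWithLinearPart_linear 0 (lam 1)) (by simpa using hwf) (by simpa using hXf)
      (by simp [h0, h1]) {1} (by decide)
      (by filter_upwards [hcrit] with x hx h; exact ⟨1, by simp, hx.1 h⟩)
    obtain rfl : l = 0 := hl (by decide)
    obtain ⟨s, t, _, ht, hst⟩ := exists_pow_mul_pow_eq hν hlm
    rw [pow_zero, one_mul] at hst
    refine ⟨m, _, by omega, by simpa using hω.scale 1 t⁻¹, Or.inr <|
      hasNormalForm_of_triple H (X := fun x => 1 * w x) (Y := fun x => t * X x)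
        (analyticAt_const.fun_mul hw) (by simp [hw0]) (analyticAt_const.fun_mul hX) (by simp [hX0])
        hZ hZ0 (linearIndependent_scale_two hw hX hZ hi one_ne_zero ht) ?_ ?_⟩
    · filter_upwards [hwf, hXf, hZf] with x e1 e2 e3
      simp [e1, e2, e3, ht, mul_pow, hst]
      ring
    · simpa [ht] using hcrit

theorem normalForm_2_2_2_fixed_of_eigenfunctions (H : IsContractingWithEigenvalues f lam)
    (h0 : lam 0 ≠ 0) (h1 : lam 1 ≠ 0) (h2 : lam 2 = 0)
    {X Y : (Fin 3 → ℂ) → ℂ} (hX : AnalyticAt ℂ X 0)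
    (hX0 : X 0 = 0) (hY : AnalyticAt ℂ Y 0) (hY0 : Y 0 = 0)
    (hXY : LinearIndependent ℂ ![covector X, covector Y])
    (hXf : ∀ᶠ x in 𝓝 0, X (f x) = lam 0 * X x) (hYf : ∀ᶠ x in 𝓝 0, Y (f x) = lam 1 * Y x)
    (hcrit : ∀ᶠ x in 𝓝 0, x ∈ genCritSet f ↔ X x = 0 ∨ Y x = 0) :
    NormalForm_2_2_2_fixed f lam := by
  obtain ⟨l, m, ν, Z, ω, hν, -, -, hlm, hω, hZ, hZ0, hi, hZf⟩ :=
    H.exists_fibre_form_of_det_ne_zero h2 hX hX0 hY hY0 hXY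
    (isGermWithLinearPart_linear (lam 0) 0)
    (isGermWithLinearPart_linear 0 (lam 1)) (by simpa using hXf) (by simpa using hYf)
    (by simp [h0, h1]) {0, 1} (by decide)
    (by filter_upwards [hcrit] with x hx h; simpa using hx.1 h)
  obtain ⟨s, t, hs, ht, hst⟩ := exists_pow_mul_pow_eq hν hlm
  obtain ⟨ω', hω', he⟩ : ∃ ω', IsGermWithLinearPart ω' 0 0 ∧ ∀ a b, ω' (s * a, t * b) = ω (a, b) :=
    ⟨_, by simpa using hω.scale s⁻¹ t⁻¹, fun a b => by simp [hs, ht]⟩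
  have hNF : HasNormalForm f (fun v => ![lam 0 * v 0, lam 1 * v 1,
      v 0 ^ l * v 1 ^ m * v 2 + ω' (v 0, v 1)]) {0, 1} := by
    refine hasNormalForm_of_triple H (X := fun x => s * X x) (Y := fun x => t * Y x)
      (analyticAt_const.fun_mul hX) (by simp [hX0]) (analyticAt_const.fun_mul hY) (by simp [hY0])
      hZ hZ0 (linearIndependent_scale_two hX hY hZ hi hs ht) ?_ ?_
    · filter_upwards [hXf, hYf, hZf] with x e1 e2 e3
      simp [e1, e2, e3, mul_pow, ← hst, he]
      refine ⟨?_, ?_, Or.inl ?_⟩ <;> ring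
    · simpa [hs, ht] using hcrit
  obtain ⟨c1, c2⟩ := constraint_2_2_2 H h0 h1 hNF
  exact ⟨l, m, _, c1, c2, hω', hNF⟩

theorem normalForm_2_2_2_swapped_of_functions (H : IsContractingWithEigenvalues f lam)
    (h2 : lam 2 = 0) {X Y : (Fin 3 → ℂ) → ℂ} (hX : AnalyticAt ℂ X 0)
    (hX0 : X 0 = 0) (hY : AnalyticAt ℂ Y 0) (hY0 : Y 0 = 0)
    (hXY : LinearIndependent ℂ ![covector X, covector Y]) {c₀ c₁ : ℂ} (hc₀ : c₀ ≠ 0) (hc₁ : c₁ ≠ 0)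
    (hc : c₀ * c₁ = -(lam 0 * lam 1))
    (hXf : ∀ᶠ x in 𝓝 0, X (f x) = c₀ * Y x) (hYf : ∀ᶠ x in 𝓝 0, Y (f x) = c₁ * X x)
    (hcrit : ∀ᶠ x in 𝓝 0, x ∈ genCritSet f ↔ X x = 0 ∨ Y x = 0) :
    NormalForm_2_2_2_swapped f lam := by
  obtain ⟨l, m, ν, Z, ω, hν, -, -, hlm, hω, hZ, hZ0, hi, hZf⟩ :=
    H.exists_fibre_form_of_det_ne_zero h2 hX hX0 hY hY0 hXY
    (isGermWithLinearPart_linear 0 c₀)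
    (isGermWithLinearPart_linear c₁ 0) (by simpa using hXf) (by simpa using hYf)
    (by simp [hc₀, hc₁]) {0, 1} (by decide)
    (by filter_upwards [hcrit] with x hx h; simpa using hx.1 h)
  obtain ⟨s, t, hs, ht, hst⟩ := exists_pow_mul_pow_eq hν hlm
  refine ⟨s * c₀ / t, t * c₁ / s, l, m, _, ?_, hlm, by simpa using hω.scale s⁻¹ t⁻¹,
    hasNormalForm_of_triple H (X := fun x => s * X x) (Y := fun x => t * Y x)
      (analyticAt_const.fun_mul hX) (by simp [hX0]) (analyticAt_const.fun_mul hY) (by simp [hY0])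
      hZ hZ0 (linearIndependent_scale_two hX hY hZ hi hs ht) ?_ ?_⟩
  · rw [← hc]; field_simp
  · filter_upwards [hXf, hYf, hZf] with x e1 e2 e3
    simp [e1, e2, e3, hs, ht, mul_pow, ← hst]
    refine ⟨?_, ?_, Or.inl (by ring)⟩
    · field_simp
    · field_simp
  · simpa [hs, ht] using hcrit

end InvertibleBase

/-! ### Two critical components, at least one of them periodic. -/

section TwoComponents

variable {f : (Fin 3 → ℂ) → (Fin 3 → ℂ)} {lam : Fin 3 → ℂ}
  {y : Fin 2 → (Fin 3 → ℂ) → ℂ} {A : Matrix (Fin 2) (Fin 2) ℕ}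

theorem NormalCrossingData.linearIndependent_two (R : NormalCrossingData f y A) :
    LinearIndependent ℂ ![covector (y 0), covector (y 1)] := by
  have e : ![covector (y 0), covector (y 1)] = fun k => covector (y k) := by
    ext1 i; fin_cases i <;> rfl
  rw [e]; exact R.indep

theorem linearIndependent_scale_pair {X Y : (Fin 3 → ℂ) → ℂ} (hX : AnalyticAt ℂ X 0)
    (hY : AnalyticAt ℂ Y 0) (hi : LinearIndependent ℂ ![covector X, covector Y]) {s t : ℂ}
    (hs : s ≠ 0) (ht : t ≠ 0) :
    LinearIndependent ℂ ![covector fun x => s * X x, covector fun x => t * Y x] := by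
  rw [covector_const_mul hX, covector_const_mul hY]
  have h2 := hi.units_smul ![Units.mk0 s hs, Units.mk0 t ht]
  have h3 : (![Units.mk0 s hs, Units.mk0 t ht] • ![covector X, covector Y]) =
      ![s • covector X, t • covector Y] := by
    ext1 i; fin_cases i <;> rfl
  rwa [h3] at h2

theorem codifferential_monomial (H : IsContractingWithEigenvalues f lam)
    {X Y : (Fin 3 → ℂ) → ℂ} (hX : AnalyticAt ℂ X 0) (hX0 : X 0 = 0) (hY : AnalyticAt ℂ Y 0)
    (hY0 : Y 0 = 0) {w : (Fin 3 → ℂ) → ℂ} (hw : AnalyticAt ℂ w 0) {β : ℂ} {c d : ℕ}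
    (hcd : 2 ≤ c + d) (h : ∀ᶠ x in 𝓝 0, w (f x) = β * X x ^ c * Y x ^ d) :
    codifferential f (covector w) = 0 := by
  rw [codifferential_covector H.analytic H.apply_zero hw, covector_congr h,
    covector_comp_pair (isGermWithLinearPart_monomial hcd β) hX hX0 hY hY0]
  simp

/-- The equations are normalised in succession. The first change replaces y₀ by y₀exp(v₀), which
alters the unit of the second equation by exp(-A₀₁v₀); this is absorbed by v₁ because A₁₁ ≥ 1. The
remaining constant is removed by scaling. -/
theorem NormalCrossingData.exists_skew_form (R : NormalCrossingData f y A)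
    (H : IsContractingWithEigenvalues f lam) (h00 : A 0 0 = 1) (h10 : A 1 0 = 0)
    (h11 : 1 ≤ A 1 1) (hsum : 2 ≤ A 0 1 + A 1 1) :
    ∃ (μ : ℂ) (X Y : (Fin 3 → ℂ) → ℂ), μ ≠ 0 ∧ AnalyticAt ℂ X 0 ∧ X 0 = 0 ∧ AnalyticAt ℂ Y 0 ∧
      Y 0 = 0 ∧ LinearIndependent ℂ ![covector X, covector Y] ∧
      (∀ᶠ x in 𝓝 0, X (f x) = μ * X x) ∧ (∀ᶠ x in 𝓝 0, Y (f x) = X x ^ A 0 1 * Y x ^ A 1 1) ∧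
      (∀ᶠ x in 𝓝 0, x ∈ genCritSet f ↔ X x = 0 ∨ Y x = 0) ∧ codifferential f (covector Y) = 0 := by
  obtain ⟨u₀, hu₀, hu₀0, he₀⟩ := R.pullback 0
  obtain ⟨u₁, hu₁, hu₁0, he₁⟩ := R.pullback 1
  simp only [Fin.prod_univ_two, h00, h10, pow_one, pow_zero, mul_one] at he₀ he₁
  obtain ⟨v₀, hv₀, hv₀0, hX⟩ := H.exists_normalisation (y := y 0) (P := fun _ => 1) (d := 1)
    le_rfl hu₀ hu₀0 (by
      filter_upwards [he₀] with x hx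
      rw [hx]; ring)
  have hu' : AnalyticAt ℂ (fun x => u₁ x * Complex.exp (-(A 0 1 * v₀ x))) 0 :=
    hu₁.fun_mul (analyticAt_const.fun_mul hv₀).fun_neg.cexp'
  obtain ⟨v₁, hv₁, hv₁0, hY⟩ := H.exists_normalisation (y := y 1)
    (P := fun x => (y 0 x * Complex.exp (v₀ x)) ^ A 0 1) h11 hu' (by simp [hu₁0]) (by
      filter_upwards [he₁] with x hx
      have h1 : Complex.exp (v₀ x) ^ A 0 1 * Complex.exp (-(A 0 1 * v₀ x)) = 1 := by
        rw [← Complex.exp_nat_mul, ← Complex.exp_add, add_neg_cancel, Complex.exp_zero]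
      rw [hx, mul_pow]
      linear_combination -(y 0 x ^ A 0 1 * y 1 x ^ A 1 1 * u₁ x) * h1)
  obtain ⟨s, t, hs, ht, hst⟩ := exists_pow_mul_pow_eq (l := A 0 1) (m := A 1 1 - 1)
    (show u₁ 0 * Complex.exp (-(A 0 1 * v₀ 0)) ≠ 0 by simp [hu₁0]) (by omega)
  have hXa := analyticAt_mul_exp (R.analytic 0) hv₀
  have hYa := analyticAt_mul_exp (R.analytic 1) hv₁
  have hXs : AnalyticAt ℂ (fun x => s * (y 0 x * Complex.exp (v₀ x))) 0 :=
    analyticAt_const.fun_mul hXa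
  have hYs : AnalyticAt ℂ (fun x => t * (y 1 x * Complex.exp (v₁ x))) 0 :=
    analyticAt_const.fun_mul hYa
  have hYf : ∀ᶠ x in 𝓝 0, t * (y 1 (f x) * Complex.exp (v₁ (f x))) =
      (s * (y 0 x * Complex.exp (v₀ x))) ^ A 0 1 * (t * (y 1 x * Complex.exp (v₁ x))) ^ A 1 1 := by
    filter_upwards [hY] with x hx
    obtain ⟨d, hd⟩ : ∃ d, A 1 1 = d + 1 := ⟨A 1 1 - 1, by omega⟩
    rw [hx, mul_pow s, mul_pow t, ← hst, hd, Nat.add_sub_cancel, pow_succ t]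
    ring
  refine ⟨u₀ 0, _, _, hu₀0, hXs, by simp [R.apply_zero], hYs, by simp [R.apply_zero],
    linearIndependent_scale_pair hXa hYa ?_ hs ht, ?_, hYf, ?_, ?_⟩
  · rw [covector_mul_exp (R.analytic 0) (R.apply_zero 0) hv₀ hv₀0,
      covector_mul_exp (R.analytic 1) (R.apply_zero 1) hv₁ hv₁0]
    exact R.linearIndependent_two
  · filter_upwards [hX] with x hx
    rw [hx]; ring
  · filter_upwards [R.crit] with x hx
    rw [hx]; simp [hs, ht, Fin.exists_fin_two]
  · exact codifferential_monomial H hXs (by simp [R.apply_zero]) hYs (by simp [R.apply_zero]) hYs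
      (β := 1) hsum (by simpa only [one_mul] using hYf)

theorem IsContractingWithEigenvalues.eigenfunction_eigenvalue
    (H : IsContractingWithEigenvalues f lam) (h2 : lam 2 = 0) {X : (Fin 3 → ℂ) → ℂ}
    (hX : AnalyticAt ℂ X 0) (hXc : covector X ≠ 0) {μ : ℂ} (hμ : μ ≠ 0)
    (h : ∀ᶠ x in 𝓝 0, X (f x) = μ * X x) : μ = lam 0 ∨ μ = lam 1 := by
  rcases H.eq_or_eq_of_covector hXc (codifferential_eigenfunction H hX h) with h | h | h
  · exact Or.inl h
  · exact Or.inr h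
  · exact absurd (h.trans h2) hμ

theorem normalForm_2_1_1_of_data (R : NormalCrossingData f y A)
    (H : IsContractingWithEigenvalues f lam) (h00 : A 0 0 = 1) (h10 : A 1 0 = 0)
    (h11 : 1 ≤ A 1 1) (hsum : 2 ≤ A 0 1 + A 1 1) (h1 : lam 1 = 0) (h2 : lam 2 = 0) :
    NormalForm_2_1_1 f lam := by
  obtain ⟨μ, X, Y, hμ, hX, hX0, hY, hY0, hXY, hXf, hYf, hcrit, -⟩ :=
    R.exists_skew_form H h00 h10 h11 hsum
  obtain rfl : μ = lam 0 :=
    (H.eigenfunction_eigenvalue h2 hX (hXY.ne_zero 0) hμ hXf).resolve_right fun h => hμ (h.trans h1)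
  obtain ⟨T, hT, hT0, hi⟩ := exists_completion_two hXY
  obtain ⟨l, m, ν, a, b, hν, -, -, hid, hZ⟩ := H.exists_fibre_form hX hX0 hY hY0 hT hT0 hi
    (K := {0, 1}) (isGermWithLinearPart_linear (lam 0) 0)
    (isGermWithLinearPart_monomial (l := A 0 1) (m := A 1 1) hsum 1)
    (by simpa using hXf) (by simpa using hYf) (by decide)
    (by filter_upwards [hcrit] with x hx h; simpa using hx.1 h)
  have hm : 1 ≤ l + m := by
    by_contra! hm
    have := (hid (by omega)).2.1
    simp [h1, h2, hμ, hν] at this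
  obtain ⟨t, ht, htb⟩ := exists_unit_linear_coefficient b
  obtain ⟨Z, ω, hω, hZa, hZ0, hi', hZf⟩ := hZ hm t (-(t * a) / lam 0) 0 ht
  have hNF : HasNormalForm f (fun v => ![lam 0 * v 0, v 0 ^ A 0 1 * v 1 ^ A 1 1,
        ν * v 0 ^ l * v 1 ^ m * v 2 + ω (v 0, v 1)]) {0, 1} := by
    refine hasNormalForm_of_triple H hX hX0 hY hY0 hZa hZ0 hi' ?_ ?_
    · filter_upwards [hXf, hYf, hZf] with x e1 e2 e3
      simp [e1, e2, e3]
    · simpa using hcrit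
  obtain ⟨c1, c2⟩ := constraint_2_1_1 H hμ hν h11 hNF
  refine ⟨A 0 1, A 1 1, l, m, ν, t * b, ω, hsum, hm, c1, h11, c2, hν, htb, ?_, hNF⟩
  convert hω using 1
  · field_simp; ring
  · ring

theorem normalForm_2_1_2_of_data (R : NormalCrossingData f y A)
    (H : IsContractingWithEigenvalues f lam) (hord : ∀ i j, i ≤ j → ‖lam j‖ ≤ ‖lam i‖)
    (h00 : A 0 0 = 1) (h10 : A 1 0 = 0) (h11 : 1 ≤ A 1 1) (hsum : 2 ≤ A 0 1 + A 1 1)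
    (h0 : lam 0 ≠ 0) (h1 : lam 1 ≠ 0) (h2 : lam 2 = 0) : NormalForm_2_1_2 f lam := by
  obtain ⟨μ, X, Z, hμ, hX, hX0, hZ, hZ0, hXZ, hXf, hZf, hcrit, hSZ⟩ :=
    R.exists_skew_form H h00 h10 h11 hsum
  have hXc : covector X ≠ 0 := hXZ.ne_zero 0
  have hZc : covector Z ≠ 0 := hXZ.ne_zero 1
  by_cases hμ0 : μ = lam 0
  · subst hμ0
    obtain ⟨n, ρ, Y, hn, hρ, hY, hY0, hXY, hYf⟩ := H.exists_planar_form hord h0 h1 hX hX0 hXc hXf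
    have hNF : HasNormalForm f (fun v => ![lam 0 * v 0, lam 1 * v 1 + ρ * v 0 ^ n,
        v 0 ^ A 0 1 * v 2 ^ A 1 1]) {0, 2} := by
      refine hasNormalForm_of_triple H hX hX0 hY hY0 hZ hZ0
        (linearIndependent_of_kernel hXY hZc (codifferential_eigenfunction H hX hXf)
        (codifferential_of_planar H hX hX0 hY hY0 hYf (by omega)) hSZ h0 h1) ?_ ?_
      · filter_upwards [hXf, hYf, hZf] with x e1 e2 e3
        simp [e1, e2, e3]
      · simpa using hcrit
    obtain ⟨c1, c2⟩ := constraint_2_1_2_fst H h0 h1 h11 hNF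
    exact ⟨A 0 1, A 1 1, c1, c2, Or.inl ⟨n, ρ, hn, hρ, hNF⟩⟩
  · obtain rfl : μ = lam 1 := (H.eigenfunction_eigenvalue h2 hX hXc hμ hXf).resolve_left hμ0
    obtain ⟨w, hw, hw0, hwc, hwf⟩ := H.exists_eigenfunction hord h0
    have hSX := codifferential_eigenfunction H hX hXf
    have hSw := codifferential_eigenfunction H hw hwf
    have hNF : HasNormalForm f (fun v => ![lam 0 * v 0, lam 1 * v 1,
        v 1 ^ A 0 1 * v 2 ^ A 1 1]) {1, 2} := by
      refine hasNormalForm_of_triple H hw hw0 hX hX0 hZ hZ0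
        (linearIndependent_of_kernel (c := 0)
          (linearIndependent_of_eigenfunctions hSw hSX hwc hXc (Ne.symm hμ0)) hZc
          hSw (by rw [hSX]; simp) hSZ h0 h1) ?_ ?_
      · filter_upwards [hwf, hXf, hZf] with x e1 e2 e3
        simp [e1, e2, e3]
      · simpa using hcrit
    obtain ⟨c1, c2⟩ := constraint_2_1_2_snd H h0 h1 h11 hNF
    exact ⟨A 0 1, A 1 1, c1, c2, Or.inr hNF⟩

theorem exists_fixed_pair (H : IsContractingWithEigenvalues f lam) {q : ℕ}
    {y : Fin q → (Fin 3 → ℂ) → ℂ} {A : Matrix (Fin q) (Fin q) ℕ} (R : NormalCrossingData f y A)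
    {k : Fin q} (hk : ∀ i, A i k = if i = k then 1 else 0) :
    ∃ (μ : ℂ) (v : (Fin 3 → ℂ) → ℂ), μ ≠ 0 ∧ AnalyticAt ℂ v 0 ∧ v 0 = 0 ∧
      ∀ᶠ x in 𝓝 0, y k (f x) * Complex.exp (v (f x)) = μ * (y k x * Complex.exp (v x)) := by
  obtain ⟨u, hu, hu0, he⟩ := R.pullback k
  obtain ⟨v, hv, hv0, hX⟩ := H.exists_normalisation (y := y k) (P := fun _ => 1) (d := 1)
    le_rfl hu hu0 (by
      filter_upwards [he] with x hx
      rw [hx]; simp [hk])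
  refine ⟨u 0, v, hu0, hv, hv0, ?_⟩
  filter_upwards [hX] with x hx
  rw [hx]; ring

theorem exists_swapped_pair (H : IsContractingWithEigenvalues f lam) {q : ℕ}
    {y : Fin q → (Fin 3 → ℂ) → ℂ} {A : Matrix (Fin q) (Fin q) ℕ} (R : NormalCrossingData f y A)
    {k l : Fin q} (hk : ∀ i, A i k = if i = l then 1 else 0)
    (hl : ∀ i, A i l = if i = k then 1 else 0) :
    ∃ (μ ν : ℂ) (v w : (Fin 3 → ℂ) → ℂ), μ ≠ 0 ∧ ν ≠ 0 ∧ AnalyticAt ℂ v 0 ∧ v 0 = 0 ∧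
      AnalyticAt ℂ w 0 ∧ w 0 = 0 ∧
      (∀ᶠ x in 𝓝 0, y k (f x) * Complex.exp (v (f x)) = μ * (y l x * Complex.exp (w x))) ∧
      ∀ᶠ x in 𝓝 0, y l (f x) * Complex.exp (w (f x)) = ν * (y k x * Complex.exp (v x)) := by
  obtain ⟨u, hu, hu0, he⟩ := R.pullback k
  obtain ⟨u', hu', hu'0, he'⟩ := R.pullback l
  obtain ⟨v, w, hv, hv0, hw, hw0, h1, h2⟩ := H.exists_normalisation_swap (y₀ := y k) (y₁ := y l)
    hu hu0 hu' hu'0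
    (by filter_upwards [he] with x hx; rw [hx]; simp [hk])
    (by filter_upwards [he'] with x hx; rw [hx]; simp [hl])
  exact ⟨u 0, u' 0, v, w, hu0, hu'0, hv, hv0, hw, hw0, h1, h2⟩

/-- Two eigenvalues of eigenfunctions with independent differentials are, up to order, the two
nonzero eigenvalues. -/
theorem IsContractingWithEigenvalues.eigenvalues_of_pair (H : IsContractingWithEigenvalues f lam)
    (h2 : lam 2 = 0) {X Y : (Fin 3 → ℂ) → ℂ}
    (hXY : LinearIndependent ℂ ![covector X, covector Y]) {μ ν : ℂ} (hμ : μ ≠ 0) (hν : ν ≠ 0)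
    (hX : codifferential f (covector X) = μ • covector X)
    (hY : codifferential f (covector Y) = ν • covector Y) :
    lam 0 ≠ 0 ∧ lam 1 ≠ 0 ∧ (μ = lam 0 ∧ ν = lam 1 ∨ μ = lam 1 ∧ ν = lam 0) := by
  obtain ⟨τ, e1, e2, e3⟩ := H.planar_identities h2 hXY (a₁ := μ) (b₁ := 0) (a₂ := 0) (b₂ := ν)
    (by rw [hX]; simp) (by rw [hY]; simp)
  obtain rfl : τ = 0 := by simpa [hμ, hν] using e3
  have h0 : lam 0 * lam 1 ≠ 0 := by rw [e2]; simp [hμ, hν]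
  refine ⟨left_ne_zero_of_mul h0, right_ne_zero_of_mul h0, ?_⟩
  have h3 : (μ - lam 0) * (μ - lam 1) = 0 := by linear_combination -μ * e1 + e2
  rcases mul_eq_zero.1 h3 with h | h
  · exact Or.inl ⟨by linear_combination h, by linear_combination -e1 - h⟩
  · exact Or.inr ⟨by linear_combination h, by linear_combination -e1 - h⟩

/-- On the span of the two covectors the swap has determinant -μν ≠ 0. Singularity of df₀ therefore
forces the third diagonal entry to vanish, and λ¹λ² is that determinant. -/
theorem IsContractingWithEigenvalues.eigenvalues_of_swapped_pair
    (H : IsContractingWithEigenvalues f lam) (h2 : lam 2 = 0) {X Y : (Fin 3 → ℂ) → ℂ}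
    (hXY : LinearIndependent ℂ ![covector X, covector Y]) {μ ν : ℂ} (hμ : μ ≠ 0) (hν : ν ≠ 0)
    (hX : codifferential f (covector X) = μ • covector Y)
    (hY : codifferential f (covector Y) = ν • covector X) :
    lam 0 ≠ 0 ∧ lam 1 ≠ 0 ∧ μ * ν = -(lam 0 * lam 1) := by
  obtain ⟨τ, e1, e2, e3⟩ := H.planar_identities h2 hXY (a₁ := 0) (b₁ := μ) (a₂ := ν) (b₂ := 0)
    (by rw [hX]; simp) (by rw [hY]; simp)
  obtain rfl : τ = 0 := by simpa [hμ, hν] using e3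
  have h0 : lam 0 * lam 1 ≠ 0 := by rw [e2]; simp [hμ, hν]
  exact ⟨left_ne_zero_of_mul h0, right_ne_zero_of_mul h0, by rw [e2]; ring⟩

theorem normalForm_2_2_2_fixed_of_data (R : NormalCrossingData f y A)
    (H : IsContractingWithEigenvalues f lam) (h2 : lam 2 = 0)
    (hA0 : ∀ i, A i 0 = if i = 0 then 1 else 0) (hA1 : ∀ i, A i 1 = if i = 1 then 1 else 0) :
    lam 0 ≠ 0 ∧ lam 1 ≠ 0 ∧ NormalForm_2_2_2_fixed f lam := by
  obtain ⟨μ, v, hμ, hv, hv0, hXf⟩ := exists_fixed_pair H R hA0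
  obtain ⟨ν, w, hν, hw, hw0, hYf⟩ := exists_fixed_pair H R hA1
  have hX := analyticAt_mul_exp (R.analytic 0) hv
  have hY := analyticAt_mul_exp (R.analytic 1) hw
  have hX0 : y 0 0 * Complex.exp (v 0) = 0 := by simp [R.apply_zero]
  have hY0 : y 1 0 * Complex.exp (w 0) = 0 := by simp [R.apply_zero]
  have hXY : LinearIndependent ℂ ![covector fun x => y 0 x * Complex.exp (v x),
      covector fun x => y 1 x * Complex.exp (w x)] := by
    rw [covector_mul_exp (R.analytic 0) (R.apply_zero 0) hv hv0,
      covector_mul_exp (R.analytic 1) (R.apply_zero 1) hw hw0]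
    exact R.linearIndependent_two
  have hcrit : ∀ᶠ x in 𝓝 0, x ∈ genCritSet f ↔ y 0 x * Complex.exp (v x) = 0 ∨
      y 1 x * Complex.exp (w x) = 0 := by
    filter_upwards [R.crit] with x hx
    rw [hx]; simp [Fin.exists_fin_two]
  obtain ⟨h0, h1, h⟩ := H.eigenvalues_of_pair h2 hXY hμ hν (codifferential_eigenfunction H hX hXf)
    (codifferential_eigenfunction H hY hYf)
  refine ⟨h0, h1, ?_⟩
  rcases h with ⟨rfl, rfl⟩ | ⟨rfl, rfl⟩
  · exact normalForm_2_2_2_fixed_of_eigenfunctions H h0 h1 h2 hX hX0 hY hY0 hXY hXf hYf hcrit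
  · exact normalForm_2_2_2_fixed_of_eigenfunctions H h0 h1 h2 hY hY0 hX hX0
      (LinearIndependent.pair_symm_iff.1 hXY) hYf hXf (by simpa only [or_comm] using hcrit)

theorem normalForm_2_2_2_swapped_of_data (R : NormalCrossingData f y A)
    (H : IsContractingWithEigenvalues f lam) (h2 : lam 2 = 0)
    (hA0 : ∀ i, A i 0 = if i = 1 then 1 else 0) (hA1 : ∀ i, A i 1 = if i = 0 then 1 else 0) :
    lam 0 ≠ 0 ∧ lam 1 ≠ 0 ∧ NormalForm_2_2_2_swapped f lam := by
  obtain ⟨μ, ν, v, w, hμ, hν, hv, hv0, hw, hw0, hXf, hYf⟩ := exists_swapped_pair H R hA0 hA1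
  have hX := analyticAt_mul_exp (R.analytic 0) hv
  have hY := analyticAt_mul_exp (R.analytic 1) hw
  have hX0 : y 0 0 * Complex.exp (v 0) = 0 := by simp [R.apply_zero]
  have hY0 : y 1 0 * Complex.exp (w 0) = 0 := by simp [R.apply_zero]
  have hXY : LinearIndependent ℂ ![covector fun x => y 0 x * Complex.exp (v x),
      covector fun x => y 1 x * Complex.exp (w x)] := by
    rw [covector_mul_exp (R.analytic 0) (R.apply_zero 0) hv hv0,
      covector_mul_exp (R.analytic 1) (R.apply_zero 1) hw hw0]
    exact R.linearIndependent_two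
  have hcrit : ∀ᶠ x in 𝓝 0, x ∈ genCritSet f ↔ y 0 x * Complex.exp (v x) = 0 ∨
      y 1 x * Complex.exp (w x) = 0 := by
    filter_upwards [R.crit] with x hx
    rw [hx]; simp [Fin.exists_fin_two]
  obtain ⟨h0, h1, h⟩ := H.eigenvalues_of_swapped_pair h2 hXY hμ hν
    (by rw [codifferential_covector H.analytic H.apply_zero hX, covector_congr hXf,
      covector_const_mul hY])
    (by rw [codifferential_covector H.analytic H.apply_zero hY, covector_congr hYf,
      covector_const_mul hX])
  exact ⟨h0, h1, normalForm_2_2_2_swapped_of_functions H h2 hX hX0 hY hY0 hXY hμ hν h hXf hYf hcrit⟩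

end TwoComponents

/-! ### Two non-periodic components. -/

section SuperattractingPlane

variable {f : (Fin 3 → ℂ) → (Fin 3 → ℂ)} {lam : Fin 3 → ℂ}

theorem exists_isGermWithLinearPart_monomial (β : ℂ) {i j : ℕ} (h : 2 ≤ i ∨ 1 ≤ j) :
    ∃ b, IsGermWithLinearPart (fun z => β * z.1 ^ i * z.2 ^ j) 0 b := by
  by_cases hij : 2 ≤ i + j
  · exact ⟨0, isGermWithLinearPart_monomial hij β⟩
  · obtain ⟨rfl, rfl⟩ : i = 0 ∧ j = 1 := by omega
    refine ⟨β, ?_⟩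
    simpa using isGermWithLinearPart_linear 0 β

theorem int_det_ne_zero {D : Matrix (Fin 2) (Fin 2) ℕ} (h : D 0 0 * D 1 1 ≠ D 0 1 * D 1 0) :
    (D.map (Nat.cast : ℕ → ℤ)).det ≠ 0 := by
  rw [Matrix.det_fin_two]
  simp only [Matrix.map_apply]
  rw [sub_ne_zero]
  exact_mod_cast h

theorem normalForm_2_0_0_of_data {y : Fin 2 → (Fin 3 → ℂ) → ℂ} {A : Matrix (Fin 2) (Fin 2) ℕ}
    (R : NormalCrossingData f y A) (H : IsContractingWithEigenvalues f lam)
    (hdet : A 0 0 * A 1 1 ≠ A 0 1 * A 1 0) (h₀ : 2 ≤ A 0 0 ∨ 1 ≤ A 1 0)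
    (h₁ : 2 ≤ A 0 1 + A 1 1) (hlam : ∀ i, lam i = 0) : NormalForm_2_0_0 f := by
  choose u hu hu0 he using R.pullback
  obtain ⟨v, hv, hv0, hyv⟩ := H.exists_normalisation_of_nilpotent hlam (int_det_ne_zero hdet) hu hu0 he
  obtain ⟨X, hX⟩ : ∃ X, X = fun x => y 0 x * Complex.exp (v 0 x) := ⟨_, rfl⟩
  obtain ⟨Y, hY⟩ : ∃ Y, Y = fun x => y 1 x * Complex.exp (v 1 x) := ⟨_, rfl⟩
  have hXa : AnalyticAt ℂ X 0 := hX ▸ analyticAt_mul_exp (R.analytic 0) (hv 0)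
  have hYa : AnalyticAt ℂ Y 0 := hY ▸ analyticAt_mul_exp (R.analytic 1) (hv 1)
  have hX0 : X 0 = 0 := by simp [hX, R.apply_zero]
  have hY0 : Y 0 = 0 := by simp [hY, R.apply_zero]
  have hXY : LinearIndependent ℂ ![covector X, covector Y] := by
    rw [hX, hY, covector_mul_exp (R.analytic 0) (R.apply_zero 0) (hv 0) (hv0 0),
      covector_mul_exp (R.analytic 1) (R.apply_zero 1) (hv 1) (hv0 1)]
    exact R.linearIndependent_two
  have hcrit : ∀ᶠ x in 𝓝 0, x ∈ genCritSet f ↔ X x = 0 ∨ Y x = 0 := by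
    filter_upwards [R.crit] with x hx
    rw [hx]; simp [Fin.exists_fin_two, hX, hY]
  have hXf : ∀ᶠ x in 𝓝 0, X (f x) = u 0 0 * X x ^ A 0 0 * Y x ^ A 1 0 := by
    filter_upwards [hyv] with x hx
    rw [hX, hY]
    simp only
    rw [hx 0, Fin.prod_univ_two, mul_assoc]
  have hYf : ∀ᶠ x in 𝓝 0, Y (f x) = u 1 0 * X x ^ A 0 1 * Y x ^ A 1 1 := by
    filter_upwards [hyv] with x hx
    rw [hX, hY]
    simp only
    rw [hx 1, Fin.prod_univ_two, mul_assoc]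
  obtain ⟨T, hT, hT0, hi⟩ := exists_completion_two hXY
  obtain ⟨b₁, hG₁⟩ := exists_isGermWithLinearPart_monomial (u 0 0) h₀
  obtain ⟨l, m, ν, a, b, hν, -, -, hid, hZ⟩ := H.exists_fibre_form hXa hX0 hYa hY0 hT hT0 hi
    (K := {0, 1}) hG₁ (isGermWithLinearPart_monomial h₁ (u 1 0)) hXf hYf (by decide)
    (by filter_upwards [hcrit] with x hx h; simpa using hx.1 h)
  -- If l = m = 0, the trace of df₀ would be ν ≠ 0, although all eigenvalues vanish.
  have hm : 1 ≤ l + m := by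
    by_contra! hm
    have := (hid (by omega)).1
    simp [hlam] at this
    exact hν this.symm
  obtain ⟨Z, ω, hω, hZa, hZ0, hi', hZf⟩ := hZ hm 1 0 0 one_ne_zero
  -- Since the constants β₁, β₂ and ν are left free, scaling X and Y is available to make each
  -- linear coefficient of ω equal to 0 or 1.
  obtain ⟨s, hs, hsa⟩ := exists_unit_linear_coefficient a
  obtain ⟨t, ht, htb⟩ := exists_unit_linear_coefficient b
  refine ⟨A, s⁻¹ * u 0 0 * s ^ A 0 0 * t ^ A 1 0, t⁻¹ * u 1 0 * s ^ A 0 1 * t ^ A 1 1,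
    ν * s ^ l * t ^ m, l, m, s * a, t * b, _, by simp [hs, ht, hu0], by simp [hs, ht, hu0], hdet, h₁,
    h₀, by simp [hs, ht, hν], hm, hsa, htb, by simpa using hω.scale s t,
    hasNormalForm_of_triple H (X := fun x => s⁻¹ * X x) (Y := fun x => t⁻¹ * Y x)
      (analyticAt_const.fun_mul hXa) (by simp [hX0]) (analyticAt_const.fun_mul hYa) (by simp [hY0])
      hZa hZ0 (linearIndependent_scale_two hXa hYa hZa hi' (inv_ne_zero hs) (inv_ne_zero ht)) ?_ ?_⟩
  · filter_upwards [hXf, hYf, hZf] with x e1 e2 e3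
    have hpow : ∀ i j : ℕ, s ^ i * t ^ j * ((s⁻¹ * X x) ^ i * (t⁻¹ * Y x) ^ j) = X x ^ i * Y x ^ j := by
      intro i j
      rw [mul_mul_mul_comm, ← mul_pow, ← mul_pow, mul_inv_cancel_left₀ hs, mul_inv_cancel_left₀ ht]
    ext i
    fin_cases i
    · change s⁻¹ * u 0 0 * s ^ A 0 0 * t ^ A 1 0 * (s⁻¹ * X x) ^ A 0 0 * (t⁻¹ * Y x) ^ A 1 0 =
        s⁻¹ * X (f x)
      rw [e1]
      linear_combination s⁻¹ * u 0 0 * hpow (A 0 0) (A 1 0)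
    · change t⁻¹ * u 1 0 * s ^ A 0 1 * t ^ A 1 1 * (s⁻¹ * X x) ^ A 0 1 * (t⁻¹ * Y x) ^ A 1 1 =
        t⁻¹ * Y (f x)
      rw [e2]
      linear_combination t⁻¹ * u 1 0 * hpow (A 0 1) (A 1 1)
    · change ν * s ^ l * t ^ m * (s⁻¹ * X x) ^ l * (t⁻¹ * Y x) ^ m * Z x +
        ω (s * (s⁻¹ * X x), t * (t⁻¹ * Y x)) = Z (f x)
      rw [e3, mul_inv_cancel_left₀ hs, mul_inv_cancel_left₀ ht]
      linear_combination ν * Z x * hpow l m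
  · simpa [hs, ht] using hcrit

/-- The linearised solution leaves a factor 1 + γw^n; scaling w by an n-th root of γ makes its
coefficient 1. The factors P allow powers of w in the two equations, as needed when there is a
third, periodic component. -/
theorem IsContractingWithEigenvalues.exists_resonant_pair_form
    (H : IsContractingWithEigenvalues f lam) (h0 : lam 0 ≠ 0) (h1 : lam 1 = 0) (h2 : lam 2 = 0)
    {w : (Fin 3 → ℂ) → ℂ} (hw : AnalyticAt ℂ w 0)
    (hw0 : w 0 = 0) (hwc : covector w ≠ 0) (hwf : ∀ᶠ x in 𝓝 0, w (f x) = lam 0 * w x)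
    {D : Matrix (Fin 2) (Fin 2) ℕ} (hD : D 0 0 * D 1 1 ≠ D 0 1 * D 1 0)
    {y P u : Fin 2 → (Fin 3 → ℂ) → ℂ} (hu : ∀ k, AnalyticAt ℂ (u k) 0) (hu0 : ∀ k, u k 0 ≠ 0)
    (hy : ∀ k, ∀ᶠ x in 𝓝 0, y k (f x) = P k x * (∏ l, y l x ^ D l k) * u k x) :
    ∃ (n : ℕ) (g t : ℂ), 1 ≤ n ∧ t ≠ 0 ∧ (g = 0 ∨ g = 1 ∧ characteristicValue D (lam 0 ^ n) = 0) ∧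
      ∃ v : Fin 2 → (Fin 3 → ℂ) → ℂ, (∀ k, AnalyticAt ℂ (v k) 0) ∧ (∀ k, v k 0 = 0) ∧
        ∀ᶠ x in 𝓝 0, ∀ k, y k (f x) * Complex.exp (v k (f x)) =
          u k 0 * P k x * ![1 + g * (t * w x) ^ n, 1] k *
            ∏ l, (y l x * Complex.exp (v l x)) ^ D l k := by
  choose h hh hh0 hlog using fun k => exists_log (hu k) (hu0 k)
  obtain ⟨n, γ, hn, hγ, v, hv, hv0, hv₀, hv₁⟩ := H.exists_solution_of_eigenfunction h0 h1 h2 hw hw0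
    hwc hwf hD hh hh0
  obtain ⟨g, t, ht, hg, hgt⟩ : ∃ g t : ℂ, t ≠ 0 ∧
      (g = 0 ∨ g = 1 ∧ characteristicValue D (lam 0 ^ n) = 0) ∧ g * t ^ n = γ := by
    by_cases hγ0 : γ = 0
    · exact ⟨0, 1, one_ne_zero, Or.inl rfl, by simp [hγ0]⟩
    · obtain ⟨s, t, _, ht, hst⟩ := exists_pow_mul_pow_eq hγ0 (l := 0) (m := n) (by omega)
      exact ⟨1, t, ht, Or.inr ⟨rfl, hγ.resolve_left hγ0⟩, by simpa using hst⟩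
  refine ⟨n, g, t, hn, ht, hg, v, hv, hv0, ?_⟩
  have hne : ∀ᶠ x in 𝓝 0, 1 + γ * w x ^ n ≠ 0 := by
    have hc : ContinuousAt (fun x => 1 + γ * w x ^ n) 0 :=
      (analyticAt_const.fun_add (analyticAt_const.fun_mul (hw.fun_pow n))).continuousAt
    refine hc.eventually_ne ?_
    simp [hw0, show n ≠ 0 by omega]
  filter_upwards [hv₀, hv₁, hne, hy 0, hy 1, hlog 0, hlog 1] with x e0 e1 e2 e3 e4 e5 e6 k
  have hgw : g * (t * w x) ^ n = γ * w x ^ n := by rw [mul_pow, ← hgt]; ring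
  refine exp_normalisation (c := fun k => u k 0) (Pf := fun k => P k x)
    (u' := ![1 + g * (t * w x) ^ n, 1]) (yf := fun k => y k (f x)) (y := fun k => y k x)
    (u := fun k => u k x) (h := ![h 0 x - Complex.log (1 + γ * w x ^ n), h 1 x])
    (v := fun k => v k x) (vf := fun k => v k (f x)) ?_ ?_ ?_ k
  · intro k; fin_cases k
    · exact e3
    · exact e4
  · intro k; fin_cases k
    · change u 0 x = u 0 0 * (1 + g * (t * w x) ^ n) *
        Complex.exp (h 0 x - Complex.log (1 + γ * w x ^ n))
      rw [e5, hgw, Complex.exp_sub, Complex.exp_log e2]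
      field_simp
    · change u 1 x = u 1 0 * 1 * Complex.exp (h 1 x)
      rw [e6, mul_one]
  · intro k; fin_cases k
    · change v 0 (f x) = ∑ l, D l 0 * v l x - (h 0 x - Complex.log (1 + γ * w x ^ n))
      rw [Fin.sum_univ_two, e0]
    · change v 1 (f x) = ∑ l, D l 1 * v l x - h 1 x
      rw [Fin.sum_univ_two, e1]

theorem normalForm_2_0_1_of_data {y : Fin 2 → (Fin 3 → ℂ) → ℂ} {A : Matrix (Fin 2) (Fin 2) ℕ}
    (R : NormalCrossingData f y A) (H : IsContractingWithEigenvalues f lam)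
    (hord : ∀ i j, i ≤ j → ‖lam j‖ ≤ ‖lam i‖)
    (hdet : A 0 0 * A 1 1 ≠ A 0 1 * A 1 0) (hA : 2 ≤ A 0 0 ∨ 1 ≤ A 1 0)
    (hS₀ : codifferential f (codifferential f (covector (y 0))) = 0)
    (hS₁ : codifferential f (covector (y 1)) = 0)
    (h0 : lam 0 ≠ 0) (h1 : lam 1 = 0) (h2 : lam 2 = 0) : NormalForm_2_0_1 f lam := by
  choose u hu hu0 he using R.pullback
  obtain ⟨w, hw, hw0, hwc, hwf⟩ := H.exists_eigenfunction hord h0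
  obtain ⟨n, g, t, hn, ht, hg, v, hv, hv0, hyv⟩ := H.exists_resonant_pair_form h0 h1 h2 hw hw0 hwc hwf
    hdet (P := fun _ _ => 1) hu hu0 (fun k => by simpa only [one_mul] using he k)
  have hYZ : LinearIndependent ℂ ![covector fun x => y 0 x * Complex.exp (v 0 x),
      covector fun x => y 1 x * Complex.exp (v 1 x)] := by
    rw [covector_mul_exp (R.analytic 0) (R.apply_zero 0) (hv 0) (hv0 0),
      covector_mul_exp (R.analytic 1) (R.apply_zero 1) (hv 1) (hv0 1)]
    exact R.linearIndependent_two
  have hwt : AnalyticAt ℂ (fun x => t * w x) 0 := analyticAt_const.fun_mul hw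
  refine ⟨A, u 0 0, u 1 0, g, n, hu0 0, hu0 1, hdet, hA, hn, hg.imp_right fun h => ⟨h.1, ?_⟩,
    hasNormalForm_of_triple H (X := fun x => t * w x) (Y := fun x => y 0 x * Complex.exp (v 0 x))
      (Z := fun x => y 1 x * Complex.exp (v 1 x)) hwt (by simp [hw0])
      (analyticAt_mul_exp (R.analytic 0) (hv 0)) (by simp [R.apply_zero])
      (analyticAt_mul_exp (R.analytic 1) (hv 1)) (by simp [R.apply_zero])
      (linearIndependent_of_kernel_square (f := f) (a := lam 0) hYZ ?_ ?_ ?_ ?_ h0) ?_ ?_⟩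
  · exact sub_eq_zero.1 h.2
  · rw [covector_const_mul hw]; exact smul_ne_zero ht hwc
  · rw [covector_const_mul hw, map_smul, codifferential_eigenfunction H hw hwf, smul_comm]
  · rw [covector_mul_exp (R.analytic 0) (R.apply_zero 0) (hv 0) (hv0 0), hS₀]
  · rw [covector_mul_exp (R.analytic 1) (R.apply_zero 1) (hv 1) (hv0 1), hS₁, map_zero]
  · filter_upwards [hwf, hyv] with x e1 e2
    ext i
    fin_cases i
    · change lam 0 * (t * w x) = t * w (f x)
      rw [e1]; ring
    · refine Eq.trans ?_ (e2 0).symm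
      rw [Fin.prod_univ_two]
      change u 0 0 * (y 0 x * Complex.exp (v 0 x)) ^ A 0 0 *
        (y 1 x * Complex.exp (v 1 x)) ^ A 1 0 * (1 + g * (t * w x) ^ n) =
        u 0 0 * 1 * (1 + g * (t * w x) ^ n) * _
      ring
    · refine Eq.trans ?_ (e2 1).symm
      rw [Fin.prod_univ_two]
      change u 1 0 * (y 0 x * Complex.exp (v 0 x)) ^ A 0 1 *
        (y 1 x * Complex.exp (v 1 x)) ^ A 1 1 = u 1 0 * 1 * 1 * _
      ring
  · filter_upwards [R.crit] with x hx
    rw [hx]; simp [Fin.exists_fin_two]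

end SuperattractingPlane

/-! ### Three critical components. -/

section ThreeComponents

variable {f : (Fin 3 → ℂ) → (Fin 3 → ℂ)} {lam : Fin 3 → ℂ}
  {y : Fin 3 → (Fin 3 → ℂ) → ℂ} {A : Matrix (Fin 3) (Fin 3) ℕ}

theorem NormalCrossingData.linearIndependent_three (R : NormalCrossingData f y A) :
    LinearIndependent ℂ ![covector (y 0), covector (y 1), covector (y 2)] := by
  have e : ![covector (y 0), covector (y 1), covector (y 2)] = fun k => covector (y k) := by
    ext1 i; fin_cases i <;> rfl
  rw [e]; exact R.indep

theorem NormalCrossingData.linearIndependent_mul_exp (R : NormalCrossingData f y A)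
    {v : Fin 3 → (Fin 3 → ℂ) → ℂ} (hv : ∀ k, AnalyticAt ℂ (v k) 0) (hv0 : ∀ k, v k 0 = 0) :
    LinearIndependent ℂ ![covector fun x => y 0 x * Complex.exp (v 0 x),
      covector fun x => y 1 x * Complex.exp (v 1 x),
      covector fun x => y 2 x * Complex.exp (v 2 x)] := by
  rw [covector_mul_exp (R.analytic 0) (R.apply_zero 0) (hv 0) (hv0 0),
    covector_mul_exp (R.analytic 1) (R.apply_zero 1) (hv 1) (hv0 1),
    covector_mul_exp (R.analytic 2) (R.apply_zero 2) (hv 2) (hv0 2)]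
  exact R.linearIndependent_three

theorem linearIndependent_pair_of_triple {X Y Z : (Fin 3 → ℂ) → ℂ}
    (hi : LinearIndependent ℂ ![covector X, covector Y, covector Z]) :
    LinearIndependent ℂ ![covector X, covector Y] := by
  have h := hi.comp ![0, 1] (by decide)
  have e : (![covector X, covector Y, covector Z] ∘ ![0, 1]) = ![covector X, covector Y] := by
    ext1 i; fin_cases i <;> rfl
  rwa [e] at h

theorem linearIndependent_swap_of_triple {X Y Z : (Fin 3 → ℂ) → ℂ}
    (hi : LinearIndependent ℂ ![covector X, covector Y, covector Z]) :
    LinearIndependent ℂ ![covector Y, covector X, covector Z] := by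
  have h := hi.comp ![1, 0, 2] (by decide)
  have e : (![covector X, covector Y, covector Z] ∘ ![1, 0, 2]) =
      ![covector Y, covector X, covector Z] := by
    ext1 i; fin_cases i <;> rfl
  rwa [e] at h

theorem normalForm_3_0_0_of_data (R : NormalCrossingData f y A)
    (H : IsContractingWithEigenvalues f lam) (hdet : (A.map (Nat.cast : ℕ → ℤ)).det ≠ 0)
    (hA₀ : 2 ≤ A 0 0 ∨ 1 ≤ A 1 0 ∨ 1 ≤ A 2 0) (hA₁ : 2 ≤ A 0 1 + A 1 1 ∨ 1 ≤ A 2 1)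
    (hA₂ : 2 ≤ A 0 2 + A 1 2 + A 2 2) (hlam : ∀ i, lam i = 0) : NormalForm_3_0_0 f := by
  choose u hu hu0 he using R.pullback
  obtain ⟨v, hv, hv0, hyv⟩ := H.exists_normalisation_of_nilpotent hlam hdet hu hu0 he
  refine ⟨A, fun j => u j 0, hu0, hdet, hA₀, hA₁, hA₂,
    hasNormalForm_of_triple H (analyticAt_mul_exp (R.analytic 0) (hv 0)) (by simp [R.apply_zero])
      (analyticAt_mul_exp (R.analytic 1) (hv 1)) (by simp [R.apply_zero])
      (analyticAt_mul_exp (R.analytic 2) (hv 2)) (by simp [R.apply_zero])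
      (R.linearIndependent_mul_exp hv hv0) ?_ ?_⟩
  · filter_upwards [hyv] with x hx
    ext i
    refine Eq.trans ?_ ((hx i).symm.trans ?_)
    · rw [Fin.prod_univ_three]; rfl
    · fin_cases i <;> rfl
  · filter_upwards [R.crit] with x hx
    rw [hx]; simp [Fin.exists_fin_succ]

/-- If the monomial involves one of the first two variables, scaling that variable absorbs ν.
Otherwise d ≥ 2, and scaling the third variable by a (d-1)-th root does. -/
theorem exists_triple_pow_eq {ν : ℂ} (hν : ν ≠ 0) {a b d : ℕ} (hd : 1 ≤ d) (h : 2 ≤ a + b + d) :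
    ∃ s t r : ℂ, s ≠ 0 ∧ t ≠ 0 ∧ r ≠ 0 ∧ s ^ a * t ^ b * r ^ d = ν * r := by
  by_cases hab : 1 ≤ a + b
  · obtain ⟨s, t, hs, ht, hst⟩ := exists_pow_mul_pow_eq hν hab
    exact ⟨s, t, 1, hs, ht, one_ne_zero, by simp [hst]⟩
  · obtain ⟨s, r, -, hr, hst⟩ : ∃ s r : ℂ, s ≠ 0 ∧ r ≠ 0 ∧ r ^ (d - 1) = ν := by
      obtain ⟨s, r, hs, hr, h1⟩ := exists_pow_mul_pow_eq hν (l := 0) (m := d - 1) (by omega)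
      exact ⟨s, r, hs, hr, by simpa using h1⟩
    refine ⟨1, 1, r, one_ne_zero, one_ne_zero, hr, ?_⟩
    rw [one_pow, one_pow, one_mul, one_mul, ← hst, ← pow_succ, Nat.sub_add_cancel hd]

/-- A third equation, normalised relative to two equations that have been normalised before. -/
theorem NormalCrossingData.exists_relative_normalisation (R : NormalCrossingData f y A)
    (H : IsContractingWithEigenvalues f lam) (hA : 1 ≤ A 2 2) {v w : (Fin 3 → ℂ) → ℂ}
    (hv : AnalyticAt ℂ v 0) (hw : AnalyticAt ℂ w 0) :
    ∃ (β : ℂ) (z : (Fin 3 → ℂ) → ℂ), β ≠ 0 ∧ AnalyticAt ℂ z 0 ∧ z 0 = 0 ∧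
      ∀ᶠ x in 𝓝 0, y 2 (f x) * Complex.exp (z (f x)) =
        β * (y 0 x * Complex.exp (v x)) ^ A 0 2 * (y 1 x * Complex.exp (w x)) ^ A 1 2 *
          (y 2 x * Complex.exp (z x)) ^ A 2 2 := by
  obtain ⟨u, hu, hu0, he⟩ := R.pullback 2
  have hu' : AnalyticAt ℂ (fun x => u x * Complex.exp (-(A 0 2 * v x + A 1 2 * w x))) 0 :=
    hu.fun_mul ((analyticAt_const.fun_mul hv).fun_add (analyticAt_const.fun_mul hw)).fun_neg.cexp'
  obtain ⟨z, hz, hz0, hZ⟩ := H.exists_normalisation (y := y 2)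
    (P := fun x => (y 0 x * Complex.exp (v x)) ^ A 0 2 * (y 1 x * Complex.exp (w x)) ^ A 1 2)
    hA hu' (by simp [hu0]) (by
      filter_upwards [he] with x hx
      have h1 : Complex.exp (v x) ^ A 0 2 * Complex.exp (w x) ^ A 1 2 *
          Complex.exp (-(A 0 2 * v x + A 1 2 * w x)) = 1 := by
        rw [← Complex.exp_nat_mul, ← Complex.exp_nat_mul, ← Complex.exp_add, ← Complex.exp_add,
          add_neg_cancel, Complex.exp_zero]
      rw [hx, Fin.prod_univ_three, mul_pow, mul_pow]
      linear_combination -(y 0 x ^ A 0 2 * y 1 x ^ A 1 2 * y 2 x ^ A 2 2 * u x) * h1)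
  refine ⟨u 0 * Complex.exp (-(A 0 2 * v 0 + A 1 2 * w 0)), z, by simp [hu0], hz, hz0, ?_⟩
  filter_upwards [hZ] with x hx
  rw [hx]; ring

theorem normalForm_3_2_2_fixed_of_eigenfunctions (H : IsContractingWithEigenvalues f lam)
    (h0 : lam 0 ≠ 0) (h1 : lam 1 ≠ 0) {X Y Z : (Fin 3 → ℂ) → ℂ} (hX : AnalyticAt ℂ X 0)
    (hX0 : X 0 = 0) (hY : AnalyticAt ℂ Y 0) (hY0 : Y 0 = 0) (hZ : AnalyticAt ℂ Z 0) (hZ0 : Z 0 = 0)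
    (hi : LinearIndependent ℂ ![covector X, covector Y, covector Z]) {a b d : ℕ} {β : ℂ}
    (hβ : β ≠ 0) (hd : 1 ≤ d) (habd : 2 ≤ a + b + d)
    (hXf : ∀ᶠ x in 𝓝 0, X (f x) = lam 0 * X x) (hYf : ∀ᶠ x in 𝓝 0, Y (f x) = lam 1 * Y x)
    (hZf : ∀ᶠ x in 𝓝 0, Z (f x) = β * X x ^ a * Y x ^ b * Z x ^ d)
    (hcrit : ∀ᶠ x in 𝓝 0, x ∈ genCritSet f ↔ X x = 0 ∨ Y x = 0 ∨ Z x = 0) :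
    NormalForm_3_2_2_fixed f lam := by
  obtain ⟨s, t, r, hs, ht, hr, hst⟩ := exists_triple_pow_eq hβ hd habd
  have hNF : HasNormalForm f (fun v => ![lam 0 * v 0, lam 1 * v 1,
      v 0 ^ a * v 1 ^ b * v 2 ^ d]) {0, 1, 2} := by
    refine hasNormalForm_of_triple H (X := fun x => s * X x) (Y := fun x => t * Y x)
      (Z := fun x => r * Z x)
      (analyticAt_const.fun_mul hX) (by simp [hX0]) (analyticAt_const.fun_mul hY) (by simp [hY0])
      (analyticAt_const.fun_mul hZ) (by simp [hZ0]) (linearIndependent_scale hX hY hZ hi hs ht hr)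
      ?_ ?_
    · filter_upwards [hXf, hYf, hZf] with x e1 e2 e3
      ext i
      fin_cases i
      · change lam 0 * (s * X x) = s * X (f x)
        rw [e1]; ring
      · change lam 1 * (t * Y x) = t * Y (f x)
        rw [e2]; ring
      · change (s * X x) ^ a * (t * Y x) ^ b * (r * Z x) ^ d = r * Z (f x)
        rw [e3, mul_pow, mul_pow, mul_pow]
        linear_combination X x ^ a * Y x ^ b * Z x ^ d * hst
    · simpa [hs, ht, hr] using hcrit
  obtain ⟨c1, c2, c3⟩ := constraint_3_2_2 H h0 h1 hd hNF
  exact ⟨a, b, d, c1, c2, c3, hNF⟩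

theorem normalForm_3_2_2_swapped_of_functions (H : IsContractingWithEigenvalues f lam)
    {X Y Z : (Fin 3 → ℂ) → ℂ} (hX : AnalyticAt ℂ X 0)
    (hX0 : X 0 = 0) (hY : AnalyticAt ℂ Y 0) (hY0 : Y 0 = 0) (hZ : AnalyticAt ℂ Z 0) (hZ0 : Z 0 = 0)
    (hi : LinearIndependent ℂ ![covector X, covector Y, covector Z]) {a b d : ℕ} {β c₀ c₁ : ℂ}
    (hβ : β ≠ 0) (hd : 1 ≤ d) (habd : 2 ≤ a + b + d) (hc₀ : c₀ ≠ 0) (hc₁ : c₁ ≠ 0)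
    (hc : c₀ * c₁ = -(lam 0 * lam 1))
    (hXf : ∀ᶠ x in 𝓝 0, X (f x) = c₀ * Y x) (hYf : ∀ᶠ x in 𝓝 0, Y (f x) = c₁ * X x)
    (hZf : ∀ᶠ x in 𝓝 0, Z (f x) = β * X x ^ a * Y x ^ b * Z x ^ d)
    (hcrit : ∀ᶠ x in 𝓝 0, x ∈ genCritSet f ↔ X x = 0 ∨ Y x = 0 ∨ Z x = 0) :
    NormalForm_3_2_2_swapped f lam := by
  obtain ⟨s, t, r, hs, ht, hr, hst⟩ := exists_triple_pow_eq hβ hd habd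
  have hNF : HasNormalForm f (fun v => ![s * c₀ / t * v 1, t * c₁ / s * v 0,
      v 0 ^ a * v 1 ^ b * v 2 ^ d]) {0, 1, 2} := by
    refine hasNormalForm_of_triple H (X := fun x => s * X x) (Y := fun x => t * Y x)
      (Z := fun x => r * Z x)
      (analyticAt_const.fun_mul hX) (by simp [hX0]) (analyticAt_const.fun_mul hY) (by simp [hY0])
      (analyticAt_const.fun_mul hZ) (by simp [hZ0]) (linearIndependent_scale hX hY hZ hi hs ht hr)
      ?_ ?_
    · filter_upwards [hXf, hYf, hZf] with x e1 e2 e3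
      ext i
      fin_cases i
      · change s * c₀ / t * (t * Y x) = s * X (f x)
        rw [e1]; field_simp
      · change t * c₁ / s * (s * X x) = t * Y (f x)
        rw [e2]; field_simp
      · change (s * X x) ^ a * (t * Y x) ^ b * (r * Z x) ^ d = r * Z (f x)
        rw [e3, mul_pow, mul_pow, mul_pow]
        linear_combination X x ^ a * Y x ^ b * Z x ^ d * hst
    · simpa [hs, ht, hr] using hcrit
  obtain ⟨c1, c2⟩ := constraint_3_2_2_swapped H (by simp [hs, ht, hc₀]) (by simp [hs, ht, hc₁])
    hd hNF
  exact ⟨_, _, a, b, d, by rw [← hc]; field_simp, c1, c2, hNF⟩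

theorem one_le_of_det_ne_zero (hdet : (A.map (Nat.cast : ℕ → ℤ)).det ≠ 0) (h20 : A 2 0 = 0)
    (h21 : A 2 1 = 0) : 1 ≤ A 2 2 := by
  by_contra! h
  refine hdet ?_
  rw [Matrix.det_fin_three]
  simp [h20, h21, show A 2 2 = 0 by omega]

theorem normalForm_3_2_2_fixed_of_data (R : NormalCrossingData f y A)
    (H : IsContractingWithEigenvalues f lam) (h2 : lam 2 = 0)
    (hdet : (A.map (Nat.cast : ℕ → ℤ)).det ≠ 0)
    (hA0 : ∀ i, A i 0 = if i = 0 then 1 else 0) (hA1 : ∀ i, A i 1 = if i = 1 then 1 else 0)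
    (hA2 : 2 ≤ A 0 2 + A 1 2 + A 2 2) :
    lam 0 ≠ 0 ∧ lam 1 ≠ 0 ∧ NormalForm_3_2_2_fixed f lam := by
  have hd : 1 ≤ A 2 2 := one_le_of_det_ne_zero hdet (by simp [hA0]) (by simp [hA1])
  obtain ⟨μ, v, hμ, hv, hv0, hXf⟩ := exists_fixed_pair H R hA0
  obtain ⟨ν, w, hν, hw, hw0, hYf⟩ := exists_fixed_pair H R hA1
  obtain ⟨β, z, hβ, hz, hz0, hZf⟩ := R.exists_relative_normalisation H hd hv hw
  have hX := analyticAt_mul_exp (R.analytic 0) hv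
  have hY := analyticAt_mul_exp (R.analytic 1) hw
  have hZ := analyticAt_mul_exp (R.analytic 2) hz
  have hX0 : y 0 0 * Complex.exp (v 0) = 0 := by simp [R.apply_zero]
  have hY0 : y 1 0 * Complex.exp (w 0) = 0 := by simp [R.apply_zero]
  have hZ0 : y 2 0 * Complex.exp (z 0) = 0 := by simp [R.apply_zero]
  have hi := R.linearIndependent_mul_exp (v := ![v, w, z])
    (by intro k; fin_cases k <;> assumption) (by intro k; fin_cases k <;> assumption)
  have hcrit : ∀ᶠ x in 𝓝 0, x ∈ genCritSet f ↔ y 0 x * Complex.exp (v x) = 0 ∨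
      y 1 x * Complex.exp (w x) = 0 ∨ y 2 x * Complex.exp (z x) = 0 := by
    filter_upwards [R.crit] with x hx
    rw [hx]; simp [Fin.exists_fin_succ]
  have hXY := linearIndependent_pair_of_triple hi
  obtain ⟨h0, h1, h⟩ := H.eigenvalues_of_pair h2 hXY hμ hν (codifferential_eigenfunction H hX hXf)
    (codifferential_eigenfunction H hY hYf)
  refine ⟨h0, h1, ?_⟩
  rcases h with ⟨rfl, rfl⟩ | ⟨rfl, rfl⟩
  · exact normalForm_3_2_2_fixed_of_eigenfunctions H h0 h1 hX hX0 hY hY0 hZ hZ0 hi hβ hd hA2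
      hXf hYf hZf hcrit
  · refine normalForm_3_2_2_fixed_of_eigenfunctions H h0 h1 hY hY0 hX hX0 hZ hZ0
      (linearIndependent_swap_of_triple hi) (a := A 1 2) (b := A 0 2) hβ hd (by omega)
      hYf hXf ?_ ?_
    · filter_upwards [hZf] with x hx
      rw [hx]; ring
    · filter_upwards [hcrit] with x hx
      rw [hx, or_left_comm]

theorem normalForm_3_2_2_swapped_of_data (R : NormalCrossingData f y A)
    (H : IsContractingWithEigenvalues f lam) (h2 : lam 2 = 0)
    (hdet : (A.map (Nat.cast : ℕ → ℤ)).det ≠ 0)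
    (hA0 : ∀ i, A i 0 = if i = 1 then 1 else 0) (hA1 : ∀ i, A i 1 = if i = 0 then 1 else 0)
    (hA2 : 2 ≤ A 0 2 + A 1 2 + A 2 2) :
    lam 0 ≠ 0 ∧ lam 1 ≠ 0 ∧ NormalForm_3_2_2_swapped f lam := by
  have hd : 1 ≤ A 2 2 := one_le_of_det_ne_zero hdet (by simp [hA0]) (by simp [hA1])
  obtain ⟨μ, ν, v, w, hμ, hν, hv, hv0, hw, hw0, hXf, hYf⟩ := exists_swapped_pair H R hA0 hA1
  obtain ⟨β, z, hβ, hz, hz0, hZf⟩ := R.exists_relative_normalisation H hd hv hw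
  have hX := analyticAt_mul_exp (R.analytic 0) hv
  have hY := analyticAt_mul_exp (R.analytic 1) hw
  have hZ := analyticAt_mul_exp (R.analytic 2) hz
  have hi := R.linearIndependent_mul_exp (v := ![v, w, z])
    (by intro k; fin_cases k <;> assumption) (by intro k; fin_cases k <;> assumption)
  have hcrit : ∀ᶠ x in 𝓝 0, x ∈ genCritSet f ↔ y 0 x * Complex.exp (v x) = 0 ∨
      y 1 x * Complex.exp (w x) = 0 ∨ y 2 x * Complex.exp (z x) = 0 := by
    filter_upwards [R.crit] with x hx
    rw [hx]; simp [Fin.exists_fin_succ]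
  have hXY : LinearIndependent ℂ ![covector fun x => y 0 x * Complex.exp (v x),
      covector fun x => y 1 x * Complex.exp (w x)] := linearIndependent_pair_of_triple hi
  obtain ⟨h0, h1, h⟩ := H.eigenvalues_of_swapped_pair h2 hXY hμ hν
    (by rw [codifferential_covector H.analytic H.apply_zero hX, covector_congr hXf,
      covector_const_mul hY])
    (by rw [codifferential_covector H.analytic H.apply_zero hY, covector_congr hYf,
      covector_const_mul hX])
  exact ⟨h0, h1, normalForm_3_2_2_swapped_of_functions H hX (by simp [R.apply_zero]) hY
    (by simp [R.apply_zero]) hZ (by simp [R.apply_zero]) hi hβ hd hA2 hμ hν h hXf hYf hZf hcrit⟩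

theorem normalForm_3_1_1_of_data (R : NormalCrossingData f y A)
    (H : IsContractingWithEigenvalues f lam) (hdet : (A.map (Nat.cast : ℕ → ℤ)).det ≠ 0)
    (hA0 : ∀ i, A i 0 = if i = 0 then 1 else 0) (hA1 : 2 ≤ A 0 1 + A 1 1 ∨ 1 ≤ A 2 1)
    (hA2 : 2 ≤ A 0 2 + A 1 2 + A 2 2) (h1 : lam 1 = 0) (h2 : lam 2 = 0) :
    NormalForm_3_1_1 f lam := by
  obtain ⟨μ, v, hμ, hv, hv0, hXf⟩ := exists_fixed_pair H R hA0
  have hX := analyticAt_mul_exp (R.analytic 0) hv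
  have hX0 : y 0 0 * Complex.exp (v 0) = 0 := by simp [R.apply_zero]
  have hXc : (covector fun x => y 0 x * Complex.exp (v x)) ≠ 0 := by
    rw [covector_mul_exp (R.analytic 0) (R.apply_zero 0) hv hv0]
    exact R.indep.ne_zero 0
  obtain rfl : μ = lam 0 :=
    (H.eigenfunction_eigenvalue h2 hX hXc hμ hXf).resolve_right fun h => hμ (h.trans h1)
  choose u hu hu0 he using R.pullback
  -- The first column of A is the first basis vector, so the determinant of A is that of the lower
  -- right block.
  have hD : A.submatrix Fin.succ Fin.succ 0 0 * A.submatrix Fin.succ Fin.succ 1 1 ≠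
      A.submatrix Fin.succ Fin.succ 0 1 * A.submatrix Fin.succ (Fin.succ : Fin 2 → Fin 3) 1 0 := by
    intro h
    refine hdet ?_
    change A 1 1 * A 2 2 = A 1 2 * A 2 1 at h
    have h' : (A 1 1 : ℤ) * A 2 2 = A 1 2 * A 2 1 := by exact_mod_cast h
    rw [Matrix.det_fin_three]
    simp [hA0]
    linear_combination h'
  obtain ⟨n, g, t, hn, ht, hg, z, hz, hz0, hyz⟩ := H.exists_resonant_pair_form hμ h1 h2 hX hX0 hXc
    hXf hD (y := fun k => y k.succ) (P := fun k x => (y 0 x * Complex.exp (v x)) ^ A 0 k.succ)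
    -- The exponential compensates for writing P in terms of the normalised first coordinate.
    (u := fun k x => u k.succ x * Complex.exp (-(A 0 k.succ * v x)))
    (fun k => (hu k.succ).fun_mul (analyticAt_const.fun_mul hv).fun_neg.cexp')
    (fun k => by simp [hu0]) (fun k => by
      filter_upwards [he k.succ] with x hx
      have h1 : Complex.exp (v x) ^ A 0 k.succ * Complex.exp (-(A 0 k.succ * v x)) = 1 := by
        rw [← Complex.exp_nat_mul, ← Complex.exp_add, add_neg_cancel, Complex.exp_zero]
      rw [hx, Fin.prod_univ_succ, mul_pow]
      change _ = y 0 x ^ A 0 k.succ * Complex.exp (v x) ^ A 0 k.succ *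
        (∏ l : Fin 2, y l.succ x ^ A l.succ k.succ) *
        (u k.succ x * Complex.exp (-(A 0 k.succ * v x)))
      linear_combination -(y 0 x ^ A 0 k.succ * (∏ l : Fin 2, y l.succ x ^ A l.succ k.succ) *
        u k.succ x) * h1)
  have hi := R.linearIndependent_mul_exp (v := ![v, z 0, z 1])
    (by intro k; fin_cases k; exacts [hv, hz 0, hz 1])
    (by intro k; fin_cases k; exacts [hv0, hz0 0, hz0 1])
  have hY := analyticAt_mul_exp (R.analytic 1) (hz 0)
  have hZ := analyticAt_mul_exp (R.analytic 2) (hz 1)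
  have hi' : LinearIndependent ℂ ![covector fun x => t * (y 0 x * Complex.exp (v x)),
      covector fun x => y 1 x * Complex.exp (z 0 x),
      covector fun x => y 2 x * Complex.exp (z 1 x)] := by
    have := linearIndependent_scale hX hY hZ hi ht one_ne_zero one_ne_zero
    simpa only [one_mul] using this
  have hβ : ∀ k : Fin 2, u k.succ 0 * Complex.exp (-(A 0 k.succ * v 0)) * t⁻¹ ^ A 0 k.succ ≠ 0 := by
    intro k; simp [hu0, ht]
  have hNF : HasNormalForm f (fun x => ![lam 0 * x 0,
      u 1 0 * Complex.exp (-(A 0 1 * v 0)) * t⁻¹ ^ A 0 1 * x 0 ^ A 0 1 * x 1 ^ A 1 1 *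
        x 2 ^ A 2 1 * (1 + g * x 0 ^ n),
      u 2 0 * Complex.exp (-(A 0 2 * v 0)) * t⁻¹ ^ A 0 2 * x 0 ^ A 0 2 * x 1 ^ A 1 2 *
        x 2 ^ A 2 2]) {0, 1, 2} := by
    refine hasNormalForm_of_triple H (X := fun x => t * (y 0 x * Complex.exp (v x)))
      (analyticAt_const.fun_mul hX) (by simp [R.apply_zero]) hY (by simp [R.apply_zero]) hZ
      (by simp [R.apply_zero]) hi' ?_ ?_
    · filter_upwards [hXf, hyz] with x e1 e2
      have hpow : ∀ k : ℕ, t⁻¹ ^ k * (t * (y 0 x * Complex.exp (v x))) ^ k =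
          (y 0 x * Complex.exp (v x)) ^ k := by
        intro k
        rw [← mul_pow, inv_mul_cancel_left₀ ht]
      ext i
      fin_cases i
      · change lam 0 * (t * (y 0 x * Complex.exp (v x))) = t * (y 0 (f x) * Complex.exp (v (f x)))
        rw [e1]; ring
      · refine Eq.trans ?_ (e2 0).symm
        rw [Fin.prod_univ_two]
        change u 1 0 * Complex.exp (-(A 0 1 * v 0)) * t⁻¹ ^ A 0 1 *
          (t * (y 0 x * Complex.exp (v x))) ^ A 0 1 * (y 1 x * Complex.exp (z 0 x)) ^ A 1 1 *
          (y 2 x * Complex.exp (z 1 x)) ^ A 2 1 *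
            (1 + g * (t * (y 0 x * Complex.exp (v x))) ^ n) =
          u 1 0 * Complex.exp (-(A 0 1 * v 0)) * (y 0 x * Complex.exp (v x)) ^ A 0 1 *
          (1 + g * (t * (y 0 x * Complex.exp (v x))) ^ n) *
          ((y 1 x * Complex.exp (z 0 x)) ^ A 1 1 * (y 2 x * Complex.exp (z 1 x)) ^ A 2 1)
        rw [← hpow (A 0 1)]; ring
      · refine Eq.trans ?_ (e2 1).symm
        rw [Fin.prod_univ_two]
        change u 2 0 * Complex.exp (-(A 0 2 * v 0)) * t⁻¹ ^ A 0 2 *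
          (t * (y 0 x * Complex.exp (v x))) ^ A 0 2 * (y 1 x * Complex.exp (z 0 x)) ^ A 1 2 *
          (y 2 x * Complex.exp (z 1 x)) ^ A 2 2 =
          u 2 0 * Complex.exp (-(A 0 2 * v 0)) * (y 0 x * Complex.exp (v x)) ^ A 0 2 * 1 *
          ((y 1 x * Complex.exp (z 0 x)) ^ A 1 2 * (y 2 x * Complex.exp (z 1 x)) ^ A 2 2)
        rw [← hpow (A 0 2)]; ring
    · filter_upwards [R.crit] with x hx
      rw [hx]; simp [Fin.exists_fin_succ, ht]
  have hcc := constraint_3_1_1 (D := A.submatrix Fin.succ Fin.succ) H hμ (hβ 0) (hβ 1) hD hn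
    (hg.imp_right And.left) hNF
  exact ⟨A.submatrix Fin.succ Fin.succ, A 0 1, A 0 2, _, _, g, n, hβ 0, hβ 1, hD, hcc, hA1, hA2, hn,
    hg.imp_right fun h => ⟨h.1, sub_eq_zero.1 h.2⟩, hNF⟩

end ThreeComponents

/-! ### Enumerations of the components adapted to the action. -/

section Enumerations

variable {ι : Type*} [Fintype ι] [DecidableEq ι] {A : Matrix ι ι ℕ}

theorem isUnitColumn_submatrix {q : ℕ} (e : Fin q ≃ ι) {k l : Fin q}
    (h : IsUnitColumn A (e k) (e l)) (i : Fin q) :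
    A.submatrix e e i k = if i = l then 1 else 0 := by
  rw [Matrix.submatrix_apply, isUnitColumn_iff.1 h]
  simp

theorem sum_submatrix {ι : Type*} [Fintype ι] {A : Matrix ι ι ℕ} {q : ℕ} (e : Fin q ≃ ι) (k : Fin q) :
    ∑ i, A.submatrix e e i k = ∑ j, A j (e k) :=
  e.sum_comp fun j => A j (e k)

/-- The enumeration obtained from `e` by an injective relabelling. -/
def relabel {q : ℕ} (e : Fin q ≃ ι) {s : Fin q → Fin q} (hs : Function.Injective s) : Fin q ≃ ι :=
  (Equiv.ofBijective s (Finite.injective_iff_bijective.1 hs)).trans e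

theorem exists_enumeration_two (hA : Function.Injective A.mulVec) (e : Fin 2 ≃ ι) :
    ∃ e : Fin 2 ≃ ι,
      (¬ IsPeriodicIndex A (e 0) ∧ ¬ IsPeriodicIndex A (e 1) ∧ 2 ≤ ∑ j, A j (e 1) ∧
        (2 ≤ ∑ j, A j (e 0) ∨ IsUnitColumn A (e 0) (e 1))) ∨
      (IsPeriodicIndex A (e 0) ∧ ¬ IsPeriodicIndex A (e 1) ∧ IsUnitColumn A (e 0) (e 0) ∧
        2 ≤ ∑ j, A j (e 1)) ∨
      (IsPeriodicIndex A (e 0) ∧ IsPeriodicIndex A (e 1) ∧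
        (IsUnitColumn A (e 0) (e 0) ∧ IsUnitColumn A (e 1) (e 1) ∨
          IsUnitColumn A (e 0) (e 1) ∧ IsUnitColumn A (e 1) (e 0))) := by
  obtain ⟨T, P, hP, hT, hn, a1, a2, a3, a4, a5, -⟩ := exists_column_map hA e
  obtain ⟨s, hs, h⟩ := column_map_two T P a1 a2 a3 a4 a5
  have hsi : Function.Injective s := by
    intro i j hij
    fin_cases i <;> fin_cases j <;> first | rfl | exact absurd hij hs | exact absurd hij.symm hs
  refine ⟨relabel e hsi, ?_⟩
  change (¬ IsPeriodicIndex A (e (s 0)) ∧ ¬ IsPeriodicIndex A (e (s 1)) ∧ 2 ≤ ∑ j, A j (e (s 1)) ∧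
        (2 ≤ ∑ j, A j (e (s 0)) ∨ IsUnitColumn A (e (s 0)) (e (s 1)))) ∨
      (IsPeriodicIndex A (e (s 0)) ∧ ¬ IsPeriodicIndex A (e (s 1)) ∧
        IsUnitColumn A (e (s 0)) (e (s 0)) ∧ 2 ≤ ∑ j, A j (e (s 1))) ∨
      (IsPeriodicIndex A (e (s 0)) ∧ IsPeriodicIndex A (e (s 1)) ∧
        (IsUnitColumn A (e (s 0)) (e (s 0)) ∧ IsUnitColumn A (e (s 1)) (e (s 1)) ∨
          IsUnitColumn A (e (s 0)) (e (s 1)) ∧ IsUnitColumn A (e (s 1)) (e (s 0))))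
  simp only [← hP, Bool.not_eq_true]
  rcases h with ⟨p0, p1, h1, h2⟩ | ⟨p0, p1, h1, h2⟩ | ⟨p0, p1, h2⟩
  · exact Or.inl ⟨p0, p1, hn _ h1, h2.imp (hn _) (hT _ _)⟩
  · exact Or.inr (Or.inl ⟨p0, p1, hT _ _ h1, hn _ h2⟩)
  · exact Or.inr (Or.inr ⟨p0, p1, h2.imp (fun h => ⟨hT _ _ h.1, hT _ _ h.2⟩)
      fun h => ⟨hT _ _ h.1, hT _ _ h.2⟩⟩)

theorem exists_enumeration_three (hA : Function.Injective A.mulVec) (e : Fin 3 ≃ ι) :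
    ∃ e : Fin 3 ≃ ι,
      (¬ IsPeriodicIndex A (e 0) ∧ ¬ IsPeriodicIndex A (e 1) ∧ ¬ IsPeriodicIndex A (e 2) ∧
        2 ≤ ∑ j, A j (e 2) ∧ (2 ≤ ∑ j, A j (e 1) ∨ IsUnitColumn A (e 1) (e 2)) ∧
        (2 ≤ ∑ j, A j (e 0) ∨ IsUnitColumn A (e 0) (e 1) ∨ IsUnitColumn A (e 0) (e 2))) ∨
      (IsPeriodicIndex A (e 0) ∧ ¬ IsPeriodicIndex A (e 1) ∧ ¬ IsPeriodicIndex A (e 2) ∧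
        IsUnitColumn A (e 0) (e 0) ∧ 2 ≤ ∑ j, A j (e 2) ∧
        (2 ≤ ∑ j, A j (e 1) ∨ IsUnitColumn A (e 1) (e 2))) ∨
      (IsPeriodicIndex A (e 0) ∧ IsPeriodicIndex A (e 1) ∧ ¬ IsPeriodicIndex A (e 2) ∧
        2 ≤ ∑ j, A j (e 2) ∧
        (IsUnitColumn A (e 0) (e 0) ∧ IsUnitColumn A (e 1) (e 1) ∨
          IsUnitColumn A (e 0) (e 1) ∧ IsUnitColumn A (e 1) (e 0))) ∨
      ∀ k, IsPeriodicIndex A (e k) := by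
  obtain ⟨T, P, hP, hT, hn, a1, a2, a3, a4, a5, a6⟩ := exists_column_map hA e
  obtain ⟨s, hs, h⟩ := column_map_three T P a1 a2 a3 a4 a5 a6
  have hsi : Function.Injective s := by
    intro i j hij
    fin_cases i <;> fin_cases j <;> first
      | rfl
      | exact absurd hij hs.1
      | exact absurd hij.symm hs.1
      | exact absurd hij hs.2.1
      | exact absurd hij.symm hs.2.1
      | exact absurd hij hs.2.2
      | exact absurd hij.symm hs.2.2
  refine ⟨relabel e hsi, ?_⟩
  have hr : ∀ k, relabel e hsi k = e (s k) := fun k => rfl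
  simp only [hr, ← hP, Bool.not_eq_true]
  rcases h with ⟨p0, p1, p2, h1, h2, h3⟩ | ⟨p0, p1, p2, h1, h2, h3⟩ | ⟨p0, p1, p2, h1, h2⟩ | h
  · exact Or.inl ⟨p0, p1, p2, hn _ h1, h2.imp (hn _) (hT _ _),
      h3.imp (hn _) (Or.imp (hT _ _) (hT _ _))⟩
  · exact Or.inr (Or.inl ⟨p0, p1, p2, hT _ _ h1, hn _ h2, h3.imp (hn _) (hT _ _)⟩)
  · exact Or.inr (Or.inr (Or.inl ⟨p0, p1, p2, hn _ h1, h2.imp (fun h => ⟨hT _ _ h.1, hT _ _ h.2⟩)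
      fun h => ⟨hT _ _ h.1, hT _ _ h.2⟩⟩))
  · exact Or.inr (Or.inr (Or.inr fun k => h _))

theorem det_ne_zero_of_injective (hA : Function.Injective (A.map (Nat.cast : ℕ → ℤ)).mulVec) {q : ℕ}
    (e : Fin q ≃ ι) : ((A.submatrix e e).map (Nat.cast : ℕ → ℤ)).det ≠ 0 := by
  have h : (A.submatrix e e).map (Nat.cast : ℕ → ℤ) =
      (A.map (Nat.cast : ℕ → ℤ)).submatrix e e := rfl
  rw [h, Matrix.det_submatrix_equiv_self]
  intro h0
  obtain ⟨v, hv, hv0⟩ := Matrix.exists_mulVec_eq_zero_iff.2 h0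
  exact hv (hA (hv0.trans (Matrix.mulVec_zero _).symm))

end Enumerations

/-! ### The invariants r, s and η, and the case of empty critical set. -/

section Invariants

variable {f φ : (Fin 3 → ℂ) → (Fin 3 → ℂ)} {K : Finset (Fin 3)}

theorem fixedByIterate_iff {η : ℕ} {k : K} :
    FixedByIterate f φ K η k ↔ IsUnitColumn (internalAction f φ K ^ η) k k := by
  rw [isUnitColumn_iff]
  simp only [FixedByIterate, Matrix.one_apply]

theorem isPeriodicComponent_iff {k : K} :
    IsPeriodicComponent f φ K k ↔ IsPeriodicIndex (internalAction f φ K) k := by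
  simp only [IsPeriodicComponent, IsPeriodicIndex, fixedByIterate_iff]

open Classical in
theorem numPeriodic_eq {q : ℕ} (e : Fin q ≃ K) : numPeriodic f φ K =
    ∑ i, if IsPeriodicIndex (internalAction f φ K) (e i) then 1 else 0 := by
  rw [e.sum_comp fun k => if IsPeriodicIndex (internalAction f φ K) k then 1 else 0,
    numPeriodic, Set.ncard_eq_toFinset_card', Finset.sum_boole]
  congr 1
  ext k
  simp [isPeriodicComponent_iff]

theorem periodOrder_eq_one
    (h : ∀ k, IsPeriodicIndex (internalAction f φ K) k → IsUnitColumn (internalAction f φ K) k k) :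
    periodOrder f φ K = 1 := by
  have hmem : 1 ∈ {η : ℕ | 1 ≤ η ∧ ∀ k : K, IsPeriodicComponent f φ K k →
      FixedByIterate f φ K η k} :=
    ⟨le_rfl, fun k hk => fixedByIterate_iff.2 (by
      rw [pow_one]; exact h k (isPeriodicComponent_iff.1 hk))⟩
  exact le_antisymm (Nat.sInf_le hmem) (Nat.sInf_mem ⟨1, hmem⟩).1

theorem periodOrder_eq_two {k l : K} (hkl : k ≠ l)
    (hk : IsUnitColumn (internalAction f φ K) k l) (hl : IsUnitColumn (internalAction f φ K) l k)
    (h : ∀ m, IsPeriodicIndex (internalAction f φ K) m → m = k ∨ m = l) :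
    periodOrder f φ K = 2 := by
  have hmem : 2 ∈ {η : ℕ | 1 ≤ η ∧ ∀ k : K, IsPeriodicComponent f φ K k →
      FixedByIterate f φ K η k} := by
    refine ⟨by norm_num, fun m hm => fixedByIterate_iff.2 ?_⟩
    rw [pow_two]
    rcases h m (isPeriodicComponent_iff.1 hm) with rfl | rfl
    · exact hk.comp hl
    · exact hl.comp hk
  have h1 := Nat.sInf_mem ⟨2, hmem⟩
  have h2 : periodOrder f φ K ≤ 2 := Nat.sInf_le hmem
  have h3 : periodOrder f φ K ≠ 1 := by
    intro h3
    have h4 := fixedByIterate_iff.1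
      (h1.2 k (isPeriodicComponent_iff.2 (hk.isPeriodicIndex_of_two hl)))
    rw [show sInf {η : ℕ | 1 ≤ η ∧ ∀ k : K, IsPeriodicComponent f φ K k →
      FixedByIterate f φ K η k} = 1 from h3, pow_one] at h4
    exact hkl (h4.unique hk)
  have h4 : 1 ≤ periodOrder f φ K := h1.1
  omega

theorem IsContractingGerm.isContractingWithEigenvalues (hf : IsContractingGerm f)
    {lam : Fin 3 → ℂ} (hlam : eigenvaluesAtZero f = {lam 0, lam 1, lam 2}) :
    IsContractingWithEigenvalues f lam where
  analytic := hf.analytic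
  apply_zero := hf.map_zero
  det_sub z := by
    rw [det_codifferential, det_sub_eq_of_eigenvalues hlam z]
  norm_lt_one i := by
    refine hf.contracting _ ((Module.End.hasEigenvalue_iff_isRoot_charpoly _ _).2 (Polynomial.isRoot_of_mem_roots ?_))
    change lam i ∈ eigenvaluesAtZero f
    rw [hlam]
    fin_cases i <;> simp

theorem numNonzeroEigenvalues_eq {lam : Fin 3 → ℂ}
    (hlam : eigenvaluesAtZero f = {lam 0, lam 1, lam 2}) : numNonzeroEigenvalues f =
      (if lam 0 = 0 then 0 else 1) + (if lam 1 = 0 then 0 else 1) +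
        (if lam 2 = 0 then 0 else 1) := by
  rw [numNonzeroEigenvalues, hlam]
  change Multiset.card (Multiset.filter _ (lam 0 ::ₘ lam 1 ::ₘ lam 2 ::ₘ 0)) = _
  by_cases h0 : lam 0 = 0 <;> by_cases h1 : lam 1 = 0 <;> by_cases h2 : lam 2 = 0 <;>
    simp [h0, h1, h2, Multiset.filter_cons_of_pos, Multiset.filter_cons_of_neg, Multiset.filter_singleton]

/-- An empty critical set means that df₀ is invertible, so all three eigenvalues are non-zero and
the Poincaré–Dulac form applies to each coordinate. -/
theorem normalForm_0_0_3_of_genCritEq {lam : Fin 3 → ℂ} (H : IsContractingWithEigenvalues f lam)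
    (hord : ∀ i j, i ≤ j → ‖lam j‖ ≤ ‖lam i‖) (h : GenCritEq f φ ∅) :
    lam 0 ≠ 0 ∧ lam 1 ≠ 0 ∧ lam 2 ≠ 0 ∧ NormalForm_0_0_3 f lam := by
  have hdet : (fderiv ℂ f 0).det ≠ 0 := by
    intro h0
    have h1 := h.self_of_nhds
    simp only [Finset.notMem_empty, false_and, exists_false, iff_false] at h1
    exact h1 ⟨0, h0⟩
  have h3 : lam 0 * lam 1 * lam 2 ≠ 0 := by
    have h1 := H.det_sub 0
    rw [det_codifferential] at h1
    simp only [map_zero, zero_sub, Fin.prod_univ_three] at h1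
    rw [← neg_one_smul ℂ, LinearMap.det_smul] at h1
    intro h0
    have h2 : (-1 : ℂ) ^ Module.finrank ℂ (Fin 3 → ℂ) *
        LinearMap.det (fderiv ℂ f 0 : (Fin 3 → ℂ) →ₗ[ℂ] (Fin 3 → ℂ)) = 0 := by
      rw [h1]; linear_combination -h0
    exact hdet ((mul_eq_zero.1 h2).resolve_left (by simp))
  have n2 := right_ne_zero_of_mul h3
  have n1 := right_ne_zero_of_mul (left_ne_zero_of_mul h3)
  have n0 := left_ne_zero_of_mul (left_ne_zero_of_mul h3)
  obtain ⟨w, hw, hw0, hwc, hwf⟩ := H.exists_eigenfunction hord n0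
  obtain ⟨e, he, hew, he1, he2⟩ := H.poincareDulac hord hw hw0 hwc hwf
  obtain ⟨ρ₁, hρ₁, hf1⟩ := he1 n1
  obtain ⟨ρ₂, hρ₂, hf2⟩ := he2 n2
  refine ⟨n0, n1, n2, ρ₁, ρ₂, fun n hn => (hρ₁ n hn).2, hρ₂,
    hasNormalForm_of_conj H.analytic H.apply_zero H.orbitStable he ?_ ?_⟩
  · filter_upwards [hwf, hf1, hf2] with x e0 e1 e2
    ext i
    fin_cases i
    · change e (f x) 0 = lam 0 * e x 0
      rw [hew, hew, e0]
    · exact e1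
    · exact e2
  · filter_upwards [h] with x hx
    rw [hx]; simp

end Invariants

/-! ### The classification according to the number of components. -/

section Table

variable {f φ : (Fin 3 → ℂ) → (Fin 3 → ℂ)} {K : Finset (Fin 3)} {lam : Fin 3 → ℂ}

theorem lam_one_eq_zero_of_mul (hord : ∀ i j, i ≤ j → ‖lam j‖ ≤ ‖lam i‖)
    (h : lam 0 * lam 1 = 0) : lam 1 = 0 := by
  rcases mul_eq_zero.1 h with h0 | h1
  · simpa [h0] using hord 0 1 (by decide)
  · exact h1

theorem lam_zero_ne_zero (hord : ∀ i j, i ≤ j → ‖lam j‖ ≤ ‖lam i‖) {μ : ℂ} (hμ : μ ≠ 0)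
    (h : μ = lam 0 ∨ μ = lam 1) : lam 0 ≠ 0 := by
  intro h0
  rcases h with h | h
  · exact hμ (h.trans h0)
  · exact hμ (h.trans (lam_one_eq_zero_of_mul hord (by rw [h0, zero_mul])))

theorem normalFormTable_one (hrigid : IsRigidWith f φ K)
    (H : IsContractingWithEigenvalues f lam) (hord : ∀ i j, i ≤ j → ‖lam j‖ ≤ ‖lam i‖)
    (hlam : eigenvaluesAtZero f = {lam 0, lam 1, lam 2})
    (hinj : Function.Injective (internalAction f φ K).mulVec) (e : Fin 1 ≃ K) :
    NormalFormTable f lam 1 (numPeriodic f φ K) (numNonzeroEigenvalues f)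
      (periodOrder f φ K) := by
  have R := hrigid.normalCrossingData H.analytic H.apply_zero e
  have h2 := R.lam_two_eq_zero H hord 0
  have h1 := one_le_sum_column hinj (e 0)
  rw [← sum_submatrix e 0, Fin.sum_univ_one] at h1
  rw [numPeriodic_eq e, numNonzeroEigenvalues_eq hlam, Fin.sum_univ_one]
  rcases h1.eq_or_lt with hA | hA
  · have hu : IsUnitColumn (internalAction f φ K) (e 0) (e 0) := by
      refine isUnitColumn_iff.2 fun i => ?_
      obtain ⟨j, rfl⟩ := e.surjective i
      rw [Subsingleton.elim j 0, if_pos rfl]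
      exact hA.symm
    rw [if_pos hu.isPeriodicIndex_of_self]
    obtain ⟨c, Y, hc, hc0, -⟩ := R.exists_linear_form H hA.symm h2
    have h0 := lam_zero_ne_zero hord hc0 hc
    by_cases hl : lam 1 = 0
    · simp [NormalFormTable, h0, hl, h2, normalForm_1_1_1_of_data R H hA.symm hl h2]
    · simp [NormalFormTable, h0, hl, h2, normalForm_1_1_2_of_data R H hord hA.symm h0 hl h2]
  · have hp : ¬ IsPeriodicIndex (internalAction f φ K) (e 0) := by
      intro hp
      obtain ⟨l, hl, -⟩ := hp.exists_isUnitColumn hinj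
      obtain ⟨j, rfl⟩ := e.surjective l
      have h3 := isUnitColumn_iff.1 hl (e 0)
      rw [Subsingleton.elim j 0, if_pos rfl] at h3
      exact hA.ne' h3
    rw [if_neg hp]
    by_cases h0 : lam 0 = 0
    · have hl : lam 1 = 0 := lam_one_eq_zero_of_mul hord (by rw [h0, zero_mul])
      simp [NormalFormTable, h0, hl, h2, normalForm_1_0_0_of_data R H hA]
    · by_cases hl : lam 1 = 0
      · simp [NormalFormTable, h0, hl, h2, normalForm_1_0_1_of_data R H hord hA h0 hl h2]
      · simp [NormalFormTable, h0, hl, h2, normalForm_1_0_2_of_data R H hord hA h0 hl]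

theorem mul_ne_mul_of_det_ne_zero {D : Matrix (Fin 2) (Fin 2) ℕ}
    (h : (D.map (Nat.cast : ℕ → ℤ)).det ≠ 0) : D 0 0 * D 1 1 ≠ D 0 1 * D 1 0 := by
  rw [Matrix.det_fin_two] at h
  simp only [Matrix.map_apply, sub_ne_zero] at h
  exact_mod_cast h

theorem normalFormTable_two (hrigid : IsRigidWith f φ K)
    (H : IsContractingWithEigenvalues f lam) (hord : ∀ i j, i ≤ j → ‖lam j‖ ≤ ‖lam i‖)
    (hlam : eigenvaluesAtZero f = {lam 0, lam 1, lam 2})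
    (hinj : InjectiveInternalAction f φ K) (e₀ : Fin 2 ≃ K) :
    NormalFormTable f lam 2 (numPeriodic f φ K) (numNonzeroEigenvalues f)
      (periodOrder f φ K) := by
  obtain ⟨e, he⟩ := exists_enumeration_two (injective_mulVec_of_injective_map hinj) e₀
  have R := hrigid.normalCrossingData H.analytic H.apply_zero e
  have h2 := R.lam_two_eq_zero H hord 0
  have hdet := mul_ne_mul_of_det_ne_zero (det_ne_zero_of_injective hinj e)
  rw [numPeriodic_eq e, numNonzeroEigenvalues_eq hlam, Fin.sum_univ_two]
  simp only [← sum_submatrix e] at he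
  rcases he with ⟨p0, p1, hs1, hs0⟩ | ⟨p0, p1, hu, hs1⟩ | ⟨p0, p1, hu⟩
  · rw [if_neg p0, if_neg p1]
    have hS1 := R.codifferential_eq_zero H.analytic H.apply_zero hs1
    obtain ⟨c, hS0, hA⟩ : ∃ c : ℂ, codifferential f (covector fun x => φ x (e 0)) =
        c • (covector fun x => φ x (e 1)) ∧
        (2 ≤ (internalAction f φ K).submatrix e e 0 0 ∨
          1 ≤ (internalAction f φ K).submatrix e e 1 0) := by
      rcases hs0 with hs0 | hu
      · refine ⟨0, by rw [R.codifferential_eq_zero H.analytic H.apply_zero hs0, zero_smul], ?_⟩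
        rw [Fin.sum_univ_two] at hs0
        omega
      · obtain ⟨c, -, hc⟩ := R.codifferential_eq_smul H.analytic H.apply_zero
          (isUnitColumn_submatrix e hu)
        refine ⟨c, hc, Or.inr ?_⟩
        rw [isUnitColumn_submatrix e hu, if_pos rfl]
    -- The codifferential is strictly triangular on the span of the two covectors, so it has 0 as a
    -- double eigenvalue there; the product of λ¹ and λ² vanishes and the order of the moduli gives
    -- λ² = 0.
    have hl : lam 1 = 0 := by
      obtain ⟨τ, -, e2, -⟩ := H.planar_identities h2 R.linearIndependent_two (a₁ := 0) (b₁ := c)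
        (a₂ := 0) (b₂ := 0) (by rw [hS0]; simp) (by rw [hS1]; simp)
      exact lam_one_eq_zero_of_mul hord (by rw [e2]; simp)
    by_cases h0 : lam 0 = 0
    · rw [Fin.sum_univ_two] at hs1
      have hNF := normalForm_2_0_0_of_data R H hdet hA hs1
        (by intro i; fin_cases i <;> assumption)
      simp [NormalFormTable, h0, hl, h2, hNF]
    · have hNF := normalForm_2_0_1_of_data R H hord hdet hA
        (by rw [hS0, map_smul, hS1, smul_zero]) hS1 h0 hl h2
      simp [NormalFormTable, h0, hl, h2, hNF]
  · rw [if_pos p0, if_neg p1]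
    have h00 := isUnitColumn_submatrix e hu 0
    have h10 := isUnitColumn_submatrix e hu 1
    simp only [if_true, one_ne_zero, if_false] at h00 h10
    rw [Fin.sum_univ_two] at hs1
    -- The first column is the first basis vector, so A 1 1 is the determinant.
    have h11 : 1 ≤ (internalAction f φ K).submatrix e e 1 1 := by
      by_contra! h
      rw [h10, mul_zero, show (internalAction f φ K).submatrix e e 1 1 = 0 by omega] at hdet
      exact hdet (mul_zero _)
    have h0 : lam 0 ≠ 0 := by
      obtain ⟨c, hc, hc'⟩ := R.codifferential_eq_smul H.analytic H.apply_zero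
        (isUnitColumn_submatrix e hu)
      rcases H.eq_or_eq_of_covector (R.covector_ne_zero 0) hc' with h | h | h
      · exact lam_zero_ne_zero hord hc (Or.inl h)
      · exact lam_zero_ne_zero hord hc (Or.inr h)
      · exact absurd (h.trans h2) hc
    by_cases hl : lam 1 = 0
    · simp [NormalFormTable, h0, hl, h2, normalForm_2_1_1_of_data R H h00 h10 h11 hs1 hl h2]
    · simp [NormalFormTable, h0, hl, h2, normalForm_2_1_2_of_data R H hord h00 h10 h11 hs1 h0 hl h2]
  · rw [if_pos p0, if_pos p1]
    rcases hu with ⟨hu0, hu1⟩ | ⟨hu0, hu1⟩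
    · obtain ⟨h0, hl, hNF⟩ := normalForm_2_2_2_fixed_of_data R H h2 (isUnitColumn_submatrix e hu0)
        (isUnitColumn_submatrix e hu1)
      have hη : periodOrder f φ K = 1 := periodOrder_eq_one fun k _ => by
        obtain ⟨j, rfl⟩ := e.surjective k
        fin_cases j
        · exact hu0
        · exact hu1
      simp [NormalFormTable, h0, hl, h2, hNF, hη]
    · obtain ⟨h0, hl, hNF⟩ := normalForm_2_2_2_swapped_of_data R H h2 (isUnitColumn_submatrix e hu0)
        (isUnitColumn_submatrix e hu1)
      have hη : periodOrder f φ K = 2 := periodOrder_eq_two (e.injective.ne (by decide)) hu0 hu1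
        fun k _ => by
          obtain ⟨j, rfl⟩ := e.surjective k
          fin_cases j
          · exact Or.inl rfl
          · exact Or.inr rfl
      simp [NormalFormTable, h0, hl, h2, hNF, hη]

theorem normalFormTable_three (hrigid : IsRigidWith f φ K)
    (H : IsContractingWithEigenvalues f lam) (hord : ∀ i j, i ≤ j → ‖lam j‖ ≤ ‖lam i‖)
    (hlam : eigenvaluesAtZero f = {lam 0, lam 1, lam 2})
    (hinj : InjectiveInternalAction f φ K) (e₀ : Fin 3 ≃ K) :
    NormalFormTable f lam 3 (numPeriodic f φ K) (numNonzeroEigenvalues f)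
      (periodOrder f φ K) := by
  have hinj' := injective_mulVec_of_injective_map hinj
  obtain ⟨e, he⟩ := exists_enumeration_three hinj' e₀
  have R := hrigid.normalCrossingData H.analytic H.apply_zero e
  have h2 := R.lam_two_eq_zero H hord 0
  have hdet := det_ne_zero_of_injective hinj e
  have hzero : ∀ {k}, 2 ≤ ∑ j, (internalAction f φ K).submatrix e e j k →
      codifferential f (covector fun x => φ x (e k)) = 0 :=
    fun h => R.codifferential_eq_zero H.analytic H.apply_zero h
  have hsmul : ∀ {k l}, IsUnitColumn (internalAction f φ K) (e k) (e l) →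
      ∃ c : ℂ, c ≠ 0 ∧ codifferential f (covector fun x => φ x (e k)) =
        c • (covector fun x => φ x (e l)) :=
    fun h => R.codifferential_eq_smul H.analytic H.apply_zero (isUnitColumn_submatrix e h)
  have hrow₁ : (2 ≤ ∑ j, (internalAction f φ K).submatrix e e j 1 ∨
      IsUnitColumn (internalAction f φ K) (e 1) (e 2)) →
      (∃ c : ℂ, codifferential f (covector fun x => φ x (e 1)) =
        c • (covector fun x => φ x (e 2))) ∧
      (2 ≤ (internalAction f φ K).submatrix e e 0 1 + (internalAction f φ K).submatrix e e 1 1 ∨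
        1 ≤ (internalAction f φ K).submatrix e e 2 1) := by
    rintro (hs | hu)
    · refine ⟨⟨0, by rw [hzero hs, zero_smul]⟩, ?_⟩
      rw [Fin.sum_univ_three] at hs
      omega
    · obtain ⟨c, -, hc⟩ := hsmul hu
      exact ⟨⟨c, hc⟩, Or.inr (by rw [isUnitColumn_submatrix e hu, if_pos rfl])⟩
  rw [numPeriodic_eq e, numNonzeroEigenvalues_eq hlam, Fin.sum_univ_three]
  simp only [← sum_submatrix e] at he
  rcases he with ⟨p0, p1, p2, hs2, hs1, hs0⟩ | ⟨p0, p1, p2, hu, hs2, hs1⟩ |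
    ⟨p0, p1, p2, hs2, hu⟩ | hp
  · rw [if_neg p0, if_neg p1, if_neg p2]
    obtain ⟨⟨c, hS1⟩, hA1⟩ := hrow₁ hs1
    have hS2 := hzero hs2
    obtain ⟨a, b, hS0, hA0⟩ : ∃ a b : ℂ, codifferential f (covector fun x => φ x (e 0)) =
        a • (covector fun x => φ x (e 1)) + b • (covector fun x => φ x (e 2)) ∧
        (2 ≤ (internalAction f φ K).submatrix e e 0 0 ∨
          1 ≤ (internalAction f φ K).submatrix e e 1 0 ∨
          1 ≤ (internalAction f φ K).submatrix e e 2 0) := by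
      rcases hs0 with hs | hu | hu
      · refine ⟨0, 0, by rw [hzero hs]; simp, ?_⟩
        rw [Fin.sum_univ_three] at hs
        omega
      · obtain ⟨c, -, hc⟩ := hsmul hu
        exact ⟨c, 0, by rw [hc]; simp, Or.inr (Or.inl (by
          rw [isUnitColumn_submatrix e hu, if_pos rfl]))⟩
      · obtain ⟨c, -, hc⟩ := hsmul hu
        exact ⟨0, c, by rw [hc]; simp, Or.inr (Or.inr (by
          rw [isUnitColumn_submatrix e hu, if_pos rfl]))⟩
    -- In the chosen order the codifferential is strictly triangular, hence nilpotent, whichever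
    -- columns are basis vectors.
    obtain ⟨e1, e2, -⟩ := H.eigenvalue_identities R.linearIndependent_three
      (M := !![0, a, b; 0, 0, c; 0, 0, 0]) (by
        intro i
        rw [Fin.sum_univ_three]
        fin_cases i
        · simpa using hS0
        · simpa using hS1
        · simpa using hS2)
    simp [h2] at e1 e2
    have hl : lam 1 = 0 := lam_one_eq_zero_of_mul hord (by simpa using e2)
    have h0 : lam 0 = 0 := by simpa [hl] using e1
    rw [Fin.sum_univ_three] at hs2
    have hNF := normalForm_3_0_0_of_data R H hdet hA0 hA1 hs2
      (by intro i; fin_cases i <;> assumption)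
    simp [NormalFormTable, h0, hl, h2, hNF]
  · rw [if_pos p0, if_neg p1, if_neg p2]
    obtain ⟨⟨c, hS1⟩, hA1⟩ := hrow₁ hs1
    have hS2 := hzero hs2
    obtain ⟨μ, hμ, hS0⟩ := hsmul hu
    obtain ⟨e1, e2, -⟩ := H.eigenvalue_identities R.linearIndependent_three
      (M := !![μ, 0, 0; 0, 0, c; 0, 0, 0]) (by
        intro i
        rw [Fin.sum_univ_three]
        fin_cases i
        · simpa using hS0
        · simpa using hS1
        · simpa using hS2)
    simp [h2] at e1 e2
    have hl : lam 1 = 0 := lam_one_eq_zero_of_mul hord (by simpa using e2)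
    have h0 : lam 0 ≠ 0 := by
      rw [hl, add_zero] at e1
      rwa [e1]
    rw [Fin.sum_univ_three] at hs2
    have hNF := normalForm_3_1_1_of_data R H hdet (isUnitColumn_submatrix e hu) hA1 hs2 hl h2
    simp [NormalFormTable, h0, hl, h2, hNF]
  · rw [if_pos p0, if_pos p1, if_neg p2]
    rw [Fin.sum_univ_three] at hs2
    rcases hu with ⟨hu0, hu1⟩ | ⟨hu0, hu1⟩
    · obtain ⟨h0, hl, hNF⟩ := normalForm_3_2_2_fixed_of_data R H h2 hdet
        (isUnitColumn_submatrix e hu0) (isUnitColumn_submatrix e hu1) hs2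
      have hη : periodOrder f φ K = 1 := periodOrder_eq_one fun k hk => by
        obtain ⟨j, rfl⟩ := e.surjective k
        fin_cases j
        · exact hu0
        · exact hu1
        · exact absurd hk p2
      simp [NormalFormTable, h0, hl, h2, hNF, hη]
    · obtain ⟨h0, hl, hNF⟩ := normalForm_3_2_2_swapped_of_data R H h2 hdet
        (isUnitColumn_submatrix e hu0) (isUnitColumn_submatrix e hu1) hs2
      have hη : periodOrder f φ K = 2 := periodOrder_eq_two (e.injective.ne (by decide)) hu0 hu1
        fun k hk => by
          obtain ⟨j, rfl⟩ := e.surjective k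
          fin_cases j
          · exact Or.inl rfl
          · exact Or.inr rfl
          · exact absurd hk p2
      simp [NormalFormTable, h0, hl, h2, hNF, hη]
  -- If all three components were periodic, the codifferential would permute a basis of covectors up
  -- to non-zero factors. It would be surjective, against λ³ = 0.
  · exfalso
    have hstep : ∀ k, ∃ l, IsUnitColumn (internalAction f φ K) (e k) (e l) := by
      intro k
      obtain ⟨l, hl, -⟩ := (hp k).exists_isUnitColumn hinj'
      exact ⟨e.symm l, by simpa using hl⟩
    choose σ hσ using hstep
    choose c hc hS using fun k => hsmul (hσ k)
    have hσi : Function.Injective σ := by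
      intro i j hij
      have h := hσ j
      rw [← hij] at h
      exact e.injective ((hσ i).injective hinj' h)
    have hσs : Function.Surjective σ := Finite.surjective_of_injective hσi
    have hsurj : Function.Surjective (codifferential f) := by
      intro b
      obtain ⟨a, ha⟩ := exists_coefficients R.indep b
      choose τ hτ using hσs
      refine ⟨∑ j, (a j / c (τ j)) • covector fun x => φ x (e (τ j)), ?_⟩
      rw [map_sum, ha]
      refine Finset.sum_congr rfl fun j _ => ?_
      rw [map_smul, hS, smul_smul, div_mul_cancel₀ _ (hc _), hτ]
    have hinjS := LinearMap.injective_iff_surjective.2 hsurj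
    have h3 := H.det_sub 0
    rw [map_zero, zero_sub, Fin.prod_univ_three, h2] at h3
    have h4 : LinearMap.det (codifferential f) = 0 := by
      rw [← neg_one_smul ℂ, LinearMap.det_smul] at h3
      refine (mul_eq_zero.1 (h3.trans ?_)).resolve_left (by simp)
      ring
    have h5 := LinearMap.bot_lt_ker_of_det_eq_zero h4
    rw [LinearMap.ker_eq_bot.2 hinjS] at h5
    exact lt_irrefl _ h5

end Table
theorem mainTheorem7 (f φ : (Fin 3 → ℂ) → (Fin 3 → ℂ)) (K : Finset (Fin 3))
    (hf : IsContractingGerm f) (hrigid : IsRigidWith f φ K)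
    (hinj : InjectiveInternalAction f φ K)
    (lam : Fin 3 → ℂ)
    (hlam : eigenvaluesAtZero f = {lam 0, lam 1, lam 2})
    (hord : ‖lam 1‖ ≤ ‖lam 0‖ ∧ ‖lam 2‖ ≤ ‖lam 1‖) :
    NormalFormTable f lam K.card (numPeriodic f φ K) (numNonzeroEigenvalues f)
      (periodOrder f φ K) := by
  have H := hf.isContractingWithEigenvalues hlam
  have hord' : ∀ i j, i ≤ j → ‖lam j‖ ≤ ‖lam i‖ := by
    have h02 := hord.2.trans hord.1
    intro i j hij
    fin_cases i <;> fin_cases j <;> first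
      | exact le_rfl
      | exact hord.1
      | exact hord.2
      | exact h02
      | exact absurd hij (by decide)
  have hK : K.card ≤ 3 := K.card_le_univ.trans (by simp)
  have e := K.equivFin.symm
  generalize hq : K.card = q at hK e
  interval_cases q
  · obtain rfl := Finset.card_eq_zero.1 hq
    obtain ⟨h0, h1, h2, hNF⟩ := normalForm_0_0_3_of_genCritEq H hord' hrigid.genCrit
    rw [numPeriodic_eq e, numNonzeroEigenvalues_eq hlam]
    simp [NormalFormTable, h0, h1, h2, hNF]
  · exact normalFormTable_one hrigid H hord' hlam (injective_mulVec_of_injective_map hinj) e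
  · exact normalFormTable_two hrigid H hord' hlam hinj e
  · exact normalFormTable_three hrigid H hord' hlam hinj e
end
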